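/- All manifolds are smooth, Hausdorff and second countable. Let $(N,\xi)$ be a connected contact 3-manifold, i.e. $\xi\subset TN$ is a plane field which is locally the kernel of a one-form $\alpha$ with $\alpha\wedge d\alpha\neq 0$ everywhere ($\xi$ need not be coorientable). Let $\mathbb S(\xi)$ be its Cartan prolongation: the 4-manifold of pairs $(x,R)$ with $x\in N$ and $R$ an oriented line in $\xi_x$, with projection $\pi:\mathbb S(\xi)\to N$ and the Engel structure $\mathcal D_{(x,R)}=(T_{(x,R)}\pi)^{-1}(R)$. Let $\mathcal W$ be its kernel, i.e. the line field $\mathcal W\subset\mathcal E:=[\mathcal D,\mathcal D]$ with $[\mathcal W,\mathcal E]\subseteq\mathcal E$. Suppose that $\mathbb S(\xi)$ admits an oriented foliation $\mathcal F$ by circles such that i) $T_uS\oplus\mathcal W_u=\mathcal D_u$ for all $S\in\mathcal F$ and $u\in S$; ii) the space of leaves $M:=\mathbb S(\xi)/\mathcal F$ is a manifold and the projection $p:\mathbb S(\xi)\to M$ is a submersion; iii) for every $S\in\mathcal F$, the image $p_*\mathcal D|_S=\bigcup_{u\in S}p_*\mathcal D_u$ is a cone in $T_{p(S)}M$ (the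 set of zeros of a quadratic form of Lorentzian signature), and the map $u\in S\mapsto p_*\mathcal D_u$ is injective. Then $M$ is connected and carries a Lorentzian metric whose bundle of null cones is $p_*\mathcal D$. For every such metric $g$: (a) $(N,\xi)$ is contactomorphic to the contact manifold of null geodesics of $(M,g)$. That is, the set $\mathcal N$ of the images of the maximal null geodesics of $(M,g)$ is a manifold, for the smooth structure which makes the map from null vectors to the null geodesics tangent to them a submersion; it carries the canonical contact structure $\mathcal H_\gamma=T_\gamma\mathfrak S_x\oplus T_\gamma\mathfrak S_y$, where $\mathfrak S_x=\{\gamma\in\mathcal N: x\in\gamma\}$ and $x,y\in\gamma$ are not conjugate along $\gamma$; and $(N,\xi)$ is contactomorphic to $(\mathcal N,\mathcal H)$. (b) If $\xi$ is coorientable, then $(M,g)$ is time-orientable, hence a spacetime (a connected time-oriented Lorentzian manifold). -/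

import Mathlib

open Set Filter
open scoped Manifold ContDiff Topology Bundle

local notation "E3" => EuclideanSpace ℝ (Fin 3)

noncomputable section

namespace NullGeod

/-! Conventions: manifolds of dimension three are modelled on `E3`, the Euclidean three-space, with the model with corners
`𝓡 3`, and "smooth" means `∞`. A vector field is a function `X` with `X x` in the tangent space at
`x`; it is smooth as a map into the tangent bundle. -/

/-! ### Contact structures -/

/-- The value on `u, v, w` of the three-form `a ∧ da` at `y`, for a one-form `a` on an open subset
of `E3`, where `da(s, t) = D_s a (t) - D_t a (s)`. -/
def wedgeExtDeriv (a : E3 → E3 →L[ℝ] ℝ) (y u v w : E3) : ℝ :=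
  let da : E3 → E3 → ℝ := fun s t => fderiv ℝ a y s t - fderiv ℝ a y t s
  a y u * da v w + a y v * da w u + a y w * da u v

/-- A contact structure on a three-manifold: a field of planes in the tangent spaces which, near
every point, is the kernel of a smooth one-form `α` with `α ∧ dα` nowhere zero. The form is written
in the coordinates of the chart at the point, `α = φ^* a`. It need not exist globally. -/
structure ContactStructure (N : Type*) [TopologicalSpace N] [ChartedSpace E3 N] where
  plane : (x : N) → Submodule ℝ (TangentSpace (𝓡 3) x)
  exists_form : ∀ x₀ : N, ∃ (U : Set E3) (a : E3 → E3 →L[ℝ] ℝ),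
    IsOpen U ∧ extChartAt (𝓡 3) x₀ x₀ ∈ U ∧ U ⊆ (extChartAt (𝓡 3) x₀).target ∧
    ContDiffOn ℝ ∞ a U ∧
    (∀ x ∈ (extChartAt (𝓡 3) x₀).source, extChartAt (𝓡 3) x₀ x ∈ U →
      ∀ v : TangentSpace (𝓡 3) x, v ∈ plane x ↔
        a (extChartAt (𝓡 3) x₀ x) (mfderiv (𝓡 3) 𝓘(ℝ, E3) (extChartAt (𝓡 3) x₀) x v) = 0) ∧
    ∀ y ∈ U, ∃ u v w : E3, wedgeExtDeriv a y u v w ≠ 0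

/-- A contact structure is coorientable if it is the kernel of a global smooth one-form. -/
def ContactStructure.IsCoorientable {N : Type*} [TopologicalSpace N] [ChartedSpace E3 N]
    [IsManifold (𝓡 3) ∞ N] (ξ : ContactStructure N) : Prop :=
  ∃ α : (x : N) → TangentSpace (𝓡 3) x →L[ℝ] ℝ,
    ContMDiff (𝓡 3).tangent 𝓘(ℝ, ℝ) ∞ (fun v : TangentBundle (𝓡 3) N => α v.1 v.2) ∧
    ∀ (x : N) (v : TangentSpace (𝓡 3) x), v ∈ ξ.plane x ↔ α x v = 0

/-- Two contact manifolds are contactomorphic if some diffeomorphism carries one contact structure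
to the other. -/
def Contactomorphic {N N' : Type*} [TopologicalSpace N] [ChartedSpace E3 N] [TopologicalSpace N']
    [ChartedSpace E3 N'] (ξ : ContactStructure N) (η : ContactStructure N') : Prop :=
  ∃ Ψ : N ≃ₘ^∞⟮𝓡 3, 𝓡 3⟯ N', ∀ (x : N) (v : TangentSpace (𝓡 3) x),
    v ∈ ξ.plane x ↔ mfderiv (𝓡 3) (𝓡 3) Ψ x v ∈ η.plane (Ψ x)

/-! ### The Cartan prolongation as a four-manifold -/

variable {N : Type*} [TopologicalSpace N] [ChartedSpace E3 N]

/-- The Cartan prolongation `S(ξ)`: pairs of a point `x` and an oriented line in the contact plane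
at `x`, that is, a class of nonzero vectors of `ξ_x` up to positive multiples. -/
structure CartanProlongation (ξ : ContactStructure N) where
  base : N
  ray : Module.Ray ℝ (ξ.plane base)

namespace CartanProlongation

variable {ξ : ContactStructure N}

/-- A local frame `V, Y` of the contact planes, in the coordinates of the chart at `center`, with
constant linear forms `lam, mu` that are dual to it along the planes. It yields a chart of `S(ξ)`
below. -/
structure Frame (ξ : ContactStructure N) where
  center : N
  dom : Set E3
  V : E3 → E3
  Y : E3 → E3
  lam : E3 →L[ℝ] ℝ
  mu : E3 →L[ℝ] ℝ
  isOpen_dom : IsOpen dom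
  center_mem : extChartAt (𝓡 3) center center ∈ dom
  dom_subset : dom ⊆ (extChartAt (𝓡 3) center).target
  contDiffOn_V : ContDiffOn ℝ ∞ V dom
  contDiffOn_Y : ContDiffOn ℝ ∞ Y dom
  mem_plane_iff : ∀ x ∈ (extChartAt (𝓡 3) center).source, extChartAt (𝓡 3) center x ∈ dom →
    ∀ v : TangentSpace (𝓡 3) x, v ∈ ξ.plane x ↔ ∃ c s : ℝ,
      mfderiv (𝓡 3) 𝓘(ℝ, E3) (extChartAt (𝓡 3) center) x v
        = c • V (extChartAt (𝓡 3) center x) + s • Y (extChartAt (𝓡 3) center x)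
  lam_V : ∀ y ∈ dom, lam (V y) = 1
  lam_Y : ∀ y ∈ dom, lam (Y y) = 0
  mu_V : ∀ y ∈ dom, mu (V y) = 0
  mu_Y : ∀ y ∈ dom, mu (Y y) = 1

lemma exists_someVector_eq_smul {P : Type*} [AddCommGroup P] [Module ℝ P] (v : P) (h : v ≠ 0) :
    ∃ c : ℝ, 0 < c ∧ (rayOfNeZero ℝ v h).someVector = c • v := by
  obtain ⟨c, hc, h3⟩ := ((ray_eq_iff _ h).1
    (rayOfNeZero ℝ v h).someVector_ray).symm.exists_pos_left h (Module.Ray.someVector_ne_zero _)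
  exact ⟨c, hc, h3.symm⟩

/-- A vector on the ray, in the coordinates of the chart at `x₀`. -/
def vec (x₀ : N) (u : CartanProlongation ξ) : E3 :=
  mfderiv (𝓡 3) 𝓘(ℝ, E3) (extChartAt (𝓡 3) x₀) u.base
    (u.ray.someVector : TangentSpace (𝓡 3) u.base)

section
variable [IsManifold (𝓡 3) ∞ N]

lemma mfderiv_ext_eq {x₀ x : N} (hx : x ∈ (extChartAt (𝓡 3) x₀).source) :
    mfderiv (𝓡 3) 𝓘(ℝ, E3) (extChartAt (𝓡 3) x₀) x = tangentCoordChange (𝓡 3) x x₀ x := by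
  have : MDifferentiableAt (𝓡 3) 𝓘(ℝ, E3) (extChartAt (𝓡 3) x₀) x :=
    mdifferentiableAt_extChartAt (by simpa using hx)
  rw [tangentCoordChange_def]
  exact if_pos this

lemma tcc_left {x₀ x : N} (hx : x ∈ (extChartAt (𝓡 3) x₀).source) (v : E3) :
    tangentCoordChange (𝓡 3) x₀ x x (tangentCoordChange (𝓡 3) x x₀ x v) = v := by
  rw [tangentCoordChange_comp ⟨⟨mem_extChartAt_source x, hx⟩, mem_extChartAt_source x⟩,
    tangentCoordChange_self (mem_extChartAt_source x)]

lemma tcc_right {x₀ x : N} (hx : x ∈ (extChartAt (𝓡 3) x₀).source) (v : E3) :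
    tangentCoordChange (𝓡 3) x x₀ x (tangentCoordChange (𝓡 3) x₀ x x v) = v := by
  rw [tangentCoordChange_comp ⟨⟨hx, mem_extChartAt_source x⟩, hx⟩, tangentCoordChange_self hx]

/-- The point of the prolongation given by a nonzero vector of the plane. -/
def mk' (x : N) (v : TangentSpace (𝓡 3) x) (hv : v ∈ ξ.plane x) (h0 : v ≠ 0) :
    CartanProlongation ξ :=
  ⟨x, rayOfNeZero ℝ ⟨v, hv⟩ (by simpa [Subtype.ext_iff] using h0)⟩

lemma vec_mk' (x₀ x : N) (v : TangentSpace (𝓡 3) x) (hv : v ∈ ξ.plane x) (h0 : v ≠ 0) :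
    ∃ c : ℝ, 0 < c ∧ vec x₀ (mk' x v hv h0) =
      c • (mfderiv (𝓡 3) 𝓘(ℝ, E3) (extChartAt (𝓡 3) x₀) x v : E3) := by
  have h0' : (⟨v, hv⟩ : ξ.plane x) ≠ 0 := by simpa [Subtype.ext_iff] using h0
  obtain ⟨c, hc, h⟩ := exists_someVector_eq_smul (⟨v, hv⟩ : ξ.plane x) h0'
  refine ⟨c, hc, ?_⟩
  refine Eq.trans ?_ ((mfderiv (𝓡 3) 𝓘(ℝ, E3) (extChartAt (𝓡 3) x₀) x).map_smul c v)
  exact congrArg (fun z : ξ.plane x => (mfderiv (𝓡 3) 𝓘(ℝ, E3) (extChartAt (𝓡 3) x₀) x z : E3)) h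

lemma mk'_eq (x : N) (v : TangentSpace (𝓡 3) x) (hv : v ∈ ξ.plane x) (h0 : v ≠ 0)
    (u : CartanProlongation ξ) (hx : x = u.base) (c : ℝ) (hc : 0 < c)
    (h : (v : E3) = c • ((u.ray.someVector : TangentSpace (𝓡 3) u.base) : E3)) :
    mk' x v hv h0 = u := by
  obtain ⟨b, r⟩ := u
  dsimp only at hx
  subst hx
  have h0' : (⟨v, hv⟩ : ξ.plane x) ≠ 0 := by simpa [Subtype.ext_iff] using h0
  have : rayOfNeZero ℝ (⟨v, hv⟩ : ξ.plane x) h0' = r := by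
    conv_rhs => rw [← r.someVector_ray]
    rw [ray_eq_iff]
    have : (⟨v, hv⟩ : ξ.plane x) = c • r.someVector := Subtype.ext h
    rw [this]
    exact SameRay.sameRay_pos_smul_left _ hc
  simp only [mk', this]

namespace Frame

variable (f : Frame ξ)

/-- The frame vector `V + τ Y`. -/
def coord (p : E3 × ℝ) : E3 := f.V p.1 + p.2 • f.Y p.1

lemma pt_aux {p : E3 × ℝ} (h : p.1 ∈ f.dom) :
    (tangentCoordChange (𝓡 3) f.center ((extChartAt (𝓡 3) f.center).symm p.1)
      ((extChartAt (𝓡 3) f.center).symm p.1) (f.coord p) :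
      TangentSpace (𝓡 3) ((extChartAt (𝓡 3) f.center).symm p.1)) ∈
        ξ.plane ((extChartAt (𝓡 3) f.center).symm p.1) ∧
    (tangentCoordChange (𝓡 3) f.center ((extChartAt (𝓡 3) f.center).symm p.1)
      ((extChartAt (𝓡 3) f.center).symm p.1) (f.coord p) : E3) ≠ 0 := by
  have ht := f.dom_subset h
  have hs := (extChartAt (𝓡 3) f.center).map_target ht
  have hr := (extChartAt (𝓡 3) f.center).right_inv ht
  constructor
  · refine (f.mem_plane_iff _ hs (by rwa [hr]) _).2 ⟨1, p.2, ?_⟩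
    rw [mfderiv_ext_eq hs, hr, one_smul]
    exact tcc_right hs _
  · intro h0
    have := tcc_right hs (f.coord p)
    rw [h0, map_zero] at this
    have h1 : f.lam (f.coord p) = 1 := by simp [coord, f.lam_V _ h, f.lam_Y _ h]
    rw [← this] at h1
    simp at h1

/-- The point of `S(ξ)` over the point with coordinates `y` given by the ray of `V + τ Y`. -/
def pt (p : E3 × ℝ) (h : p.1 ∈ f.dom) : CartanProlongation ξ :=
  mk' ((extChartAt (𝓡 3) f.center).symm p.1) _ (f.pt_aux h).1 (f.pt_aux h).2

lemma vec_pt (x₁ : N) (p : E3 × ℝ) (h : p.1 ∈ f.dom)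
    (hx : (extChartAt (𝓡 3) f.center).symm p.1 ∈ (extChartAt (𝓡 3) x₁).source) :
    ∃ c : ℝ, 0 < c ∧ vec x₁ (f.pt p h) = c • tangentCoordChange (𝓡 3) f.center x₁
      ((extChartAt (𝓡 3) f.center).symm p.1) (f.coord p) := by
  obtain ⟨c, hc, h1⟩ := vec_mk' x₁ _ _ (f.pt_aux h).1 (f.pt_aux h).2
  refine ⟨c, hc, ?_⟩
  unfold pt
  rw [h1, mfderiv_ext_eq hx]
  refine congrArg (fun z : E3 => c • z) ?_
  have hs := (extChartAt (𝓡 3) f.center).map_target (f.dom_subset h)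
  exact tangentCoordChange_comp ⟨⟨hs, mem_extChartAt_source _⟩, hx⟩

lemma vec_eq (u : CartanProlongation ξ) (hu : u.base ∈ (extChartAt (𝓡 3) f.center).source)
    (hd : extChartAt (𝓡 3) f.center u.base ∈ f.dom) :
    vec f.center u = f.lam (vec f.center u) • f.V (extChartAt (𝓡 3) f.center u.base) +
      f.mu (vec f.center u) • f.Y (extChartAt (𝓡 3) f.center u.base) := by
  obtain ⟨c, s, h⟩ := (f.mem_plane_iff _ hu hd _).1 u.ray.someVector.2
  have h' : vec f.center u = c • f.V (extChartAt (𝓡 3) f.center u.base) +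
      s • f.Y (extChartAt (𝓡 3) f.center u.base) := h
  rw [h', map_add, map_add, map_smul, map_smul, map_smul, map_smul, f.lam_V _ hd, f.lam_Y _ hd,
    f.mu_V _ hd, f.mu_Y _ hd]
  simp

open Classical in
/-- The chart of the prolongation defined by a frame: the ray spanned by `V + τ Y` at the point
with coordinates `y` has coordinates `(y, τ)`. -/
def chart : PartialEquiv (CartanProlongation ξ) (E3 × ℝ) where
  toFun u := (extChartAt (𝓡 3) f.center u.base,
    f.mu (vec f.center u) / f.lam (vec f.center u))
  invFun p := if h : p.1 ∈ f.dom then f.pt p h else f.pt (_, 0) f.center_mem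
  source := {u | u.base ∈ (extChartAt (𝓡 3) f.center).source ∧
    extChartAt (𝓡 3) f.center u.base ∈ f.dom ∧ 0 < f.lam (vec f.center u)}
  target := {p | p.1 ∈ f.dom}
  map_source' u hu := hu.2.1
  map_target' p hp := by
    have hp' : p.1 ∈ f.dom := hp
    have ht := f.dom_subset hp'
    have hs := (extChartAt (𝓡 3) f.center).map_target ht
    rw [dif_pos hp']
    obtain ⟨c, hc, h⟩ := f.vec_pt f.center p hp' hs
    rw [tangentCoordChange_self hs] at h
    refine ⟨hs, ?_, ?_⟩
    · change extChartAt (𝓡 3) f.center ((extChartAt (𝓡 3) f.center).symm p.1) ∈ f.dom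
      rwa [(extChartAt (𝓡 3) f.center).right_inv ht]
    · rw [h]
      simpa [coord, f.lam_V _ hp', f.lam_Y _ hp'] using hc
  left_inv' u hu := by
    obtain ⟨hs, hd, hl⟩ := hu
    rw [dif_pos (show _ ∈ f.dom from hd)]
    have hb : (extChartAt (𝓡 3) f.center).symm (extChartAt (𝓡 3) f.center u.base) = u.base :=
      (extChartAt (𝓡 3) f.center).left_inv hs
    refine mk'_eq _ _ _ _ u hb (f.lam (vec f.center u))⁻¹ (inv_pos.2 hl) ?_
    dsimp only
    rw [hb]
    have h1 : f.coord (extChartAt (𝓡 3) f.center u.base,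
        f.mu (vec f.center u) / f.lam (vec f.center u)) =
        (f.lam (vec f.center u))⁻¹ • vec f.center u := by
      have h2 := congrArg (fun z => (f.lam (vec f.center u))⁻¹ • z) (f.vec_eq u hs hd)
      refine Eq.trans ?_ h2.symm
      simp only [coord, smul_add, smul_smul, inv_mul_cancel₀ hl.ne', one_smul]
      congr 2
      field_simp
    rw [h1, map_smul]
    congr 1
    unfold vec
    rw [mfderiv_ext_eq hs]
    exact tcc_left hs _
  right_inv' p hp := by
    have hp' : p.1 ∈ f.dom := hp
    have ht := f.dom_subset hp'
    have hs := (extChartAt (𝓡 3) f.center).map_target ht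
    rw [dif_pos hp']
    obtain ⟨c, hc, h⟩ := f.vec_pt f.center p hp' hs
    rw [tangentCoordChange_self hs] at h
    have hb : (f.pt p hp').base = (extChartAt (𝓡 3) f.center).symm p.1 := rfl
    rw [h, hb, (extChartAt (𝓡 3) f.center).right_inv ht]
    ext1
    · rfl
    · simp [coord, f.lam_V _ hp', f.lam_Y _ hp', f.mu_V _ hp', f.mu_Y _ hp', hc.ne']

/-- Coordinates of the frame vector of `f` in the chart at the centre of `f'`. -/
def trans (f' : Frame ξ) (p : E3 × ℝ) : E3 :=
  tangentCoordChange (𝓡 3) f.center f'.center ((extChartAt (𝓡 3) f.center).symm p.1) (f.coord p)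

lemma source_trans (f' : Frame ξ) : (f.chart.symm.trans f'.chart).source =
    {p | p.1 ∈ f.dom ∧ (extChartAt (𝓡 3) f.center).symm p.1 ∈ (extChartAt (𝓡 3) f'.center).source ∧
      extChartAt (𝓡 3) f'.center ((extChartAt (𝓡 3) f.center).symm p.1) ∈ f'.dom ∧
      0 < f'.lam (f.trans f' p)} := by
  ext p
  simp only [PartialEquiv.trans_source, PartialEquiv.symm_source, mem_inter_iff, mem_preimage,
    mem_ofPred_eq]
  refine and_congr_right fun hp => ?_
  have hp' : p.1 ∈ f.dom := hp
  have e : f.chart.symm p = f.pt p hp' := dif_pos hp'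
  rw [e]
  refine and_congr_right fun hs => and_congr_right fun _ => ?_
  obtain ⟨c, hc, h⟩ := f.vec_pt f'.center p hp' hs
  rw [h, map_smul, smul_eq_mul, mul_pos_iff_of_pos_left hc]
  rfl

lemma trans_eqOn (f' : Frame ξ) : EqOn (f.chart.symm.trans f'.chart)
    (fun p => (extChartAt (𝓡 3) f'.center ((extChartAt (𝓡 3) f.center).symm p.1),
      f'.mu (f.trans f' p) / f'.lam (f.trans f' p))) (f.chart.symm.trans f'.chart).source := by
  intro p hp
  rw [source_trans] at hp
  obtain ⟨hp', hs, -, -⟩ := hp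
  have e : f.chart.symm p = f.pt p hp' := dif_pos hp'
  rw [PartialEquiv.trans_apply, e]
  obtain ⟨c, hc, h⟩ := f.vec_pt f'.center p hp' hs
  ext1
  · rfl
  · change f'.mu (vec f'.center (f.pt p hp')) / f'.lam (vec f'.center (f.pt p hp')) = _
    rw [h, map_smul, map_smul, smul_eq_mul, smul_eq_mul, mul_div_mul_left _ _ hc.ne']
    rfl

/-- The domain of the base change of coordinates. -/
def baseDom (f' : Frame ξ) : Set (E3 × ℝ) :=
  {p | p.1 ∈ f.dom ∧ (extChartAt (𝓡 3) f.center).symm p.1 ∈ (extChartAt (𝓡 3) f'.center).source}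

lemma isOpen_ccs (x x' : N) : IsOpen ((extChartAt (𝓡 3) x').symm ≫ extChartAt (𝓡 3) x).source := by
  rw [PartialEquiv.trans_source]
  exact (continuousOn_extChartAt_symm x').isOpen_inter_preimage (isOpen_extChartAt_target x')
    (isOpen_extChartAt_source x)

lemma isOpen_baseDom (f' : Frame ξ) : IsOpen (f.baseDom f') := by
  have : f.baseDom f' = Prod.fst ⁻¹' (f.dom ∩
      ((extChartAt (𝓡 3) f.center).symm ≫ extChartAt (𝓡 3) f'.center).source) := by
    ext p
    simp only [baseDom, mem_ofPred_eq, mem_preimage, mem_inter_iff, PartialEquiv.trans_source,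
      PartialEquiv.symm_source]
    exact ⟨fun h => ⟨h.1, f.dom_subset h.1, h.2⟩, fun h => ⟨h.1, h.2.2⟩⟩
  rw [this]
  exact (f.isOpen_dom.inter (isOpen_ccs _ _)).preimage continuous_fst

lemma contDiffOn_base (f' : Frame ξ) : ContDiffOn ℝ ∞ (fun p : E3 × ℝ =>
    extChartAt (𝓡 3) f'.center ((extChartAt (𝓡 3) f.center).symm p.1)) (f.baseDom f') := by
  refine (contDiffOn_ext_coord_change (n := ∞) (I := 𝓡 3) f'.center f.center).comp
    contDiff_fst.contDiffOn ?_
  intro p hp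
  exact ⟨f.dom_subset hp.1, hp.2⟩

lemma contDiffOn_trans (f' : Frame ξ) : ContDiffOn ℝ ∞ (f.trans f') (f.baseDom f') := by
  have h1 : ContDiffOn ℝ ∞ (fun p : E3 × ℝ => fderiv ℝ
      (extChartAt (𝓡 3) f'.center ∘ (extChartAt (𝓡 3) f.center).symm) p.1) (f.baseDom f') := by
    refine ((contDiffOn_ext_coord_change (n := ∞) (I := 𝓡 3) f'.center f.center).fderiv_of_isOpen
      (m := ∞) (isOpen_ccs _ _) le_rfl).comp contDiff_fst.contDiffOn ?_
    intro p hp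
    exact ⟨f.dom_subset hp.1, hp.2⟩
  have hm : MapsTo Prod.fst (f.baseDom f') f.dom := fun p hp => hp.1
  have h2 : ContDiffOn ℝ ∞ f.coord (f.baseDom f') :=
    (f.contDiffOn_V.comp contDiff_fst.contDiffOn hm).add
      (contDiff_snd.contDiffOn.smul (f.contDiffOn_Y.comp contDiff_fst.contDiffOn hm))
  refine (h1.clm_apply h2).congr fun p hp => ?_
  unfold trans
  rw [tangentCoordChange_def, (extChartAt (𝓡 3) f.center).right_inv (f.dom_subset hp.1)]
  simp [fderivWithin_univ]

lemma isOpen_source (f' : Frame ξ) : IsOpen (f.chart.symm.trans f'.chart).source := by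
  rw [source_trans]
  have h1 := ((f.contDiffOn_base f').continuousOn.prodMk
    (f'.lam.continuous.comp_continuousOn (f.contDiffOn_trans f').continuousOn)).isOpen_inter_preimage
      (f.isOpen_baseDom f') (f'.isOpen_dom.prod isOpen_Ioi : IsOpen (f'.dom ×ˢ Ioi (0 : ℝ)))
  refine Eq.mp (congrArg IsOpen ?_) h1
  ext p
  exact ⟨fun h => ⟨h.1.1, h.1.2, h.2⟩, fun h => ⟨⟨h.1, h.2.1⟩, h.2.2⟩⟩

lemma contDiffOn_chart_change (f' : Frame ξ) : ContDiffOn ℝ ∞ (f.chart.symm.trans f'.chart)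
    (f.chart.symm.trans f'.chart).source := by
  refine ContDiffOn.congr ?_ (f.trans_eqOn f')
  have hsub : (f.chart.symm.trans f'.chart).source ⊆ f.baseDom f' := by
    rw [source_trans]
    exact fun p hp => ⟨hp.1, hp.2.1⟩
  have h1 := (f.contDiffOn_trans f').mono hsub
  refine ((f.contDiffOn_base f').mono hsub).prodMk
    ((f'.mu.contDiff.comp_contDiffOn h1).div (f'.lam.contDiff.comp_contDiffOn h1) ?_)
  intro p hp
  rw [source_trans] at hp
  exact hp.2.2.2.ne'

end Frame

lemma vec_ne_zero (u : CartanProlongation ξ) : vec u.base u ≠ 0 := by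
  intro h
  unfold vec at h
  rw [mfderiv_ext_eq (mem_extChartAt_source _)] at h
  have h' := tangentCoordChange_self (I := 𝓡 3) (mem_extChartAt_source (I := 𝓡 3) u.base)
    (v := ((u.ray.someVector : TangentSpace (𝓡 3) u.base) : E3))
  have h2 : ((u.ray.someVector : TangentSpace (𝓡 3) u.base) : E3) = 0 := h'.symm.trans h
  exact u.ray.someVector_ne_zero (Subtype.ext h2)

lemma exists_frame (u : CartanProlongation ξ) : ∃ f : Frame ξ, u ∈ f.chart.source := by
  obtain ⟨U, a, hU, hxU, hUt, ha, hpl, hw⟩ := ξ.exists_form u.base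
  set y₀ := extChartAt (𝓡 3) u.base u.base with hy₀
  set v : E3 := vec u.base u with hv
  have hv0 : v ≠ 0 := vec_ne_zero u
  have hav : a y₀ v = 0 := (hpl _ (mem_extChartAt_source _) hxU _).1 u.ray.someVector.2
  have ha0 : a y₀ ≠ 0 := by
    intro h0
    obtain ⟨p, q, r, h⟩ := hw y₀ hxU
    simp [wedgeExtDeriv, h0] at h
  obtain ⟨n', hn'⟩ : ∃ n, a y₀ n ≠ 0 := by
    by_contra! h
    exact ha0 (ContinuousLinearMap.ext h)
  set K := LinearMap.ker (a y₀ : E3 →ₗ[ℝ] ℝ) with hK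
  have hKdim : 1 < Module.finrank ℝ K := by
    have h1 : Module.finrank ℝ (LinearMap.range (a y₀ : E3 →ₗ[ℝ] ℝ)) + Module.finrank ℝ K =
        Module.finrank ℝ E3 := LinearMap.finrank_range_add_finrank_ker _
    have h2 : Module.finrank ℝ (LinearMap.range (a y₀ : E3 →ₗ[ℝ] ℝ)) ≤ 1 := by
      simpa using Submodule.finrank_le (LinearMap.range (a y₀ : E3 →ₗ[ℝ] ℝ))
    have h3 : Module.finrank ℝ E3 = 3 := by simp
    omega
  have hvK : (⟨v, hav⟩ : K) ≠ 0 := by simpa [Subtype.ext_iff] using hv0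
  obtain ⟨⟨v₂, hv₂⟩, hli⟩ := exists_linearIndependent_pair_of_one_lt_finrank hKdim hvK
  have hav₂ : a y₀ v₂ = 0 := hv₂
  have hli3 : LinearIndependent ℝ ![v, v₂, n'] := by
    rw [LinearIndependent.pair_iff] at hli
    rw [Fintype.linearIndependent_iff]
    intro g hg
    simp only [Fin.sum_univ_three, Matrix.cons_val_zero, Matrix.cons_val_one,
      Matrix.cons_val_two, Matrix.head_cons, Matrix.tail_cons] at hg
    have h2 : g 2 = 0 := by
      have := congrArg (a y₀) hg
      simpa [hav, hav₂, hn'] using this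
    rw [h2, zero_smul, add_zero] at hg
    have h01 := hli (g 0) (g 1) (Subtype.ext hg)
    intro i
    fin_cases i
    · exact h01.1
    · exact h01.2
    · exact h2
  set b := basisOfLinearIndependentOfCardEqFinrank hli3 (by simp) with hb
  have hb0 : b 0 = v := by simp [hb]
  have hb1 : b 1 = v₂ := by simp [hb]
  have hb2 : b 2 = n' := by simp [hb]
  set lam : E3 →L[ℝ] ℝ := LinearMap.toContinuousLinearMap (b.coord 0) with hlam
  set mu : E3 →L[ℝ] ℝ := LinearMap.toContinuousLinearMap (b.coord 1) with hmu
  set nu : E3 →L[ℝ] ℝ := LinearMap.toContinuousLinearMap (b.coord 2) with hnu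
  have l0 : lam v = 1 := by simp [hlam, ← hb0]
  have l1 : lam v₂ = 0 := by simp [hlam, ← hb1]
  have l2 : lam n' = 0 := by simp [hlam, ← hb2]
  have m0 : mu v = 0 := by simp [hmu, ← hb0]
  have m1 : mu v₂ = 1 := by simp [hmu, ← hb1]
  have m2 : mu n' = 0 := by simp [hmu, ← hb2]
  have hexp : ∀ w : E3, w = lam w • v + mu w • v₂ + nu w • n' := by
    intro w
    have := b.sum_repr w
    rw [Fin.sum_univ_three, hb0, hb1, hb2] at this
    exact this.symm
  have hdom : IsOpen (U ∩ (fun y => a y n') ⁻¹' {0}ᶜ) :=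
    (ha.continuousOn.clm_apply continuousOn_const).isOpen_inter_preimage hU isOpen_compl_singleton
  have hsm : ∀ z : E3, ContDiffOn ℝ ∞ (fun y => z - (a y z / a y n') • n')
      (U ∩ (fun y => a y n') ⁻¹' {0}ᶜ) := by
    intro z
    have h1 : ∀ z : E3, ContDiffOn ℝ ∞ (fun y => a y z) (U ∩ (fun y => a y n') ⁻¹' {0}ᶜ) :=
      fun z => (ha.mono inter_subset_left).clm_apply contDiffOn_const
    exact contDiffOn_const.sub (((h1 z).div (h1 n') fun y hy => hy.2).smul contDiffOn_const)
  refine ⟨⟨u.base, U ∩ (fun y => a y n') ⁻¹' {0}ᶜ, fun y => v - (a y v / a y n') • n',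
    fun y => v₂ - (a y v₂ / a y n') • n', lam, mu, hdom, ⟨hxU, hn'⟩,
    inter_subset_left.trans hUt, hsm v, hsm v₂, ?_, ?_, ?_, ?_, ?_⟩, ?_⟩
  · intro x hx hxd w
    rw [hpl x hx hxd.1]
    have hn : a (extChartAt (𝓡 3) u.base x) n' ≠ 0 := hxd.2
    generalize (mfderiv (𝓡 3) 𝓘(ℝ, E3) (extChartAt (𝓡 3) u.base) x) w = w'
    change a (extChartAt (𝓡 3) u.base x) (w' : E3) = 0 ↔ ∃ c s : ℝ, (w' : E3) = _
    generalize a (extChartAt (𝓡 3) u.base x) = A at hn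
    constructor
    · intro h
      refine ⟨lam w', mu w', ?_⟩
      have h1 := hexp w'
      have h2 : lam w' * A v + mu w' * A v₂ + nu w' * A n' = 0 := by
        rw [h1] at h
        simpa using h
      have h3 : nu w' = -(lam w' * (A v / A n') + mu w' * (A v₂ / A n')) := by
        field_simp
        linarith
      refine h1.trans ?_
      rw [h3]
      module
    · rintro ⟨c, s, rfl⟩
      simp [hn]
  · intro y _
    simp [l0, l2]
  · intro y _
    simp [l1, l2]
  · intro y _
    simp [m0, m2]
  · intro y _
    simp [m1, m2]
  · refine ⟨mem_extChartAt_source _, ⟨hxU, hn'⟩, ?_⟩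
    change 0 < lam v
    rw [l0]
    exact one_pos

/-- The smooth atlas of the prolongation. -/
def core (ξ : ContactStructure N) : ChartedSpaceCore (E3 × ℝ) (CartanProlongation ξ) where
  atlas := range Frame.chart
  chartAt u := (exists_frame u).choose.chart
  mem_chart_source u := (exists_frame u).choose_spec
  chart_mem_atlas u := mem_range_self _
  open_source := by
    rintro _ _ ⟨f, rfl⟩ ⟨f', rfl⟩
    exact f.isOpen_source f'
  continuousOn_toFun := by
    rintro _ _ ⟨f, rfl⟩ ⟨f', rfl⟩
    exact (f.contDiffOn_chart_change f').continuousOn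

instance : TopologicalSpace (CartanProlongation ξ) := (core ξ).toTopologicalSpace

instance : ChartedSpace (E3 × ℝ) (CartanProlongation ξ) := (core ξ).toChartedSpace

instance : IsManifold 𝓘(ℝ, E3 × ℝ) ∞ (CartanProlongation ξ) := by
  refine isManifold_of_contDiffOn _ _ _ ?_
  intro e e' he he'
  simp only [atlas, ChartedSpace.atlas, core] at he he'
  simp only [mem_iUnion, mem_range] at he he'
  obtain ⟨_, ⟨f, rfl⟩, rfl⟩ := he
  obtain ⟨_, ⟨f', rfl⟩, rfl⟩ := he'
  exact (f.contDiffOn_chart_change f').mono fun p hp => hp.1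

/-- The projection of the prolongation is smooth. -/
lemma contMDiff_base : ContMDiff 𝓘(ℝ, E3 × ℝ) (𝓡 3) ∞ (base : CartanProlongation ξ → N) := by
  intro u
  set f := (exists_frame u).choose with hf
  have hu : u ∈ f.chart.source := (exists_frame u).choose_spec
  have hsrc : (chartAt (E3 × ℝ) u).source = f.chart.source := rfl
  have h1 : ContMDiffAt 𝓘(ℝ, E3 × ℝ) 𝓘(ℝ, E3 × ℝ) ∞ (chartAt (E3 × ℝ) u) u :=
    (contMDiffOn_chart (I := 𝓘(ℝ, E3 × ℝ))).contMDiffAt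
      (((chartAt (E3 × ℝ) u).open_source).mem_nhds (mem_chart_source _ u))
  have h2 : ContMDiffAt 𝓘(ℝ, E3 × ℝ) 𝓘(ℝ, E3) ∞ (fun z => (chartAt (E3 × ℝ) u z).1) u :=
    (contDiff_fst (𝕜 := ℝ) (E := E3) (F := ℝ)).contMDiff.contMDiffAt.comp u h1
  have h3 : ContMDiffAt 𝓘(ℝ, E3) (𝓡 3) ∞ (extChartAt (𝓡 3) f.center).symm
      (chartAt (E3 × ℝ) u u).1 :=
    (contMDiffOn_extChartAt_symm f.center).contMDiffAt
      ((isOpen_extChartAt_target f.center).mem_nhds (f.dom_subset hu.2.1))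
  refine (h3.comp u h2).congr_of_eventuallyEq ?_
  filter_upwards [(chartAt (E3 × ℝ) u).open_source.mem_nhds (mem_chart_source _ u)] with z hz
  exact ((extChartAt (𝓡 3) f.center).left_inv hz.1).symm

/-- The canonical (Engel) distribution `D` of the Cartan prolongation: the vectors which the
projection to `N` maps into the line spanned by the ray. -/
def engel (ξ : ContactStructure N) (u : CartanProlongation ξ) :
    Submodule ℝ (TangentSpace 𝓘(ℝ, E3 × ℝ) u) :=
  (Submodule.span ℝ {(u.ray.someVector : TangentSpace (𝓡 3) u.base)}).comap
    (mfderiv 𝓘(ℝ, E3 × ℝ) (𝓡 3) (base : CartanProlongation ξ → N) u).toLinearMap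

end

end CartanProlongation

/-! ### Distributions, their brackets and kernels, and foliations by circles -/

section Distributions

variable {E H Q : Type*} [NormedAddCommGroup E] [NormedSpace ℝ E] [TopologicalSpace H]
  {I : ModelWithCorners ℝ E H} [TopologicalSpace Q] [ChartedSpace H Q] [IsManifold I ∞ Q]

/-- `X` is a smooth section of the distribution `Δ` on an open neighbourhood of `x`. -/
def IsLocalSection (Δ : (x : Q) → Submodule ℝ (TangentSpace I x))
    (X : (x : Q) → TangentSpace I x) (x : Q) : Prop :=
  ∃ U : Set Q, IsOpen U ∧ x ∈ U ∧
    ContMDiffOn I I.tangent ∞ (fun y => (⟨y, X y⟩ : TangentBundle I Q)) U ∧ ∀ y ∈ U, X y ∈ Δ y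

/-- The distribution `[Δ, Δ]` generated by the local sections of `Δ` and their Lie brackets. -/
def derivedDistribution (Δ : (x : Q) → Submodule ℝ (TangentSpace I x)) (x : Q) :
    Submodule ℝ (TangentSpace I x) :=
  Δ x ⊔ Submodule.span ℝ {v | ∃ X Y : (y : Q) → TangentSpace I y,
    IsLocalSection Δ X x ∧ IsLocalSection Δ Y x ∧ v = VectorField.mlieBracket I X Y x}

/-- The kernel (Cauchy characteristic) of a distribution `Δ`: the directions `X x` of local
sections `X` of `Δ` with `[X, Y] x ∈ Δ x` for all local sections `Y` of `Δ`. -/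
def characteristic (Δ : (x : Q) → Submodule ℝ (TangentSpace I x)) (x : Q) :
    Submodule ℝ (TangentSpace I x) :=
  Submodule.span ℝ {v | ∃ X : (y : Q) → TangentSpace I y, IsLocalSection Δ X x ∧ X x = v ∧
    ∀ Y : (y : Q) → TangentSpace I y, IsLocalSection Δ Y x →
      VectorField.mlieBracket I X Y x ∈ Δ x}

/-- The kernel `W` of an Engel structure `D`: the line field in `E = [D, D]` with
`[W, E] ⊆ E`. -/
def engelKernel (D : (x : Q) → Submodule ℝ (TangentSpace I x)) (x : Q) :
    Submodule ℝ (TangentSpace I x) :=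
  characteristic (derivedDistribution D) x

variable (Q I) in
/-- An oriented foliation by circles, given by a nowhere vanishing smooth vector field which spans
the tangent lines of the leaves positively, and all of whose integral curves are periodic. -/
structure OrientedCircleFoliation where
  field : (u : Q) → TangentSpace I u
  smooth : ContMDiff I I.tangent ∞ (fun u => (⟨u, field u⟩ : TangentBundle I Q))
  ne_zero : ∀ u, field u ≠ 0
  periodic : ∀ u, ∃ γ : ℝ → Q, γ 0 = u ∧ IsMIntegralCurve (I := I) γ field ∧
    ∃ T : ℝ, 0 < T ∧ Function.Periodic γ T

namespace OrientedCircleFoliation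

variable (F : OrientedCircleFoliation Q I)

/-- The tangent line at `u` of the leaf through `u`. -/
def tangent (u : Q) : Submodule ℝ (TangentSpace I u) := Submodule.span ℝ {F.field u}

/-- The leaf through `u`: the orbit of `u`. -/
def leaf (u : Q) : Set Q :=
  {w | ∃ γ : ℝ → Q, γ 0 = u ∧ IsMIntegralCurve (I := I) γ F.field ∧ w ∈ range γ}

/-- The space of leaves: two points are identified if their leaves coincide. -/
def LeafSpace : Type _ := Quotient (Setoid.ker F.leaf)

/-- The space of leaves carries the quotient topology. -/
instance : TopologicalSpace F.LeafSpace :=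
  inferInstanceAs (TopologicalSpace (Quotient (Setoid.ker F.leaf)))

/-- The projection to the space of leaves. -/
def proj (u : Q) : F.LeafSpace := Quotient.mk (Setoid.ker F.leaf) u

end OrientedCircleFoliation

variable {M : Type*} [TopologicalSpace M] [ChartedSpace E3 M]

/-- The image `p_* D_u` of the subspace `D_u`, as a set of tangent vectors of `M` (at `p u`). -/
def pushforward (D : (x : Q) → Submodule ℝ (TangentSpace I x)) (p : Q → M) (u : Q) :
    Set (TangentBundle (𝓡 3) M) :=
  {w | ∃ d ∈ D u, tangentMap I (𝓡 3) p ⟨u, d⟩ = w}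

/-- The union in `T_m M` of the images `p_* D_u` over all points `u` of the fibre over `m`. -/
def pushforwardFibre (D : (x : Q) → Submodule ℝ (TangentSpace I x)) (p : Q → M) (m : M) :
    Set (TangentSpace (𝓡 3) m) :=
  {v | ∃ u : Q, p u = m ∧ (⟨m, v⟩ : TangentBundle (𝓡 3) M) ∈ pushforward D p u}

end Distributions

/-! ### Lorentzian metrics -/

/-- A symmetric form of Lorentzian signature `(+, …, +, -)`: there is a negative vector whose
orthogonal complement is positive definite. -/
def IsLorentzForm {V : Type*} [Zero V] (b : V → V → ℝ) : Prop :=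
  (∀ v w, b v w = b w v) ∧ ∃ T, b T T < 0 ∧ ∀ v, b T v = 0 → v ≠ 0 → 0 < b v v

section Lorentz

variable {M : Type*} [TopologicalSpace M] [ChartedSpace E3 M]

/-- A set of tangent vectors at `m` is a cone if it is the set of zeros of a quadratic form of
Lorentzian signature, i.e. a nondegenerate quadratic cone (including its vertex). -/
def IsCone {m : M} (C : Set (TangentSpace (𝓡 3) m)) : Prop :=
  ∃ b : TangentSpace (𝓡 3) m →L[ℝ] TangentSpace (𝓡 3) m →L[ℝ] ℝ,
    IsLorentzForm (fun v w => b v w) ∧ C = {v | b v v = 0}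

variable [IsManifold (𝓡 3) ∞ M]

variable (M) in
/-- A smooth Lorentzian metric on a three-manifold. -/
structure LorentzMetric where
  form : (x : M) → TangentSpace (𝓡 3) x →L[ℝ] TangentSpace (𝓡 3) x →L[ℝ] ℝ
  lorentz : ∀ x, IsLorentzForm (fun v w => form x v w)
  smooth : ContMDiff (𝓡 3) ((𝓡 3).prod 𝓘(ℝ, E3 →L[ℝ] E3 →L[ℝ] ℝ)) ∞
    (fun x => Bundle.TotalSpace.mk' (E3 →L[ℝ] E3 →L[ℝ] ℝ) x (form x))

namespace LorentzMetric

variable (g : LorentzMetric M)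

/-- The null cones of `g`, with their vertices, are the sets `C m`. -/
def HasNullCones (C : (m : M) → Set (TangentSpace (𝓡 3) m)) : Prop :=
  ∀ m, C m = {v | g.form m v v = 0}

/-- A metric is time-orientable if there is a global smooth timelike vector field. -/
def IsTimeOrientable : Prop :=
  ∃ X : (x : M) → TangentSpace (𝓡 3) x,
    ContMDiff (𝓡 3) (𝓡 3).tangent ∞ (fun x => (⟨x, X x⟩ : TangentBundle (𝓡 3) M)) ∧
    ∀ x, g.form x (X x) (X x) < 0

/-- A null vector: nonzero with `g(v, v) = 0`. -/
def IsNull (v : TangentBundle (𝓡 3) M) : Prop := v.2 ≠ 0 ∧ g.form v.1 v.2 v.2 = 0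

/-- The metric in the coordinates of the chart at `x₀`, at the coordinate point `y`. -/
def coord (x₀ : M) (y v w : E3) : ℝ :=
  g.form ((extChartAt (𝓡 3) x₀).symm y)
    (mfderiv 𝓘(ℝ, E3) (𝓡 3) (extChartAt (𝓡 3) x₀).symm y v)
    (mfderiv 𝓘(ℝ, E3) (𝓡 3) (extChartAt (𝓡 3) x₀).symm y w)

/-- `γ` is a (smooth, affinely parametrized) geodesic on the set `J` of parameters (an open
interval below): in coordinates `c = φ ∘ γ`, for all vectors `w`,
`g(c'', w) + (D_{c'} g)(c', w) - (1/2) (D_w g)(c', c') = 0`.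
This is `g(c'' + Γ(c', c'), w) = 0` with `Γ` the Christoffel symbols of the Levi-Civita
connection. The equation does not depend on the chart; at each `t` the chart at `γ t` is used. -/
def IsGeodesicOn (γ : ℝ → M) (J : Set ℝ) : Prop :=
  ContMDiffOn 𝓘(ℝ, ℝ) (𝓡 3) ∞ γ J ∧ ∀ t ∈ J, ∀ w : E3,
    let c : ℝ → E3 := fun s => extChartAt (𝓡 3) (γ t) (γ s)
    g.coord (γ t) (c t) (deriv (deriv c) t) w
      + fderiv ℝ (fun y => g.coord (γ t) y (deriv c t) w) (c t) (deriv c t)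
      - (1 / 2) * fderiv ℝ (fun y => g.coord (γ t) y (deriv c t) (deriv c t)) (c t) w = 0

end LorentzMetric

/-- The velocity vector of a curve. -/
def velocity (γ : ℝ → M) (t : ℝ) : TangentBundle (𝓡 3) M :=
  tangentMap 𝓘(ℝ, ℝ) (𝓡 3) γ ⟨t, (1 : ℝ)⟩

namespace LorentzMetric

variable (g : LorentzMetric M)

/-- `γ`, restricted to the open interval `J`, is an inextendible null geodesic. -/
structure IsMaximalNullGeodesic (γ : ℝ → M) (J : Set ℝ) : Prop where
  isOpen : IsOpen J
  ordConnected : J.OrdConnected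
  nonempty : J.Nonempty
  isGeodesicOn : g.IsGeodesicOn γ J
  isNull : ∀ t ∈ J, g.IsNull (velocity γ t)
  maximal : ∀ (γ' : ℝ → M) (J' : Set ℝ), IsOpen J' → J'.OrdConnected → J ⊆ J' →
    g.IsGeodesicOn γ' J' → EqOn γ' γ J → J' = J

/-- The space of null geodesics: the set of the images `γ(J)` of the maximal null geodesics. As
`t ↦ γ (-t)` has the same image as `γ`, these are the images of the future-directed maximal null
geodesics for any time-orientation of `g`. -/
def NullGeodesicSpace : Type _ :=
  {L : Set M // ∃ (γ : ℝ → M) (J : Set ℝ), g.IsMaximalNullGeodesic γ J ∧ L = γ '' J}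

variable {g} in
/-- `v` is a velocity vector of a parametrization of the null geodesic `L`. -/
def IsTangentTo (v : TangentBundle (𝓡 3) M) (L : g.NullGeodesicSpace) : Prop :=
  ∃ (γ : ℝ → M) (J : Set ℝ), g.IsMaximalNullGeodesic γ J ∧ L.1 = γ '' J ∧
    ∃ t ∈ J, velocity γ t = v

section

variable [TopologicalSpace g.NullGeodesicSpace] [ChartedSpace E3 g.NullGeodesicSpace]

/-- A smooth structure on the space of null geodesics is the canonical one if the projection from
the manifold of null vectors, which takes a null vector to the null geodesic tangent to it, is a
smooth submersion: it is smooth (locally the restriction of a smooth map on an open subset of the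
tangent bundle), and each null vector lies on a smooth local section of it. There is at most one
such smooth structure, namely that of the quotient by geodesic flow and scaling. -/
def IsCanonicalSmoothStructure : Prop :=
  (∀ v, g.IsNull v → ∃ (O : Set (TangentBundle (𝓡 3) M))
    (P : TangentBundle (𝓡 3) M → g.NullGeodesicSpace), IsOpen O ∧ v ∈ O ∧
      ContMDiffOn (𝓡 3).tangent (𝓡 3) ∞ P O ∧ ∀ w ∈ O, g.IsNull w → IsTangentTo w (P w)) ∧
  (∀ (L : g.NullGeodesicSpace) (v : TangentBundle (𝓡 3) M), IsTangentTo v L →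
    ∃ (O : Set g.NullGeodesicSpace) (s : g.NullGeodesicSpace → TangentBundle (𝓡 3) M),
      IsOpen O ∧ L ∈ O ∧ ContMDiffOn (𝓡 3) (𝓡 3).tangent ∞ s O ∧ s L = v ∧
      ∀ L' ∈ O, IsTangentTo (s L') L')

variable {g}

/-- The tangent space at `L` of the sky of `x`, where `v` is a null vector at `x` tangent to `L`:
the sky of `x` consists of the null geodesics through `x`, and its tangent vectors at `L` are the
velocities of the curves of null geodesics `ℓ ε` through `x` with direction `c ε` at `x`, where
`c 0 = v` and `ℓ 0 = L`. (If `L` passes through `x` more than once, `v` picks the branch.) -/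
def skyTangent (L : g.NullGeodesicSpace) (v : TangentBundle (𝓡 3) M) :
    Submodule ℝ (TangentSpace (𝓡 3) L) :=
  Submodule.span ℝ {w | ∃ (c : ℝ → TangentBundle (𝓡 3) M) (ℓ : ℝ → g.NullGeodesicSpace),
    ContMDiff 𝓘(ℝ, ℝ) (𝓡 3).tangent ∞ c ∧ ContMDiff 𝓘(ℝ, ℝ) (𝓡 3) ∞ ℓ ∧
    (∀ ε, (c ε).proj = v.proj) ∧ (∀ ε, IsTangentTo (c ε) (ℓ ε)) ∧ c 0 = v ∧ ℓ 0 = L ∧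
    tangentMap 𝓘(ℝ, ℝ) (𝓡 3) ℓ ⟨0, (1 : ℝ)⟩ = ⟨L, w⟩}

/-- The canonical contact structure on the space of null geodesics: at a null geodesic `L` it is
the direct sum of the tangent spaces of the skies of two points of `L` (given with the tangent
vectors `v`, `w` of `L` there) that are not conjugate along `L`, i.e. for which no one-parameter
family of null geodesics joins them to first order, so that the two tangent spaces meet only in
zero. Such points exist, and all such pairs give the same plane. -/
def IsCanonicalContactStructure (H : ContactStructure g.NullGeodesicSpace) : Prop :=
  ∀ L : g.NullGeodesicSpace,
    (∃ v w, IsTangentTo v L ∧ IsTangentTo w L ∧ Disjoint (skyTangent L v) (skyTangent L w)) ∧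
    ∀ v w, IsTangentTo v L → IsTangentTo w L → Disjoint (skyTangent L v) (skyTangent L w) →
      H.plane L = skyTangent L v ⊔ skyTangent L w

end

end LorentzMetric

/-- `(N, ξ)` is contactomorphic to the contact manifold of null geodesics of `g`: the space of null
geodesics is a manifold for its canonical smooth structure, it has its canonical contact structure,
and this contact manifold is contactomorphic to `(N, ξ)`. -/
def IsContactomorphicToNullGeodesics (ξ : ContactStructure N) (g : LorentzMetric M) : Prop :=
  ∃ (_ : TopologicalSpace g.NullGeodesicSpace) (_ : ChartedSpace E3 g.NullGeodesicSpace)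
    (_ : IsManifold (𝓡 3) ∞ g.NullGeodesicSpace) (H : ContactStructure g.NullGeodesicSpace),
    g.IsCanonicalSmoothStructure ∧ LorentzMetric.IsCanonicalContactStructure H ∧
      Contactomorphic ξ H

end Lorentz

end NullGeod

end

/-! Let `p` be the projection to the leaf space `M`. In polar coordinates `(y, θ)` on the
prolongation, with `y` in a chart of `N`, the Engel plane is spanned by `∂_θ` and by the horizontal
vector `dir = cos θ V + sin θ Y`. The fibre direction `∂_θ` lies in the kernel `W`. A leaf is
transverse to `W` inside the Engel plane, so it is spanned by `leafDir = (dir, -slope)`, and `p_* D`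
is the line of the null vector `k = dp(∂_θ)`. Thus the fibres of the prolongation over `N` project
to null curves of `M`, and the whole theorem follows from the interplay of the two fibrations.

The basic identity is `fderiv_nullVec_leafDir`: along a leaf, the derivative of `k` is `-dp(dir')`
modulo `k`, where `dir'` is the derivative of `dir` in the angle. Along one leaf `k` moves on one
cone, so `dp(dir')` is orthogonal to `k` (`coordForm_dir'`), and `k^⊥` is spanned by `k` and
`dp(dir')`. Hence a horizontal vector `v` satisfies `⟨k, dp v⟩ = 0` exactly when it lies in the
contact plane (`coordForm_horizontal_eq_zero_iff`).

Geodesics. The derivative in `θ` of `⟨k, dp v⟩` is the Euler-Lagrange form of the energy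
(`fderiv_apply_variation`). For fixed `y` all the functionals `v ↦ ⟨k, dp v⟩` have the same kernel,
so they are multiples `φ(θ) c(v)` of a fixed one, and the curve `θ ↦ p(y, θ)` is a geodesic for the
affine parameter with derivative `φ` (`isGeodesicOn_model`). Since `φ` is periodic without zeros,
this parameter fills the line. Conversely, the lift of a null geodesic cannot move along the leaves:
a component `β leafDir` of its velocity would violate the geodesic equation in the spacelike
direction `dp(dir')` (`eventually_velocity_eq`). So the null geodesics are exactly the projected
fibres (`image_maximalNullGeodesic`), and different fibres have different images because a common
image would force a tangency (`nullCurve_injective`). This identifies the space of null geodesics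
with `N`, whose smooth and contact structures are carried over. Moving in a sky means moving along a
leaf, and the horizontal part of `leafDir` is `dir`; the tangent line of the sky is therefore the
ray of the prolongation (`skyTangent_eq`), and two such lines span the contact plane.

Metric. The given cones determine a Lorentzian form up to scale at each point. Three null fields and
two fields `dp(dir')` determine the ratios of the entries of the form smoothly
(`contDiffAt_normalised_form`), and the local metrics are glued by a partition of unity.

Time orientation. A contact form lifted to the prolongation is `⟨r k, dp ·⟩` with a nowhere zero
factor `r`. The sign of its value on a timelike vector cannot change along a leaf, so `r k` selects
one half of each cone (`isNegative_iff_of_proj_eq`), and local timelike fields in the chosen halves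
are glued by convexity. -/

set_option linter.unusedSectionVars false

noncomputable section

namespace NullGeod

/-! ### Linear algebra of Lorentzian forms -/

section LorentzAlgebra

variable {E : Type*} [NormedAddCommGroup E] [NormedSpace ℝ E] {b : E →L[ℝ] E →L[ℝ] ℝ}

/-- A nonzero null vector is not orthogonal to a timelike vector with positive complement. -/
lemma apply_ne_zero_of_null {T k : E} (hT : ∀ v, b T v = 0 → v ≠ 0 → 0 < b v v)
    (hk : b k k = 0) (hk0 : k ≠ 0) : b T k ≠ 0 := fun h => by
  have := hT k h hk0
  linarith

/-- Subtracting a multiple of `k` from `w` reaches the positive definite complement of `T`, and it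
does not change the square of `w`, because `k` is null and orthogonal to `w`. -/
lemma IsLorentzForm.pos_of_orthogonal_null (hb : IsLorentzForm fun v w => b v w) {k w : E}
    (hk : b k k = 0) (hk0 : k ≠ 0) (hkw : b k w = 0) (hw : ∀ c : ℝ, w ≠ c • k) : 0 < b w w := by
  obtain ⟨hs, T, -, hpos⟩ := hb
  have hTk := apply_ne_zero_of_null hpos hk hk0
  have h1 := hpos (w - (b T w / b T k) • k) (by simp [hTk]) (sub_ne_zero.2 (hw _))
  have hwk : b w k = 0 := (hs w k).trans hkw
  simpa [hk, hkw, hwk] using h1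

lemma IsLorentzForm.eq_zero_of_forall (hb : IsLorentzForm fun v w => b v w) {v : E}
    (h : ∀ w, b v w = 0) : v = 0 := by
  obtain ⟨hs, T, -, hpos⟩ := hb
  by_contra h0
  exact (hpos v ((hs T v).trans (h T)) h0).ne' (h v)

lemma IsLorentzForm.null_apply_ne_zero (hb : IsLorentzForm fun v w => b v w) {k l : E}
    (hk : b k k = 0) (hk0 : k ≠ 0) (hl : b l l = 0) (hkl : ∀ c : ℝ, l ≠ c • k) : b k l ≠ 0 :=
  fun h => (hb.pos_of_orthogonal_null hk hk0 h hkl).ne' hl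

/-- The orthogonal complement of any timelike vector is positive definite. -/
lemma IsLorentzForm.pos_of_orthogonal_timelike (hb : IsLorentzForm fun v w => b v w) {S : E}
    (hS : b S S < 0) {v : E} (hv : b S v = 0) (hv0 : v ≠ 0) : 0 < b v v := by
  obtain ⟨hs, T, -, hpos⟩ := hb
  have hvS : b v S = 0 := (hs v S).trans hv
  by_contra! hle
  have hTS : b T S ≠ 0 := fun h => by
    have := hpos S h (fun h0 => by simp [h0] at hS)
    linarith
  -- This combination is orthogonal to `T`, so its square should be positive; but `S` and `v` are
  -- orthogonal with squares at most zero.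
  have h0 : b T v • S - b T S • v ≠ 0 := by
    intro h
    have h1 := congrArg (b S) h
    simp only [map_sub, map_smul, smul_eq_mul, hv, mul_zero, sub_zero, map_zero] at h1
    have h2 : b T v = 0 := by
      rcases mul_eq_zero.1 h1 with h | h
      · exact h
      · exact absurd h hS.ne
    rw [h2, zero_smul, zero_sub, neg_eq_zero, smul_eq_zero] at h
    exact h.elim hTS hv0
  have h1 := hpos (b T v • S - b T S • v) (by simp; ring) h0
  simp only [map_sub, map_smul, sub_apply, smul_apply, smul_eq_mul, hv, hvS,
    mul_zero, sub_zero, zero_sub] at h1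
  nlinarith [sq_nonneg (b T v), sq_nonneg (b T S)]

/-- Timelike vectors on the same side as a null vector are on the same side. -/
lemma IsLorentzForm.timelike_apply_neg (hb : IsLorentzForm fun v w => b v w) {k S S' : E}
    (hk : b k k = 0) (hS : b S S < 0) (hS' : b S' S' < 0) (hSk : b S k < 0)
    (hSk' : b S' k < 0) : b S S' < 0 := by
  have hs := hb.1
  dsimp only at hs
  -- With this `c` the vector `S' - c k` is orthogonal to `S`, so its square is nonnegative. As `k`
  -- is null, this reads `b S' S' - 2 c b S' k ≥ 0` and forces `c > 0`.
  set c := b S S' / b S k with hc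
  have h0 : b S (S' - c • k) = 0 := by
    simp [hc, hSk.ne]
  have h1 : 0 ≤ b (S' - c • k) (S' - c • k) := by
    rcases eq_or_ne (S' - c • k) 0 with h | h
    · simp [h]
    · exact (hb.pos_of_orthogonal_timelike hS h0 h).le
  simp only [map_sub, map_smul, sub_apply, smul_apply, smul_eq_mul,
    hk, hs k S', mul_zero, sub_zero] at h1
  have h2 : 0 < c := by
    by_contra! h
    nlinarith [mul_nonneg_of_nonpos_of_nonpos h hSk'.le]
  have h3 : b S S' = c * b S k := by
    rw [hc, div_mul_cancel₀ _ hSk.ne]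
  rw [h3]
  exact mul_neg_of_pos_of_neg h2 hSk

/-- The cross term in the square of a convex combination is negative by `timelike_apply_neg`; the
single null vector `K i₀` already puts all these timelike vectors in the same half. -/
lemma IsLorentzForm.convex_timelike (hb : IsLorentzForm fun v w => b v w) {ι : Type*} (i₀ : ι)
    (K : ι → E) (hK : b (K i₀) (K i₀) = 0) :
    Convex ℝ {T : E | b T T < 0 ∧ ∀ i, b T (K i) < 0} := by
  have hs := hb.1
  dsimp only at hs
  rintro S ⟨hS, hSk⟩ S' ⟨hS', hSk'⟩ x y hx hy hxy
  have h := hb.timelike_apply_neg hK hS hS' (hSk i₀) (hSk' i₀)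
  have hxy' : 0 < x ∨ 0 < y := by
    by_contra! h'
    linarith [h'.1, h'.2]
  refine ⟨?_, fun i => ?_⟩
  · simp only [map_add, map_smul, add_apply, smul_apply, smul_eq_mul, hs S' S]
    have h1 := mul_nonneg hx hy
    rcases hxy' with h' | h'
    · nlinarith [mul_pos h' h', mul_nonneg hy hy]
    · nlinarith [mul_pos h' h', mul_nonneg hx hx]
  · simp only [map_add, map_smul, add_apply, smul_apply, smul_eq_mul]
    rcases hxy' with h' | h'
    · nlinarith [hSk i, hSk' i]
    · nlinarith [hSk i, hSk' i]

end LorentzAlgebra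

/-- A Lorentzian form on three-space has a basis of null vectors. -/
lemma IsLorentzForm.exists_null_basis {b : E3 →L[ℝ] E3 →L[ℝ] ℝ}
    (hb : IsLorentzForm fun v w => b v w) :
    ∃ k : Fin 3 → E3, LinearIndependent ℝ k ∧ ∀ i, b (k i) (k i) = 0 := by
  obtain ⟨hs, T₀, hT₀, hpos₀⟩ := hb
  dsimp only at hs
  -- normalise the timelike vector
  obtain ⟨T, hT, hpos⟩ : ∃ T, b T T = -1 ∧ ∀ v, b T v = 0 → v ≠ 0 → 0 < b v v := by
    have h1 : 0 < -b T₀ T₀ := by linarith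
    have h2 : 0 < Real.sqrt (-b T₀ T₀) := Real.sqrt_pos.2 h1
    refine ⟨(Real.sqrt (-b T₀ T₀))⁻¹ • T₀, ?_, fun v hv => hpos₀ v ?_⟩
    · simp only [map_smul, smul_apply, smul_eq_mul]
      field_simp
      rw [Real.sq_sqrt h1.le, neg_neg]
    · simp only [map_smul, smul_apply, smul_eq_mul] at hv
      exact (mul_eq_zero.1 hv).resolve_left (inv_pos.2 h2).ne'
  have normalise : ∀ v, b T v = 0 → v ≠ 0 → ∃ c : ℝ, c ≠ 0 ∧ b (c • v) (c • v) = 1 := by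
    intro v hv hv0
    have h1 := hpos v hv hv0
    have h2 := Real.sqrt_pos.2 h1
    refine ⟨(Real.sqrt (b v v))⁻¹, (inv_pos.2 h2).ne', ?_⟩
    simp only [map_smul, smul_apply, smul_eq_mul]
    field_simp
    rw [Real.sq_sqrt h1.le]
  have hne : ∀ s : Set E3, s.Finite → s.ncard < 3 → ∃ v, v ∉ Submodule.span ℝ s := by
    intro s hf hs
    by_contra! h
    have h1 : Submodule.span ℝ s = ⊤ := Submodule.eq_top_iff'.2 h
    have : Fintype s := hf.fintype
    have h2 := finrank_span_le_card (R := ℝ) s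
    rw [h1, finrank_top, finrank_euclideanSpace_fin] at h2
    rw [Set.ncard_eq_toFinset_card'] at hs
    simp at h2 hs
    omega
  obtain ⟨v₁, hv₁⟩ := hne {T} (Set.toFinite _) (by simp)
  -- Gram-Schmidt, with a plus sign because `b T T = -1`.
  set w₁ := v₁ + b T v₁ • T with hw₁
  have h1 : b T w₁ = 0 := by simp [hw₁, hT]
  have h10 : w₁ ≠ 0 := fun h => hv₁ (by
    rw [Submodule.mem_span_singleton]
    exact ⟨-b T v₁, by rw [neg_smul]; exact (eq_neg_of_add_eq_zero_left h).symm⟩)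
  obtain ⟨c, hc, hq⟩ := normalise w₁ h1 h10
  set q := c • w₁ with hqdef
  have hTq : b T q = 0 := by simp [hqdef, h1]
  have hqT : b q T = 0 := (hs _ _).trans hTq
  obtain ⟨v₂, hv₂⟩ := hne {T, q} (Set.toFinite _) (by
    have := Set.ncard_insert_le T {q}
    simp only [Set.ncard_singleton] at this
    omega)
  set w₂ := v₂ + b T v₂ • T - b q v₂ • q with hw₂
  have h2 : b T w₂ = 0 := by simp [hw₂, hT, hTq]
  have h2' : b q w₂ = 0 := by simp [hw₂, hq, hqT]
  have h20 : w₂ ≠ 0 := fun h => hv₂ (by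
    rw [Submodule.mem_span_pair]
    refine ⟨-b T v₂, b q v₂, ?_⟩
    have : v₂ = w₂ + (-b T v₂ • T + b q v₂ • q) := by rw [hw₂]; module
    rw [h, zero_add] at this
    exact this.symm)
  obtain ⟨d, hd, hr⟩ := normalise w₂ h2 h20
  set r := d • w₂ with hrdef
  have hTr : b T r = 0 := by simp [hrdef, h2]
  have hqr : b q r = 0 := by simp [hrdef, h2']
  have hrT : b r T = 0 := (hs _ _).trans hTr
  have hrq : b r q = 0 := (hs _ _).trans hqr
  -- `T, q, r` are orthogonal with squares `-1, 1, 1`, so these three vectors are null.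
  refine ⟨![T + q, T - q, T + r], ?_, ?_⟩
  · rw [Fintype.linearIndependent_iff]
    intro x hx
    simp only [Fin.sum_univ_three, Matrix.cons_val_zero, Matrix.cons_val_one,
      Matrix.cons_val_two, Matrix.head_cons, Matrix.tail_cons] at hx
    have e1 := congrArg (b T) hx
    have e2 := congrArg (b q) hx
    have e3 := congrArg (b r) hx
    simp [hT, hTq, hqT, hTr, hqr, hrT, hrq, hq, hr] at e1 e2 e3
    intro i
    fin_cases i
    · change x 0 = 0; linarith
    · change x 1 = 0; linarith
    · exact e3
  · intro i
    fin_cases i <;> simp [hT, hTq, hqT, hTr, hrT, hq, hr]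

/-! ### Inverse functions -/

section InverseFunction

variable {E F : Type*} [NormedAddCommGroup E] [NormedSpace ℝ E] [CompleteSpace E]
  [NormedAddCommGroup F] [NormedSpace ℝ F]

/-- The inverse is smooth at all points near `f a` and not only at `f a`, because the derivative
stays invertible near `a`: the invertible maps form an open set. -/
lemma exists_smooth_localInverse {f : E → F} {a : E} (hf : ∀ᶠ x in 𝓝 a, ContDiffAt ℝ ∞ f x)
    (A : E ≃L[ℝ] F) (hA : HasFDerivAt f (A : E →L[ℝ] F) a) :
    ∃ G : F → E, (∀ᶠ z in 𝓝 (f a), ContDiffAt ℝ ∞ G z) ∧ G (f a) = a ∧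
      (∀ᶠ z in 𝓝 (f a), f (G z) = z) ∧ (∀ᶠ x in 𝓝 a, G (f x) = x) ∧
      HasFDerivAt G (A.symm : F →L[ℝ] E) (f a) := by
  have hn : (∞ : WithTop ℕ∞) ≠ 0 := by simp
  have hfa := hf.self_of_nhds
  have hs : HasStrictFDerivAt f (A : E →L[ℝ] F) a := hfa.hasStrictFDerivAt' hA hn
  set e := hs.toOpenPartialHomeomorph f with he
  have hae : a ∈ e.source := hs.mem_toOpenPartialHomeomorph_source
  have hta : f a ∈ e.target := hs.image_mem_toOpenPartialHomeomorph_target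
  have hsa : e.symm (f a) = a := e.left_inv hae
  refine ⟨e.symm, ?_, hsa, ?_, ?_, hs.to_localInverse.hasFDerivAt⟩
  · have h1 : ∀ᶠ x in 𝓝 a, ∃ A' : E ≃L[ℝ] F, HasFDerivAt f (A' : E →L[ℝ] F) x := by
      have hc : ContinuousAt (fderiv ℝ f) a :=
        (hfa.fderiv_right (m := ∞) le_rfl).continuousAt
      have h2 := hc.eventually (hA.fderiv.symm ▸ A.nhds)
      filter_upwards [h2, hf] with x hx hfx
      obtain ⟨A', hA'⟩ := hx
      exact ⟨A', hA' ▸ (hfx.differentiableAt hn).hasFDerivAt⟩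
    have hc : Tendsto e.symm (𝓝 (f a)) (𝓝 a) := by
      have := (e.continuousAt_symm hta).tendsto
      rwa [hsa] at this
    filter_upwards [e.open_target.mem_nhds hta, hc.eventually h1, hc.eventually hf] with z hz h2 h3
    obtain ⟨A', hA'⟩ := h2
    exact e.contDiffAt_symm hz hA' h3
  · exact hs.eventually_right_inverse
  · exact hs.eventually_left_inverse

/-- Near a point where its derivative is onto with kernel spanned by `n`, a map `E → F` is a
projection in suitable coordinates. -/
lemma exists_smooth_straightening [FiniteDimensional ℝ E] [FiniteDimensional ℝ F]
    (hdim : Module.finrank ℝ E = Module.finrank ℝ F + 1) {f : E → F} {a n : E}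
    (hf : ∀ᶠ x in 𝓝 a, ContDiffAt ℝ ∞ f x) (hsurj : Function.Surjective (fderiv ℝ f a))
    (hn : fderiv ℝ f a n = 0) (hn0 : n ≠ 0) :
    ∃ G : F × ℝ → E, (∀ᶠ z in 𝓝 (f a, (0 : ℝ)), ContDiffAt ℝ ∞ G z) ∧ G (f a, 0) = a ∧
      (∀ᶠ z in 𝓝 (f a, (0 : ℝ)), f (G z) = z.1) ∧ fderiv ℝ G (f a, 0) (0, 1) = n := by
  obtain ⟨l, hl⟩ := SeparatingDual.exists_eq_one (R := ℝ) hn0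
  -- The functional `l` with `l n = 1` is injective on the kernel line, so it completes `f` to a
  -- local coordinate system; its last coordinate direction is `n`.
  set Φ : E → F × ℝ := fun x => (f x, l (x - a)) with hΦ
  have hΦs : ∀ᶠ x in 𝓝 a, ContDiffAt ℝ ∞ Φ x := hf.mono fun x hx =>
    hx.prodMk (l.contDiff.contDiffAt.comp x (contDiffAt_id.sub contDiffAt_const))
  have hd : HasFDerivAt Φ ((fderiv ℝ f a).prod l) a := by
    refine (hf.self_of_nhds.differentiableAt (by simp)).hasFDerivAt.prodMk ?_
    exact l.hasFDerivAt.comp a ((hasFDerivAt_id a).sub_const a)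
  have hdim' : Module.finrank ℝ E = Module.finrank ℝ (F × ℝ) := by
    rw [hdim, Module.finrank_prod, Module.finrank_self]
  have hker : Module.finrank ℝ (LinearMap.ker (fderiv ℝ f a : E →ₗ[ℝ] F)) = 1 := by
    have h1 := LinearMap.finrank_range_add_finrank_ker (fderiv ℝ f a : E →ₗ[ℝ] F)
    rw [LinearMap.range_eq_top.2 hsurj, finrank_top, hdim] at h1
    omega
  have hinj : Function.Injective ((fderiv ℝ f a).prod l : E →ₗ[ℝ] F × ℝ) := by
    rw [← LinearMap.ker_eq_bot, LinearMap.ker_eq_bot']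
    intro v hv
    have hv1 : fderiv ℝ f a v = 0 := congrArg Prod.fst hv
    have hv2 : l v = 0 := congrArg Prod.snd hv
    obtain ⟨c, hc⟩ := exists_smul_eq_of_finrank_eq_one hker
      (x := ⟨n, hn⟩) (by simpa [Subtype.ext_iff] using hn0) ⟨v, hv1⟩
    have hc' : c • n = v := congrArg Subtype.val hc
    rw [← hc', map_smul, hl, smul_eq_mul, mul_one] at hv2
    rw [← hc', hv2, zero_smul]
  set A : E ≃L[ℝ] F × ℝ :=
    (LinearEquiv.ofInjectiveOfFinrankEq _ hinj hdim').toContinuousLinearEquiv with hA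
  have hAd : HasFDerivAt Φ (A : E →L[ℝ] F × ℝ) a := by
    have : (A : E →L[ℝ] F × ℝ) = (fderiv ℝ f a).prod l := ContinuousLinearMap.ext fun v => rfl
    rwa [this]
  obtain ⟨G, hG, hGa, hG1, -, hG2⟩ := exists_smooth_localInverse hΦs A hAd
  have hΦa : Φ a = (f a, 0) := by simp [hΦ]
  rw [hΦa] at hG hGa hG1 hG2
  refine ⟨G, hG, hGa, hG1.mono fun z hz => congrArg Prod.fst hz, ?_⟩
  rw [hG2.fderiv]
  have : A n = (0, 1) := by
    change ((fderiv ℝ f a).prod l) n = _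
    simp [hn, hl]
  rw [← this]
  exact A.symm_apply_apply n

end InverseFunction

/-! ### The Euler-Lagrange form of a family of null curves -/

section EulerLagrange

variable {E F : Type*} [NormedAddCommGroup E] [NormedSpace ℝ E]
  [NormedAddCommGroup F] [NormedSpace ℝ F]

lemma contDiffAt_fderiv_apply {Q : E → F} {q : E} (hQ : ContDiffAt ℝ ∞ Q q) (v : E) :
    ContDiffAt ℝ ∞ (fun x => fderiv ℝ Q x v) q :=
  (hQ.fderiv_right (m := ∞) le_rfl).clm_apply contDiffAt_const

lemma fderiv_fderiv_apply {Q : E → F} {q : E} (hQ : ContDiffAt ℝ ∞ Q q) (v w : E) :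
    fderiv ℝ (fun x => fderiv ℝ Q x v) q w = fderiv ℝ (fderiv ℝ Q) q w v := by
  have h1 : DifferentiableAt ℝ (fderiv ℝ Q) q :=
    (hQ.fderiv_right (m := ∞) le_rfl).differentiableAt (by simp)
  exact (h1.hasFDerivAt.clm_apply (hasFDerivAt_const v q)).fderiv ▸ by simp

lemma fderiv_fderiv_apply_comm {Q : E → F} {q : E} (hQ : ContDiffAt ℝ ∞ Q q) (v w : E) :
    fderiv ℝ (fun x => fderiv ℝ Q x v) q w = fderiv ℝ (fun x => fderiv ℝ Q x w) q v := by
  rw [fderiv_fderiv_apply hQ, fderiv_fderiv_apply hQ]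
  refine (hQ.isSymmSndFDerivAt ?_) w v
  simpa using (WithTop.coe_le_coe.2 le_top : ((2 : ℕ∞) : WithTop ℕ∞) ≤ ∞)

/-- If `e` is mapped to a multiple `h` of the image `k` of `τ`, then the derivative of `k` along
the kernel direction `e - h τ` is, up to a multiple of `k`, minus the image of `∂_τ e`. -/
lemma fderiv_image_along_kernel [FiniteDimensional ℝ F] {Q : E → F} {q τ : E} {e : E → E}
    {h : E → ℝ} (hQ : ContDiffAt ℝ ∞ Q q) (he : DifferentiableAt ℝ e q)
    (hk : fderiv ℝ Q q τ ≠ 0) (heh : ∀ᶠ x in 𝓝 q, fderiv ℝ Q x (e x) = h x • fderiv ℝ Q x τ) :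
    ∃ h' : ℝ, fderiv ℝ (fun x => fderiv ℝ Q x τ) q (e q - h q • τ) =
      h' • fderiv ℝ Q q τ - fderiv ℝ Q q (fderiv ℝ e q τ) := by
  obtain ⟨l, hl⟩ := SeparatingDual.exists_eq_one (R := ℝ) hk
  have hd : DifferentiableAt ℝ (fderiv ℝ Q) q :=
    (hQ.fderiv_right (m := ∞) le_rfl).differentiableAt (by simp)
  have hkd : DifferentiableAt ℝ (fun x => fderiv ℝ Q x τ) q :=
    (contDiffAt_fderiv_apply hQ τ).differentiableAt (by simp)
  have hed : DifferentiableAt ℝ (fun x => fderiv ℝ Q x (e x)) q := hd.clm_apply he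
  have hne : ∀ᶠ x in 𝓝 q, l (fderiv ℝ Q x τ) ≠ 0 := by
    have : ContinuousAt (fun x => l (fderiv ℝ Q x τ)) q :=
      l.continuous.continuousAt.comp hkd.continuousAt
    exact this.eventually_ne (by simp [hl])
  -- No regularity of `h` is assumed: `l` recovers it as a quotient of differentiable functions.
  have hh : h =ᶠ[𝓝 q] fun x => l (fderiv ℝ Q x (e x)) / l (fderiv ℝ Q x τ) := by
    filter_upwards [heh, hne] with x h1 h2
    rw [h1, map_smul, smul_eq_mul, mul_div_cancel_right₀ _ h2]
  have hhd : DifferentiableAt ℝ h q := by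
    refine DifferentiableAt.congr_of_eventuallyEq ?_ hh
    simp only [div_eq_mul_inv]
    exact (l.differentiableAt.comp q hed).fun_mul
      ((l.differentiableAt.comp q hkd).fun_inv (by simp [hl]))
  refine ⟨fderiv ℝ h q τ, ?_⟩
  -- Both sides of the relation are differentiated along `τ`; the symmetry of the second derivative
  -- of `Q` then turns `τ`-derivatives of the image of `e q` into derivatives of `k` along `e q`.
  have h1 := (hd.hasFDerivAt.clm_apply he.hasFDerivAt).fderiv
  have h2 := (hhd.hasFDerivAt.smul hkd.hasFDerivAt).fderiv
  have h3 := Filter.EventuallyEq.fderiv_eq (𝕜 := ℝ) heh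
  have h4 : fderiv ℝ (fun x => fderiv ℝ Q x (e x)) q τ =
      fderiv ℝ (fun x => h x • fderiv ℝ Q x τ) q τ := by rw [h3]
  have h5 : fderiv ℝ (fun x => h x • fderiv ℝ Q x τ) q τ =
      h q • fderiv ℝ (fun x => fderiv ℝ Q x τ) q τ + fderiv ℝ h q τ • fderiv ℝ Q q τ := by
    change fderiv ℝ (h • fun x => fderiv ℝ Q x τ) q τ = _
    rw [h2]
    simp
  rw [h1, h5] at h4
  simp only [add_apply, ContinuousLinearMap.comp_apply, ContinuousLinearMap.flip_apply] at h4
  rw [← fderiv_fderiv_apply hQ, fderiv_fderiv_apply_comm hQ] at h4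
  rw [map_sub, map_smul]
  rw [sub_eq_sub_iff_add_eq_add, add_comm (fderiv ℝ h q τ • fderiv ℝ Q q τ), ← h4, add_comm]

variable {B : F → F →L[ℝ] F →L[ℝ] ℝ} {Q : E → F} {q τ : E}

set_option synthInstance.maxHeartbeats 200000 in
/-- The Euler-Lagrange form of the energy along `τ`-curves of a family of null curves, applied to
the variation vector of the family. -/
lemma fderiv_apply_variation (hB : DifferentiableAt ℝ B (Q q)) (hQ : ContDiffAt ℝ ∞ Q q)
    (hs : ∀ x v w, B x v w = B x w v)
    (hnull : ∀ᶠ x in 𝓝 q, B (Q x) (fderiv ℝ Q x τ) (fderiv ℝ Q x τ) = 0) (v : E) :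
    fderiv ℝ (fun x => B (Q x) (fderiv ℝ Q x τ) (fderiv ℝ Q x v)) q τ =
      B (Q q) (fderiv ℝ (fun x => fderiv ℝ Q x τ) q τ) (fderiv ℝ Q q v) +
      fderiv ℝ B (Q q) (fderiv ℝ Q q τ) (fderiv ℝ Q q τ) (fderiv ℝ Q q v) -
      (1 / 2) * fderiv ℝ B (Q q) (fderiv ℝ Q q v) (fderiv ℝ Q q τ) (fderiv ℝ Q q τ) := by
  have hBQ : HasFDerivAt (fun x => B (Q x)) ((fderiv ℝ B (Q q)).comp (fderiv ℝ Q q)) q :=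
    HasFDerivAt.comp (g := B) q hB.hasFDerivAt (hQ.differentiableAt (by simp)).hasFDerivAt
  have hd : ∀ w, HasFDerivAt (fun x => fderiv ℝ Q x w) (fderiv ℝ (fun x => fderiv ℝ Q x w) q) q :=
    fun w => ((contDiffAt_fderiv_apply hQ w).differentiableAt (by simp)).hasFDerivAt
  have key : ∀ w u, fderiv ℝ (fun x => B (Q x) (fderiv ℝ Q x τ) (fderiv ℝ Q x w)) q u =
      fderiv ℝ B (Q q) (fderiv ℝ Q q u) (fderiv ℝ Q q τ) (fderiv ℝ Q q w) +
      B (Q q) (fderiv ℝ (fun x => fderiv ℝ Q x τ) q u) (fderiv ℝ Q q w) +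
      B (Q q) (fderiv ℝ Q q τ) (fderiv ℝ (fun x => fderiv ℝ Q x w) q u) := by
    intro w u
    rw [((hBQ.clm_apply (hd τ)).clm_apply (hd w)).fderiv]
    simp only [add_apply, ContinuousLinearMap.comp_apply, ContinuousLinearMap.flip_apply]
    ring
  -- Differentiating the null condition along `v` trades the mixed second derivative of `Q` for half
  -- a derivative of the metric, which is the last term of the Euler-Lagrange form.
  have h0 : fderiv ℝ (fun x => B (Q x) (fderiv ℝ Q x τ) (fderiv ℝ Q x τ)) q v = 0 := by
    rw [Filter.EventuallyEq.fderiv_eq (f := fun _ => (0 : ℝ)) hnull]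
    simp
  rw [key] at h0 ⊢
  rw [fderiv_fderiv_apply_comm hQ τ v] at h0
  rw [hs _ (fderiv ℝ (fun x => fderiv ℝ Q x v) q τ)] at h0
  linarith

set_option synthInstance.maxHeartbeats 200000 in
/-- The geodesic form, for vectors in the image of `dQ`, of a curve `Q ∘ x` whose velocity is the
multiple `a` of the image of `τ`. -/
lemma geodesicForm_of_lift (hB : DifferentiableAt ℝ B (Q q)) (hQ : ContDiffAt ℝ ∞ Q q)
    (hs : ∀ x v w, B x v w = B x w v)
    (hnull : ∀ᶠ x in 𝓝 q, B (Q x) (fderiv ℝ Q x τ) (fderiv ℝ Q x τ) = 0)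
    {n : E} {h' : ℝ} {d : F}
    (hn : fderiv ℝ (fun x => fderiv ℝ Q x τ) q n = h' • fderiv ℝ Q q τ - d)
    {c : ℝ → F} {x : ℝ → E} {a : ℝ → ℝ} {t a' β : ℝ} (hxt : x t = q) (hct : c t = Q q)
    (hx : HasDerivAt x (β • n + a t • τ) t) (ha : HasDerivAt a a' t)
    (hc : ∀ᶠ s in 𝓝 t, deriv c s = a s • fderiv ℝ Q (x s) τ) (v : E) :
    B (c t) (deriv (deriv c) t) (fderiv ℝ Q q v) +
      fderiv ℝ (fun y => B y (deriv c t) (fderiv ℝ Q q v)) (c t) (deriv c t) -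
      (1 / 2) * fderiv ℝ (fun y => B y (deriv c t) (deriv c t)) (c t) (fderiv ℝ Q q v) =
    a t ^ 2 * fderiv ℝ (fun x => B (Q x) (fderiv ℝ Q x τ) (fderiv ℝ Q x v)) q τ +
      (a' + a t * β * h') * B (Q q) (fderiv ℝ Q q τ) (fderiv ℝ Q q v) -
      a t * β * B (Q q) d (fderiv ℝ Q q v) := by
  have hBd : ∀ u w z, fderiv ℝ (fun y => B y u w) (Q q) z = fderiv ℝ B (Q q) z u w := by
    intro u w z
    rw [((hB.hasFDerivAt.clm_apply (hasFDerivAt_const u _)).clm_apply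
      (hasFDerivAt_const w _)).fderiv]
    simp
  have hk : HasFDerivAt (fun x => fderiv ℝ Q x τ) (fderiv ℝ (fun x => fderiv ℝ Q x τ) q) (x t) := by
    rw [hxt]
    exact ((contDiffAt_fderiv_apply hQ τ).differentiableAt (by simp)).hasFDerivAt
  have h1 : deriv c t = a t • fderiv ℝ Q q τ := by rw [hc.self_of_nhds, hxt]
  have h2 : deriv (deriv c) t = a' • fderiv ℝ Q q τ +
      a t • fderiv ℝ (fun x => fderiv ℝ Q x τ) q (β • n + a t • τ) := by
    rw [Filter.EventuallyEq.deriv_eq hc]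
    have := (ha.smul (hk.comp_hasDerivAt t hx)).deriv
    simp only [Function.comp_def, hxt] at this
    rw [add_comm]
    exact this
  -- The `τ`-part of the velocity gives the Euler-Lagrange form with the factor `a t ^ 2`. The
  -- `n`-part enters only through the second derivative of `c`, as the multiple `a t * β` of `h' k -
  -- d`.
  rw [fderiv_apply_variation hB hQ hs hnull, hct, hBd, hBd, h1, h2,
    map_add (fderiv ℝ (fun x => fderiv ℝ Q x τ) q), map_smul (fderiv ℝ (fun x => fderiv ℝ Q x τ) q) β n, hn]
  simp only [map_add, map_sub, map_smul, add_apply, sub_apply, smul_apply, smul_eq_mul]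
  ring

end EulerLagrange

/-! ### Analytic tools: null vectors near a given one, tangency of curves, primitives, smoothness of
normalised forms. -/

section

variable {E F G : Type*} [NormedAddCommGroup E] [NormedSpace ℝ E] [NormedAddCommGroup F]
  [NormedSpace ℝ F] [NormedAddCommGroup G] [NormedSpace ℝ G]

lemma contDiffAt_clm_apply_iff [FiniteDimensional ℝ F] {f : E → F →L[ℝ] G} {x : E} {n : WithTop ℕ∞} :
    ContDiffAt ℝ n f x ↔ ∀ v, ContDiffAt ℝ n (fun y => f y v) x := by
  refine ⟨fun h v => h.clm_apply contDiffAt_const, fun h => ?_⟩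
  let d := Module.finrank ℝ F
  have hd : d = Module.finrank ℝ (Fin d → ℝ) := (Module.finrank_fin_fun ℝ).symm
  let e₁ := ContinuousLinearEquiv.ofFinrankEq hd
  let e₂ := (e₁.arrowCongr (1 : G ≃L[ℝ] G)).trans (ContinuousLinearEquiv.piRing (Fin d))
  rw [← Function.id_comp f, ← e₂.symm_comp_self]
  exact e₂.symm.contDiff.contDiffAt.comp x (contDiffAt_pi.mpr fun i => h _)

/-- In suitable coordinates, the nonzero null vectors `r k` near a given one form a hypersurface
which is parametrised by the pairs of a point and a scale. -/
lemma exists_smooth_null_lift [FiniteDimensional ℝ E] [FiniteDimensional ℝ F]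
    (hE : Module.finrank ℝ E = 4) (hF : Module.finrank ℝ F = 3) {B : F → F →L[ℝ] F →L[ℝ] ℝ}
    {Q : E → F} {q τ n : E} {ν : F} (hB : ContinuousAt B (Q q))
    (hQ : ∀ᶠ x in 𝓝 q, ContDiffAt ℝ ∞ Q x) (hsurj : Function.Surjective (fderiv ℝ Q q)) (hn : fderiv ℝ Q q n = 0) (hn0 : n ≠ 0)
    (hs : ∀ x v w, B x v w = B x w v)
    (hnull : ∀ᶠ x in 𝓝 q, B (Q x) (fderiv ℝ Q x τ) (fderiv ℝ Q x τ) = 0)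
    (hν : B (Q q) (fderiv ℝ Q q τ) ν ≠ 0)
    (hkn : B (Q q) (fderiv ℝ Q q τ) (fderiv ℝ (fun x => fderiv ℝ Q x τ) q n) = 0)
    (hkn' : ∀ c : ℝ, fderiv ℝ (fun x => fderiv ℝ Q x τ) q n ≠ c • fderiv ℝ Q q τ)
    {r : ℝ} (hr : r ≠ 0) :
    ∃ G : F × F → E × ℝ, (∀ᶠ z in 𝓝 (Q q, r • fderiv ℝ Q q τ), ContDiffAt ℝ ∞ G z) ∧
      G (Q q, r • fderiv ℝ Q q τ) = (q, r) ∧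
      ∀ᶠ z in 𝓝 (Q q, r • fderiv ℝ Q q τ), B z.1 z.2 z.2 = 0 →
        Q (G z).1 = z.1 ∧ z.2 = (G z).2 • fderiv ℝ Q (G z).1 τ ∧ (G z).2 ≠ 0 := by
  set k := fun x => fderiv ℝ Q x τ with hk
  change B (Q q) (k q) ν ≠ 0 at hν
  change B (Q q) (k q) (fderiv ℝ k q n) = 0 at hkn
  change ∀ c : ℝ, fderiv ℝ k q n ≠ c • k q at hkn'
  change ∃ G : F × F → E × ℝ, (∀ᶠ z in 𝓝 (Q q, r • k q), ContDiffAt ℝ ∞ G z) ∧ G (Q q, r • k q) = (q, r) ∧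
      ∀ᶠ z in 𝓝 (Q q, r • k q), B z.1 z.2 z.2 = 0 →
        Q (G z).1 = z.1 ∧ z.2 = (G z).2 • k (G z).1 ∧ (G z).2 ≠ 0
  -- The null vectors have codimension one, so a coefficient along the transverse vector `ν` is
  -- added: both sides then have dimension six, and the null vectors correspond to coefficient zero.
  set Φ : E × ℝ × ℝ → F × F := fun p => (Q p.1, p.2.1 • k p.1 + p.2.2 • ν) with hΦ
  have hQ' : ∀ p : E × ℝ × ℝ, ContDiffAt ℝ ∞ Q p.1 → ContDiffAt ℝ ∞ (fun p : E × ℝ × ℝ => Q p.1) p :=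
    fun p hp => ContDiffAt.comp p (g := Q) (f := Prod.fst) hp contDiffAt_fst
  have hks' : ∀ p : E × ℝ × ℝ, ContDiffAt ℝ ∞ Q p.1 → ContDiffAt ℝ ∞ (fun p : E × ℝ × ℝ => k p.1) p :=
    fun p hp => ContDiffAt.comp p (g := k) (f := Prod.fst) (contDiffAt_fderiv_apply hp τ) contDiffAt_fst
  have hΦs : ∀ᶠ p in 𝓝 (q, r, (0 : ℝ)), ContDiffAt ℝ ∞ Φ p := by
    filter_upwards [(continuousAt_fst (p := (q, r, (0 : ℝ)))).eventually hQ] with p hp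
    exact (hQ' p hp).prodMk ((contDiffAt_fst.comp _ contDiffAt_snd).smul (hks' p hp) |>.add
      ((contDiffAt_snd.comp _ contDiffAt_snd).smul contDiffAt_const))
  replace hQ := hQ.self_of_nhds
  have hks : ContDiffAt ℝ ∞ k q := contDiffAt_fderiv_apply hQ τ
  have hd : HasFDerivAt Φ (fderiv ℝ Φ (q, r, 0)) (q, r, 0) :=
    (hΦs.self_of_nhds.differentiableAt (by simp)).hasFDerivAt
  have hd' : ∀ δ ρ σ, fderiv ℝ Φ (q, r, 0) (δ, ρ, σ) =
      (fderiv ℝ Q q δ, r • fderiv ℝ k q δ + ρ • k q + σ • ν) := by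
    intro δ ρ σ
    have h1 : HasFDerivAt (fun p : E × ℝ × ℝ => Q p.1)
        ((fderiv ℝ Q q).comp (ContinuousLinearMap.fst ℝ E (ℝ × ℝ))) (q, r, 0) :=
      HasFDerivAt.comp (g := Q) (q, r, (0 : ℝ)) (hQ.differentiableAt (by simp)).hasFDerivAt
        hasFDerivAt_fst
    have h2 : HasFDerivAt (fun p : E × ℝ × ℝ => k p.1)
        ((fderiv ℝ k q).comp (ContinuousLinearMap.fst ℝ E (ℝ × ℝ))) (q, r, 0) :=
      HasFDerivAt.comp (g := k) (q, r, (0 : ℝ)) (hks.differentiableAt (by simp)).hasFDerivAt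
        hasFDerivAt_fst
    have h3 : HasFDerivAt (fun p : E × ℝ × ℝ => p.2.1) ((ContinuousLinearMap.fst ℝ ℝ ℝ).comp
        (ContinuousLinearMap.snd ℝ E (ℝ × ℝ))) (q, r, (0 : ℝ)) :=
      ((ContinuousLinearMap.fst ℝ ℝ ℝ).comp (ContinuousLinearMap.snd ℝ E (ℝ × ℝ))).hasFDerivAt
    have h4 : HasFDerivAt (fun p : E × ℝ × ℝ => p.2.2) ((ContinuousLinearMap.snd ℝ ℝ ℝ).comp
        (ContinuousLinearMap.snd ℝ E (ℝ × ℝ))) (q, r, (0 : ℝ)) :=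
      ((ContinuousLinearMap.snd ℝ ℝ ℝ).comp (ContinuousLinearMap.snd ℝ E (ℝ × ℝ))).hasFDerivAt
    have h5 : HasFDerivAt Φ _ (q, r, 0) :=
      h1.prodMk ((h3.smul h2).add (h4.smul (hasFDerivAt_const ν _)))
    rw [h5.fderiv]
    simp
  have hdim : Module.finrank ℝ (E × ℝ × ℝ) = Module.finrank ℝ (F × F) := by
    simp [Module.finrank_prod, hE, hF]
  have hker : Module.finrank ℝ (LinearMap.ker (fderiv ℝ Q q : E →ₗ[ℝ] F)) = 1 := by
    have h1 := LinearMap.finrank_range_add_finrank_ker (fderiv ℝ Q q : E →ₗ[ℝ] F)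
    rw [LinearMap.range_eq_top.2 hsurj, finrank_top, hE, hF] at h1
    omega
  have hkk : B (Q q) (k q) (k q) = 0 := hnull.self_of_nhds
  have hk0 : k q ≠ 0 := by
    intro h
    apply hν
    simp [h]
  have hinj : Function.Injective (fderiv ℝ Φ (q, r, 0) : E × ℝ × ℝ →ₗ[ℝ] F × F) := by
    rw [← LinearMap.ker_eq_bot, LinearMap.ker_eq_bot']
    rintro ⟨δ, ρ, σ⟩ hv
    have hv' : fderiv ℝ Φ (q, r, 0) (δ, ρ, σ) = 0 := hv
    rw [hd'] at hv'
    have hv1 : fderiv ℝ Q q δ = 0 := congrArg Prod.fst hv'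
    have hv2 : r • fderiv ℝ k q δ + ρ • k q + σ • ν = 0 := congrArg Prod.snd hv'
    obtain ⟨c, hc⟩ := exists_smul_eq_of_finrank_eq_one hker
      (x := ⟨n, hn⟩) (by simpa [Subtype.ext_iff] using hn0) ⟨δ, hv1⟩
    have hc' : c • n = δ := congrArg Subtype.val hc
    -- Pairing with `k q` kills every term except the one in `ν`.
    have hσ : σ = 0 := by
      have := congrArg (B (Q q) (k q)) hv2
      rw [← hc'] at this
      simp only [map_add, map_smul, hkk, hkn, smul_eq_mul, mul_zero, zero_add, map_zero] at this
      exact (mul_eq_zero.1 this).resolve_right hν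
    rw [hσ, zero_smul, add_zero, ← hc', map_smul, smul_smul] at hv2
    have hc0 : c = 0 := by
      by_contra hc0
      refine hkn' (-(r * c)⁻¹ * ρ) ?_
      have h3 : (r * c) • fderiv ℝ k q n = -(ρ • k q) := eq_neg_of_add_eq_zero_left hv2
      have h4 := congrArg (fun z => (r * c)⁻¹ • z) h3
      simp only [smul_smul, inv_mul_cancel₀ (mul_ne_zero hr hc0), one_smul] at h4
      rw [h4, smul_neg, smul_smul, neg_mul, neg_smul]
    rw [hc0, mul_zero, zero_smul, zero_add, smul_eq_zero] at hv2
    rw [← hc', hc0, zero_smul, hσ, hv2.resolve_right hk0]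
    rfl
  set A : (E × ℝ × ℝ) ≃L[ℝ] F × F :=
    (LinearEquiv.ofInjectiveOfFinrankEq _ hinj hdim).toContinuousLinearEquiv with hA
  have hAd : HasFDerivAt Φ (A : (E × ℝ × ℝ) →L[ℝ] F × F) (q, r, 0) := by
    have : (A : (E × ℝ × ℝ) →L[ℝ] F × F) = fderiv ℝ Φ (q, r, 0) :=
      ContinuousLinearMap.ext fun v => rfl
    rwa [this]
  obtain ⟨G, hG, hGa, hG1, -, -⟩ := exists_smooth_localInverse hΦs A hAd
  have hΦa : Φ (q, r, 0) = (Q q, r • k q) := by simp [hΦ]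
  rw [hΦa] at hG hGa hG1
  refine ⟨fun z => ((G z).1, (G z).2.1), hG.mono fun z hz => (contDiffAt_fst.comp _ hz).prodMk
    ((contDiffAt_fst.comp _ contDiffAt_snd).comp _ hz), by dsimp only; rw [hGa], ?_⟩
  have hGc := hG.self_of_nhds.continuousAt
  have hG' : Tendsto G (𝓝 (Q q, r • k q)) (𝓝 (q, r, 0)) := hGa ▸ hGc.tendsto
  have e1 : ∀ᶠ p in 𝓝 (q, r, (0 : ℝ)), p.2.1 ≠ 0 :=
    (continuous_fst.comp continuous_snd).continuousAt.eventually_ne hr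
  -- The square of the second component of `Φ p` is the `ν`-coefficient times this factor. The
  -- factor does not vanish near the base point, so null vectors have `ν`-coefficient zero.
  have e2 : ∀ᶠ p in 𝓝 (q, r, (0 : ℝ)),
      2 * p.2.1 * B (Q p.1) (k p.1) ν + p.2.2 * B (Q p.1) ν ν ≠ 0 := by
    have hBc : ContinuousAt (fun p : E × ℝ × ℝ => B (Q p.1)) (q, r, 0) :=
      ContinuousAt.comp (g := B) (f := fun p : E × ℝ × ℝ => Q p.1) hB (hQ' _ hQ).continuousAt
    refine ContinuousAt.eventually_ne (.add (.mul ?_ ?_) (.mul ?_ ?_)) ?_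
    · fun_prop
    · exact (hBc.clm_apply (hks' (q, r, 0) hQ).continuousAt).clm_apply continuousAt_const
    · fun_prop
    · exact (hBc.clm_apply continuousAt_const).clm_apply continuousAt_const
    · simpa using ⟨hr, hν⟩
  have e3 : ∀ᶠ p in 𝓝 (q, r, (0 : ℝ)), B (Q p.1) (k p.1) (k p.1) = 0 :=
    (continuousAt_fst (p := (q, r, (0 : ℝ)))).eventually hnull
  filter_upwards [hG1, hG'.eventually e1, hG'.eventually e2, hG'.eventually e3] with z hz h1 h2 h3
  intro hz0
  have hz1 : Q (G z).1 = z.1 := congrArg Prod.fst hz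
  have hz2 : (G z).2.1 • k (G z).1 + (G z).2.2 • ν = z.2 := congrArg Prod.snd hz
  have h4 : (G z).2.2 = 0 := by
    rw [← hz1, ← hz2] at hz0
    simp only [map_add, map_smul, add_apply, smul_apply, smul_eq_mul, h3,
      hs _ ν (k (G z).1)] at hz0
    refine (mul_eq_zero.1 (?_ : (G z).2.2 * (2 * (G z).2.1 * B (Q (G z).1) (k (G z).1) ν +
      (G z).2.2 * B (Q (G z).1) ν ν) = 0)).resolve_right h2
    linear_combination hz0
  refine ⟨hz1, ?_, h1⟩
  rw [← hz2, h4, zero_smul, add_zero]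

end

/-- Two curves through a point which meet along sequences of other parameters converging to it are
tangent there. -/
lemma exists_smul_of_accumulating_intersections {F : Type*} [NormedAddCommGroup F]
    [NormedSpace ℝ F] {a b : ℝ → F} {s₀ φ₀ : ℝ} {s φ : ℕ → ℝ} (ha : DifferentiableAt ℝ a s₀)
    (hb : DifferentiableAt ℝ b φ₀) (hb0 : deriv b φ₀ ≠ 0) (hs : Tendsto s atTop (𝓝 s₀))
    (hs' : ∀ n, s n ≠ s₀) (hφ : Tendsto φ atTop (𝓝 φ₀)) (h : a s₀ = b φ₀)
    (h' : ∀ᶠ n in atTop, a (s n) = b (φ n)) : ∃ c : ℝ, deriv a s₀ = c • deriv b φ₀ := by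
  obtain ⟨l, hl⟩ := SeparatingDual.exists_eq_one (R := ℝ) hb0
  refine ⟨l (deriv a s₀), ?_⟩
  have hα : Tendsto (fun n => dslope a s₀ (s n)) atTop (𝓝 (deriv a s₀)) := by
    have := (continuousAt_dslope_same.2 ha).tendsto.comp hs
    rwa [dslope_same] at this
  have hβ : Tendsto (fun n => dslope b φ₀ (φ n)) atTop (𝓝 (deriv b φ₀)) := by
    have := (continuousAt_dslope_same.2 hb).tendsto.comp hφ
    rwa [dslope_same] at this
  have hlα := (l.continuous.tendsto _).comp hα
  have hlβ := (l.continuous.tendsto _).comp hβ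
  have h1 := hlβ.smul hα
  have h2 := hlα.smul hβ
  rw [hl, one_smul] at h1
  refine tendsto_nhds_unique_of_eventuallyEq h1 h2 ?_
  filter_upwards [h'] with n hn
  -- Both sides are the same chord. Applying `l` eliminates the ratio of the two parameter
  -- increments, on which there is no control.
  have e : (s n - s₀) • dslope a s₀ (s n) = (φ n - φ₀) • dslope b φ₀ (φ n) := by
    rw [sub_smul_dslope, sub_smul_dslope, hn, h]
  have e' := congrArg l e
  simp only [map_smul, smul_eq_mul] at e'
  have h0 : s n - s₀ ≠ 0 := sub_ne_zero.2 (hs' n)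
  simp only [Function.comp_apply]
  apply smul_right_injective _ h0
  change (s n - s₀) • (l (dslope b φ₀ (φ n)) • dslope a s₀ (s n)) =
    (s n - s₀) • (l (dslope a s₀ (s n)) • dslope b φ₀ (φ n))
  rw [smul_smul, smul_smul, e', mul_comm (s n - s₀), mul_comm (φ n - φ₀), ← smul_smul, e,
    smul_smul]

/-- A primitive of a nowhere vanishing smooth function is a diffeomorphism onto an open interval. -/
lemma exists_primitive_with_inverse {f : ℝ → ℝ} (hf : ContDiff ℝ ∞ f) (h0 : ∀ x, f x ≠ 0) :
    ∃ T S : ℝ → ℝ, ContDiff ℝ ∞ T ∧ (∀ x, HasDerivAt T (f x) x) ∧ IsOpen (range T) ∧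
      (range T).OrdConnected ∧ (∀ x, S (T x) = x) ∧ ContDiffOn ℝ ∞ S (range T) := by
  set T : ℝ → ℝ := fun x => ∫ y in (0 : ℝ)..x, f y with hT
  have hd : ∀ x, HasStrictDerivAt T (f x) x := fun x => hf.continuous.integral_hasStrictDerivAt 0 x
  have hTs : ContDiff ℝ ∞ T := by
    rw [contDiff_infty_iff_deriv]
    refine ⟨fun x => (hd x).hasDerivAt.differentiableAt, ?_⟩
    have : deriv T = f := funext fun x => (hd x).hasDerivAt.deriv
    rwa [this]
  have hinj : Function.Injective T := by
    intro x y hxy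
    by_contra hne
    obtain ⟨z, -, hz⟩ : ∃ z ∈ Ioo (min x y) (max x y), deriv T z = 0 :=
      exists_deriv_eq_zero (by simpa using Ne.symm hne) hTs.continuous.continuousOn (by
        rcases le_total x y with h | h <;> simp [h, hxy])
    exact h0 z ((hd z).hasDerivAt.deriv ▸ hz)
  -- The local inverses show that the range is open; by injectivity they agree with the global
  -- inverse, which is therefore smooth.
  have hinv : ∀ x, ∃ G : ℝ → ℝ, ContDiffAt ℝ ∞ G (T x) ∧ ∀ᶠ z in 𝓝 (T x), T (G z) = z := by
    intro x
    have hA := (hd x).hasDerivAt.hasFDerivAt_equiv (h0 x)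
    obtain ⟨G, hG, -, hG1, -⟩ := exists_smooth_localInverse (.of_forall fun _ => hTs.contDiffAt) _ hA
    exact ⟨G, hG.self_of_nhds, hG1⟩
  have hS : ∀ x, Function.invFun T (T x) = x := Function.leftInverse_invFun hinj
  refine ⟨T, Function.invFun T, hTs, fun x => (hd x).hasDerivAt, ?_, ?_, hS, ?_⟩
  · rw [isOpen_iff_mem_nhds]
    rintro _ ⟨x, rfl⟩
    obtain ⟨G, -, hG⟩ := hinv x
    filter_upwards [hG] with z hz using ⟨_, hz⟩
  · exact (isPreconnected_range hTs.continuous).ordConnected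
  · rintro _ ⟨x, rfl⟩
    obtain ⟨G, hG, hG1⟩ := hinv x
    refine (hG.congr_of_eventuallyEq ?_).contDiffWithinAt
    filter_upwards [hG1] with z hz
    rw [← hz, hS, hz]

/-- A family of Lorentzian forms, normalised on a vector field, is smooth if one knows three smooth
null fields `k i` forming a frame, and, for two of them, smooth fields `d i` orthogonal to `k i`. -/
lemma contDiffAt_normalised_form {b : E3 → E3 →L[ℝ] E3 →L[ℝ] ℝ} {z₀ : E3} {k : Fin 3 → E3 → E3}
    {d₀ d₁ : E3 → E3}
    (hb : ∀ᶠ z in 𝓝 z₀, IsLorentzForm fun v w => b z v w)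
    (hk : ∀ i, ContDiffAt ℝ ∞ (k i) z₀) (hki : LinearIndependent ℝ fun i => k i z₀)
    (hd₀ : ContDiffAt ℝ ∞ d₀ z₀) (hd₁ : ContDiffAt ℝ ∞ d₁ z₀)
    (hnull : ∀ᶠ z in 𝓝 z₀, ∀ i, b z (k i z) (k i z) = 0)
    (h₀ : ∀ᶠ z in 𝓝 z₀, b z (k 0 z) (d₀ z) = 0 ∧ ∀ c : ℝ, d₀ z ≠ c • k 0 z)
    (h₁ : ∀ᶠ z in 𝓝 z₀, b z (k 1 z) (d₁ z) = 0 ∧ ∀ c : ℝ, d₁ z ≠ c • k 1 z) :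
    ContDiffAt ℝ ∞ (fun z => (b z (d₀ z) (d₀ z))⁻¹ • b z) z₀ := by
  set Λ : E3 → (Fin 3 → ℝ) →L[ℝ] E3 :=
    fun z => ∑ i, (ContinuousLinearMap.proj (R := ℝ) (φ := fun _ : Fin 3 => ℝ) i).smulRight (k i z)
    with hΛ
  have hΛa : ∀ z x, Λ z x = ∑ i, x i • k i z := by
    intro z x
    simp [hΛ]
  have hΛs : ContDiffAt ℝ ∞ Λ z₀ := by
    rw [contDiffAt_clm_apply_iff]
    intro x
    simp only [hΛa]
    refine ContDiffAt.sum fun i _ => ?_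
    exact ContDiffAt.smul (f := fun _ => x i) contDiffAt_const (hk i)
  have hinj : Function.Injective (Λ z₀ : (Fin 3 → ℝ) →ₗ[ℝ] E3) := by
    rw [← LinearMap.ker_eq_bot, LinearMap.ker_eq_bot']
    intro x hx
    have hx' : Λ z₀ x = 0 := hx
    rw [hΛa] at hx'
    exact funext (Fintype.linearIndependent_iff.1 hki x hx')
  set A : (Fin 3 → ℝ) ≃L[ℝ] E3 :=
    (LinearEquiv.ofInjectiveOfFinrankEq _ hinj (by simp)).toContinuousLinearEquiv with hA
  have hAΛ : (A : (Fin 3 → ℝ) →L[ℝ] E3) = Λ z₀ := ContinuousLinearMap.ext fun v => rfl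
  set X : E3 → E3 →L[ℝ] (Fin 3 → ℝ) := fun z => (Λ z).inverse with hX
  have hXs : ContDiffAt ℝ ∞ X z₀ := by
    have := contDiffAt_map_inverse (n := ∞) A
    rw [hAΛ] at this
    exact this.comp z₀ hΛs
  have hequiv : ∀ᶠ z in 𝓝 z₀, ∃ A' : (Fin 3 → ℝ) ≃L[ℝ] E3, Λ z = (A' : (Fin 3 → ℝ) →L[ℝ] E3) := by
    have h1 := hΛs.continuousAt.eventually (hAΛ ▸ A.nhds)
    filter_upwards [h1] with z hz
    obtain ⟨A', hA'⟩ := hz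
    exact ⟨A', hA'.symm⟩
  have hli : ∀ᶠ z in 𝓝 z₀, LinearIndependent ℝ fun i => k i z := by
    filter_upwards [hequiv] with z hz
    obtain ⟨A', hA'⟩ := hz
    rw [Fintype.linearIndependent_iff]
    intro x hx
    rw [← hΛa, hA'] at hx
    exact congrFun (A'.map_eq_zero_iff.1 hx)
  have hinv : ∀ᶠ z in 𝓝 z₀, ∀ v, ∑ i, X z v i • k i z = v := by
    filter_upwards [hequiv] with z hz v
    obtain ⟨A', hA''⟩ := hz
    rw [← hΛa, hX]
    dsimp only
    rw [hA'', ContinuousLinearMap.inverse_equiv]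
    exact A'.apply_symm_apply v
  have hXv : ∀ {v : E3 → E3} (i : Fin 3), ContDiffAt ℝ ∞ v z₀ →
      ContDiffAt ℝ ∞ (fun z => X z (v z) i) z₀ := fun i hv =>
    contDiffAt_pi.1 (hXs.clm_apply hv) i
  -- In a null frame the form has three unknown entries. The orthogonality of `d₀` to `k 0` gives
  -- `b(k 0, k 2) = -P b(k 0, k 1)`, and that of `d₁` to `k 1` gives `b(k 1, k 2) = -R b(k 0, k 1)`.
  -- So `b` is `b(k 0, k 1)` times the explicit smooth form `β`.
  set P : E3 → ℝ := fun z => X z (d₀ z) 1 / X z (d₀ z) 2 with hP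
  set R : E3 → ℝ := fun z => X z (d₁ z) 0 / X z (d₁ z) 2 with hR
  set β : E3 → E3 → E3 → ℝ := fun z v w =>
    (X z v 0 * X z w 1 + X z v 1 * X z w 0) - P z * (X z v 0 * X z w 2 + X z v 2 * X z w 0)
      - R z * (X z v 1 * X z w 2 + X z v 2 * X z w 1) with hβ
  -- the pointwise relation
  have hrel : ∀ᶠ z in 𝓝 z₀, X z (d₀ z) 2 ≠ 0 ∧ X z (d₁ z) 2 ≠ 0 ∧
      b z (k 0 z) (k 1 z) ≠ 0 ∧ ∀ v w, b z v w = b z (k 0 z) (k 1 z) * β z v w := by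
    filter_upwards [hb, hnull, h₀, h₁, hinv, hli] with z hb hnull h₀ h₁ hinv hli
    have hs := hb.1
    dsimp only at hs
    have hexp : ∀ v w, b z v w =
        b z (k 0 z) (k 1 z) * (X z v 0 * X z w 1 + X z v 1 * X z w 0) +
        b z (k 0 z) (k 2 z) * (X z v 0 * X z w 2 + X z v 2 * X z w 0) +
        b z (k 1 z) (k 2 z) * (X z v 1 * X z w 2 + X z v 2 * X z w 1) := by
      intro v w
      conv_lhs => rw [← hinv v, ← hinv w]
      simp only [Fin.sum_univ_three, map_add, map_smul, add_apply, smul_apply, smul_eq_mul, hnull,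
        hs (k 1 z) (k 0 z), hs (k 2 z) (k 0 z), hs (k 2 z) (k 1 z)]
      ring
    have e₀ : X z (d₀ z) 1 * b z (k 0 z) (k 1 z) + X z (d₀ z) 2 * b z (k 0 z) (k 2 z) = 0 := by
      have := h₀.1
      rw [← hinv (d₀ z)] at this
      simpa [Fin.sum_univ_three, hnull] using this
    have e₁ : X z (d₁ z) 0 * b z (k 0 z) (k 1 z) + X z (d₁ z) 2 * b z (k 1 z) (k 2 z) = 0 := by
      have := h₁.1
      rw [← hinv (d₁ z)] at this
      simpa [Fin.sum_univ_three, hnull, hs (k 1 z) (k 0 z)] using this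
    have hb01 : b z (k 0 z) (k 1 z) ≠ 0 := by
      refine hb.null_apply_ne_zero (hnull 0) (hli.ne_zero 0) (hnull 1) fun c hc => ?_
      have := Fintype.linearIndependent_iff.1 hli ![c, -1, 0] (by
        simp [Fin.sum_univ_three, hc]) 1
      simp at this
    have hx2 : X z (d₀ z) 2 ≠ 0 := by
      intro h
      rw [h, zero_mul, add_zero] at e₀
      have h1 := (mul_eq_zero.1 e₀).resolve_right hb01
      refine h₀.2 (X z (d₀ z) 0) ?_
      conv_lhs => rw [← hinv (d₀ z)]
      simp [Fin.sum_univ_three, h, h1]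
    have hy2 : X z (d₁ z) 2 ≠ 0 := by
      intro h
      rw [h, zero_mul, add_zero] at e₁
      have h1 := (mul_eq_zero.1 e₁).resolve_right hb01
      refine h₁.2 (X z (d₁ z) 1) ?_
      conv_lhs => rw [← hinv (d₁ z)]
      simp [Fin.sum_univ_three, h, h1]
    refine ⟨hx2, hy2, hb01, fun v w => ?_⟩
    have e02 : b z (k 0 z) (k 2 z) = - (P z * b z (k 0 z) (k 1 z)) := by
      simp only [hP]
      field_simp
      linarith
    have e12 : b z (k 1 z) (k 2 z) = - (R z * b z (k 0 z) (k 1 z)) := by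
      simp only [hR]
      field_simp
      linarith
    rw [hexp, e02, e12]
    simp only [hβ]
    ring
  have hPs : ContDiffAt ℝ ∞ P z₀ := (hXv 1 hd₀).div (hXv 2 hd₀) hrel.self_of_nhds.1
  have hRs : ContDiffAt ℝ ∞ R z₀ := (hXv 0 hd₁).div (hXv 2 hd₁) hrel.self_of_nhds.2.1
  have hβs : ∀ {v w : E3 → E3}, ContDiffAt ℝ ∞ v z₀ → ContDiffAt ℝ ∞ w z₀ →
      ContDiffAt ℝ ∞ (fun z => β z (v z) (w z)) z₀ := by
    intro v w hv hw
    exact ((((hXv 0 hv).mul (hXv 1 hw)).add ((hXv 1 hv).mul (hXv 0 hw))).sub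
      (hPs.mul (((hXv 0 hv).mul (hXv 2 hw)).add ((hXv 2 hv).mul (hXv 0 hw))))).sub
      (hRs.mul (((hXv 1 hv).mul (hXv 2 hw)).add ((hXv 2 hv).mul (hXv 1 hw))))
  have hβ0 : β z₀ (d₀ z₀) (d₀ z₀) ≠ 0 := by
    intro h
    have h1 := hrel.self_of_nhds.2.2.2 (d₀ z₀) (d₀ z₀)
    rw [h, mul_zero] at h1
    have hk0 : k 0 z₀ ≠ 0 := hki.ne_zero 0
    exact (hb.self_of_nhds.pos_of_orthogonal_null (hnull.self_of_nhds 0) hk0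
      h₀.self_of_nhds.1 h₀.self_of_nhds.2).ne' h1
  rw [contDiffAt_clm_apply_iff]
  intro v
  rw [contDiffAt_clm_apply_iff]
  intro w
  -- The factor `b(k 0, k 1)`, which need not be smooth, cancels in the normalised form.
  refine ((hβs (v := fun _ => v) (w := fun _ => w) contDiffAt_const contDiffAt_const).div
    (hβs hd₀ hd₀) hβ0).congr_of_eventuallyEq ?_
  filter_upwards [hrel] with z hz
  obtain ⟨-, -, h01, h⟩ := hz
  simp only [smul_apply, smul_eq_mul]
  rw [h v w, h (d₀ z) (d₀ z), mul_inv]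
  change _ = β z v w / β z (d₀ z) (d₀ z)
  field_simp

/-! ### Polar coordinates on the Cartan prolongation -/

namespace CartanProlongation

variable {N : Type*} [TopologicalSpace N] [ChartedSpace E3 N] [IsManifold (𝓡 3) ∞ N]
  {ξ : ContactStructure N}

lemma exists_combination_iff_rotated {V : Type*} [AddCommGroup V] [Module ℝ V] (φ : ℝ)
    (w A B : V) : (∃ c s : ℝ, w = c • A + s • B) ↔
      ∃ c s : ℝ, w = c • (Real.cos φ • A + Real.sin φ • B) +
        s • (-Real.sin φ • A + Real.cos φ • B) := by
  have hcs := Real.sin_sq_add_cos_sq φ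
  constructor
  · rintro ⟨c, s, rfl⟩
    refine ⟨c * Real.cos φ + s * Real.sin φ, -c * Real.sin φ + s * Real.cos φ, ?_⟩
    have e1 : (c * Real.cos φ + s * Real.sin φ) * Real.cos φ +
        (-c * Real.sin φ + s * Real.cos φ) * -Real.sin φ = c := by
      linear_combination c * hcs
    have e2 : (c * Real.cos φ + s * Real.sin φ) * Real.sin φ +
        (-c * Real.sin φ + s * Real.cos φ) * Real.cos φ = s := by
      linear_combination s * hcs
    generalize (c * Real.cos φ + s * Real.sin φ) = c' at *
    generalize (-c * Real.sin φ + s * Real.cos φ) = s' at *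
    rw [← e1, ← e2]
    module
  · rintro ⟨c, s, rfl⟩
    exact ⟨c * Real.cos φ - s * Real.sin φ, c * Real.sin φ + s * Real.cos φ, by module⟩

lemma someVector_eq {x₀ : N} {u : CartanProlongation ξ}
    (hs : u.base ∈ (extChartAt (𝓡 3) x₀).source) :
    ((u.ray.someVector : TangentSpace (𝓡 3) u.base) : E3) =
      tangentCoordChange (𝓡 3) x₀ u.base u.base (vec x₀ u) := by
  unfold vec
  rw [mfderiv_ext_eq hs]
  exact (tcc_left hs _).symm

lemma eq_of_vec_eq_smul {x₀ : N} {u w : CartanProlongation ξ} (hb : u.base = w.base)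
    (hs : u.base ∈ (extChartAt (𝓡 3) x₀).source) {c : ℝ} (hc : 0 < c)
    (h : vec x₀ u = c • vec x₀ w) : u = w := by
  obtain ⟨b, r⟩ := u
  dsimp only at hb hs
  subst hb
  have h1 : ((r.someVector : TangentSpace (𝓡 3) w.base) : E3) =
      c • ((w.ray.someVector : TangentSpace (𝓡 3) w.base) : E3) := by
    have h2 := someVector_eq (u := ⟨w.base, r⟩) hs
    have h3 := someVector_eq (u := w) hs
    refine h2.trans ?_
    rw [h, h3]
    exact (tangentCoordChange (𝓡 3) x₀ w.base w.base).map_smul c _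
  have h0 : (r.someVector : TangentSpace (𝓡 3) w.base) ≠ 0 := fun h =>
    r.someVector_ne_zero (Subtype.ext h)
  refine Eq.trans ?_ (mk'_eq w.base _ r.someVector.2 h0 w rfl c hc h1)
  unfold mk'
  congr 1
  exact r.someVector_ray.symm

namespace Frame

variable (f : Frame ξ)

/-- The frame rotated by the angle `φ`. -/
def rot (φ : ℝ) : Frame ξ where
  center := f.center
  dom := f.dom
  V y := Real.cos φ • f.V y + Real.sin φ • f.Y y
  Y y := -Real.sin φ • f.V y + Real.cos φ • f.Y y
  lam := Real.cos φ • f.lam + Real.sin φ • f.mu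
  mu := -Real.sin φ • f.lam + Real.cos φ • f.mu
  isOpen_dom := f.isOpen_dom
  center_mem := f.center_mem
  dom_subset := f.dom_subset
  contDiffOn_V := (f.contDiffOn_V.const_smul _).add (f.contDiffOn_Y.const_smul _)
  contDiffOn_Y := (f.contDiffOn_V.const_smul _).add (f.contDiffOn_Y.const_smul _)
  mem_plane_iff x hx hd v := by
    rw [f.mem_plane_iff x hx hd v]
    exact exists_combination_iff_rotated φ _ _ _
  lam_V y hy := by
    simp [f.lam_V y hy, f.lam_Y y hy, f.mu_V y hy, f.mu_Y y hy]
    linear_combination Real.sin_sq_add_cos_sq φ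
  lam_Y y hy := by
    simp [f.lam_V y hy, f.lam_Y y hy, f.mu_V y hy, f.mu_Y y hy]
    ring
  mu_V y hy := by
    simp [f.lam_V y hy, f.lam_Y y hy, f.mu_V y hy, f.mu_Y y hy]
    ring
  mu_Y y hy := by
    simp [f.lam_V y hy, f.lam_Y y hy, f.mu_V y hy, f.mu_Y y hy]
    linear_combination Real.sin_sq_add_cos_sq φ

/-- The vector of the plane at `p.1` with polar angle `p.2`. -/
def dir (p : E3 × ℝ) : E3 := Real.cos p.2 • f.V p.1 + Real.sin p.2 • f.Y p.1

/-- The derivative of `dir` in the angle. -/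
def dir' (p : E3 × ℝ) : E3 := -Real.sin p.2 • f.V p.1 + Real.cos p.2 • f.Y p.1

lemma lam_dir {p : E3 × ℝ} (hp : p.1 ∈ f.dom) : f.lam (f.dir p) = Real.cos p.2 := by
  simp [dir, f.lam_V _ hp, f.lam_Y _ hp]

lemma mu_dir {p : E3 × ℝ} (hp : p.1 ∈ f.dom) : f.mu (f.dir p) = Real.sin p.2 := by
  simp [dir, f.mu_V _ hp, f.mu_Y _ hp]

lemma lam_dir' {p : E3 × ℝ} (hp : p.1 ∈ f.dom) : f.lam (f.dir' p) = -Real.sin p.2 := by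
  simp [dir', f.lam_V _ hp, f.lam_Y _ hp]

lemma mu_dir' {p : E3 × ℝ} (hp : p.1 ∈ f.dom) : f.mu (f.dir' p) = Real.cos p.2 := by
  simp [dir', f.mu_V _ hp, f.mu_Y _ hp]

lemma dir_ne_zero {p : E3 × ℝ} (hp : p.1 ∈ f.dom) : f.dir p ≠ 0 := fun h => by
  have h1 := f.lam_dir hp
  have h2 := f.mu_dir hp
  rw [h, map_zero] at h1 h2
  have := Real.sin_sq_add_cos_sq p.2
  rw [← h1, ← h2] at this
  norm_num at this

lemma dir'_ne_smul_dir {p : E3 × ℝ} (hp : p.1 ∈ f.dom) (c : ℝ) : f.dir' p ≠ c • f.dir p := fun h => by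
  have h1 := congrArg f.lam h
  have h2 := congrArg f.mu h
  rw [map_smul, f.lam_dir hp, f.lam_dir' hp, smul_eq_mul] at h1
  rw [map_smul, f.mu_dir hp, f.mu_dir' hp, smul_eq_mul] at h2
  have := Real.sin_sq_add_cos_sq p.2
  have e : Real.sin p.2 * -Real.sin p.2 = Real.cos p.2 * Real.cos p.2 := by rw [h1, h2]; ring
  nlinarith [sq_nonneg (Real.sin p.2), sq_nonneg (Real.cos p.2)]

/-- The point of the prolongation with base point of coordinates `p.1` and polar angle `p.2`. -/
def circ (p : E3 × ℝ) : CartanProlongation ξ := (f.rot p.2).chart.symm (p.1, 0)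

lemma circ_eq_pt {p : E3 × ℝ} (hp : p.1 ∈ f.dom) :
    f.circ p = (f.rot p.2).pt (p.1, 0) hp := dif_pos hp

lemma base_circ {p : E3 × ℝ} (hp : p.1 ∈ f.dom) :
    (f.circ p).base = (extChartAt (𝓡 3) f.center).symm p.1 := by
  rw [f.circ_eq_pt hp]
  rfl

lemma base_circ_mem {p : E3 × ℝ} (hp : p.1 ∈ f.dom) :
    (f.circ p).base ∈ (extChartAt (𝓡 3) f.center).source := by
  rw [f.base_circ hp]
  exact (extChartAt (𝓡 3) f.center).map_target (f.dom_subset hp)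

lemma ext_base_circ {p : E3 × ℝ} (hp : p.1 ∈ f.dom) :
    extChartAt (𝓡 3) f.center (f.circ p).base = p.1 := by
  rw [f.base_circ hp]
  exact (extChartAt (𝓡 3) f.center).right_inv (f.dom_subset hp)

lemma vec_circ (x₁ : N) {p : E3 × ℝ} (hp : p.1 ∈ f.dom)
    (hx : (extChartAt (𝓡 3) f.center).symm p.1 ∈ (extChartAt (𝓡 3) x₁).source) :
    ∃ c : ℝ, 0 < c ∧ vec x₁ (f.circ p) = c • tangentCoordChange (𝓡 3) f.center x₁
      ((extChartAt (𝓡 3) f.center).symm p.1) (f.dir p) := by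
  obtain ⟨c, hc, h⟩ := (f.rot p.2).vec_pt x₁ (p.1, 0) hp hx
  refine ⟨c, hc, ?_⟩
  rw [f.circ_eq_pt hp, h]
  congr 2
  simp [coord, rot, dir]

lemma vec_circ_center {p : E3 × ℝ} (hp : p.1 ∈ f.dom) :
    ∃ c : ℝ, 0 < c ∧ vec f.center (f.circ p) = c • f.dir p := by
  have hs := (extChartAt (𝓡 3) f.center).map_target (f.dom_subset hp)
  obtain ⟨c, hc, h⟩ := f.vec_circ f.center hp hs
  rw [tangentCoordChange_self hs] at h
  exact ⟨c, hc, h⟩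

lemma circ_eq_circ_iff {p q : E3 × ℝ} (hp : p.1 ∈ f.dom) (hq : q.1 ∈ f.dom) :
    f.circ p = f.circ q ↔ p.1 = q.1 ∧ (p.2 : Real.Angle) = q.2 := by
  obtain ⟨c, hc, h⟩ := f.vec_circ_center hp
  obtain ⟨d, hd, h'⟩ := f.vec_circ_center hq
  constructor
  · intro e
    refine ⟨by rw [← f.ext_base_circ hp, e, f.ext_base_circ hq], ?_⟩
    rw [e, h'] at h
    have h1 := congrArg f.lam h
    have h2 := congrArg f.mu h
    rw [map_smul, map_smul, f.lam_dir hp, f.lam_dir hq, smul_eq_mul, smul_eq_mul] at h1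
    rw [map_smul, map_smul, f.mu_dir hp, f.mu_dir hq, smul_eq_mul, smul_eq_mul] at h2
    -- The pairs (cosine, sine) have length one, so the two positive scales agree, and then the
    -- angles do.
    have e1 := Real.sin_sq_add_cos_sq p.2
    have e2 := Real.sin_sq_add_cos_sq q.2
    have h3 : d = c := by
      have : d ^ 2 = c ^ 2 := by
        linear_combination (-d ^ 2) * e2 + c ^ 2 * e1 + (d * Real.cos q.2 + c * Real.cos p.2) * h1 +
          (d * Real.sin q.2 + c * Real.sin p.2) * h2
      nlinarith
    subst h3
    exact (Real.Angle.cos_sin_inj (mul_left_cancel₀ hc.ne' h1)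
      (mul_left_cancel₀ hc.ne' h2)).symm
  · rintro ⟨e1, e2⟩
    have hdir : f.dir p = f.dir q := by
      rw [dir, dir, e1, ← Real.Angle.cos_coe, ← Real.Angle.sin_coe, e2, Real.Angle.cos_coe,
        Real.Angle.sin_coe]
    refine eq_of_vec_eq_smul (x₀ := f.center) (c := c / d)
      (by rw [f.base_circ hp, f.base_circ hq, e1]) (f.base_circ_mem hp) (div_pos hc hd) ?_
    rw [h, h', hdir, smul_smul, div_mul_cancel₀ _ hd.ne']

lemma exists_circ_eq {u : CartanProlongation ξ} (hs : u.base ∈ (extChartAt (𝓡 3) f.center).source)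
    (hd : extChartAt (𝓡 3) f.center u.base ∈ f.dom) :
    ∃ θ, f.circ (extChartAt (𝓡 3) f.center u.base, θ) = u := by
  have h := f.vec_eq u hs hd
  set a := f.lam (vec f.center u)
  set b := f.mu (vec f.center u)
  have h0 : (⟨a, b⟩ : ℂ) ≠ 0 := by
    intro h0
    have ha : a = 0 := congrArg Complex.re h0
    have hb : b = 0 := congrArg Complex.im h0
    rw [ha, hb, zero_smul, zero_smul, add_zero] at h
    have h2 := someVector_eq hs
    rw [h, map_zero] at h2
    exact u.ray.someVector_ne_zero (Subtype.ext h2)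
  refine ⟨Complex.arg ⟨a, b⟩, ?_⟩
  set θ := Complex.arg ⟨a, b⟩
  have hpos : 0 < ‖(⟨a, b⟩ : ℂ)‖ := norm_pos_iff.2 h0
  obtain ⟨c, hc, h'⟩ := f.vec_circ_center (p := (extChartAt (𝓡 3) f.center u.base, θ)) hd
  refine eq_of_vec_eq_smul (x₀ := f.center) (c := c / ‖(⟨a, b⟩ : ℂ)‖) ?_ (f.base_circ_mem hd)
    (div_pos hc hpos) ?_
  · rw [f.base_circ hd]
    exact (extChartAt (𝓡 3) f.center).left_inv hs
  · have ea : a = ‖(⟨a, b⟩ : ℂ)‖ * Real.cos θ := (Complex.norm_mul_cos_arg ⟨a, b⟩).symm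
    have eb : b = ‖(⟨a, b⟩ : ℂ)‖ * Real.sin θ := (Complex.norm_mul_sin_arg ⟨a, b⟩).symm
    generalize ‖(⟨a, b⟩ : ℂ)‖ = r at *
    rw [h', h, ea, eb, dir]
    simp only [smul_add, smul_smul]
    congr 2 <;> field_simp

/-- The charts of the frames, as elements of the maximal atlas. -/
def openChart : OpenPartialHomeomorph (CartanProlongation ξ) (E3 × ℝ) :=
  (core ξ).openPartialHomeomorph f.chart (mem_range_self f)

lemma openChart_mem : f.openChart ∈ IsManifold.maximalAtlas 𝓘(ℝ, E3 × ℝ) ∞ (CartanProlongation ξ) := by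
  apply IsManifold.subset_maximalAtlas
  change _ ∈ ⋃ (e : PartialEquiv (CartanProlongation ξ) (E3 × ℝ)) (he : e ∈ (core ξ).atlas), _
  simp only [mem_iUnion]
  exact ⟨f.chart, mem_range_self f, rfl⟩

/-- The chart of the frame rotated by `φ` covers an open half circle of rays and sees the polar
angle through the tangent of `p.2 - φ`. This relates the polar coordinates, which are periodic, to
genuine charts. -/
lemma circ_mem_source {φ : ℝ} {p : E3 × ℝ} (hp : p.1 ∈ f.dom) (h : 0 < Real.cos (p.2 - φ)) :
    f.circ p ∈ (f.rot φ).openChart.source ∧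
      (f.rot φ).openChart (f.circ p) = (p.1, Real.tan (p.2 - φ)) := by
  obtain ⟨c, hc, h'⟩ := f.vec_circ_center hp
  have h1 : (f.rot φ).lam (vec f.center (f.circ p)) = c * Real.cos (p.2 - φ) := by
    rw [h', Real.cos_sub]
    simp only [rot, map_smul, add_apply, smul_apply, f.lam_dir hp, f.mu_dir hp, smul_eq_mul]
    ring
  have h2 : (f.rot φ).mu (vec f.center (f.circ p)) = c * Real.sin (p.2 - φ) := by
    rw [h', Real.sin_sub]
    simp only [rot, map_smul, add_apply, smul_apply, f.lam_dir hp, f.mu_dir hp, smul_eq_mul]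
    ring
  have hd : extChartAt (𝓡 3) f.center (f.circ p).base ∈ f.dom := by rwa [f.ext_base_circ hp]
  refine ⟨⟨f.base_circ_mem hp, hd, ?_⟩, ?_⟩
  · change 0 < (f.rot φ).lam (vec f.center (f.circ p))
    rw [h1]
    positivity
  · change (extChartAt (𝓡 3) f.center (f.circ p).base, (f.rot φ).mu (vec f.center (f.circ p)) /
      (f.rot φ).lam (vec f.center (f.circ p))) = _
    rw [f.ext_base_circ hp, h1, h2, Real.tan_eq_sin_div_cos, mul_div_mul_left _ _ hc.ne']

lemma circ_eq_symm {φ : ℝ} {p : E3 × ℝ} (hp : p.1 ∈ f.dom) (h : 0 < Real.cos (p.2 - φ)) :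
    f.circ p = (f.rot φ).openChart.symm (p.1, Real.tan (p.2 - φ)) := by
  obtain ⟨h1, h2⟩ := f.circ_mem_source hp h
  rw [← h2, (f.rot φ).openChart.left_inv h1]

lemma eventually_cos_pos (p : E3 × ℝ) : ∀ᶠ q : E3 × ℝ in 𝓝 p, 0 < Real.cos (q.2 - p.2) := by
  have : ContinuousAt (fun q : E3 × ℝ => Real.cos (q.2 - p.2)) p := by fun_prop
  exact this.eventually (lt_mem_nhds (by simp))

lemma eventually_mem_dom {p : E3 × ℝ} (hp : p.1 ∈ f.dom) : ∀ᶠ q : E3 × ℝ in 𝓝 p, q.1 ∈ f.dom :=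
  continuousAt_fst.eventually (f.isOpen_dom.mem_nhds hp)

lemma contMDiffAt_circ {p : E3 × ℝ} (hp : p.1 ∈ f.dom) :
    ContMDiffAt 𝓘(ℝ, E3 × ℝ) 𝓘(ℝ, E3 × ℝ) ∞ f.circ p := by
  have h1 : ContMDiffAt 𝓘(ℝ, E3 × ℝ) 𝓘(ℝ, E3 × ℝ) ∞ (f.rot p.2).openChart.symm (p.1, 0) :=
    contMDiffAt_symm_of_mem_maximalAtlas (f.rot p.2).openChart_mem hp
  have h2 : ContDiffAt ℝ ∞ (fun q : E3 × ℝ => (q.1, Real.tan (q.2 - p.2))) p := by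
    refine contDiffAt_fst.prodMk ?_
    have : ContDiffAt ℝ ∞ Real.tan (p.2 - p.2) := Real.contDiffAt_tan.2 (by simp)
    exact ContDiffAt.comp (g := Real.tan) (f := fun q : E3 × ℝ => q.2 - p.2) p this
      (contDiffAt_snd.sub contDiffAt_const)
  have h3 : ContMDiffAt 𝓘(ℝ, E3 × ℝ) 𝓘(ℝ, E3 × ℝ) ∞ (fun q : E3 × ℝ => (f.rot p.2).openChart.symm
      (q.1, Real.tan (q.2 - p.2))) p := by
    refine ContMDiffAt.comp (g := (f.rot p.2).openChart.symm) p ?_ h2.contMDiffAt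
    simpa using h1
  refine h3.congr_of_eventuallyEq ?_
  filter_upwards [eventually_cos_pos p, f.eventually_mem_dom hp] with q h4 h5
  exact f.circ_eq_symm h5 h4

/-- A smooth local inverse of the polar coordinates. -/
def polar (θ : ℝ) (u : CartanProlongation ξ) : E3 × ℝ :=
  (((f.rot θ).openChart u).1, θ + Real.arctan ((f.rot θ).openChart u).2)

lemma contMDiffAt_polar {p : E3 × ℝ} (hp : p.1 ∈ f.dom) :
    ContMDiffAt 𝓘(ℝ, E3 × ℝ) 𝓘(ℝ, E3 × ℝ) ∞ (f.polar p.2) (f.circ p) := by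
  have h1 : ContMDiffAt 𝓘(ℝ, E3 × ℝ) 𝓘(ℝ, E3 × ℝ) ∞ (f.rot p.2).openChart (f.circ p) :=
    contMDiffAt_of_mem_maximalAtlas (f.rot p.2).openChart_mem
      (f.circ_mem_source hp (by simp)).1
  have h2 : ContDiff ℝ ∞ (fun q : E3 × ℝ => (q.1, p.2 + Real.arctan q.2)) :=
    contDiff_fst.prodMk (contDiff_const.add (Real.contDiff_arctan.comp contDiff_snd))
  exact h2.contMDiff.contMDiffAt.comp _ h1

lemma eventually_polar_circ {p : E3 × ℝ} (hp : p.1 ∈ f.dom) :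
    ∀ᶠ q in 𝓝 p, f.polar p.2 (f.circ q) = q := by
  have hc : ∀ᶠ q : E3 × ℝ in 𝓝 p, q.2 - p.2 ∈ Ioo (-(Real.pi / 2)) (Real.pi / 2) := by
    have : ContinuousAt (fun q : E3 × ℝ => q.2 - p.2) p := by fun_prop
    refine this.eventually (isOpen_Ioo.mem_nhds ?_)
    exact ⟨by linarith [Real.pi_pos], by linarith [Real.pi_pos]⟩
  filter_upwards [hc, f.eventually_mem_dom hp] with q h4 h5
  have h6 := (f.circ_mem_source h5 (Real.cos_pos_of_mem_Ioo h4)).2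
  rw [polar, h6]
  ext1
  · rfl
  · change p.2 + Real.arctan (Real.tan (q.2 - p.2)) = q.2
    rw [Real.arctan_tan h4.1 h4.2]
    ring

lemma eventually_circ_polar {p : E3 × ℝ} (hp : p.1 ∈ f.dom) :
    ∀ᶠ u in 𝓝 (f.circ p), (f.polar p.2 u).1 ∈ f.dom ∧ f.circ (f.polar p.2 u) = u := by
  have hs := (f.circ_mem_source (φ := p.2) hp (by simp)).1
  filter_upwards [(f.rot p.2).openChart.open_source.mem_nhds hs] with u hu
  have h1 : (f.polar p.2 u).1 ∈ f.dom := (f.rot p.2).openChart.map_source hu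
  refine ⟨h1, ?_⟩
  have h2 : 0 < Real.cos ((f.polar p.2 u).2 - p.2) := by
    change 0 < Real.cos (p.2 + Real.arctan ((f.rot p.2).openChart u).2 - p.2)
    rw [add_sub_cancel_left]
    exact Real.cos_arctan_pos _
  rw [f.circ_eq_symm h1 h2]
  have h3 : Real.tan ((f.polar p.2 u).2 - p.2) = ((f.rot p.2).openChart u).2 := by
    change Real.tan (p.2 + Real.arctan ((f.rot p.2).openChart u).2 - p.2) = _
    rw [add_sub_cancel_left, Real.tan_arctan]
  rw [h3]
  exact (f.rot p.2).openChart.left_inv hu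

end Frame

lemma exists_frame_circ (u : CartanProlongation ξ) :
    ∃ (f : Frame ξ) (p : E3 × ℝ), p.1 ∈ f.dom ∧ f.circ p = u := by
  obtain ⟨f, hf⟩ := exists_frame u
  obtain ⟨θ, h⟩ := f.exists_circ_eq hf.1 hf.2.1
  exact ⟨f, _, hf.2.1, h⟩

/-- Different base points are separated in `N`. Over one base point, two rays that are not opposite
lie in the chart centred at their bisector, which has angle `(θ₁ + θ₂) / 2` or differs from it by
`π`; two opposite rays lie in disjoint half-plane charts. -/
instance [T2Space N] : T2Space (CartanProlongation ξ) := by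
  refine ⟨fun u w hne => ?_⟩
  by_cases hb : u.base = w.base
  · obtain ⟨f, hf⟩ := exists_frame u
    obtain ⟨θ₁, h₁⟩ := f.exists_circ_eq hf.1 hf.2.1
    have hf1 := hf.1
    have hf2 := hf.2.1
    rw [hb] at hf1 hf2
    obtain ⟨θ₂, h₂⟩ := f.exists_circ_eq hf1 hf2
    have hchart : ∀ φ, 0 < Real.cos (θ₁ - φ) → 0 < Real.cos (θ₂ - φ) →
        ∃ U U' : Set (CartanProlongation ξ), IsOpen U ∧ IsOpen U' ∧ u ∈ U ∧ w ∈ U' ∧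
          Disjoint U U' := by
      intro φ c1 c2
      have s1 := (f.circ_mem_source (p := (_, θ₁)) hf.2.1 c1).1
      have s2 := (f.circ_mem_source (p := (_, θ₂)) hf2 c2).1
      rw [h₁] at s1
      rw [h₂] at s2
      have hne' := (f.rot φ).openChart.injOn.ne s1 s2 hne
      obtain ⟨O, O', hO, hO', m, m', hdis⟩ := t2_separation hne'
      exact ⟨_, _, (f.rot φ).openChart.isOpen_inter_preimage hO,
        (f.rot φ).openChart.isOpen_inter_preimage hO', ⟨s1, m⟩, ⟨s2, m'⟩,
        (hdis.preimage _).mono inter_subset_right inter_subset_right⟩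
    rcases lt_trichotomy (Real.cos ((θ₁ - θ₂) / 2)) 0 with hc | hc | hc
    · refine hchart ((θ₁ + θ₂) / 2 + Real.pi) ?_ ?_
      · rw [show θ₁ - ((θ₁ + θ₂) / 2 + Real.pi) = (θ₁ - θ₂) / 2 - Real.pi by ring,
          Real.cos_sub_pi]
        linarith
      · rw [show θ₂ - ((θ₁ + θ₂) / 2 + Real.pi) = -((θ₁ - θ₂) / 2) - Real.pi by ring,
          Real.cos_sub_pi, Real.cos_neg]
        linarith
    · have hc' : Real.cos (θ₂ - (θ₁ + Real.pi)) = 1 := by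
        have : θ₂ - (θ₁ + Real.pi) = -(2 * ((θ₁ - θ₂) / 2)) - Real.pi := by ring
        rw [this, Real.cos_sub_pi, Real.cos_neg, Real.cos_two_mul, hc]
        norm_num
      have s1 := (f.circ_mem_source (φ := θ₁) (p := (_, θ₁)) hf.2.1 (by simp)).1
      have s2 := (f.circ_mem_source (φ := θ₁ + Real.pi) (p := (_, θ₂)) hf2 (by rw [hc']; simp)).1
      rw [h₁] at s1
      rw [h₂] at s2
      refine ⟨_, _, (f.rot θ₁).openChart.open_source, (f.rot (θ₁ + Real.pi)).openChart.open_source,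
        s1, s2, Set.disjoint_left.2 ?_⟩
      rintro z ⟨-, -, z1⟩ ⟨-, -, z2⟩
      change 0 < (Real.cos θ₁ • f.lam + Real.sin θ₁ • f.mu) (vec f.center z) at z1
      change 0 < (Real.cos (θ₁ + Real.pi) • f.lam + Real.sin (θ₁ + Real.pi) • f.mu)
        (vec f.center z) at z2
      rw [Real.cos_add_pi, Real.sin_add_pi] at z2
      simp only [add_apply, smul_apply, smul_eq_mul] at z1 z2
      linarith
    · refine hchart ((θ₁ + θ₂) / 2) ?_ ?_
      · rwa [show θ₁ - (θ₁ + θ₂) / 2 = (θ₁ - θ₂) / 2 by ring]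
      · rwa [show θ₂ - (θ₁ + θ₂) / 2 = -((θ₁ - θ₂) / 2) by ring, Real.cos_neg]
  · obtain ⟨O, O', hO, hO', m, m', hdis⟩ := t2_separation hb
    have hc : Continuous (base : CartanProlongation ξ → N) := contMDiff_base.continuous
    exact ⟨_, _, hO.preimage hc, hO'.preimage hc, m, m', hdis.preimage _⟩

end CartanProlongation

/-! ### The Engel structure in polar coordinates -/

namespace CartanProlongation

variable {N : Type*} [TopologicalSpace N] [ChartedSpace E3 N] [IsManifold (𝓡 3) ∞ N]
  {ξ : ContactStructure N}

lemma exists_smul_eq_iff_of_injective {V W : Type*} [NormedAddCommGroup V] [NormedSpace ℝ V]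
    [NormedAddCommGroup W] [NormedSpace ℝ W] {L : V →L[ℝ] W} (hL : Function.Injective L)
    {A B : V} {e d : W} {c : ℝ} (hc : c ≠ 0) (hA : L A = c • e) (hB : L B = d) :
    (∃ a : ℝ, a • A = B) ↔ ∃ a : ℝ, d = a • e := by
  constructor
  · rintro ⟨a, h⟩
    exact ⟨a * c, by rw [← hB, ← h, map_smul, hA, smul_smul]⟩
  · rintro ⟨a, h⟩
    exact ⟨a / c, hL (by rw [hB, h, map_smul, hA, smul_smul, div_mul_cancel₀ _ hc])⟩

/-- The plane field of the vectors which the projection maps into the contact planes. -/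
def contactLift (ξ : ContactStructure N) (u : CartanProlongation ξ) :
    Submodule ℝ (TangentSpace 𝓘(ℝ, E3 × ℝ) u) :=
  (ξ.plane u.base).comap
    (mfderiv 𝓘(ℝ, E3 × ℝ) (𝓡 3) (base : CartanProlongation ξ → N) u).toLinearMap

lemma engel_le_contactLift (u : CartanProlongation ξ) : engel ξ u ≤ contactLift ξ u := by
  refine Submodule.comap_mono ?_
  rw [Submodule.span_singleton_le_iff_mem]
  exact u.ray.someVector.2

namespace Frame

variable (f : Frame ξ)

lemma contMDiffAt_polar' {φ : ℝ} {u : CartanProlongation ξ}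
    (hu : u ∈ (f.rot φ).openChart.source) :
    ContMDiffAt 𝓘(ℝ, E3 × ℝ) 𝓘(ℝ, E3 × ℝ) ∞ (f.polar φ) u := by
  have h1 : ContMDiffAt 𝓘(ℝ, E3 × ℝ) 𝓘(ℝ, E3 × ℝ) ∞ (f.rot φ).openChart u :=
    contMDiffAt_of_mem_maximalAtlas (f.rot φ).openChart_mem hu
  have h2 : ContDiff ℝ ∞ (fun q : E3 × ℝ => (q.1, φ + Real.arctan q.2)) :=
    contDiff_fst.prodMk (contDiff_const.add (Real.contDiff_arctan.comp contDiff_snd))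
  exact h2.contMDiff.contMDiffAt.comp _ h1

lemma polar_mem_dom {φ : ℝ} {u : CartanProlongation ξ} (hu : u ∈ (f.rot φ).openChart.source) :
    (f.polar φ u).1 ∈ f.dom := (f.rot φ).openChart.map_source hu

lemma circ_polar {φ : ℝ} {u : CartanProlongation ξ} (hu : u ∈ (f.rot φ).openChart.source) :
    f.circ (f.polar φ u) = u := by
  have h2 : 0 < Real.cos ((f.polar φ u).2 - φ) := by
    change 0 < Real.cos (φ + Real.arctan ((f.rot φ).openChart u).2 - φ)
    rw [add_sub_cancel_left]
    exact Real.cos_arctan_pos _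
  rw [f.circ_eq_symm (f.polar_mem_dom hu) h2]
  have h3 : Real.tan ((f.polar φ u).2 - φ) = ((f.rot φ).openChart u).2 := by
    change Real.tan (φ + Real.arctan ((f.rot φ).openChart u).2 - φ) = _
    rw [add_sub_cancel_left, Real.tan_arctan]
  rw [h3]
  exact (f.rot φ).openChart.left_inv hu

lemma polar_circ {φ : ℝ} {q : E3 × ℝ} (hq : q.1 ∈ f.dom)
    (h : q.2 - φ ∈ Ioo (-(Real.pi / 2)) (Real.pi / 2)) : f.polar φ (f.circ q) = q := by
  have h6 := (f.circ_mem_source hq (Real.cos_pos_of_mem_Ioo h)).2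
  rw [polar, h6]
  ext1
  · rfl
  · change φ + Real.arctan (Real.tan (q.2 - φ)) = q.2
    rw [Real.arctan_tan h.1 h.2]
    ring

/-- The differential of the polar coordinates. -/
def dcirc (q : E3 × ℝ) : E3 × ℝ →L[ℝ] TangentSpace 𝓘(ℝ, E3 × ℝ) (f.circ q) :=
  mfderiv 𝓘(ℝ, E3 × ℝ) 𝓘(ℝ, E3 × ℝ) f.circ q

lemma hasMFDerivAt_circ {q : E3 × ℝ} (hq : q.1 ∈ f.dom) :
    HasMFDerivAt 𝓘(ℝ, E3 × ℝ) 𝓘(ℝ, E3 × ℝ) f.circ q (f.dcirc q) :=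
  ((f.contMDiffAt_circ hq).mdifferentiableAt (by simp)).hasMFDerivAt

lemma mfderiv_polar_dcirc {φ : ℝ} {q : E3 × ℝ} (hq : q.1 ∈ f.dom)
    (h : q.2 - φ ∈ Ioo (-(Real.pi / 2)) (Real.pi / 2)) (δ : E3 × ℝ) :
    (mfderiv 𝓘(ℝ, E3 × ℝ) 𝓘(ℝ, E3 × ℝ) (f.polar φ) (f.circ q) (f.dcirc q δ) : E3 × ℝ) = δ := by
  have hs := (f.circ_mem_source hq (Real.cos_pos_of_mem_Ioo h)).1
  have h1 : HasMFDerivAt 𝓘(ℝ, E3 × ℝ) 𝓘(ℝ, E3 × ℝ) (f.polar φ ∘ f.circ) q _ :=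
    ((f.contMDiffAt_polar' hs).mdifferentiableAt (by simp)).hasMFDerivAt.comp q
      (f.hasMFDerivAt_circ hq)
  have h2 : f.polar φ ∘ f.circ =ᶠ[𝓝 q] id := by
    have hc : ∀ᶠ q : E3 × ℝ in 𝓝 q, q.2 - φ ∈ Ioo (-(Real.pi / 2)) (Real.pi / 2) := by
      have : ContinuousAt (fun q : E3 × ℝ => q.2 - φ) q := by fun_prop
      exact this.eventually (isOpen_Ioo.mem_nhds h)
    filter_upwards [hc, f.eventually_mem_dom hq] with q h4 h5
    exact f.polar_circ h5 h4
  have h3 := hasMFDerivAt_unique h1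
    ((hasMFDerivAt_id (I := 𝓘(ℝ, E3 × ℝ)) q).congr_of_eventuallyEq h2)
  exact congrArg (fun T : E3 × ℝ →L[ℝ] E3 × ℝ => T δ) h3

lemma dcirc_mfderiv_polar {φ : ℝ} {q : E3 × ℝ} (hq : q.1 ∈ f.dom)
    (h : q.2 - φ ∈ Ioo (-(Real.pi / 2)) (Real.pi / 2))
    (v : TangentSpace 𝓘(ℝ, E3 × ℝ) (f.circ q)) :
    f.dcirc q (mfderiv 𝓘(ℝ, E3 × ℝ) 𝓘(ℝ, E3 × ℝ) (f.polar φ) (f.circ q) v) = v := by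
  have hs := (f.circ_mem_source hq (Real.cos_pos_of_mem_Ioo h)).1
  have hp := f.polar_circ hq h
  have h0 : HasMFDerivAt 𝓘(ℝ, E3 × ℝ) 𝓘(ℝ, E3 × ℝ) f.circ (f.polar φ (f.circ q)) (f.dcirc q) := by
    have := f.hasMFDerivAt_circ hq
    rw [← hp] at this
    convert! this using 2; rw [hp]
  have h1 : HasMFDerivAt 𝓘(ℝ, E3 × ℝ) 𝓘(ℝ, E3 × ℝ) (f.circ ∘ f.polar φ) (f.circ q) _ :=
    h0.comp (f.circ q) ((f.contMDiffAt_polar' hs).mdifferentiableAt (by simp)).hasMFDerivAt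
  have h2 : f.circ ∘ f.polar φ =ᶠ[𝓝 (f.circ q)] id := by
    filter_upwards [(f.rot φ).openChart.open_source.mem_nhds hs] with u hu
    exact f.circ_polar hu
  have h3 := hasMFDerivAt_unique h1
    ((hasMFDerivAt_id (I := 𝓘(ℝ, E3 × ℝ)) (f.circ q)).congr_of_eventuallyEq h2)
  exact congrArg (fun T : E3 × ℝ →L[ℝ] E3 × ℝ => T v) h3

lemma zero_mem_Ioo (q : E3 × ℝ) : q.2 - q.2 ∈ Ioo (-(Real.pi / 2)) (Real.pi / 2) := by
  rw [sub_self]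
  exact ⟨by linarith [Real.pi_pos], by linarith [Real.pi_pos]⟩

lemma dcirc_surjective {q : E3 × ℝ} (hq : q.1 ∈ f.dom)
    (v : TangentSpace 𝓘(ℝ, E3 × ℝ) (f.circ q)) : ∃ δ, f.dcirc q δ = v :=
  ⟨_, f.dcirc_mfderiv_polar hq (zero_mem_Ioo q) v⟩

lemma dcirc_injective {q : E3 × ℝ} (hq : q.1 ∈ f.dom) : Function.Injective (f.dcirc q) :=
  Function.LeftInverse.injective (f.mfderiv_polar_dcirc hq (zero_mem_Ioo q))

lemma isInvertible_dcirc {q : E3 × ℝ} (hq : q.1 ∈ f.dom) :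
    (mfderiv 𝓘(ℝ, E3 × ℝ) 𝓘(ℝ, E3 × ℝ) f.circ q).IsInvertible :=
  ContinuousLinearMap.IsInvertible.of_inverse
    (g := mfderiv 𝓘(ℝ, E3 × ℝ) 𝓘(ℝ, E3 × ℝ) (f.polar q.2) (f.circ q))
    (ContinuousLinearMap.ext (f.dcirc_mfderiv_polar hq (zero_mem_Ioo q)))
    (ContinuousLinearMap.ext (f.mfderiv_polar_dcirc hq (zero_mem_Ioo q)))

lemma isInvertible_mfderiv_polar {φ : ℝ} {q : E3 × ℝ} (hq : q.1 ∈ f.dom)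
    (h : q.2 - φ ∈ Ioo (-(Real.pi / 2)) (Real.pi / 2)) :
    (mfderiv 𝓘(ℝ, E3 × ℝ) 𝓘(ℝ, E3 × ℝ) (f.polar φ) (f.circ q)).IsInvertible :=
  ContinuousLinearMap.IsInvertible.of_inverse
    (g := mfderiv 𝓘(ℝ, E3 × ℝ) 𝓘(ℝ, E3 × ℝ) f.circ q)
    (ContinuousLinearMap.ext (f.mfderiv_polar_dcirc hq h))
    (ContinuousLinearMap.ext (f.dcirc_mfderiv_polar hq h))

lemma ext_mfderiv_base_dcirc {q : E3 × ℝ} (hq : q.1 ∈ f.dom) (δ : E3 × ℝ) :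
    (mfderiv (𝓡 3) 𝓘(ℝ, E3) (extChartAt (𝓡 3) f.center) (f.circ q).base
      (mfderiv 𝓘(ℝ, E3 × ℝ) (𝓡 3) (base : CartanProlongation ξ → N) (f.circ q) (f.dcirc q δ)) : E3) =
      δ.1 := by
  have h0 : MDifferentiableAt (𝓡 3) 𝓘(ℝ, E3) (extChartAt (𝓡 3) f.center) (f.circ q).base :=
    mdifferentiableAt_extChartAt (by simpa using f.base_circ_mem hq)
  have h1 := h0.hasMFDerivAt.comp q
    (((contMDiff_base (ξ := ξ) (f.circ q)).mdifferentiableAt (by simp)).hasMFDerivAt.comp q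
      (f.hasMFDerivAt_circ hq))
  have h2 : (extChartAt (𝓡 3) f.center ∘ base ∘ f.circ) =ᶠ[𝓝 q] Prod.fst := by
    filter_upwards [f.eventually_mem_dom hq] with q hq
    exact f.ext_base_circ hq
  have h3 : HasMFDerivAt 𝓘(ℝ, E3 × ℝ) 𝓘(ℝ, E3) (Prod.fst : E3 × ℝ → E3) q
      (ContinuousLinearMap.fst ℝ E3 ℝ) := hasFDerivAt_fst.hasMFDerivAt
  have h4 := hasMFDerivAt_unique h1 (h3.congr_of_eventuallyEq h2)
  exact congrArg (fun T : E3 × ℝ →L[ℝ] E3 => T δ) h4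

lemma mem_contactLift_circ {q : E3 × ℝ} (hq : q.1 ∈ f.dom) (δ : E3 × ℝ) :
    f.dcirc q δ ∈ contactLift ξ (f.circ q) ↔ ∃ a b : ℝ, δ.1 = a • f.dir q + b • f.dir' q := by
  have h1 := f.mem_plane_iff (f.circ q).base (f.base_circ_mem hq)
    (by rwa [f.ext_base_circ hq])
    (mfderiv 𝓘(ℝ, E3 × ℝ) (𝓡 3) (base : CartanProlongation ξ → N) (f.circ q) (f.dcirc q δ))
  rw [f.ext_mfderiv_base_dcirc hq, f.ext_base_circ hq] at h1
  exact h1.trans (exists_combination_iff_rotated q.2 _ _ _)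

lemma mem_engel_circ {q : E3 × ℝ} (hq : q.1 ∈ f.dom) (δ : E3 × ℝ) :
    f.dcirc q δ ∈ engel ξ (f.circ q) ↔ ∃ a : ℝ, δ.1 = a • f.dir q := by
  have e : f.dcirc q δ ∈ engel ξ (f.circ q) ↔ ∃ a : ℝ,
      a • ((f.circ q).ray.someVector : TangentSpace (𝓡 3) (f.circ q).base) =
      mfderiv 𝓘(ℝ, E3 × ℝ) (𝓡 3) (base : CartanProlongation ξ → N) (f.circ q) (f.dcirc q δ) :=
    Submodule.mem_span_singleton
  rw [e]
  obtain ⟨c, hc, hv⟩ := f.vec_circ_center hq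
  have hs := f.base_circ_mem hq
  have hd := f.ext_mfderiv_base_dcirc hq δ
  set L : E3 →L[ℝ] E3 := mfderiv (𝓡 3) 𝓘(ℝ, E3) (extChartAt (𝓡 3) f.center) (f.circ q).base with hL
  have hinj : Function.Injective L := by
    intro v w h
    rw [hL, mfderiv_ext_eq hs] at h
    exact (tcc_left hs v).symm.trans ((congrArg _ h).trans (tcc_left hs w))
  have hv' : L ((f.circ q).ray.someVector : TangentSpace (𝓡 3) (f.circ q).base) = c • f.dir q := hv
  exact exists_smul_eq_iff_of_injective hinj hc.ne' hv' hd

/-- A vector field on the prolongation in polar coordinates. -/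
def coordField (X : (u : CartanProlongation ξ) → TangentSpace 𝓘(ℝ, E3 × ℝ) u) (q : E3 × ℝ) :
    E3 × ℝ :=
  VectorField.mpullback 𝓘(ℝ, E3 × ℝ) 𝓘(ℝ, E3 × ℝ) f.circ X q

lemma dcirc_coordField {X : (u : CartanProlongation ξ) → TangentSpace 𝓘(ℝ, E3 × ℝ) u}
    {q : E3 × ℝ} (hq : q.1 ∈ f.dom) : f.dcirc q (f.coordField X q) = X (f.circ q) :=
  (f.isInvertible_dcirc hq).self_apply_inverse _

lemma coordField_eq {X : (u : CartanProlongation ξ) → TangentSpace 𝓘(ℝ, E3 × ℝ) u}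
    {q : E3 × ℝ} (hq : q.1 ∈ f.dom) {δ : E3 × ℝ} (h : f.dcirc q δ = X (f.circ q)) :
    f.coordField X q = δ :=
  f.dcirc_injective hq ((f.dcirc_coordField hq).trans h.symm)

lemma contDiffAt_coordField {X : (u : CartanProlongation ξ) → TangentSpace 𝓘(ℝ, E3 × ℝ) u}
    {q : E3 × ℝ} (hq : q.1 ∈ f.dom) (hX : ContMDiffAt 𝓘(ℝ, E3 × ℝ) 𝓘(ℝ, E3 × ℝ).tangent ∞
      (fun y => (⟨y, X y⟩ : TangentBundle 𝓘(ℝ, E3 × ℝ) (CartanProlongation ξ))) (f.circ q)) :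
    ContDiffAt ℝ ∞ (f.coordField X) q := by
  have := ContMDiffAt.mpullback_vectorField_preimage (m := ∞) (n := ∞) hX (f.contMDiffAt_circ hq)
    (f.isInvertible_dcirc hq) (by simp)
  exact contMDiffAt_vectorSpace_iff_contDiffAt.1 this

lemma dcirc_lieBracket_coordField
    {X Y : (u : CartanProlongation ξ) → TangentSpace 𝓘(ℝ, E3 × ℝ) u}
    {q : E3 × ℝ} (hq : q.1 ∈ f.dom) (hX : ContMDiffAt 𝓘(ℝ, E3 × ℝ) 𝓘(ℝ, E3 × ℝ).tangent ∞
      (fun y => (⟨y, X y⟩ : TangentBundle 𝓘(ℝ, E3 × ℝ) (CartanProlongation ξ))) (f.circ q))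
    (hY : ContMDiffAt 𝓘(ℝ, E3 × ℝ) 𝓘(ℝ, E3 × ℝ).tangent ∞
      (fun y => (⟨y, Y y⟩ : TangentBundle 𝓘(ℝ, E3 × ℝ) (CartanProlongation ξ))) (f.circ q)) :
    f.dcirc q (VectorField.lieBracket ℝ (f.coordField X) (f.coordField Y) q) =
      VectorField.mlieBracket 𝓘(ℝ, E3 × ℝ) X Y (f.circ q) := by
  have : IsManifold 𝓘(ℝ, E3 × ℝ) (minSmoothness ℝ 2) (CartanProlongation ξ) :=
    IsManifold.of_le (n := ∞) (by rw [minSmoothness_of_isRCLikeNormedField]; exact ENat.LEInfty.out)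
  have h := VectorField.mpullback_mlieBracket (n := ∞) (hX.mdifferentiableAt (by simp))
    (hY.mdifferentiableAt (by simp)) (f.contMDiffAt_circ hq)
    (by rw [minSmoothness_of_isRCLikeNormedField]; exact ENat.LEInfty.out)
  have h2 := (f.isInvertible_dcirc hq).self_apply_inverse
    (VectorField.mlieBracket 𝓘(ℝ, E3 × ℝ) X Y (f.circ q))
  refine Eq.trans ?_ h2
  refine congrArg (f.dcirc q) ?_
  refine Eq.trans ?_ h.symm
  rw [← VectorField.mlieBracketWithin_univ, VectorField.mlieBracketWithin_eq_lieBracketWithin]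
  exact congrFun VectorField.lieBracketWithin_univ.symm q

/-- The vector field with coordinates `Z` in polar coordinates. -/
def pushField (φ : ℝ) (Z : E3 × ℝ → E3 × ℝ) :
    (u : CartanProlongation ξ) → TangentSpace 𝓘(ℝ, E3 × ℝ) u :=
  VectorField.mpullback 𝓘(ℝ, E3 × ℝ) 𝓘(ℝ, E3 × ℝ) (f.polar φ) Z

lemma pushField_circ {φ : ℝ} {q : E3 × ℝ} (hq : q.1 ∈ f.dom)
    (h : q.2 - φ ∈ Ioo (-(Real.pi / 2)) (Real.pi / 2)) (Z : E3 × ℝ → E3 × ℝ) :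
    f.pushField φ Z (f.circ q) = f.dcirc q (Z q) := by
  have h1 := (f.isInvertible_mfderiv_polar hq h).inverse_apply_self (f.dcirc q (Z q))
  rw [f.mfderiv_polar_dcirc hq h] at h1
  rw [← h1]
  change (mfderiv 𝓘(ℝ, E3 × ℝ) 𝓘(ℝ, E3 × ℝ) (f.polar φ) (f.circ q)).inverse
    (Z (f.polar φ (f.circ q))) = _
  rw [f.polar_circ hq h]

lemma polar_snd_mem {φ : ℝ} {u : CartanProlongation ξ} :
    (f.polar φ u).2 - φ ∈ Ioo (-(Real.pi / 2)) (Real.pi / 2) := by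
  change φ + Real.arctan ((f.rot φ).openChart u).2 - φ ∈ _
  rw [add_sub_cancel_left]
  exact Real.arctan_mem_Ioo _

/-- This supplies the explicit local sections that test the definitions of `derivedDistribution` and
`characteristic`. -/
lemma isLocalSection_pushField {Δ : (u : CartanProlongation ξ) →
    Submodule ℝ (TangentSpace 𝓘(ℝ, E3 × ℝ) u)} {Z : E3 × ℝ → E3 × ℝ}
    (hZ : ∀ q : E3 × ℝ, q.1 ∈ f.dom → ContDiffAt ℝ ∞ Z q)
    (hΔ : ∀ q : E3 × ℝ, q.1 ∈ f.dom → f.dcirc q (Z q) ∈ Δ (f.circ q)) {p : E3 × ℝ}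
    (hp : p.1 ∈ f.dom) : IsLocalSection Δ (f.pushField p.2 Z) (f.circ p) := by
  refine ⟨(f.rot p.2).openChart.source, (f.rot p.2).openChart.open_source,
    (f.circ_mem_source hp (by simp)).1, ?_, ?_⟩
  · intro u hu
    refine ContMDiffAt.contMDiffWithinAt ?_
    have hu1 := f.polar_mem_dom hu
    have hinv := f.isInvertible_mfderiv_polar hu1 (φ := p.2) (f.polar_snd_mem (u := u))
    rw [f.circ_polar hu] at hinv
    exact ContMDiffAt.mpullback_vectorField_preimage (m := ∞) (n := ∞)
      (contMDiffAt_vectorSpace_iff_contDiffAt.2 (hZ _ hu1)) (f.contMDiffAt_polar' hu)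
      hinv (by simp)
  · intro u hu
    have hu1 := f.polar_mem_dom hu
    have h := hΔ _ hu1
    rw [← f.pushField_circ (φ := p.2) hu1 f.polar_snd_mem, f.circ_polar hu] at h
    exact h

lemma coordField_pushField_eventuallyEq {Z : E3 × ℝ → E3 × ℝ} {p : E3 × ℝ} (hp : p.1 ∈ f.dom) :
    f.coordField (f.pushField p.2 Z) =ᶠ[𝓝 p] Z := by
  have hc : ∀ᶠ q : E3 × ℝ in 𝓝 p, q.2 - p.2 ∈ Ioo (-(Real.pi / 2)) (Real.pi / 2) := by
    have : ContinuousAt (fun q : E3 × ℝ => q.2 - p.2) p := by fun_prop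
    exact this.eventually (isOpen_Ioo.mem_nhds (zero_mem_Ioo p))
  filter_upwards [hc, f.eventually_mem_dom hp] with q h4 h5
  exact f.coordField_eq h5 (f.pushField_circ h5 h4 Z).symm

lemma _root_.NullGeod.IsLocalSection.contMDiffAt {Δ : (u : CartanProlongation ξ) →
    Submodule ℝ (TangentSpace 𝓘(ℝ, E3 × ℝ) u)}
    {X : (u : CartanProlongation ξ) → TangentSpace 𝓘(ℝ, E3 × ℝ) u} {u : CartanProlongation ξ}
    (h : IsLocalSection Δ X u) : ContMDiffAt 𝓘(ℝ, E3 × ℝ) 𝓘(ℝ, E3 × ℝ).tangent ∞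
      (fun y => (⟨y, X y⟩ : TangentBundle 𝓘(ℝ, E3 × ℝ) (CartanProlongation ξ))) u := by
  obtain ⟨U, hU, hu, hX, -⟩ := h
  exact (hX u hu).contMDiffAt (hU.mem_nhds hu)

lemma eventually_dcirc_coordField_mem {Δ : (u : CartanProlongation ξ) →
    Submodule ℝ (TangentSpace 𝓘(ℝ, E3 × ℝ) u)}
    {X : (u : CartanProlongation ξ) → TangentSpace 𝓘(ℝ, E3 × ℝ) u} {p : E3 × ℝ} (hp : p.1 ∈ f.dom)
    (h : IsLocalSection Δ X (f.circ p)) :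
    ∀ᶠ q in 𝓝 p, q.1 ∈ f.dom ∧ f.dcirc q (f.coordField X q) ∈ Δ (f.circ q) := by
  obtain ⟨U, hU, hu, -, hX⟩ := h
  have hc : ContinuousAt f.circ p := (f.contMDiffAt_circ hp).continuousAt
  filter_upwards [hc.eventually (hU.mem_nhds hu), f.eventually_mem_dom hp] with q h1 h2
  exact ⟨h2, by rw [f.dcirc_coordField h2]; exact hX _ h1⟩

lemma contDiffAt_V {y : E3} (hy : y ∈ f.dom) : ContDiffAt ℝ ∞ f.V y :=
  f.contDiffOn_V.contDiffAt (f.isOpen_dom.mem_nhds hy)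

lemma contDiffAt_Y {y : E3} (hy : y ∈ f.dom) : ContDiffAt ℝ ∞ f.Y y :=
  f.contDiffOn_Y.contDiffAt (f.isOpen_dom.mem_nhds hy)

lemma contDiffAt_dir {q : E3 × ℝ} (hq : q.1 ∈ f.dom) : ContDiffAt ℝ ∞ f.dir q :=
  ((Real.contDiff_cos.contDiffAt.comp q contDiffAt_snd).smul
    ((f.contDiffAt_V hq).comp q contDiffAt_fst)).add
  ((Real.contDiff_sin.contDiffAt.comp q contDiffAt_snd).smul
    ((f.contDiffAt_Y hq).comp q contDiffAt_fst))

lemma contDiffAt_dir' {q : E3 × ℝ} (hq : q.1 ∈ f.dom) : ContDiffAt ℝ ∞ f.dir' q :=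
  ((Real.contDiff_sin.neg.contDiffAt.comp q contDiffAt_snd).smul
    ((f.contDiffAt_V hq).comp q contDiffAt_fst)).add
  ((Real.contDiff_cos.contDiffAt.comp q contDiffAt_snd).smul
    ((f.contDiffAt_Y hq).comp q contDiffAt_fst))

lemma fderiv_dir_vertical {q : E3 × ℝ} (hq : q.1 ∈ f.dom) :
    fderiv ℝ f.dir q (0, 1) = f.dir' q := by
  have h1 : HasDerivAt (fun t : ℝ => q + t • ((0, 1) : E3 × ℝ)) (0, 1) 0 := by
    simpa using ((hasDerivAt_id (0 : ℝ)).smul_const ((0, 1) : E3 × ℝ)).const_add q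
  have h0 : q + (0 : ℝ) • ((0, 1) : E3 × ℝ) = q := by simp
  have h2 : HasDerivAt (fun t : ℝ => f.dir (q + t • ((0, 1) : E3 × ℝ)))
      (fderiv ℝ f.dir q (0, 1)) 0 := by
    refine HasFDerivAt.comp_hasDerivAt (l := f.dir) (0 : ℝ) ?_ h1
    rw [h0]
    exact ((f.contDiffAt_dir hq).differentiableAt (by simp)).hasFDerivAt
  have h3 : HasDerivAt (fun t : ℝ => f.dir (q + t • ((0, 1) : E3 × ℝ))) (f.dir' q) 0 := by
    have e : (fun t : ℝ => f.dir (q + t • ((0, 1) : E3 × ℝ))) =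
        fun t => Real.cos (q.2 + t) • f.V q.1 + Real.sin (q.2 + t) • f.Y q.1 := by
      ext1 t
      simp [dir]
    rw [e]
    have hc := ((Real.hasDerivAt_cos (q.2 + 0)).comp_const_add q.2 0).smul_const (f.V q.1)
    have hs := ((Real.hasDerivAt_sin (q.2 + 0)).comp_const_add q.2 0).smul_const (f.Y q.1)
    have := hc.add hs
    rw [add_zero] at this
    exact this
  exact h2.unique h3

end Frame

end CartanProlongation

/-! ### The kernel of the Engel structure, and the leaf space -/

/-- In adapted charts the map is the projection of a product; freezing the second factor at its
value at `x` gives the section. -/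
lemma exists_section_of_isSubmersionAt {E Q : Type*} [NormedAddCommGroup E] [NormedSpace ℝ E]
    [TopologicalSpace Q] [ChartedSpace E Q] [IsManifold 𝓘(ℝ, E) ∞ Q]
    {E' Q' : Type*} [NormedAddCommGroup E'] [NormedSpace ℝ E']
    [TopologicalSpace Q'] [ChartedSpace E' Q']
    [IsManifold 𝓘(ℝ, E') ∞ Q'] {f : Q → Q'} {x : Q}
    (h : Manifold.IsSubmersionAt 𝓘(ℝ, E) 𝓘(ℝ, E') ∞ f x) :
    ∃ s : Q' → Q, s (f x) = x ∧ ContMDiffAt 𝓘(ℝ, E') 𝓘(ℝ, E) ∞ s (f x) ∧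
      ∀ᶠ y in 𝓝 (f x), f (s y) = y := by
  have hw := h.writtenInCharts
  have hx := h.mem_domChart_source
  have hfx := h.mem_codChart_source
  set a := h.domChart
  set b := h.codChart
  set e := h.equiv
  have hxt : a x ∈ a.target := a.map_source hx
  have e0 : b (f x) = (e (a x)).1 := by
    have := hw (x := a x) (by simpa using hxt)
    simpa [a.left_inv hx] using this
  set r : Q' → E := fun y => e.symm (b y, (e (a x)).2) with hr
  have hr0 : r (f x) = a x := by
    rw [hr]
    simp only
    rw [e0, Prod.mk.eta, e.symm_apply_apply]
  have hrs : ContMDiffAt 𝓘(ℝ, E') 𝓘(ℝ, E) ∞ r (f x) := by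
    have h1 : ContMDiffAt 𝓘(ℝ, E') 𝓘(ℝ, E') ∞ b (f x) :=
      contMDiffAt_of_mem_maximalAtlas h.codChart_mem_maximalAtlas hfx
    have h2 : ContDiff ℝ ∞ (fun z : E' => e.symm (z, (e (a x)).2)) :=
      e.symm.contDiff.comp (contDiff_id.prodMk contDiff_const)
    exact h2.contMDiff.contMDiffAt.comp _ h1
  refine ⟨fun y => a.symm (r y), by change a.symm (r (f x)) = x; rw [hr0, a.left_inv hx], ?_, ?_⟩
  · refine ContMDiffAt.comp (g := a.symm) _ ?_ hrs
    rw [hr0]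
    exact contMDiffAt_symm_of_mem_maximalAtlas h.domChart_mem_maximalAtlas hxt
  · have h3 : ∀ᶠ y in 𝓝 (f x), r y ∈ a.target :=
      hrs.continuousAt.eventually (a.open_target.mem_nhds (by rwa [hr0]))
    filter_upwards [h3, b.open_source.mem_nhds hfx] with y h4 h5
    have h6 : f (a.symm (r y)) ∈ b.source :=
      h.source_subset_preimage_source (a.map_target h4)
    have h7 := hw (x := r y) (by simpa using h4)
    refine b.injOn h6 h5 ?_
    refine Eq.trans (by simpa using h7) (?_ : (e (r y)).1 = b y)
    simp [hr]

namespace CartanProlongation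

variable {N : Type*} [TopologicalSpace N] [ChartedSpace E3 N] [IsManifold (𝓡 3) ∞ N]
  {ξ : ContactStructure N}

namespace Frame

variable (f : Frame ξ)

/-- The coefficient of `dir` in a vector of the plane. -/
def dirCoeff (q : E3 × ℝ) : E3 →L[ℝ] ℝ := Real.cos q.2 • f.lam + Real.sin q.2 • f.mu

lemma dirCoeff_dir {q : E3 × ℝ} (hq : q.1 ∈ f.dom) : f.dirCoeff q (f.dir q) = 1 := by
  simp only [dirCoeff, add_apply, smul_apply, f.lam_dir hq, f.mu_dir hq, smul_eq_mul]
  linear_combination Real.sin_sq_add_cos_sq q.2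

lemma contDiff_dirCoeff : ContDiff ℝ ∞ f.dirCoeff :=
  ((Real.contDiff_cos.comp contDiff_snd).smul contDiff_const).add
    ((Real.contDiff_sin.comp contDiff_snd).smul contDiff_const)

/-- The horizontal parts are multiples `a dir` and `c dir`. In the bracket, the derivatives of `dir`
along `dir` cancel, and the derivative of `dir` in the angle is `dir'`. -/
lemma bracket_mem_plane_of_multiples {p : E3 × ℝ} (hp : p.1 ∈ f.dom) {Z W : E3 × ℝ → E3 × ℝ}
    (hZ : DifferentiableAt ℝ Z p) (hW : DifferentiableAt ℝ W p)
    (hZ1 : ∀ᶠ q in 𝓝 p, q.1 ∈ f.dom ∧ ∃ a : ℝ, (Z q).1 = a • f.dir q)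
    (hW1 : ∀ᶠ q in 𝓝 p, q.1 ∈ f.dom ∧ ∃ a : ℝ, (W q).1 = a • f.dir q) :
    ∃ a b : ℝ, (VectorField.lieBracket ℝ Z W p).1 = a • f.dir p + b • f.dir' p := by
  have hdir := ((f.contDiffAt_dir hp).differentiableAt (by simp)).hasFDerivAt
  have key : ∀ {Z : E3 × ℝ → E3 × ℝ}, DifferentiableAt ℝ Z p →
      (∀ᶠ q in 𝓝 p, q.1 ∈ f.dom ∧ ∃ a : ℝ, (Z q).1 = a • f.dir q) →
      ∃ (a : ℝ) (a' : E3 × ℝ →L[ℝ] ℝ), (Z p).1 = a • f.dir p ∧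
        ∀ δ, (fderiv ℝ Z p δ).1 = a • fderiv ℝ f.dir p δ + a' δ • f.dir p := by
    intro Z hZ h
    have ha : DifferentiableAt ℝ (fun q => f.dirCoeff q (Z q).1) p :=
      ((f.contDiff_dirCoeff.contDiffAt.differentiableAt (by simp)).clm_apply hZ.fst)
    have heq : ∀ᶠ q in 𝓝 p, (Z q).1 = f.dirCoeff q (Z q).1 • f.dir q := by
      filter_upwards [h] with q ⟨hq, a, hqa⟩
      rw [hqa, map_smul, f.dirCoeff_dir hq, smul_eq_mul, mul_one]
    refine ⟨_, fderiv ℝ (fun q => f.dirCoeff q (Z q).1) p, heq.self_of_nhds, fun δ => ?_⟩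
    have h1 : HasFDerivAt (fun q => (Z q).1) _ p :=
      (ha.hasFDerivAt.smul hdir).congr_of_eventuallyEq heq
    have h2 := h1.unique hZ.hasFDerivAt.fst
    have h3 := congrArg (fun T : E3 × ℝ →L[ℝ] E3 => T δ) h2
    exact h3.symm
  obtain ⟨a, a', ha, ha'⟩ := key hZ hZ1
  obtain ⟨c, c', hc, hc'⟩ := key hW hW1
  have hsplit : ∀ δ : E3 × ℝ, ∀ r : ℝ, δ.1 = r • f.dir p →
      fderiv ℝ f.dir p δ = r • fderiv ℝ f.dir p (f.dir p, 0) + δ.2 • f.dir' p := by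
    intro δ r h
    rw [← f.fderiv_dir_vertical hp, ← map_smul, ← map_smul, ← map_add]
    congr 1
    ext1 <;> simp [h]
  refine ⟨c' (Z p) - a' (W p), c * (Z p).2 - a * (W p).2, ?_⟩
  rw [VectorField.lieBracket_eq, Prod.fst_sub, hc', ha', hsplit _ _ ha, hsplit _ _ hc]
  module

/-- The contact plane depends on the base point only: differentiating `A = lam(A) V + mu(A) Y` in
the angle leaves `V` and `Y` fixed. -/
lemma fderiv_mem_plane_of_vertical {p : E3 × ℝ} (hp : p.1 ∈ f.dom) {A : E3 × ℝ → E3}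
    (hA : DifferentiableAt ℝ A p)
    (h : ∀ᶠ q in 𝓝 p, q.1 ∈ f.dom ∧ ∃ a b : ℝ, A q = a • f.dir q + b • f.dir' q) :
    ∃ a b : ℝ, fderiv ℝ A p (0, 1) = a • f.dir p + b • f.dir' p := by
  have heq : ∀ᶠ q in 𝓝 p, A q = f.lam (A q) • f.V q.1 + f.mu (A q) • f.Y q.1 := by
    filter_upwards [h] with q ⟨hq, h⟩
    obtain ⟨c, s, hcs⟩ := (exists_combination_iff_rotated q.2 (A q) (f.V q.1) (f.Y q.1)).2 h
    rw [hcs]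
    simp [f.lam_V _ hq, f.lam_Y _ hq, f.mu_V _ hq, f.mu_Y _ hq]
  refine (exists_combination_iff_rotated p.2 _ (f.V p.1) (f.Y p.1)).1
    ⟨f.lam (fderiv ℝ A p (0, 1)), f.mu (fderiv ℝ A p (0, 1)), ?_⟩
  have hV : HasFDerivAt (fun q : E3 × ℝ => f.V q.1) _ p :=
    HasFDerivAt.comp p ((f.contDiffAt_V hp).differentiableAt (by simp)).hasFDerivAt hasFDerivAt_fst
  have hY : HasFDerivAt (fun q : E3 × ℝ => f.Y q.1) _ p :=
    HasFDerivAt.comp p ((f.contDiffAt_Y hp).differentiableAt (by simp)).hasFDerivAt hasFDerivAt_fst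
  have h1 := (((f.lam.hasFDerivAt.comp p hA.hasFDerivAt).smul hV).add
    ((f.mu.hasFDerivAt.comp p hA.hasFDerivAt).smul hY)).congr_of_eventuallyEq heq
  have h2 := congrArg (fun T : E3 × ℝ →L[ℝ] E3 => T (0, 1)) (hA.hasFDerivAt.unique h1)
  refine h2.trans ?_
  simp

end Frame

/-- Brackets of sections stay in the lifted contact planes by `bracket_mem_plane_of_multiples`, and
the bracket of the vertical field with `dir` supplies the missing direction `dir'`. -/
lemma derivedDistribution_engel : derivedDistribution (engel ξ) = contactLift ξ := by
  funext u
  obtain ⟨f, p, hp, rfl⟩ := exists_frame_circ u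
  apply le_antisymm
  · refine sup_le (engel_le_contactLift _) (Submodule.span_le.2 ?_)
    rintro v ⟨X, Y, hX, hY, rfl⟩
    rw [← f.dcirc_lieBracket_coordField hp hX.contMDiffAt hY.contMDiffAt]
    refine (f.mem_contactLift_circ hp _).2 ?_
    refine f.bracket_mem_plane_of_multiples hp
      ((f.contDiffAt_coordField hp hX.contMDiffAt).differentiableAt (by simp))
      ((f.contDiffAt_coordField hp hY.contMDiffAt).differentiableAt (by simp)) ?_ ?_
    · filter_upwards [f.eventually_dcirc_coordField_mem hp hX] with q ⟨h1, h2⟩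
      exact ⟨h1, (f.mem_engel_circ h1 _).1 h2⟩
    · filter_upwards [f.eventually_dcirc_coordField_mem hp hY] with q ⟨h1, h2⟩
      exact ⟨h1, (f.mem_engel_circ h1 _).1 h2⟩
  · intro v hv
    obtain ⟨δ, rfl⟩ := f.dcirc_surjective hp v
    obtain ⟨a, b, hab⟩ := (f.mem_contactLift_circ hp δ).1 hv
    have e : δ = (a • f.dir p, δ.2) + b • ((f.dir' p, 0) : E3 × ℝ) := by
      ext1 <;> simp [hab]
    rw [e, map_add, map_smul]
    refine Submodule.add_mem_sup ((f.mem_engel_circ hp _).2 ⟨a, rfl⟩)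
      (Submodule.smul_mem _ _ (Submodule.subset_span ?_))
    have s1 : IsLocalSection (engel ξ) (f.pushField p.2 fun _ => (0, 1)) (f.circ p) :=
      f.isLocalSection_pushField (fun q _ => contDiffAt_const)
        (fun q hq => (f.mem_engel_circ hq _).2 ⟨0, by simp⟩) hp
    have s2 : IsLocalSection (engel ξ) (f.pushField p.2 fun q => (f.dir q, 0)) (f.circ p) :=
      f.isLocalSection_pushField (fun q hq => (f.contDiffAt_dir hq).prodMk contDiffAt_const)
        (fun q hq => (f.mem_engel_circ hq _).2 ⟨1, by simp⟩) hp
    refine ⟨_, _, s1, s2, ?_⟩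
    rw [← f.dcirc_lieBracket_coordField hp s1.contMDiffAt s2.contMDiffAt]
    congr 1
    rw [(f.coordField_pushField_eventuallyEq hp).lieBracket_vectorField_eq
      (f.coordField_pushField_eventuallyEq hp), VectorField.lieBracket_eq]
    have hd := ((f.contDiffAt_dir hp).differentiableAt (by simp)).hasFDerivAt
    have h3 := (hd.prodMk (hasFDerivAt_const (0 : ℝ) p)).fderiv
    change (f.dir' p, (0 : ℝ)) = fderiv ℝ (fun q => (f.dir q, (0 : ℝ))) p (0, 1) -
      fderiv ℝ (fun _ : E3 × ℝ => ((0, 1) : E3 × ℝ)) p (f.dir p, 0)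
    rw [h3]
    ext1 <;> simp [f.fderiv_dir_vertical hp]

/-- The bracket with the constant vertical field is the derivative in the angle, which preserves the
lifted contact planes. This inclusion is all that is needed of the kernel: the leaves, being
transverse to it, are never vertical. -/
lemma vertical_mem_engelKernel (f : Frame ξ) {p : E3 × ℝ} (hp : p.1 ∈ f.dom) :
    f.dcirc p (0, 1) ∈ engelKernel (engel ξ) (f.circ p) := by
  unfold engelKernel
  rw [derivedDistribution_engel]
  refine Submodule.subset_span ⟨f.pushField p.2 fun _ => (0, 1),
    f.isLocalSection_pushField (fun q _ => contDiffAt_const)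
      (fun q hq => (f.mem_contactLift_circ hq _).2 ⟨0, 0, by simp⟩) hp,
    f.pushField_circ hp (Frame.zero_mem_Ioo p) _, fun Y hY => ?_⟩
  have s1 : IsLocalSection (contactLift ξ) (f.pushField p.2 fun _ => (0, 1)) (f.circ p) :=
    f.isLocalSection_pushField (fun q _ => contDiffAt_const)
      (fun q hq => (f.mem_contactLift_circ hq _).2 ⟨0, 0, by simp⟩) hp
  rw [← f.dcirc_lieBracket_coordField hp s1.contMDiffAt hY.contMDiffAt]
  refine (f.mem_contactLift_circ hp _).2 ?_
  rw [(f.coordField_pushField_eventuallyEq hp).lieBracket_vectorField_eq EventuallyEq.rfl,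
    VectorField.lieBracket_eq]
  have hd := (f.contDiffAt_coordField hp hY.contMDiffAt).differentiableAt (by simp)
  have h1 := f.fderiv_mem_plane_of_vertical hp (A := fun q => (f.coordField Y q).1) hd.fst (by
    filter_upwards [f.eventually_dcirc_coordField_mem hp hY] with q ⟨h1, h2⟩
    exact ⟨h1, (f.mem_contactLift_circ h1 _).1 h2⟩)
  rw [hd.hasFDerivAt.fst.fderiv] at h1
  simpa using h1

end CartanProlongation

namespace OrientedCircleFoliation

variable {E H Q : Type*} [NormedAddCommGroup E] [NormedSpace ℝ E] [CompleteSpace E]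
  [TopologicalSpace H]
  {I : ModelWithCorners ℝ E H} [TopologicalSpace Q] [ChartedSpace H Q] [IsManifold I ∞ Q]
  [BoundarylessManifold I Q] [T2Space Q] (F : OrientedCircleFoliation Q I)

lemma leaf_eq_range {γ : ℝ → Q} (hγ : IsMIntegralCurve (I := I) γ F.field) (t : ℝ) :
    F.leaf (γ t) = range γ := by
  have : IsManifold I 1 Q := IsManifold.of_le (n := ∞) (by simp)
  ext w
  constructor
  · rintro ⟨δ, h0, hδ, s, rfl⟩
    have h1 : δ = fun s => γ (s + t) :=
      isMIntegralCurve_Ioo_eq_of_contMDiff_boundaryless (t₀ := 0) (F.smooth.of_le (by simp)) hδ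
        (hγ.comp_add t) (by simpa using h0)
    exact ⟨s + t, by rw [h1]⟩
  · rintro ⟨s, rfl⟩
    exact ⟨fun s => γ (s + t), by simp, hγ.comp_add t, s - t, by simp⟩

lemma mem_leaf_self (u : Q) : u ∈ F.leaf u := by
  obtain ⟨γ, h0, hγ, -⟩ := F.periodic u
  exact ⟨γ, h0, hγ, 0, h0⟩

lemma proj_eq_iff {u w : Q} : F.proj u = F.proj w ↔ F.leaf u = F.leaf w := Quotient.eq

lemma proj_integralCurve {γ : ℝ → Q} (hγ : IsMIntegralCurve (I := I) γ F.field) (s t : ℝ) :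
    F.proj (γ s) = F.proj (γ t) := by
  rw [proj_eq_iff, F.leaf_eq_range hγ, F.leaf_eq_range hγ]

lemma mem_leaf_iff {u w : Q} : w ∈ F.leaf u ↔ F.proj w = F.proj u := by
  constructor
  · rintro ⟨γ, rfl, hγ, t, rfl⟩
    exact F.proj_integralCurve hγ _ _
  · intro h
    rw [← F.proj_eq_iff.1 h]
    exact F.mem_leaf_self w

lemma mfderiv_proj_field [ChartedSpace E3 F.LeafSpace] {u : Q}
    (h : MDifferentiableAt I (𝓡 3) F.proj u) : mfderiv I (𝓡 3) F.proj u (F.field u) = 0 := by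
  obtain ⟨γ, h0, hγ, -⟩ := F.periodic u
  subst h0
  have h1 := h.hasMFDerivAt.comp (0 : ℝ) (hγ 0)
  have h2 : F.proj ∘ γ = fun _ => F.proj (γ 0) := by
    ext1 t
    exact F.proj_integralCurve hγ _ _
  rw [h2] at h1
  have h3 := hasMFDerivAt_unique h1 (hasMFDerivAt_const (F.proj (γ 0)) (0 : ℝ))
  have h4 := congrArg (fun T : ℝ →L[ℝ] E3 => T 1) h3
  refine Eq.trans ?_ h4
  change _ = mfderiv I (𝓡 3) F.proj (γ 0) ((1 : ℝ) • F.field (γ 0))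
  rw [one_smul]

end OrientedCircleFoliation

/-! ### Tangent vectors and bilinear forms in charts -/

section BilinearSections

variable {E H B F : Type*} [NormedAddCommGroup E] [NormedSpace ℝ E] [TopologicalSpace H]
  {I : ModelWithCorners ℝ E H} [TopologicalSpace B] [ChartedSpace H B]
  [NormedAddCommGroup F] [NormedSpace ℝ F] {V : B → Type*} [∀ x, AddCommGroup (V x)]
  [∀ x, Module ℝ (V x)] [TopologicalSpace (Bundle.TotalSpace F V)] [∀ x, TopologicalSpace (V x)]
  [FiberBundle F V] [VectorBundle ℝ F V] [∀ x, IsTopologicalAddGroup (V x)]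
  [∀ x, ContinuousSMul ℝ (V x)] [IsManifold I ∞ B] [ContMDiffVectorBundle ∞ F V I]

set_option synthInstance.maxHeartbeats 400000 in
lemma contMDiffAt_bilinear_section_iff {b : (x : B) → V x →L[ℝ] V x →L[ℝ] ℝ} {m₀ m : B}
    (hm : m ∈ (trivializationAt F V m₀).baseSet) :
    ContMDiffAt I (I.prod 𝓘(ℝ, F →L[ℝ] F →L[ℝ] ℝ)) ∞
      (fun x => Bundle.TotalSpace.mk' (F →L[ℝ] F →L[ℝ] ℝ) x (b x)) m ↔
    ContMDiffAt I 𝓘(ℝ, F →L[ℝ] F →L[ℝ] ℝ) ∞ (fun x =>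
      (trivializationAt (F →L[ℝ] F →L[ℝ] ℝ) (fun m : B => V m →L[ℝ] V m →L[ℝ] ℝ) m₀
        ⟨x, b x⟩).2) m :=
  Bundle.Trivialization.contMDiffAt_section_iff (F := F →L[ℝ] F →L[ℝ] ℝ)
    (E := fun m : B => V m →L[ℝ] V m →L[ℝ] ℝ) _ ⟨hm, hm, trivial⟩

lemma trivializationAt_bilinear_snd {b : (x : B) → V x →L[ℝ] V x →L[ℝ] ℝ} {m₀ m : B}
    (hm : m ∈ (trivializationAt F V m₀).baseSet) (v w : F) :
    (trivializationAt (F →L[ℝ] F →L[ℝ] ℝ) (fun m : B => V m →L[ℝ] V m →L[ℝ] ℝ) m₀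
        ⟨m, b m⟩).2 v w = b m ((trivializationAt F V m₀).symm m v)
          ((trivializationAt F V m₀).symm m w) := by
  rw [hom_trivializationAt_apply]
  refine (inCoordinates_apply_eq₂ (E₃ := fun _ : B => ℝ) hm hm (by simp)).trans ?_
  simp

end BilinearSections

section ChartCalculus

variable {M : Type*} [TopologicalSpace M] [ChartedSpace E3 M] [IsManifold (𝓡 3) ∞ M]

open CartanProlongation

/-- The components of a tangent vector in the chart at `m₀`. -/
def vecCoord (m₀ : M) (w : TangentBundle (𝓡 3) M) : E3 :=
  mfderiv (𝓡 3) 𝓘(ℝ, E3) (extChartAt (𝓡 3) m₀) w.1 w.2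

/-- The tangent vector with given components in the chart at `m₀`. -/
def vecOfCoord (m₀ : M) (z : E3 × E3) : TangentBundle (𝓡 3) M :=
  ⟨(extChartAt (𝓡 3) m₀).symm z.1, mfderiv 𝓘(ℝ, E3) (𝓡 3) (extChartAt (𝓡 3) m₀).symm z.1 z.2⟩

lemma mdifferentiableAt_ext {m₀ m : M} (hm : m ∈ (extChartAt (𝓡 3) m₀).source) :
    MDifferentiableAt (𝓡 3) 𝓘(ℝ, E3) (extChartAt (𝓡 3) m₀) m :=
  mdifferentiableAt_extChartAt (by simpa using hm)

lemma contMDiffAt_ext {m₀ m : M} (hm : m ∈ (extChartAt (𝓡 3) m₀).source) :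
    ContMDiffAt (𝓡 3) 𝓘(ℝ, E3) ∞ (extChartAt (𝓡 3) m₀) m :=
  contMDiffAt_extChartAt' (by simpa using hm)

lemma contMDiffAt_ext_symm {m₀ : M} {z : E3} (hz : z ∈ (extChartAt (𝓡 3) m₀).target) :
    ContMDiffAt 𝓘(ℝ, E3) (𝓡 3) ∞ (extChartAt (𝓡 3) m₀).symm z :=
  (contMDiffOn_extChartAt_symm m₀).contMDiffAt ((isOpen_extChartAt_target m₀).mem_nhds hz)

lemma mfderiv_ext_symm {m₀ : M} {z : E3} (hz : z ∈ (extChartAt (𝓡 3) m₀).target) (v : E3) :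
    (mfderiv (𝓡 3) 𝓘(ℝ, E3) (extChartAt (𝓡 3) m₀) ((extChartAt (𝓡 3) m₀).symm z)
      (mfderiv 𝓘(ℝ, E3) (𝓡 3) (extChartAt (𝓡 3) m₀).symm z v) : E3) = v := by
  have h1 := (mdifferentiableAt_ext ((extChartAt (𝓡 3) m₀).map_target hz)).hasMFDerivAt.comp z
    ((contMDiffAt_ext_symm hz).mdifferentiableAt (by simp)).hasMFDerivAt
  have h2 : extChartAt (𝓡 3) m₀ ∘ (extChartAt (𝓡 3) m₀).symm =ᶠ[𝓝 z] id := by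
    filter_upwards [(isOpen_extChartAt_target m₀).mem_nhds hz] with y hy
    exact (extChartAt (𝓡 3) m₀).right_inv hy
  have h3 := hasMFDerivAt_unique h1 ((hasMFDerivAt_id (I := 𝓘(ℝ, E3)) z).congr_of_eventuallyEq h2)
  exact congrArg (fun T : E3 →L[ℝ] E3 => T v) h3

lemma mfderiv_ext_injective {m₀ m : M} (hm : m ∈ (extChartAt (𝓡 3) m₀).source) :
    Function.Injective (mfderiv (𝓡 3) 𝓘(ℝ, E3) (extChartAt (𝓡 3) m₀) m) := by
  intro v w h
  rw [mfderiv_ext_eq hm] at h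
  exact (tcc_left hm v).symm.trans ((congrArg _ h).trans (tcc_left hm w))

lemma vecCoord_vecOfCoord {m₀ : M} {z : E3 × E3} (hz : z.1 ∈ (extChartAt (𝓡 3) m₀).target) :
    vecCoord m₀ (vecOfCoord m₀ z) = z.2 := mfderiv_ext_symm hz _

lemma tangent_ext {m₀ : M} {v w : TangentBundle (𝓡 3) M}
    (hv : v.1 ∈ (extChartAt (𝓡 3) m₀).source) (h1 : v.1 = w.1)
    (h2 : vecCoord m₀ v = vecCoord m₀ w) : v = w := by
  obtain ⟨m, v⟩ := v
  obtain ⟨m', w⟩ := w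
  dsimp only at h1 hv
  subst h1
  have h3 : v = w := mfderiv_ext_injective hv h2
  rw [h3]

lemma vecOfCoord_vecCoord {m₀ : M} {w : TangentBundle (𝓡 3) M}
    (hw : w.1 ∈ (extChartAt (𝓡 3) m₀).source) :
    vecOfCoord m₀ (extChartAt (𝓡 3) m₀ w.1, vecCoord m₀ w) = w := by
  have ht := (extChartAt (𝓡 3) m₀).map_source hw
  refine tangent_ext (m₀ := m₀) ?_ ?_ (vecCoord_vecOfCoord ht)
  · exact (extChartAt (𝓡 3) m₀).map_target ht
  · exact (extChartAt (𝓡 3) m₀).left_inv hw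

lemma trivializationAt_tangent_snd {m₀ : M} {w : TangentBundle (𝓡 3) M}
    (hw : w.1 ∈ (extChartAt (𝓡 3) m₀).source) :
    (trivializationAt E3 (TangentSpace (𝓡 3)) m₀ w).2 = vecCoord m₀ w := by
  unfold vecCoord
  rw [mfderiv_ext_eq hw]
  rfl

lemma contMDiffAt_tangentBundle_iff {E' H' X : Type*} [NormedAddCommGroup E'] [NormedSpace ℝ E']
    [TopologicalSpace H'] {I' : ModelWithCorners ℝ E' H'} [TopologicalSpace X] [ChartedSpace H' X]
    {c : X → TangentBundle (𝓡 3) M} {x : X} {m₀ : M}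
    (hx : (c x).1 ∈ (extChartAt (𝓡 3) m₀).source) :
    ContMDiffAt I' (𝓡 3).tangent ∞ c x ↔ ContMDiffAt I' (𝓡 3) ∞ (fun y => (c y).1) x ∧
      ContMDiffAt I' 𝓘(ℝ, E3) ∞ (fun y => vecCoord m₀ (c y)) x := by
  have he : c x ∈ (trivializationAt E3 (TangentSpace (𝓡 3) : M → Type _) m₀).source := by
    rw [Bundle.Trivialization.mem_source]
    simpa using hx
  rw [(trivializationAt E3 (TangentSpace (𝓡 3) : M → Type _) m₀).contMDiffAt_iff he]
  refine and_congr_right fun h => ?_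
  have h1 : ∀ᶠ y in 𝓝 x, (c y).1 ∈ (extChartAt (𝓡 3) m₀).source :=
    h.continuousAt.eventually ((isOpen_extChartAt_source m₀).mem_nhds hx)
  refine EventuallyEq.contMDiffAt_iff ?_
  filter_upwards [h1] with y hy using trivializationAt_tangent_snd hy

lemma contMDiffAt_vecCoord {m₀ : M} {w : TangentBundle (𝓡 3) M}
    (hw : w.1 ∈ (extChartAt (𝓡 3) m₀).source) :
    ContMDiffAt (𝓡 3).tangent 𝓘(ℝ, E3) ∞ (vecCoord m₀) w :=
  ((contMDiffAt_tangentBundle_iff (I' := (𝓡 3).tangent) (c := id) hw).1 contMDiffAt_id).2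

lemma contMDiffAt_tangent_proj (w : TangentBundle (𝓡 3) M) :
    ContMDiffAt (𝓡 3).tangent (𝓡 3) ∞ (fun w : TangentBundle (𝓡 3) M => w.1) w :=
  Bundle.contMDiff_proj (TangentSpace (𝓡 3)) w

lemma contMDiffAt_vecOfCoord {m₀ : M} {z : E3 × E3} (hz : z.1 ∈ (extChartAt (𝓡 3) m₀).target) :
    ContMDiffAt 𝓘(ℝ, E3 × E3) (𝓡 3).tangent ∞ (vecOfCoord m₀) z := by
  refine (contMDiffAt_tangentBundle_iff (m₀ := m₀) ((extChartAt (𝓡 3) m₀).map_target hz)).2 ⟨?_, ?_⟩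
  · exact (contMDiffAt_ext_symm hz).comp z (contDiffAt_fst (𝕜 := ℝ)).contMDiffAt
  · refine (contDiffAt_snd (𝕜 := ℝ)).contMDiffAt.congr_of_eventuallyEq (f := fun z : E3 × E3 => z.2) ?_
    have : ∀ᶠ y : E3 × E3 in 𝓝 z, y.1 ∈ (extChartAt (𝓡 3) m₀).target :=
      continuousAt_fst.eventually ((isOpen_extChartAt_target m₀).mem_nhds hz)
    filter_upwards [this] with y hy using vecCoord_vecOfCoord hy

/-- A field of bilinear forms on `M` in the chart at `m₀`. -/
def coordForm (b : (m : M) → TangentSpace (𝓡 3) m →L[ℝ] TangentSpace (𝓡 3) m →L[ℝ] ℝ) (m₀ : M)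
    (z : E3) : E3 →L[ℝ] E3 →L[ℝ] ℝ :=
  let D : E3 →L[ℝ] E3 := mfderiv 𝓘(ℝ, E3) (𝓡 3) (extChartAt (𝓡 3) m₀).symm z
  let B : E3 →L[ℝ] E3 →L[ℝ] ℝ := b ((extChartAt (𝓡 3) m₀).symm z)
  B.bilinearComp D D

variable {b : (m : M) → TangentSpace (𝓡 3) m →L[ℝ] TangentSpace (𝓡 3) m →L[ℝ] ℝ}

lemma coordForm_ext {m₀ m : M} (hm : m ∈ (extChartAt (𝓡 3) m₀).source)
    (v w : TangentSpace (𝓡 3) m) :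
    coordForm b m₀ (extChartAt (𝓡 3) m₀ m) (vecCoord m₀ ⟨m, v⟩) (vecCoord m₀ ⟨m, w⟩) = b m v w := by
  have h1 := vecOfCoord_vecCoord (m₀ := m₀) (w := ⟨m, v⟩) hm
  have h2 := vecOfCoord_vecCoord (m₀ := m₀) (w := ⟨m, w⟩) hm
  have key : ∀ (x y : TangentBundle (𝓡 3) M) (hxy : y.1 = x.1) (h1 : x = ⟨m, v⟩) (h2 : y = ⟨m, w⟩),
      b x.1 x.2 (hxy ▸ y.2) = b m v w := by
    rintro _ _ hxy rfl rfl
    rfl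
  exact key (vecOfCoord m₀ (extChartAt (𝓡 3) m₀ m, vecCoord m₀ ⟨m, v⟩))
    (vecOfCoord m₀ (extChartAt (𝓡 3) m₀ m, vecCoord m₀ ⟨m, w⟩)) rfl h1 h2

lemma isLorentzForm_coordForm {m₀ : M} {z : E3} (hz : z ∈ (extChartAt (𝓡 3) m₀).target)
    (h : IsLorentzForm fun v w => b ((extChartAt (𝓡 3) m₀).symm z) v w) :
    IsLorentzForm fun v w => coordForm b m₀ z v w := by
  obtain ⟨hs, T, hT, hpos⟩ := h
  have hm := (extChartAt (𝓡 3) m₀).map_target hz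
  have e : ∀ v w : TangentSpace (𝓡 3) ((extChartAt (𝓡 3) m₀).symm z),
      coordForm b m₀ z (vecCoord m₀ ⟨_, v⟩) (vecCoord m₀ ⟨_, w⟩) = b _ v w := by
    intro v w
    have := coordForm_ext (b := b) hm v w
    rwa [(extChartAt (𝓡 3) m₀).right_inv hz] at this
  refine ⟨fun v w => hs _ _, vecCoord m₀ ⟨_, T⟩, by simpa only [e] using hT, fun v hv hv0 => ?_⟩
  have ev : vecCoord m₀ (vecOfCoord m₀ (z, v)) = v := vecCoord_vecOfCoord hz
  rw [← ev] at hv ⊢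
  have hv' := (e T (vecOfCoord m₀ (z, v)).2).symm.trans hv
  refine (hpos _ hv' ?_).trans_eq (e _ _).symm
  intro h0
  apply hv0
  rw [← ev]
  exact (congrArg (mfderiv (𝓡 3) 𝓘(ℝ, E3) (extChartAt (𝓡 3) m₀)
    ((extChartAt (𝓡 3) m₀).symm z)) h0).trans (map_zero _)

lemma vecCoord_smul (m₀ m : M) (s : ℝ) (v : TangentSpace (𝓡 3) m) :
    vecCoord m₀ ⟨m, s • v⟩ = s • vecCoord m₀ ⟨m, v⟩ :=
  (mfderiv (𝓡 3) 𝓘(ℝ, E3) (extChartAt (𝓡 3) m₀) m).map_smul s v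

lemma vecCoord_ne_zero {m₀ m : M} (hm : m ∈ (extChartAt (𝓡 3) m₀).source)
    {v : TangentSpace (𝓡 3) m} (hv : v ≠ 0) : vecCoord m₀ ⟨m, v⟩ ≠ 0 := fun h =>
  hv (mfderiv_ext_injective hm (h.trans (map_zero _).symm))

lemma trivializationAt_hom_snd {m₀ m : M} (hm : m ∈ (extChartAt (𝓡 3) m₀).source) :
    (trivializationAt (E3 →L[ℝ] E3 →L[ℝ] ℝ)
      (fun m : M => TangentSpace (𝓡 3) m →L[ℝ] TangentSpace (𝓡 3) m →L[ℝ] ℝ) m₀ ⟨m, b m⟩).2 =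
      coordForm b m₀ (extChartAt (𝓡 3) m₀ m) := by
  have hm' : m ∈ (chartAt E3 m₀).source := by simpa using hm
  ext v w
  have hbase : m ∈ (trivializationAt E3 (TangentSpace (𝓡 3) : M → Type _) m₀).baseSet := by
    simpa using hm'
  refine (trivializationAt_bilinear_snd (F := E3) (V := fun m : M => TangentSpace (𝓡 3) m) (b := b) hbase v w).trans ?_
  have hs : ∀ v : E3, (trivializationAt E3 (TangentSpace (𝓡 3) : M → Type _) m₀).symm m v =
      (tangentCoordChange (𝓡 3) m₀ m m v : E3) := by
    intro v
    refine (Bundle.Trivialization.symmL_apply (R := ℝ) _ hbase v).symm.trans ?_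
    exact congrArg (fun T : E3 →L[ℝ] E3 => T v)
      (TangentBundle.symmL_trivializationAt_eq_core (I := 𝓡 3) hm')
  have hv : ∀ v : E3, vecCoord m₀ ⟨m, (tangentCoordChange (𝓡 3) m₀ m m v : E3)⟩ = v := by
    intro v
    unfold vecCoord
    rw [mfderiv_ext_eq hm]
    exact tcc_right hm v
  rw [hs, hs]
  have h3 := coordForm_ext (b := b) hm (tangentCoordChange (𝓡 3) m₀ m m v : E3)
    (tangentCoordChange (𝓡 3) m₀ m m w : E3)
  rw [hv, hv] at h3
  exact h3.symm

lemma contMDiffAt_form_iff {m₀ m : M} (hm : m ∈ (extChartAt (𝓡 3) m₀).source) :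
    ContMDiffAt (𝓡 3) ((𝓡 3).prod 𝓘(ℝ, E3 →L[ℝ] E3 →L[ℝ] ℝ)) ∞
      (fun x => Bundle.TotalSpace.mk' (E3 →L[ℝ] E3 →L[ℝ] ℝ) x (b x)) m ↔
    ContDiffAt ℝ ∞ (coordForm b m₀) (extChartAt (𝓡 3) m₀ m) := by
  have hbase : m ∈ (trivializationAt E3 (TangentSpace (𝓡 3) : M → Type _) m₀).baseSet := by
    simpa using hm
  rw [contMDiffAt_bilinear_section_iff (F := E3) (V := fun m : M => TangentSpace (𝓡 3) m) (b := b) hbase]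
  have h1 : ∀ᶠ x in 𝓝 m, x ∈ (extChartAt (𝓡 3) m₀).source :=
    (isOpen_extChartAt_source m₀).mem_nhds hm
  have ht := (extChartAt (𝓡 3) m₀).map_source hm
  have e : (fun x => (trivializationAt (E3 →L[ℝ] E3 →L[ℝ] ℝ)
      (fun m : M => TangentSpace (𝓡 3) m →L[ℝ] TangentSpace (𝓡 3) m →L[ℝ] ℝ) m₀ ⟨x, b x⟩).2) =ᶠ[𝓝 m]
      fun x => coordForm b m₀ (extChartAt (𝓡 3) m₀ x) := by
    filter_upwards [h1] with x hx using trivializationAt_hom_snd hx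
  rw [e.contMDiffAt_iff, ← contMDiffAt_iff_contDiffAt]
  constructor
  · intro h
    have h2 : ContMDiffAt 𝓘(ℝ, E3) (𝓡 3) ∞ (extChartAt (𝓡 3) m₀).symm (extChartAt (𝓡 3) m₀ m) :=
      contMDiffAt_ext_symm ht
    have h3 := ContMDiffAt.comp_of_eq h h2 ((extChartAt (𝓡 3) m₀).left_inv hm)
    refine h3.congr_of_eventuallyEq ?_
    filter_upwards [(isOpen_extChartAt_target m₀).mem_nhds ht] with z hz
    change _ = coordForm b m₀ (extChartAt (𝓡 3) m₀ ((extChartAt (𝓡 3) m₀).symm z))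
    rw [(extChartAt (𝓡 3) m₀).right_inv hz]
  · intro h
    exact ContMDiffAt.comp m h (contMDiffAt_ext hm)

end ChartCalculus

/-! ### The parametrisation of the leaf space by polar coordinates -/

open CartanProlongation

variable {N : Type*} [TopologicalSpace N] [ChartedSpace E3 N] [IsManifold (𝓡 3) ∞ N]
  {ξ : ContactStructure N}

/-- The hypotheses on the foliation of the Cartan prolongation: it is transverse to the kernel of
the Engel structure inside it, its leaf space is a quotient manifold, and the Engel structure
projects to quadratic cones, injectively on each leaf. -/
structure IsNullFibration (F : OrientedCircleFoliation (CartanProlongation ξ) 𝓘(ℝ, E3 × ℝ))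
    [ChartedSpace E3 F.LeafSpace] [IsManifold (𝓡 3) ∞ F.LeafSpace] : Prop where
  splits : ∀ u, Disjoint (F.tangent u) (engelKernel (engel ξ) u) ∧
      F.tangent u ⊔ engelKernel (engel ξ) u = engel ξ u
  submersion : Manifold.IsSubmersion 𝓘(ℝ, E3 × ℝ) (𝓡 3) ∞ F.proj
  cone : ∀ m, IsCone (pushforwardFibre (engel ξ) F.proj m)
  injective : ∀ u, InjOn (pushforward (engel ξ) F.proj) (F.leaf u)

section Param

variable (F : OrientedCircleFoliation (CartanProlongation ξ) 𝓘(ℝ, E3 × ℝ)) (f : Frame ξ)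

/-- The projection to the leaf space in polar coordinates. -/
def param (q : E3 × ℝ) : F.LeafSpace := F.proj (f.circ q)

/-- The vector field `(dir, -slope)` is tangent to the leaves in polar coordinates. -/
def slope (q : E3 × ℝ) : ℝ :=
  -(f.coordField F.field q).2 / f.dirCoeff q (f.coordField F.field q).1

/-- The direction of the leaves in polar coordinates. -/
def leafDir (q : E3 × ℝ) : E3 × ℝ := (f.dir q, -slope F f q)

variable [ChartedSpace E3 F.LeafSpace]

/-- The differential of `param`. -/
def dparam (q : E3 × ℝ) : E3 × ℝ →L[ℝ] TangentSpace (𝓡 3) (param F f q) :=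
  mfderiv 𝓘(ℝ, E3 × ℝ) (𝓡 3) (param F f) q

/-- The derivative of `param` in the angle. -/
def nullVec (q : E3 × ℝ) : TangentBundle (𝓡 3) F.LeafSpace := ⟨param F f q, dparam F f q (0, 1)⟩

/-- The projection to the leaf space in polar coordinates and a chart. -/
def paramCoord (m₀ : F.LeafSpace) (q : E3 × ℝ) : E3 := extChartAt (𝓡 3) m₀ (param F f q)

variable [IsManifold (𝓡 3) ∞ F.LeafSpace]

namespace IsNullFibration

variable {F} (hF : IsNullFibration F) {q : E3 × ℝ}

include hF

lemma contMDiff_proj : ContMDiff 𝓘(ℝ, E3 × ℝ) (𝓡 3) ∞ F.proj := hF.submersion.contMDiff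

lemma mdifferentiableAt_proj (u : CartanProlongation ξ) :
    MDifferentiableAt 𝓘(ℝ, E3 × ℝ) (𝓡 3) F.proj u :=
  (hF.contMDiff_proj u).mdifferentiableAt (by simp)

lemma contMDiffAt_param (hq : q.1 ∈ f.dom) :
    ContMDiffAt 𝓘(ℝ, E3 × ℝ) (𝓡 3) ∞ (param F f) q :=
  (hF.contMDiff_proj _).comp q (f.contMDiffAt_circ hq)

lemma hasMFDerivAt_param (hq : q.1 ∈ f.dom) :
    HasMFDerivAt 𝓘(ℝ, E3 × ℝ) (𝓡 3) (param F f) q (dparam F f q) :=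
  ((hF.contMDiffAt_param f hq).mdifferentiableAt (by simp)).hasMFDerivAt

lemma dparam_apply (hq : q.1 ∈ f.dom) (δ : E3 × ℝ) : dparam F f q δ =
    mfderiv 𝓘(ℝ, E3 × ℝ) (𝓡 3) F.proj (f.circ q) (f.dcirc q δ) := by
  have h1 := (hF.mdifferentiableAt_proj _).hasMFDerivAt.comp q (f.hasMFDerivAt_circ hq)
  have h2 := hasMFDerivAt_unique (hF.hasMFDerivAt_param f hq) h1
  exact congrArg (fun T : E3 × ℝ →L[ℝ] E3 => T δ) h2

lemma mfderiv_proj_surjective (u : CartanProlongation ξ) :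
    Function.Surjective (mfderiv 𝓘(ℝ, E3 × ℝ) (𝓡 3) F.proj u) := by
  obtain ⟨s, h0, hs, h1⟩ := exists_section_of_isSubmersionAt (hF.submersion.isSubmersionAt u)
  have h2 : HasMFDerivAt (𝓡 3) (𝓡 3) (F.proj ∘ s) (F.proj u) _ :=
    HasMFDerivAt.comp (F.proj u) (I' := 𝓘(ℝ, E3 × ℝ)) (g := F.proj)
      (g' := mfderiv 𝓘(ℝ, E3 × ℝ) (𝓡 3) F.proj u)
      (by rw [h0]; exact (hF.mdifferentiableAt_proj u).hasMFDerivAt)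
      (hs.mdifferentiableAt (by simp)).hasMFDerivAt
  have h3 := hasMFDerivAt_unique h2
    ((hasMFDerivAt_id (I := 𝓡 3) (F.proj u)).congr_of_eventuallyEq h1)
  intro w
  exact ⟨_, congrArg (fun T : E3 →L[ℝ] E3 => T w) h3⟩

lemma dparam_surjective (hq : q.1 ∈ f.dom) : Function.Surjective (dparam F f q) := by
  intro w
  obtain ⟨v, hv⟩ := hF.mfderiv_proj_surjective (f.circ q) w
  obtain ⟨δ, rfl⟩ := f.dcirc_surjective hq v
  exact ⟨δ, (hF.dparam_apply f hq δ).trans hv⟩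

/-- The leaf direction lies in the Engel plane, so its horizontal part is a multiple of `dir`. A
zero coefficient would make it vertical, hence an element of the kernel, against the transversality
in i). -/
lemma coordField_field (hq : q.1 ∈ f.dom) : f.dirCoeff q (f.coordField F.field q).1 ≠ 0 ∧
    (f.coordField F.field q).1 = f.dirCoeff q (f.coordField F.field q).1 • f.dir q := by
  have h1 : F.field (f.circ q) ∈ engel ξ (f.circ q) := by
    rw [← (hF.splits (f.circ q)).2]
    exact Submodule.mem_sup_left (Submodule.mem_span_singleton_self _)
  rw [← f.dcirc_coordField (X := F.field) hq] at h1
  obtain ⟨a, ha⟩ := (f.mem_engel_circ hq _).1 h1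
  rw [ha, map_smul, f.dirCoeff_dir hq, smul_eq_mul, mul_one]
  refine ⟨?_, rfl⟩
  rintro rfl
  have h2 : f.coordField F.field q = (f.coordField F.field q).2 • ((0, 1) : E3 × ℝ) := by
    ext1 <;> simp [ha]
  have h3 : F.field (f.circ q) ∈ engelKernel (engel ξ) (f.circ q) := by
    rw [← f.dcirc_coordField (X := F.field) hq, h2, map_smul]
    exact Submodule.smul_mem _ _ (vertical_mem_engelKernel f hq)
  exact F.ne_zero _ (Submodule.disjoint_def.1 (hF.splits (f.circ q)).1 _
    (Submodule.mem_span_singleton_self _) h3)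

lemma coordField_field_eq (hq : q.1 ∈ f.dom) : f.coordField F.field q =
    f.dirCoeff q (f.coordField F.field q).1 • leafDir F f q := by
  obtain ⟨h1, h2⟩ := hF.coordField_field f hq
  ext1
  · exact h2
  · simp only [leafDir, slope, Prod.smul_mk, smul_eq_mul]
    field_simp

variable [T2Space N]

lemma dparam_leafDir (hq : q.1 ∈ f.dom) : dparam F f q (leafDir F f q) = 0 := by
  have h1 := F.mfderiv_proj_field (hF.mdifferentiableAt_proj (f.circ q))
  rw [← f.dcirc_coordField (X := F.field) hq] at h1
  have h2 := (hF.dparam_apply f hq (f.coordField F.field q)).trans h1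
  rw [hF.coordField_field_eq f hq, map_smul] at h2
  exact (smul_eq_zero.1 h2).resolve_left (hF.coordField_field f hq).1

lemma leafDir_ne_zero (hq : q.1 ∈ f.dom) : leafDir F f q ≠ 0 := fun h =>
  f.dir_ne_zero hq (congrArg Prod.fst h)

/-- The kernel of the differential of a submersion from dimension four to dimension three is a line.
-/
lemma exists_smul_leafDir (hq : q.1 ∈ f.dom) {δ : E3 × ℝ} (h : dparam F f q δ = 0) :
    ∃ c : ℝ, δ = c • leafDir F f q := by
  let T : E3 × ℝ →ₗ[ℝ] E3 := (dparam F f q).toLinearMap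
  have hsurj : Function.Surjective T := hF.dparam_surjective f hq
  have h1 := T.finrank_range_add_finrank_ker
  rw [LinearMap.range_eq_top.2 hsurj, finrank_top] at h1
  have h2 : Module.finrank ℝ (E3 × ℝ) = 4 := by simp
  have h3 : Module.finrank ℝ E3 = 3 := by simp
  have h4 : Module.finrank ℝ (LinearMap.ker T) = 1 := by omega
  have h5 : leafDir F f q ∈ LinearMap.ker T := hF.dparam_leafDir f hq
  obtain ⟨c, hc⟩ := (finrank_eq_one_iff_of_nonzero' (⟨_, h5⟩ : LinearMap.ker T)
    (by simpa [Subtype.ext_iff] using hF.leafDir_ne_zero f hq)).1 h4 ⟨δ, h⟩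
  exact ⟨c, (congrArg Subtype.val hc).symm⟩

lemma dparam_vertical_ne_zero (hq : q.1 ∈ f.dom) : dparam F f q (0, 1) ≠ 0 := by
  intro h
  obtain ⟨c, hc⟩ := hF.exists_smul_leafDir f hq h
  have h1 : (0 : E3) = c • f.dir q := congrArg Prod.fst hc
  have h2 : (1 : ℝ) = c • (-slope F f q) := congrArg Prod.snd hc
  have hc0 := (smul_eq_zero.1 h1.symm).resolve_right (f.dir_ne_zero hq)
  rw [hc0] at h2
  simp at h2

/-- Modulo the leaf direction every vector of the Engel plane is vertical. Hence `p_* D` is the line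
of the null vector, as recorded in `mem_pushforward_circ`. -/
lemma dparam_dir (hq : q.1 ∈ f.dom) (a s : ℝ) : dparam F f q (a • f.dir q, s) =
    (s + a * slope F f q) • dparam F f q (0, 1) := by
  have e : ((a • f.dir q, s) : E3 × ℝ) = a • leafDir F f q +
      (s + a * slope F f q) • ((0, 1) : E3 × ℝ) := by
    ext1 <;> simp [leafDir]
  rw [e, map_add, map_smul, map_smul, hF.dparam_leafDir f hq, smul_zero, zero_add]

lemma mem_pushforward_circ (hq : q.1 ∈ f.dom) {w : TangentBundle (𝓡 3) F.LeafSpace} :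
    w ∈ pushforward (engel ξ) F.proj (f.circ q) ↔
      ∃ s : ℝ, w = ⟨param F f q, s • dparam F f q (0, 1)⟩ := by
  constructor
  · rintro ⟨d, hd, rfl⟩
    obtain ⟨δ, rfl⟩ := f.dcirc_surjective hq d
    obtain ⟨a, ha⟩ := (f.mem_engel_circ hq δ).1 hd
    refine ⟨δ.2 + a * slope F f q, ?_⟩
    have h1 := hF.dparam_dir f hq a δ.2
    rw [← ha] at h1
    rw [← h1]
    exact congrArg (fun z : TangentSpace (𝓡 3) (param F f q) =>
      (⟨param F f q, z⟩ : TangentBundle (𝓡 3) F.LeafSpace)) (hF.dparam_apply f hq δ).symm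
  · rintro ⟨s, rfl⟩
    refine ⟨f.dcirc q (0, s), (f.mem_engel_circ hq _).2 ⟨0, by simp⟩, ?_⟩
    have h1 : dparam F f q (0, s) = s • dparam F f q (0, 1) := by
      rw [← map_smul]
      simp
    rw [← h1]
    exact congrArg (fun z : TangentSpace (𝓡 3) (param F f q) =>
      (⟨param F f q, z⟩ : TangentBundle (𝓡 3) F.LeafSpace)) (hF.dparam_apply f hq _).symm

lemma mem_pushforwardFibre_param (hq : q.1 ∈ f.dom) (s : ℝ) :
    s • dparam F f q (0, 1) ∈ pushforwardFibre (engel ξ) F.proj (param F f q) :=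
  ⟨f.circ q, rfl, (hF.mem_pushforward_circ f hq).2 ⟨s, rfl⟩⟩

/-- Proportional nonzero null vectors span the same line `p_* D`, and the injectivity in iii) then
identifies the two points of the leaf. -/
lemma circ_eq_of_nullVec_eq {f f' : Frame ξ} {q q' : E3 × ℝ} (hq : q.1 ∈ f.dom) (hq' : q'.1 ∈ f'.dom)
    {s : ℝ} (h : nullVec F f q = ⟨param F f' q', s • dparam F f' q' (0, 1)⟩) :
    f.circ q = f'.circ q' := by
  have hp : param F f q = param F f' q' := congrArg (fun w => w.1) h
  have hs : s ≠ 0 := by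
    rintro rfl
    have h1 := hF.dparam_vertical_ne_zero f hq
    rw [zero_smul] at h
    have key : ∀ (w : TangentBundle (𝓡 3) F.LeafSpace) (m : F.LeafSpace), w = ⟨m, 0⟩ → w.2 = 0 := by
      rintro _ m rfl
      rfl
    exact h1 (key _ _ h)
  refine hF.injective (f.circ q) (F.mem_leaf_self _) (F.mem_leaf_iff.2 hp.symm) ?_
  have key : ∀ (m m' : F.LeafSpace) (v : TangentSpace (𝓡 3) m) (v' : TangentSpace (𝓡 3) m'),
      (⟨m, v⟩ : TangentBundle (𝓡 3) F.LeafSpace) = ⟨m', v'⟩ → ∀ r : ℝ,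
      (⟨m, r • v⟩ : TangentBundle (𝓡 3) F.LeafSpace) = ⟨m', r • v'⟩ := by
    intro m m' v v' h r
    cases h
    rfl
  ext w
  rw [hF.mem_pushforward_circ f hq, hF.mem_pushforward_circ f' hq']
  constructor
  · rintro ⟨r, rfl⟩
    exact ⟨r * s, by rw [key _ _ _ _ h r, smul_smul]⟩
  · rintro ⟨r, rfl⟩
    refine ⟨r / s, ?_⟩
    rw [key _ _ _ _ h (r / s), smul_smul, div_mul_cancel₀ _ hs]

lemma exists_of_mem_pushforwardFibre {m : F.LeafSpace} {v : TangentSpace (𝓡 3) m}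
    (h : v ∈ pushforwardFibre (engel ξ) F.proj m) : ∃ (f : Frame ξ) (q : E3 × ℝ) (s : ℝ),
      q.1 ∈ f.dom ∧ (⟨m, v⟩ : TangentBundle (𝓡 3) F.LeafSpace) =
        ⟨param F f q, s • dparam F f q (0, 1)⟩ := by
  obtain ⟨u, -, hu⟩ := h
  obtain ⟨f, q, hq, rfl⟩ := exists_frame_circ u
  obtain ⟨s, hs⟩ := (hF.mem_pushforward_circ f hq).1 hu
  exact ⟨f, q, s, hq, hs⟩

end IsNullFibration

end Param

/-! ### Coordinate form of the parametrisation, and forms with prescribed null cones -/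

open CartanProlongation

/-- By nondegeneracy `k^⊥` is a plane, and `k`, `w` are independent in it. -/
lemma IsLorentzForm.exists_combination {b : E3 →L[ℝ] E3 →L[ℝ] ℝ}
    (hb : IsLorentzForm fun v w => b v w) {k w x : E3} (hk : b k k = 0) (hk0 : k ≠ 0)
    (hkw : b k w = 0) (hw : ∀ c : ℝ, w ≠ c • k) (hkx : b k x = 0) :
    ∃ c d : ℝ, x = c • k + d • w := by
  have hbk : (b k : E3 →ₗ[ℝ] ℝ) ≠ 0 := by
    intro h
    exact hk0 (hb.eq_zero_of_forall fun z => congrArg (fun T : E3 →ₗ[ℝ] ℝ => T z) h)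
  have h1 : Module.finrank ℝ (LinearMap.ker (b k : E3 →ₗ[ℝ] ℝ)) = 2 := by
    have h2 := LinearMap.finrank_range_add_finrank_ker (b k : E3 →ₗ[ℝ] ℝ)
    rw [LinearMap.range_eq_top.2 (LinearMap.surjective hbk), finrank_top] at h2
    simp at h2
    omega
  set K := LinearMap.ker (b k : E3 →ₗ[ℝ] ℝ)
  have hli : LinearIndependent ℝ ![(⟨k, hk⟩ : K), ⟨w, hkw⟩] := by
    rw [LinearIndependent.pair_iff]
    intro s t h
    have h' : s • k + t • w = 0 := congrArg Subtype.val h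
    have ht : t = 0 := by
      by_contra ht
      refine hw (-(t⁻¹ * s)) ?_
      have h3 := congrArg (fun z => t⁻¹ • z) h'
      simp only [smul_add, smul_smul, inv_mul_cancel₀ ht, one_smul, smul_zero] at h3
      rw [neg_smul]
      exact eq_neg_of_add_eq_zero_right h3
    rw [ht, zero_smul, add_zero] at h'
    exact ⟨(smul_eq_zero.1 h').resolve_right hk0, ht⟩
  have hspan := hli.span_eq_top_of_card_eq_finrank (by simp [h1])
  have hx : (⟨x, hkx⟩ : K) ∈ Submodule.span ℝ (range ![(⟨k, hk⟩ : K), ⟨w, hkw⟩]) := by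
    rw [hspan]
    trivial
  rw [Matrix.range_cons, Matrix.range_cons, Matrix.range_empty, union_empty, ← insert_eq,
    Submodule.mem_span_pair] at hx
  obtain ⟨c, d, h⟩ := hx
  exact ⟨c, d, (congrArg Subtype.val h).symm⟩

variable {N : Type*} [TopologicalSpace N] [ChartedSpace E3 N] [IsManifold (𝓡 3) ∞ N]
  {ξ : ContactStructure N}

/-- A field of Lorentzian forms on the leaf space whose null cones are the projections of the
Engel structure. -/
structure IsConeForm (F : OrientedCircleFoliation (CartanProlongation ξ) 𝓘(ℝ, E3 × ℝ))
    [ChartedSpace E3 F.LeafSpace] [IsManifold (𝓡 3) ∞ F.LeafSpace]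
    (b : (m : F.LeafSpace) → TangentSpace (𝓡 3) m →L[ℝ] TangentSpace (𝓡 3) m →L[ℝ] ℝ) : Prop where
  lorentz : ∀ m, IsLorentzForm (fun v w => b m v w)
  cone : ∀ m, pushforwardFibre (engel ξ) F.proj m = {v | b m v v = 0}

variable {F : OrientedCircleFoliation (CartanProlongation ξ) 𝓘(ℝ, E3 × ℝ)} (f : Frame ξ)
  [ChartedSpace E3 F.LeafSpace] [IsManifold (𝓡 3) ∞ F.LeafSpace]

namespace IsNullFibration

variable (hF : IsNullFibration F) {m₀ : F.LeafSpace} {q : E3 × ℝ}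

include hF

lemma eventually_mem_source (hq : q.1 ∈ f.dom) (hm : param F f q ∈ (extChartAt (𝓡 3) m₀).source) :
    ∀ᶠ x in 𝓝 q, x.1 ∈ f.dom ∧ param F f x ∈ (extChartAt (𝓡 3) m₀).source :=
  (f.eventually_mem_dom hq).and ((hF.contMDiffAt_param f hq).continuousAt.eventually
    ((isOpen_extChartAt_source m₀).mem_nhds hm))

lemma contDiffAt_paramCoord (hq : q.1 ∈ f.dom)
    (hm : param F f q ∈ (extChartAt (𝓡 3) m₀).source) : ContDiffAt ℝ ∞ (paramCoord F f m₀) q :=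
  ((contMDiffAt_ext hm).comp q (hF.contMDiffAt_param f hq)).contDiffAt

lemma eventually_contDiffAt_paramCoord (hq : q.1 ∈ f.dom)
    (hm : param F f q ∈ (extChartAt (𝓡 3) m₀).source) :
    ∀ᶠ x in 𝓝 q, ContDiffAt ℝ ∞ (paramCoord F f m₀) x :=
  (hF.eventually_mem_source f hq hm).mono fun _ h => hF.contDiffAt_paramCoord f h.1 h.2

lemma fderiv_paramCoord (hq : q.1 ∈ f.dom) (hm : param F f q ∈ (extChartAt (𝓡 3) m₀).source)
    (δ : E3 × ℝ) : fderiv ℝ (paramCoord F f m₀) q δ = vecCoord m₀ ⟨param F f q, dparam F f q δ⟩ := by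
  have h1 := (mdifferentiableAt_ext hm).hasMFDerivAt.comp q (hF.hasMFDerivAt_param f hq)
  have h2 : (fderiv ℝ (paramCoord F f m₀) q : E3 × ℝ →L[ℝ] E3) = _ :=
    (mfderiv_eq_fderiv (𝕜 := ℝ) (f := paramCoord F f m₀) (x := q)).symm.trans h1.mfderiv
  exact congrArg (fun T : E3 × ℝ →L[ℝ] E3 => T δ) h2

lemma fderiv_paramCoord_surjective (hq : q.1 ∈ f.dom)
    (hm : param F f q ∈ (extChartAt (𝓡 3) m₀).source) :
    Function.Surjective (fderiv ℝ (paramCoord F f m₀) q) := by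
  intro w
  set v := (vecOfCoord m₀ (extChartAt (𝓡 3) m₀ (param F f q), w)).2
  have ht := (extChartAt (𝓡 3) m₀).map_source hm
  have h0 : vecCoord m₀ (vecOfCoord m₀ (extChartAt (𝓡 3) m₀ (param F f q), w)) = w :=
    vecCoord_vecOfCoord ht
  obtain ⟨x, hx, hx'⟩ : ∃ x : TangentBundle (𝓡 3) F.LeafSpace,
      x.1 = param F f q ∧ vecCoord m₀ x = w := ⟨_, (extChartAt (𝓡 3) m₀).left_inv hm, h0⟩
  obtain ⟨m, x⟩ := x
  dsimp only at hx
  subst hx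
  obtain ⟨δ, rfl⟩ := hF.dparam_surjective f hq x
  exact ⟨δ, (hF.fderiv_paramCoord f hq hm δ).trans hx'⟩

variable [T2Space N]

lemma fderiv_paramCoord_eq_zero_iff (hq : q.1 ∈ f.dom)
    (hm : param F f q ∈ (extChartAt (𝓡 3) m₀).source) {δ : E3 × ℝ} :
    fderiv ℝ (paramCoord F f m₀) q δ = 0 ↔ ∃ c : ℝ, δ = c • leafDir F f q := by
  rw [hF.fderiv_paramCoord f hq hm]
  constructor
  · intro h
    refine hF.exists_smul_leafDir f hq ?_
    by_contra h0
    exact vecCoord_ne_zero hm h0 h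
  · rintro ⟨c, rfl⟩
    rw [map_smul, hF.dparam_leafDir f hq, smul_zero]
    exact map_zero (mfderiv (𝓡 3) 𝓘(ℝ, E3) (extChartAt (𝓡 3) m₀) (param F f q))

lemma fderiv_paramCoord_leafDir (hq : q.1 ∈ f.dom)
    (hm : param F f q ∈ (extChartAt (𝓡 3) m₀).source) :
    fderiv ℝ (paramCoord F f m₀) q (leafDir F f q) = 0 :=
  (hF.fderiv_paramCoord_eq_zero_iff f hq hm).2 ⟨1, (one_smul _ _).symm⟩

lemma fderiv_paramCoord_vertical_ne_zero (hq : q.1 ∈ f.dom)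
    (hm : param F f q ∈ (extChartAt (𝓡 3) m₀).source) :
    fderiv ℝ (paramCoord F f m₀) q (0, 1) ≠ 0 := by
  rw [hF.fderiv_paramCoord f hq hm]
  exact vecCoord_ne_zero hm (hF.dparam_vertical_ne_zero f hq)

lemma fderiv_paramCoord_dir (hq : q.1 ∈ f.dom)
    (hm : param F f q ∈ (extChartAt (𝓡 3) m₀).source) :
    fderiv ℝ (paramCoord F f m₀) q (f.dir q, 0) =
      slope F f q • fderiv ℝ (paramCoord F f m₀) q (0, 1) := by
  have e : ((f.dir q, 0) : E3 × ℝ) = leafDir F f q + slope F f q • ((0, 1) : E3 × ℝ) := by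
    ext1 <;> simp [leafDir]
  rw [e, map_add, hF.fderiv_paramCoord_leafDir f hq hm, zero_add, map_smul]

/-- The derivative of the null vector along the leaf. -/
lemma fderiv_nullVec_leafDir (hq : q.1 ∈ f.dom)
    (hm : param F f q ∈ (extChartAt (𝓡 3) m₀).source) : ∃ h' : ℝ,
    fderiv ℝ (fun x => fderiv ℝ (paramCoord F f m₀) x (0, 1)) q (leafDir F f q) =
      h' • fderiv ℝ (paramCoord F f m₀) q (0, 1) -
        fderiv ℝ (paramCoord F f m₀) q (f.dir' q, 0) := by
  have he : DifferentiableAt ℝ (fun x => ((f.dir x, 0) : E3 × ℝ)) q :=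
    ((f.contDiffAt_dir hq).differentiableAt (by simp)).prodMk (differentiableAt_const _)
  -- Here `e = (dir, 0)` is sent to `slope` times the null vector, `e - slope • ∂_θ` is `leafDir`,
  -- and the derivative of `e` in the angle is `(dir', 0)`.
  obtain ⟨h', h⟩ := fderiv_image_along_kernel (τ := ((0, 1) : E3 × ℝ)) (e := fun x => (f.dir x, 0))
    (h := slope F f) (hF.contDiffAt_paramCoord f hq hm) he
    (hF.fderiv_paramCoord_vertical_ne_zero f hq hm)
    ((hF.eventually_mem_source f hq hm).mono fun x hx => hF.fderiv_paramCoord_dir f hx.1 hx.2)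
  refine ⟨h', ?_⟩
  have e1 : ((f.dir q, 0) : E3 × ℝ) - slope F f q • ((0, 1) : E3 × ℝ) = leafDir F f q := by
    ext1 <;> simp [leafDir]
  have e2 : fderiv ℝ (fun x => ((f.dir x, 0) : E3 × ℝ)) q (0, 1) = (f.dir' q, 0) := by
    have := (((f.contDiffAt_dir hq).differentiableAt (by simp)).hasFDerivAt.prodMk
      (hasFDerivAt_const (0 : ℝ) q)).fderiv
    rw [this]
    ext1
    · exact f.fderiv_dir_vertical hq
    · rfl
  rw [e1, e2] at h
  exact h

/-- Otherwise `dir'` would agree with a multiple of `dir` modulo vertical vectors, while the two are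
independent. -/
lemma fderiv_paramCoord_dir'_ne_smul (hq : q.1 ∈ f.dom)
    (hm : param F f q ∈ (extChartAt (𝓡 3) m₀).source) (c : ℝ) :
    fderiv ℝ (paramCoord F f m₀) q (f.dir' q, 0) ≠
      c • fderiv ℝ (paramCoord F f m₀) q (0, 1) := by
  intro h
  have h1 : fderiv ℝ (paramCoord F f m₀) q ((f.dir' q, 0) - c • (0, 1)) = 0 := by
    rw [map_sub, map_smul, h, sub_self]
  obtain ⟨d, hd⟩ := (hF.fderiv_paramCoord_eq_zero_iff f hq hm).1 h1
  have h2 := congrArg Prod.fst hd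
  simp only [leafDir, Prod.smul_mk, Prod.fst_sub, smul_zero, sub_zero] at h2
  exact f.dir'_ne_smul_dir hq d h2

/-- Local sections of the projection to the leaf space, and the curves in its fibres. -/
lemma exists_straightening (hq : q.1 ∈ f.dom)
    (hm : param F f q ∈ (extChartAt (𝓡 3) m₀).source) :
    ∃ G : E3 × ℝ → E3 × ℝ, (∀ᶠ z in 𝓝 (paramCoord F f m₀ q, (0 : ℝ)), ContDiffAt ℝ ∞ G z ∧
      paramCoord F f m₀ (G z) = z.1 ∧ (G z).1 ∈ f.dom ∧
      param F f (G z) ∈ (extChartAt (𝓡 3) m₀).source) ∧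
      G (paramCoord F f m₀ q, 0) = q ∧
      fderiv ℝ G (paramCoord F f m₀ q, 0) (0, 1) = leafDir F f q := by
  obtain ⟨G, h1, h2, h3, h4⟩ := exists_smooth_straightening (by simp)
    (hF.eventually_contDiffAt_paramCoord f hq hm) (hF.fderiv_paramCoord_surjective f hq hm)
    (hF.fderiv_paramCoord_leafDir f hq hm) (hF.leafDir_ne_zero f hq)
  refine ⟨G, ?_, h2, h4⟩
  have hc : Tendsto G (𝓝 (paramCoord F f m₀ q, 0)) (𝓝 q) := by
    have := h1.self_of_nhds.continuousAt.tendsto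
    rwa [h2] at this
  filter_upwards [h1, h3, hc.eventually (hF.eventually_mem_source f hq hm)] with z a1 a2 a3
  exact ⟨a1, a2, a3⟩

variable {b : (m : F.LeafSpace) → TangentSpace (𝓡 3) m →L[ℝ] TangentSpace (𝓡 3) m →L[ℝ] ℝ}
  (hb : IsConeForm F b)

include hb

lemma null_dparam (hq : q.1 ∈ f.dom) :
    b (param F f q) (dparam F f q (0, 1)) (dparam F f q (0, 1)) = 0 := by
  have h := hF.mem_pushforwardFibre_param f hq 1
  rw [hb.cone, one_smul] at h
  exact h

lemma coordForm_null (hq : q.1 ∈ f.dom) (hm : param F f q ∈ (extChartAt (𝓡 3) m₀).source) :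
    coordForm b m₀ (paramCoord F f m₀ q) (fderiv ℝ (paramCoord F f m₀) q (0, 1))
      (fderiv ℝ (paramCoord F f m₀) q (0, 1)) = 0 := by
  rw [hF.fderiv_paramCoord f hq hm]
  exact (coordForm_ext hm _ _).trans (hF.null_dparam f hb hq)

lemma isLorentzForm_paramCoord (hm : param F f q ∈ (extChartAt (𝓡 3) m₀).source) :
    IsLorentzForm fun v w => coordForm b m₀ (paramCoord F f m₀ q) v w :=
  isLorentzForm_coordForm ((extChartAt (𝓡 3) m₀).map_source hm) (hb.lorentz _)

/-- The null vector is orthogonal to its derivative along the leaf. -/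
lemma coordForm_dir' (hq : q.1 ∈ f.dom) (hm : param F f q ∈ (extChartAt (𝓡 3) m₀).source) :
    coordForm b m₀ (paramCoord F f m₀ q) (fderiv ℝ (paramCoord F f m₀) q (0, 1))
      (fderiv ℝ (paramCoord F f m₀) q (f.dir' q, 0)) = 0 := by
  obtain ⟨G, hG, hGq, hGd⟩ := hF.exists_straightening f hq hm
  set z₀ := paramCoord F f m₀ q with hz₀
  set B := coordForm b m₀ z₀ with hB
  set k := fun x => fderiv ℝ (paramCoord F f m₀) x (0, 1) with hk
  obtain ⟨h', hh'⟩ := hF.fderiv_nullVec_leafDir f hq hm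
  -- This curve stays over the point `z₀` and has initial velocity `leafDir`. The null vectors along
  -- it lie on the cone of the one fixed form `B`; differentiating their vanishing square gives the
  -- orthogonality.
  have hx : HasDerivAt (fun t : ℝ => G (z₀, t)) (leafDir F f q) 0 := by
    rw [← hGd]
    have h2 : HasDerivAt (fun t : ℝ => (z₀, t)) ((0, 1) : E3 × ℝ) 0 :=
      (hasDerivAt_const _ _).prodMk (hasDerivAt_id _)
    exact (hG.self_of_nhds.1.differentiableAt (by simp)).hasFDerivAt.comp_hasDerivAt (0 : ℝ) h2
  have hkx : HasDerivAt (fun t : ℝ => k (G (z₀, t))) (fderiv ℝ k q (leafDir F f q)) 0 := by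
    have h3 : HasFDerivAt k (fderiv ℝ k q) (G (z₀, 0)) := by
      rw [hGq]
      exact ((contDiffAt_fderiv_apply (hF.contDiffAt_paramCoord f hq hm) _).differentiableAt
        (by simp)).hasFDerivAt
    exact h3.comp_hasDerivAt (0 : ℝ) hx
  have h4 : HasDerivAt (fun t : ℝ => B (k (G (z₀, t))) (k (G (z₀, t))))
      (B (fderiv ℝ k q (leafDir F f q)) (k q) + B (k q) (fderiv ℝ k q (leafDir F f q))) 0 := by
    have h5 := ((B.hasFDerivAt.comp_hasDerivAt (0 : ℝ) hkx).clm_apply hkx)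
    simp only [Function.comp_def, hGq] at h5
    exact h5
  have h6 : ∀ᶠ t : ℝ in 𝓝 0, B (k (G (z₀, t))) (k (G (z₀, t))) = 0 := by
    have hc : Tendsto (fun t : ℝ => (z₀, t)) (𝓝 0) (𝓝 (z₀, 0)) :=
      (Continuous.prodMk_right z₀).tendsto 0
    filter_upwards [hc.eventually hG] with t ht
    have := hF.coordForm_null f hb ht.2.2.1 ht.2.2.2
    rwa [ht.2.1] at this
  have h7 := h4.unique ((hasDerivAt_const (0 : ℝ) (0 : ℝ)).congr_of_eventuallyEq h6)
  have hs : ∀ v w, B v w = B w v := (hF.isLorentzForm_paramCoord f hb hm).1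
  rw [hs, hh', map_sub, map_smul] at h7
  have h8 := hF.coordForm_null f hb hq hm
  change B (k q) (k q) = 0 at h8
  change B (k q) (fderiv ℝ (paramCoord F f m₀) q (f.dir' q, 0)) = 0
  rw [h8] at h7
  simp only [smul_zero, zero_sub] at h7
  linarith

/-- This spacelike vector has two uses: it normalises the local metrics, and it excludes a motion of
null geodesics along the leaves. -/
lemma coordForm_dir'_pos (hq : q.1 ∈ f.dom)
    (hm : param F f q ∈ (extChartAt (𝓡 3) m₀).source) :
    0 < coordForm b m₀ (paramCoord F f m₀ q) (fderiv ℝ (paramCoord F f m₀) q (f.dir' q, 0))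
      (fderiv ℝ (paramCoord F f m₀) q (f.dir' q, 0)) :=
  (hF.isLorentzForm_paramCoord f hb hm).pos_of_orthogonal_null (hF.coordForm_null f hb hq hm)
    (hF.fderiv_paramCoord_vertical_ne_zero f hq hm) (hF.coordForm_dir' f hb hq hm)
    (hF.fderiv_paramCoord_dir'_ne_smul f hq hm)

/-- The contact plane consists of the directions orthogonal to the null vector. -/
lemma coordForm_horizontal_eq_zero_iff (hq : q.1 ∈ f.dom)
    (hm : param F f q ∈ (extChartAt (𝓡 3) m₀).source) {v : E3} :
    coordForm b m₀ (paramCoord F f m₀ q) (fderiv ℝ (paramCoord F f m₀) q (0, 1))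
      (fderiv ℝ (paramCoord F f m₀) q (v, 0)) = 0 ↔
      ∃ c s : ℝ, v = c • f.V q.1 + s • f.Y q.1 := by
  set B := coordForm b m₀ (paramCoord F f m₀ q) with hB
  have h0 := hF.coordForm_null f hb hq hm
  rw [exists_combination_iff_rotated q.2 v (f.V q.1) (f.Y q.1)]
  change _ ↔ ∃ c s : ℝ, v = c • f.dir q + s • f.dir' q
  constructor
  · intro h
    -- The orthogonal plane of the null vector is spanned by it and by the image of `dir'`. Lifting
    -- back leaves a multiple of `leafDir`, whose horizontal part is along `dir`.
    obtain ⟨c, d, hcd⟩ := (hF.isLorentzForm_paramCoord f hb hm).exists_combination h0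
      (hF.fderiv_paramCoord_vertical_ne_zero f hq hm) (hF.coordForm_dir' f hb hq hm)
      (hF.fderiv_paramCoord_dir'_ne_smul f hq hm) h
    have h1 : fderiv ℝ (paramCoord F f m₀) q ((v, 0) - c • (0, 1) - d • (f.dir' q, 0)) = 0 := by
      rw [map_sub, map_sub, map_smul, map_smul, hcd]
      abel
    obtain ⟨e, he⟩ := (hF.fderiv_paramCoord_eq_zero_iff f hq hm).1 h1
    have h2 := congrArg Prod.fst he
    simp only [leafDir, Prod.smul_mk, Prod.fst_sub, smul_zero, sub_zero] at h2
    exact ⟨e, d, eq_add_of_sub_eq h2⟩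
  · rintro ⟨c, s, rfl⟩
    have e : ((c • f.dir q + s • f.dir' q, 0) : E3 × ℝ) = c • (f.dir q, 0) + s • (f.dir' q, 0) := by
      ext1 <;> simp
    rw [e, map_add, map_smul, map_smul, hF.fderiv_paramCoord_dir f hq hm, map_add, map_smul,
      map_smul, map_smul, h0, hF.coordForm_dir' f hb hq hm]
    simp

end IsNullFibration

/-! ### Connectedness of the leaf space -/

open CartanProlongation

section Base

variable {N : Type*} [TopologicalSpace N] [ChartedSpace E3 N] [IsManifold (𝓡 3) ∞ N]
  {ξ : ContactStructure N}

lemma exists_base_eq (ξ : ContactStructure N) (x : N) : ∃ u : CartanProlongation ξ, u.base = x := by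
  obtain ⟨U, a, hU, hxU, hUt, ha, hpl, hw⟩ := ξ.exists_form x
  have hx := mem_extChartAt_source (I := 𝓡 3) x
  set A : E3 →ₗ[ℝ] ℝ := (a (extChartAt (𝓡 3) x x)).toLinearMap with hA
  have h1 := LinearMap.finrank_range_add_finrank_ker A
  have h2 : Module.finrank ℝ (LinearMap.range A) ≤ 1 := by
    simpa using Submodule.finrank_le (LinearMap.range A)
  have h3 : Module.finrank ℝ E3 = 3 := by simp
  have h4 : 0 < Module.finrank ℝ (LinearMap.ker A) := by omega
  obtain ⟨⟨v, hv⟩, hv0⟩ := (Module.finrank_pos_iff_exists_ne_zero (R := ℝ)).1 h4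
  have hw : (mfderiv (𝓡 3) 𝓘(ℝ, E3) (extChartAt (𝓡 3) x) x
      (tangentCoordChange (𝓡 3) x x x v : E3) : E3) = v := by
    rw [mfderiv_ext_eq hx]
    exact tcc_right hx v
  refine ⟨mk' x (tangentCoordChange (𝓡 3) x x x v : E3) ((hpl x hx hxU _).2 ?_) ?_, rfl⟩
  · rw [hw]
    exact hv
  · intro h0
    rw [h0] at hw
    apply hv0
    have : v = 0 := hw.symm.trans (map_zero (mfderiv (𝓡 3) 𝓘(ℝ, E3) (extChartAt (𝓡 3) x) x))
    simpa [Subtype.ext_iff] using this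

/-- The frame `f` is defined at `x`. -/
def CartanProlongation.Frame.Covers (f : Frame ξ) (x : N) : Prop :=
  x ∈ (extChartAt (𝓡 3) f.center).source ∧ extChartAt (𝓡 3) f.center x ∈ f.dom

lemma exists_frame_covers (ξ : ContactStructure N) (x : N) : ∃ f : Frame ξ, f.Covers x := by
  obtain ⟨u, rfl⟩ := exists_base_eq ξ x
  obtain ⟨f, q, hq, rfl⟩ := exists_frame_circ u
  exact ⟨f, f.base_circ_mem hq, by rwa [f.ext_base_circ hq]⟩

lemma base_preimage_singleton {f : Frame ξ} {x : N} (h : f.Covers x) :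
    (base ⁻¹' {x} : Set (CartanProlongation ξ)) =
      range fun θ => f.circ (extChartAt (𝓡 3) f.center x, θ) := by
  ext u
  constructor
  · rintro rfl
    exact f.exists_circ_eq h.1 h.2
  · rintro ⟨θ, rfl⟩
    change (f.circ _).base = x
    rw [f.base_circ h.2]
    exact (extChartAt (𝓡 3) f.center).left_inv h.1

/-- Keeping the polar angle constant gives a continuous local section through any point. -/
lemma isOpenMap_base : IsOpenMap (base : CartanProlongation ξ → N) := by
  rw [isOpenMap_iff_nhds_le]
  intro u
  obtain ⟨f, q, hq, rfl⟩ := exists_frame_circ u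
  have hs := f.base_circ_mem hq
  have hext := f.ext_base_circ hq
  set s : N → CartanProlongation ξ := fun y => f.circ (extChartAt (𝓡 3) f.center y, q.2) with hsdef
  have h1 : s (f.circ q).base = f.circ q := by
    simp only [hsdef]
    rw [hext]
  have h2 : ContinuousAt s (f.circ q).base := by
    refine ContinuousAt.comp (g := f.circ) (f := fun y => (extChartAt (𝓡 3) f.center y, q.2)) ?_ ?_
    · rw [hext]
      exact (f.contMDiffAt_circ hq).continuousAt
    · exact (continuousAt_extChartAt' hs).prodMk continuousAt_const
  have h3 : base ∘ s =ᶠ[𝓝 (f.circ q).base] id := by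
    filter_upwards [(isOpen_extChartAt_source f.center).mem_nhds hs,
      (continuousAt_extChartAt' hs).eventually (f.isOpen_dom.mem_nhds (hext.symm ▸ hq))] with y h4 h5
    simp only [Function.comp, hsdef, f.base_circ (p := (_, q.2)) h5]
    exact (extChartAt (𝓡 3) f.center).left_inv h4
  calc 𝓝 (f.circ q).base = map (base ∘ s) (𝓝 (f.circ q).base) := by
        rw [Filter.map_congr h3, Filter.map_id]
    _ = map base (map s (𝓝 (f.circ q).base)) := by rw [Filter.map_map]
    _ ≤ map base (𝓝 (f.circ q)) := by
        refine Filter.map_mono ?_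
        have := h2.tendsto
        rwa [h1] at this

lemma isConnected_base_preimage (x : N) :
    IsConnected (base ⁻¹' {x} : Set (CartanProlongation ξ)) := by
  obtain ⟨f, hf⟩ := exists_frame_covers ξ x
  rw [base_preimage_singleton hf]
  refine isConnected_range (continuous_iff_continuousAt.2 fun θ => ?_)
  exact ContinuousAt.comp (g := f.circ) (f.contMDiffAt_circ (p := (_, θ)) hf.2).continuousAt
    (Continuous.prodMk_right _).continuousAt

/-- The projection to `N` is an open quotient map whose fibres are images of the line under the
polar angle, hence connected. -/
instance [ConnectedSpace N] : ConnectedSpace (CartanProlongation ξ) := by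
  have hq : Topology.IsQuotientMap (base : CartanProlongation ξ → N) :=
    isOpenMap_base.isQuotientMap contMDiff_base.continuous (exists_base_eq ξ)
  have h := hq.preimage_connectedComponent isConnected_base_preimage
  obtain ⟨x⟩ := (inferInstance : Nonempty N)
  obtain ⟨u, rfl⟩ := exists_base_eq ξ x
  have h1 := isConnected_univ (α := N)
  have h2 : IsConnected (univ : Set (CartanProlongation ξ)) := by
    have := h u
    rw [PreconnectedSpace.connectedComponent_eq_univ, preimage_univ] at this
    rw [this]
    exact isConnected_connectedComponent
  exact connectedSpace_iff_univ.2 h2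

end Base

/-! ### Existence of a metric with the given null cones -/

open CartanProlongation

section Existence

variable {N : Type*} [TopologicalSpace N] [ChartedSpace E3 N] [IsManifold (𝓡 3) ∞ N]
  {ξ : ContactStructure N} {F : OrientedCircleFoliation (CartanProlongation ξ) 𝓘(ℝ, E3 × ℝ)}
  [ChartedSpace E3 F.LeafSpace] [IsManifold (𝓡 3) ∞ F.LeafSpace]
  {b : (m : F.LeafSpace) → TangentSpace (𝓡 3) m →L[ℝ] TangentSpace (𝓡 3) m →L[ℝ] ℝ}

lemma IsConeForm.smul (hb : IsConeForm F b) {c : F.LeafSpace → ℝ} (hc : ∀ m, 0 < c m) :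
    IsConeForm F fun m => c m • b m := by
  refine ⟨fun m => ?_, fun m => ?_⟩
  · obtain ⟨hs, T, hT, hpos⟩ := hb.lorentz m
    dsimp only at hs hT hpos
    refine ⟨fun v w => ?_, T, ?_, fun v hv hv0 => ?_⟩
    · change c m * b m v w = c m * b m w v
      rw [hs]
    · exact mul_neg_of_pos_of_neg (hc m) hT
    · exact mul_pos (hc m) (hpos v ((mul_eq_zero.1 hv).resolve_left (hc m).ne') hv0)
  · rw [hb.cone]
    ext v
    change b m v v = 0 ↔ c m * b m v v = 0
    rw [mul_eq_zero, or_iff_right (hc m).ne']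

variable [T2Space N] (hF : IsNullFibration F)

include hF in
lemma IsNullFibration.exists_of_coordForm_null (hb : IsConeForm F b) {m₀ m : F.LeafSpace}
    (hm : m ∈ (extChartAt (𝓡 3) m₀).source) {v : E3}
    (hv : coordForm b m₀ (extChartAt (𝓡 3) m₀ m) v v = 0) :
    ∃ (f : Frame ξ) (q : E3 × ℝ) (s : ℝ), q.1 ∈ f.dom ∧ param F f q = m ∧
      v = s • fderiv ℝ (paramCoord F f m₀) q (0, 1) := by
  obtain ⟨x, hx, hx'⟩ : ∃ x : TangentBundle (𝓡 3) F.LeafSpace, x.1 = m ∧ vecCoord m₀ x = v :=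
    ⟨vecOfCoord m₀ (extChartAt (𝓡 3) m₀ m, v), (extChartAt (𝓡 3) m₀).left_inv hm,
      vecCoord_vecOfCoord ((extChartAt (𝓡 3) m₀).map_source hm)⟩
  obtain ⟨m, x⟩ := x
  dsimp only at hx
  subst hx
  rw [← hx', coordForm_ext hm] at hv
  have h1 : x ∈ pushforwardFibre (engel ξ) F.proj m := by
    rw [hb.cone]
    exact hv
  obtain ⟨f, q, s, hq, h2⟩ := hF.exists_of_mem_pushforwardFibre h1
  have h3 : m = param F f q := congrArg (fun w => w.1) h2
  subst h3
  refine ⟨f, q, s, hq, rfl, ?_⟩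
  rw [hF.fderiv_paramCoord f hq hm, ← vecCoord_smul, ← hx', h2]

-- Along a smooth local section of the projection, `k` is the null vector and `d` the image of
-- `dir'`. These are the fields required by `contDiffAt_normalised_form`.
include hF in
lemma IsNullFibration.exists_local_null_field (hb : IsConeForm F b) {m₀ : F.LeafSpace}
    {f : Frame ξ} {q : E3 × ℝ} (hq : q.1 ∈ f.dom)
    (hm : param F f q ∈ (extChartAt (𝓡 3) m₀).source) :
    ∃ k d : E3 → E3, k (paramCoord F f m₀ q) = fderiv ℝ (paramCoord F f m₀) q (0, 1) ∧
      ∀ᶠ z in 𝓝 (paramCoord F f m₀ q), ContDiffAt ℝ ∞ k z ∧ ContDiffAt ℝ ∞ d z ∧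
        coordForm b m₀ z (k z) (k z) = 0 ∧ coordForm b m₀ z (k z) (d z) = 0 ∧
        (∀ c : ℝ, d z ≠ c • k z) ∧ 0 < coordForm b m₀ z (d z) (d z) := by
  obtain ⟨G, hG, hGq, -⟩ := hF.exists_straightening f hq hm
  refine ⟨fun z => fderiv ℝ (paramCoord F f m₀) (G (z, 0)) (0, 1),
    fun z => fderiv ℝ (paramCoord F f m₀) (G (z, 0)) (f.dir' (G (z, 0)), 0), by simp only [hGq], ?_⟩
  have hc : Tendsto (fun z : E3 => (z, (0 : ℝ))) (𝓝 (paramCoord F f m₀ q))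
      (𝓝 (paramCoord F f m₀ q, 0)) := (Continuous.prodMk_left (0 : ℝ)).tendsto _
  filter_upwards [hc.eventually hG] with z hz
  obtain ⟨h1, h2, h3, h4⟩ := hz
  have h2' : paramCoord F f m₀ (G (z, 0)) = z := h2
  have hg : ContDiffAt ℝ ∞ (fun z : E3 => G (z, (0 : ℝ))) z :=
    ContDiffAt.comp z (g := G) (f := fun z : E3 => (z, (0 : ℝ))) h1
      (contDiffAt_id.prodMk contDiffAt_const)
  have hQ : ContDiffAt ℝ ∞ (fun z : E3 => fderiv ℝ (paramCoord F f m₀) (G (z, 0))) z :=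
    ContDiffAt.comp z (g := fderiv ℝ (paramCoord F f m₀)) (f := fun z : E3 => G (z, (0 : ℝ)))
      ((hF.contDiffAt_paramCoord f h3 h4).fderiv_right (m := ∞) le_rfl) hg
  have hd : ContDiffAt ℝ ∞ (fun z : E3 => f.dir' (G (z, (0 : ℝ)))) z :=
    ContDiffAt.comp z (g := f.dir') (f := fun z : E3 => G (z, (0 : ℝ))) (f.contDiffAt_dir' h3) hg
  refine ⟨hQ.clm_apply contDiffAt_const, hQ.clm_apply (hd.prodMk contDiffAt_const), ?_, ?_,
    hF.fderiv_paramCoord_dir'_ne_smul f h3 h4, ?_⟩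
  · have := hF.coordForm_null f hb h3 h4
    rwa [h2'] at this
  · have := hF.coordForm_dir' f hb h3 h4
    rwa [h2'] at this
  · have := hF.coordForm_dir'_pos f hb h3 h4
    rwa [h2'] at this

-- Three independent null vectors at `m₀` come from three points of the leaf and extend to null
-- fields along three local sections. Dividing by the value on `d 0` makes the forms smooth near
-- `m₀`, however irregularly `b` was chosen.
include hF in
lemma IsNullFibration.exists_local_form (hb : IsConeForm F b) (m₀ : F.LeafSpace) :
    ∃ c : F.LeafSpace → ℝ, ∀ᶠ m in 𝓝 m₀, 0 < c m ∧
      ContMDiffAt (𝓡 3) ((𝓡 3).prod 𝓘(ℝ, E3 →L[ℝ] E3 →L[ℝ] ℝ)) ∞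
        (fun x => Bundle.TotalSpace.mk' (E3 →L[ℝ] E3 →L[ℝ] ℝ) x (c x • b x)) m := by
  have hm₀ := mem_extChartAt_source (I := 𝓡 3) m₀
  set z₀ := extChartAt (𝓡 3) m₀ m₀ with hz₀
  have hLz : ∀ z ∈ (extChartAt (𝓡 3) m₀).target,
      IsLorentzForm fun v w => coordForm b m₀ z v w := fun z hz =>
    isLorentzForm_coordForm hz (hb.lorentz _)
  have hL := hLz z₀ ((extChartAt (𝓡 3) m₀).map_source hm₀)
  obtain ⟨k₀, hk₀, hk₀n⟩ := hL.exists_null_basis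
  have h1 : ∀ i, ∃ (k d : E3 → E3) (s : ℝ), k₀ i = s • k z₀ ∧
      ∀ᶠ z in 𝓝 z₀, ContDiffAt ℝ ∞ k z ∧ ContDiffAt ℝ ∞ d z ∧
        coordForm b m₀ z (k z) (k z) = 0 ∧ coordForm b m₀ z (k z) (d z) = 0 ∧
        (∀ c : ℝ, d z ≠ c • k z) ∧ 0 < coordForm b m₀ z (d z) (d z) := by
    intro i
    obtain ⟨f, q, s, hq, hp, hs⟩ := hF.exists_of_coordForm_null hb hm₀ (hk₀n i)
    have hQ : paramCoord F f m₀ q = z₀ := by rw [paramCoord, hp]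
    obtain ⟨k, d, hk, h⟩ := hF.exists_local_null_field hb hq (by rw [hp]; exact hm₀)
    rw [hQ] at hk h
    exact ⟨k, d, s, by rw [hs, hk], h⟩
  choose k d s hks h using h1
  have hs0 : ∀ i, s i ≠ 0 := by
    intro i h0
    have := hk₀.ne_zero i
    rw [hks, h0, zero_smul] at this
    exact this rfl
  have hki : LinearIndependent ℝ fun i => k i z₀ := by
    have h2 := hk₀.units_smul fun i => (Units.mk0 (s i) (hs0 i))⁻¹
    convert h2 using 1
    funext i
    simp only [Pi.smul_apply', hks, Units.smul_def, Units.val_inv_eq_inv_val, Units.val_mk0]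
    rw [smul_smul, inv_mul_cancel₀ (hs0 i), one_smul]
  have hall : ∀ᶠ z in 𝓝 z₀, ∀ i, ContDiffAt ℝ ∞ (k i) z ∧ ContDiffAt ℝ ∞ (d i) z ∧
        coordForm b m₀ z (k i z) (k i z) = 0 ∧ coordForm b m₀ z (k i z) (d i z) = 0 ∧
        (∀ c : ℝ, d i z ≠ c • k i z) ∧ 0 < coordForm b m₀ z (d i z) (d i z) :=
    eventually_all.2 h
  have hind : ∀ᶠ z in 𝓝 z₀, LinearIndependent ℝ fun i => k i z := by
    have hc : ContinuousAt (fun z i => k i z) z₀ :=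
      continuousAt_pi.2 fun i => (h i).self_of_nhds.1.continuousAt
    exact hc.eventually (isOpen_setOfPred_linearIndependent.mem_nhds hki)
  have htar := (isOpen_extChartAt_target (I := 𝓡 3) m₀).mem_nhds
    ((extChartAt (𝓡 3) m₀).map_source hm₀)
  set c : F.LeafSpace → ℝ := fun m => (coordForm b m₀ (extChartAt (𝓡 3) m₀ m)
    (d 0 (extChartAt (𝓡 3) m₀ m)) (d 0 (extChartAt (𝓡 3) m₀ m)))⁻¹ with hc
  have hsm : ∀ᶠ z in 𝓝 z₀, ContDiffAt ℝ ∞ (fun z =>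
      (coordForm b m₀ z (d 0 z) (d 0 z))⁻¹ • coordForm b m₀ z) z := by
    filter_upwards [hall.eventually_nhds, hind,
      (eventually_mem_set.2 htar).eventually_nhds] with z hz hzi ht
    refine contDiffAt_normalised_form (k := k) (d₀ := d 0) (d₁ := d 1)
      (ht.mono fun y hy => hLz y hy) (fun i => (hz.self_of_nhds i).1) hzi
      (hz.self_of_nhds 0).2.1 (hz.self_of_nhds 1).2.1 (hz.mono fun y hy i => (hy i).2.2.1)
      (hz.mono fun y hy => ⟨(hy 0).2.2.2.1, (hy 0).2.2.2.2.1⟩)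
      (hz.mono fun y hy => ⟨(hy 1).2.2.2.1, (hy 1).2.2.2.2.1⟩)
  refine ⟨c, ?_⟩
  have hcont : Tendsto (extChartAt (𝓡 3) m₀) (𝓝 m₀) (𝓝 z₀) := continuousAt_extChartAt m₀
  filter_upwards [(isOpen_extChartAt_source m₀).mem_nhds hm₀, hcont.eventually hall,
    hcont.eventually hsm] with m hm h3 h4
  refine ⟨inv_pos.2 (h3 0).2.2.2.2.2, (contMDiffAt_form_iff hm).2 (h4.congr_of_eventuallyEq ?_)⟩
  filter_upwards [(isOpen_extChartAt_target m₀).mem_nhds ((extChartAt (𝓡 3) m₀).map_source hm)]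
    with z hz
  ext v w
  change c ((extChartAt (𝓡 3) m₀).symm z) * coordForm b m₀ z v w = _
  simp only [hc, (extChartAt (𝓡 3) m₀).right_inv hz]
  rfl

set_option synthInstance.maxHeartbeats 400000 in
/-- There is a Lorentzian metric whose null cones are the projections of the Engel structure. -/
theorem IsNullFibration.exists_metric [T2Space F.LeafSpace] [SecondCountableTopology F.LeafSpace]
    (hF : IsNullFibration F) :
    ∃ g : LorentzMetric F.LeafSpace, g.HasNullCones (pushforwardFibre (engel ξ) F.proj) := by
  -- The forms are chosen point by point; `IsConeForm` asks for no continuity.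
  choose b hb₁ hb₂ using hF.cone
  have hb : IsConeForm F b := ⟨hb₁, hb₂⟩
  have : LocallyCompactSpace F.LeafSpace := ChartedSpace.locallyCompactSpace E3 F.LeafSpace
  have : SigmaCompactSpace F.LeafSpace := inferInstance
  -- The positive multiples of `b m` form a convex set and all have the same null cone, so the local
  -- smooth representatives can be glued by a partition of unity.
  obtain ⟨s, hs⟩ := exists_contMDiffSection_forall_mem_convex_of_local (n := (⊤ : ℕ∞)) (𝓡 3)
    (F_fiber := E3 →L[ℝ] E3 →L[ℝ] ℝ)
    (fun m : F.LeafSpace => TangentSpace (𝓡 3) m →L[ℝ] TangentSpace (𝓡 3) m →L[ℝ] ℝ)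
    (fun m => {B | ∃ c : ℝ, 0 < c ∧ B = c • b m}) (by
      rintro m _ ⟨c, hc, rfl⟩ _ ⟨c', hc', rfl⟩ x y hx hy hxy
      refine ⟨x * c + y * c', ?_, ?_⟩
      swap
      · rw [smul_smul, smul_smul]
        exact (add_smul _ _ (b m)).symm
      rcases hx.eq_or_lt with rfl | hx
      · rw [zero_add] at hxy
        simpa [hxy] using hc'
      · exact add_pos_of_pos_of_nonneg (mul_pos hx hc) (mul_nonneg hy hc'.le)) (by
      intro m₀
      obtain ⟨c, hc⟩ := hF.exists_local_form hb m₀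
      exact ⟨_, hc, fun m => c m • b m, fun m hm => hm.2.contMDiffWithinAt,
        fun m hm => ⟨c m, hm.1, rfl⟩⟩)
  choose c hc hs using hs
  have h := hb.smul hc
  have e : (fun m => s m) = fun m => c m • b m := funext hs
  rw [← e] at h
  exact ⟨⟨fun m => s m, h.lorentz, s.contMDiff⟩, h.cone⟩

end Existence

/-! ### Time-orientability -/

open CartanProlongation

section TimeOrientation

variable {N : Type*} [TopologicalSpace N] [ChartedSpace E3 N] [IsManifold (𝓡 3) ∞ N]
  {ξ : ContactStructure N} {F : OrientedCircleFoliation (CartanProlongation ξ) 𝓘(ℝ, E3 × ℝ)}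
  [ChartedSpace E3 F.LeafSpace] [IsManifold (𝓡 3) ∞ F.LeafSpace]

lemma LorentzMetric.contDiffAt_coordForm {M : Type*} [TopologicalSpace M] [ChartedSpace E3 M]
    [IsManifold (𝓡 3) ∞ M] (g : LorentzMetric M) {m₀ : M} {z : E3}
    (hz : z ∈ (extChartAt (𝓡 3) m₀).target) : ContDiffAt ℝ ∞ (coordForm g.form m₀) z := by
  have h := (contMDiffAt_form_iff ((extChartAt (𝓡 3) m₀).map_target hz)).1 (g.smooth _)
  rwa [(extChartAt (𝓡 3) m₀).right_inv hz] at h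

lemma LorentzMetric.isConeForm {g : LorentzMetric F.LeafSpace}
    (hg : g.HasNullCones (pushforwardFibre (engel ξ) F.proj)) : IsConeForm F g.form :=
  ⟨g.lorentz, hg⟩

/-- A one-form in the chart at `x₀`. -/
def coordOneForm (α : (x : N) → TangentSpace (𝓡 3) x →L[ℝ] ℝ) (x₀ : N) (y : E3) : E3 →L[ℝ] ℝ :=
  let D : E3 →L[ℝ] E3 := mfderiv 𝓘(ℝ, E3) (𝓡 3) (extChartAt (𝓡 3) x₀).symm y
  let a : E3 →L[ℝ] ℝ := α ((extChartAt (𝓡 3) x₀).symm y)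
  a.comp D

variable {α : (x : N) → TangentSpace (𝓡 3) x →L[ℝ] ℝ}

lemma coordOneForm_apply (x₀ : N) (y v : E3) : coordOneForm α x₀ y v =
    α (vecOfCoord x₀ (y, v)).1 (vecOfCoord x₀ (y, v)).2 := rfl

lemma coordOneForm_vecCoord {x₀ : N} {w : TangentBundle (𝓡 3) N}
    (hw : w.1 ∈ (extChartAt (𝓡 3) x₀).source) :
    coordOneForm α x₀ (extChartAt (𝓡 3) x₀ w.1) (vecCoord x₀ w) = α w.1 w.2 := by
  rw [coordOneForm_apply, vecOfCoord_vecCoord hw]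

lemma continuousAt_coordOneForm
    (hα : ContMDiff (𝓡 3).tangent 𝓘(ℝ, ℝ) ∞ (fun v : TangentBundle (𝓡 3) N => α v.1 v.2)) {x₀ : N}
    {y : E3} (hy : y ∈ (extChartAt (𝓡 3) x₀).target) (v : E3) :
    ContinuousAt (fun y => coordOneForm α x₀ y v) y :=
  ContinuousAt.comp (g := fun z => α (vecOfCoord x₀ z).1 (vecOfCoord x₀ z).2)
    (f := fun y : E3 => (y, v))
    (ContinuousAt.comp (g := fun v : TangentBundle (𝓡 3) N => α v.1 v.2) (f := vecOfCoord x₀)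
      hα.continuous.continuousAt (contMDiffAt_vecOfCoord (z := (y, v)) hy).continuousAt)
    (Continuous.prodMk_left v).continuousAt

lemma CartanProlongation.Frame.coordOneForm_eq_zero_iff (f : Frame ξ)
    (hker : ∀ (x : N) (v : TangentSpace (𝓡 3) x), v ∈ ξ.plane x ↔ α x v = 0) {y v : E3}
    (hy : y ∈ f.dom) : coordOneForm α f.center y v = 0 ↔ ∃ c s : ℝ, v = c • f.V y + s • f.Y y := by
  have ht := f.dom_subset hy
  have h := f.mem_plane_iff _ ((extChartAt (𝓡 3) f.center).map_target ht)
    (by rwa [(extChartAt (𝓡 3) f.center).right_inv ht]) (vecOfCoord f.center (y, v)).2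
  replace h := (hker _ _).symm.trans h
  rw [(extChartAt (𝓡 3) f.center).right_inv ht] at h
  have h2 := vecCoord_vecOfCoord (m₀ := f.center) (z := (y, v)) ht
  refine h.trans ?_
  constructor
  · rintro ⟨c, s, h3⟩
    exact ⟨c, s, h2.symm.trans h3⟩
  · rintro ⟨c, s, h3⟩
    exact ⟨c, s, h2.trans h3⟩

lemma CartanProlongation.Frame.coordOneForm_base (f : Frame ξ) {q : E3 × ℝ} (hq : q.1 ∈ f.dom)
    (δ : E3 × ℝ) : α (f.circ q).base (mfderiv 𝓘(ℝ, E3 × ℝ) (𝓡 3) base (f.circ q) (f.dcirc q δ)) =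
      coordOneForm α f.center q.1 δ.1 := by
  have h := coordOneForm_vecCoord (α := α) (x₀ := f.center)
    (w := ⟨(f.circ q).base, mfderiv 𝓘(ℝ, E3 × ℝ) (𝓡 3) base (f.circ q) (f.dcirc q δ)⟩)
    (f.base_circ_mem hq)
  rw [← h]
  have h1 : vecCoord f.center ⟨(f.circ q).base,
    mfderiv 𝓘(ℝ, E3 × ℝ) (𝓡 3) base (f.circ q) (f.dcirc q δ)⟩ = δ.1 := f.ext_mfderiv_base_dcirc hq δ
  rw [h1]
  exact congrArg (fun y => coordOneForm α f.center y δ.1) (f.ext_base_circ hq)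

variable (α F) in
/-- The tangent vector `w` of the leaf space at the leaf through `u` lifts to vectors at `u` on
which the contact form is negative. -/
def IsNegative (w : TangentBundle (𝓡 3) F.LeafSpace) (u : CartanProlongation ξ) : Prop :=
  ∃ e : TangentSpace 𝓘(ℝ, E3 × ℝ) u, tangentMap 𝓘(ℝ, E3 × ℝ) (𝓡 3) F.proj ⟨u, e⟩ = w ∧
    α u.base (mfderiv 𝓘(ℝ, E3 × ℝ) (𝓡 3) base u e) < 0

namespace IsNullFibration

variable [T2Space N] (hF : IsNullFibration F)

include hF

/-- When the contact form factors through the differential of the projection as `ℓ`, its sign does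
not depend on the chosen lift. -/
lemma isNegative_circ_iff {f : Frame ξ} {m₀ : F.LeafSpace} {q : E3 × ℝ} (hq : q.1 ∈ f.dom)
    (hm : param F f q ∈ (extChartAt (𝓡 3) m₀).source) {ℓ : E3 → ℝ}
    (hr : ∀ δ : E3 × ℝ, coordOneForm α f.center q.1 δ.1 = ℓ (fderiv ℝ (paramCoord F f m₀) q δ))
    {w : TangentBundle (𝓡 3) F.LeafSpace} (hw : w.1 = param F f q) :
    IsNegative F α w (f.circ q) ↔ ℓ (vecCoord m₀ w) < 0 := by
  have key : ∀ δ, tangentMap 𝓘(ℝ, E3 × ℝ) (𝓡 3) F.proj ⟨f.circ q, f.dcirc q δ⟩ =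
      (⟨param F f q, dparam F f q δ⟩ : TangentBundle (𝓡 3) F.LeafSpace) := fun δ =>
    congrArg (fun z : TangentSpace (𝓡 3) (param F f q) =>
      (⟨param F f q, z⟩ : TangentBundle (𝓡 3) F.LeafSpace)) (hF.dparam_apply f hq δ).symm
  constructor
  · rintro ⟨e, rfl, he⟩
    obtain ⟨δ, rfl⟩ := f.dcirc_surjective hq e
    rw [f.coordOneForm_base hq, hr, hF.fderiv_paramCoord f hq hm] at he
    rwa [key]
  · intro h
    obtain ⟨m, w⟩ := w
    dsimp only at hw
    subst hw
    obtain ⟨δ, rfl⟩ := hF.dparam_surjective f hq w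
    refine ⟨f.dcirc q δ, key δ, ?_⟩
    rwa [f.coordOneForm_base hq, hr, hF.fderiv_paramCoord f hq hm]

variable {g : LorentzMetric F.LeafSpace}
  (hg : g.HasNullCones (pushforwardFibre (engel ξ) F.proj))
  (hα : ContMDiff (𝓡 3).tangent 𝓘(ℝ, ℝ) ∞ (fun v : TangentBundle (𝓡 3) N => α v.1 v.2))
  (hker : ∀ (x : N) (v : TangentSpace (𝓡 3) x), v ∈ ξ.plane x ↔ α x v = 0)

include hg in
/-- A direction transverse to the contact plane. -/
lemma exists_transverse (f : Frame ξ) {m₀ : F.LeafSpace} {q : E3 × ℝ} (hq : q.1 ∈ f.dom)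
    (hm : param F f q ∈ (extChartAt (𝓡 3) m₀).source) :
    ∃ v : E3, coordForm g.form m₀ (paramCoord F f m₀ q) (fderiv ℝ (paramCoord F f m₀) q (0, 1))
      (fderiv ℝ (paramCoord F f m₀) q (v, 0)) ≠ 0 := by
  have hb := LorentzMetric.isConeForm hg
  by_contra! h
  refine hF.fderiv_paramCoord_vertical_ne_zero f hq hm
    ((hF.isLorentzForm_paramCoord f hb hm).eq_zero_of_forall fun w => ?_)
  obtain ⟨δ, rfl⟩ := hF.fderiv_paramCoord_surjective f hq hm w
  have e : δ = (δ.1, 0) + δ.2 • (0, 1) := by ext1 <;> simp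
  rw [e, map_add, map_smul, map_add, map_smul, h, hF.coordForm_null f hb hq hm]
  simp

lemma continuousAt_fderiv_paramCoord (f : Frame ξ) {m₀ : F.LeafSpace} {q : E3 × ℝ} (hq : q.1 ∈ f.dom)
    (hm : param F f q ∈ (extChartAt (𝓡 3) m₀).source) (δ : E3 × ℝ) :
    ContinuousAt (fun x => fderiv ℝ (paramCoord F f m₀) x δ) q :=
  (contDiffAt_fderiv_apply (hF.contDiffAt_paramCoord f hq hm) δ).continuousAt

lemma contDiffAt_coordForm_paramCoord (f : Frame ξ) {m₀ : F.LeafSpace} {q : E3 × ℝ} (hq : q.1 ∈ f.dom)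
    (hm : param F f q ∈ (extChartAt (𝓡 3) m₀).source) :
    ContDiffAt ℝ ∞ (fun x => coordForm g.form m₀ (paramCoord F f m₀ x)) q :=
  ContDiffAt.comp q (g := coordForm g.form m₀)
    (g.contDiffAt_coordForm ((extChartAt (𝓡 3) m₀).map_source hm)) (hF.contDiffAt_paramCoord f hq hm)

include hg hα hker

/-- The contact form is a multiple of the product with the null vector. -/
lemma exists_contactForm_eq (f : Frame ξ) {m₀ : F.LeafSpace} {q : E3 × ℝ} (hq : q.1 ∈ f.dom)
    (hm : param F f q ∈ (extChartAt (𝓡 3) m₀).source) :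
    ∃ r : E3 × ℝ → ℝ, ContinuousAt r q ∧ ∀ᶠ x in 𝓝 q, r x ≠ 0 ∧ ∀ δ : E3 × ℝ,
      coordOneForm α f.center x.1 δ.1 = r x * coordForm g.form m₀ (paramCoord F f m₀ x)
        (fderiv ℝ (paramCoord F f m₀) x (0, 1)) (fderiv ℝ (paramCoord F f m₀) x δ) := by
  have hb := LorentzMetric.isConeForm hg
  obtain ⟨v, hv⟩ := hF.exists_transverse hg f hq hm
  set D : E3 × ℝ → ℝ := fun x => coordForm g.form m₀ (paramCoord F f m₀ x)
    (fderiv ℝ (paramCoord F f m₀) x (0, 1)) (fderiv ℝ (paramCoord F f m₀) x (v, 0)) with hD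
  have hDc : ContinuousAt D q :=
    (((hF.contDiffAt_coordForm_paramCoord f hq hm).continuousAt).clm_apply
      (hF.continuousAt_fderiv_paramCoord f hq hm _)).clm_apply
      (hF.continuousAt_fderiv_paramCoord f hq hm _)
  -- The contact form and the product with the null vector have the same kernel on horizontal
  -- vectors, the contact plane. They are therefore proportional, and the factor is read off on one
  -- transverse vector `v`.
  refine ⟨fun x => coordOneForm α f.center x.1 v / D x, ?_, ?_⟩
  · refine ContinuousAt.div ?_ hDc hv
    exact ContinuousAt.comp (g := fun y => coordOneForm α f.center y v)
      (continuousAt_coordOneForm hα (f.dom_subset hq) v) continuousAt_fst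
  filter_upwards [hF.eventually_mem_source f hq hm, hDc.eventually_ne hv] with x hx hDx
  constructor
  · refine div_ne_zero (fun h0 => hDx ?_) hDx
    rw [f.coordOneForm_eq_zero_iff hker hx.1] at h0
    exact (hF.coordForm_horizontal_eq_zero_iff f hb hx.1 hx.2).2 h0
  · intro δ
    set B := coordForm g.form m₀ (paramCoord F f m₀ x) (fderiv ℝ (paramCoord F f m₀) x (0, 1)) with hB
    set t := B (fderiv ℝ (paramCoord F f m₀) x δ) / D x with ht
    have e : ((δ.1 - t • v, 0) : E3 × ℝ) = δ - δ.2 • (0, 1) - t • (v, 0) := by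
      ext1 <;> simp
    have h1 : B (fderiv ℝ (paramCoord F f m₀) x (δ.1 - t • v, 0)) = 0 := by
      have h2 : B (fderiv ℝ (paramCoord F f m₀) x (0, 1)) = 0 := hF.coordForm_null f hb hx.1 hx.2
      have h3 : B (fderiv ℝ (paramCoord F f m₀) x (v, 0)) = D x := rfl
      rw [e, map_sub, map_sub, map_smul, map_smul, map_sub, map_sub, map_smul, map_smul, h2, h3, ht]
      simp [div_mul_cancel₀ _ hDx]
    have h4 := (f.coordOneForm_eq_zero_iff hker hx.1).2
      ((hF.coordForm_horizontal_eq_zero_iff f hb hx.1 hx.2).1 h1)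
    rw [map_sub, map_smul, sub_eq_zero] at h4
    rw [h4, ht, smul_eq_mul]
    ring

/-- The sign of the contact form on the lifts of a timelike vector is locally constant. -/
lemma eventually_isNegative_iff {X : Type*} [TopologicalSpace X] {x₀ : X}
    {U : X → CartanProlongation ξ} (hU : ContinuousAt U x₀) {m₀ : F.LeafSpace}
    (hm : F.proj (U x₀) ∈ (extChartAt (𝓡 3) m₀).source) {w : X → TangentBundle (𝓡 3) F.LeafSpace}
    (hw : ∀ᶠ x in 𝓝 x₀, (w x).1 = F.proj (U x)) (hwc : ContinuousAt (fun x => vecCoord m₀ (w x)) x₀)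
    (ht : g.form (w x₀).1 (w x₀).2 (w x₀).2 < 0) :
    ∀ᶠ x in 𝓝 x₀, IsNegative F α (w x) (U x) ↔ IsNegative F α (w x₀) (U x₀) := by
  have hb := LorentzMetric.isConeForm hg
  obtain ⟨f, q, hq, hqU⟩ := exists_frame_circ (U x₀)
  have hpm : param F f q = F.proj (U x₀) := congrArg F.proj hqU
  rw [← hpm] at hm
  obtain ⟨r, hrc, hr⟩ := hF.exists_contactForm_eq hg hα hker f hq hm
  have hpol : Tendsto (fun x => f.polar q.2 (U x)) (𝓝 x₀) (𝓝 q) := by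
    have h1 : ContinuousAt (f.polar q.2) (U x₀) := hqU ▸ (f.contMDiffAt_polar hq).continuousAt
    have h2 := (ContinuousAt.comp h1 hU).tendsto
    have h3 := (f.eventually_polar_circ hq).self_of_nhds
    rw [hqU] at h3
    simpa only [Function.comp_def, h3] using h2
  have hcirc : ∀ᶠ x in 𝓝 x₀, f.circ (f.polar q.2 (U x)) = U x := by
    have := f.eventually_circ_polar hq
    rw [hqU] at this
    exact (hU.eventually this).mono fun x hx => hx.2
  set ℓ : E3 × ℝ → E3 → ℝ := fun y z => r y * coordForm g.form m₀ (paramCoord F f m₀ y)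
    (fderiv ℝ (paramCoord F f m₀) y (0, 1)) z with hℓ
  have hiff : ∀ᶠ x in 𝓝 x₀, IsNegative F α (w x) (U x) ↔
      ℓ (f.polar q.2 (U x)) (vecCoord m₀ (w x)) < 0 := by
    filter_upwards [hpol.eventually (hF.eventually_mem_source f hq hm), hpol.eventually hr, hcirc,
      hw] with x h1 h2 h3 h4
    have := hF.isNegative_circ_iff (α := α) h1.1 h1.2 (ℓ := ℓ (f.polar q.2 (U x))) h2.2 (w := w x) (by
      rw [h4, param, h3])
    rwa [h3] at this
  have hpol₀ : f.polar q.2 (U x₀) = q := by rw [← hqU, (f.eventually_polar_circ hq).self_of_nhds]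
  have hcont : ContinuousAt (fun x => ℓ (f.polar q.2 (U x)) (vecCoord m₀ (w x))) x₀ := by
    have hp : ContinuousAt (fun x => f.polar q.2 (U x)) x₀ := by
      rw [ContinuousAt, hpol₀]
      exact hpol
    refine ContinuousAt.mul (ContinuousAt.comp (g := r) (hpol₀.symm ▸ hrc) hp) (.clm_apply ?_ hwc)
    refine ContinuousAt.comp (g := fun y => coordForm g.form m₀ (paramCoord F f m₀ y)
      (fderiv ℝ (paramCoord F f m₀) y (0, 1))) ?_ hp
    rw [hpol₀]
    exact ((hF.contDiffAt_coordForm_paramCoord f hq hm).continuousAt).clm_apply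
      (hF.continuousAt_fderiv_paramCoord f hq hm _)
  -- A timelike vector is never orthogonal to a nonzero null vector. So the continuous function `ℓ`
  -- does not vanish at `x₀` and keeps its sign nearby.
  have hne : ℓ (f.polar q.2 (U x₀)) (vecCoord m₀ (w x₀)) ≠ 0 := by
    rw [hpol₀]
    refine mul_ne_zero hr.self_of_nhds.1 fun h0 => ?_
    have hL := hF.isLorentzForm_paramCoord f hb hm
    have hw0 : (w x₀).1 = param F f q := hw.self_of_nhds.trans hpm.symm
    have h5 : ∀ x : TangentBundle (𝓡 3) F.LeafSpace, x.1 = param F f q →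
        coordForm g.form m₀ (paramCoord F f m₀ q) (vecCoord m₀ x) (vecCoord m₀ x) =
          g.form x.1 x.2 x.2 := by
      rintro ⟨m, v⟩ h
      dsimp only at h
      subst h
      exact coordForm_ext hm v v
    have h6 : coordForm g.form m₀ (paramCoord F f m₀ q) (vecCoord m₀ (w x₀)) (vecCoord m₀ (w x₀)) < 0 :=
      (h5 _ hw0).trans_lt ht
    have h7 := hL.pos_of_orthogonal_timelike h6 ((hL.1 _ _).trans h0)
      (hF.fderiv_paramCoord_vertical_ne_zero f hq hm)
    exact h7.ne' (hF.coordForm_null f hb hq hm)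
  have h8 : ∀ᶠ x in 𝓝 x₀, ℓ (f.polar q.2 (U x)) (vecCoord m₀ (w x)) < 0 ↔
      ℓ (f.polar q.2 (U x₀)) (vecCoord m₀ (w x₀)) < 0 := by
    rcases hne.lt_or_gt with h | h
    · filter_upwards [hcont.eventually (gt_mem_nhds h)] with x hx using iff_of_true hx h
    · filter_upwards [hcont.eventually (lt_mem_nhds h)] with x hx
      exact iff_of_false hx.not_gt h.not_gt
  filter_upwards [hiff, h8] with x h9 h10
  rw [h9, h10, hiff.self_of_nhds]

/-- On a timelike vector, the contact form has the same sign at all points of the leaf. -/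
lemma isNegative_iff_of_proj_eq {u u' : CartanProlongation ξ} (h : F.proj u = F.proj u')
    {w : TangentBundle (𝓡 3) F.LeafSpace} (hw : w.1 = F.proj u) (ht : g.form w.1 w.2 w.2 < 0) :
    IsNegative F α w u ↔ IsNegative F α w u' := by
  obtain ⟨γ, hγ, s, s', rfl, rfl⟩ : ∃ γ : ℝ → CartanProlongation ξ,
      IsMIntegralCurve (I := 𝓘(ℝ, E3 × ℝ)) γ F.field ∧ ∃ s s', γ s = u ∧ γ s' = u' := by
    have h1 : u' ∈ F.leaf u := F.mem_leaf_iff.2 h.symm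
    obtain ⟨γ, h0, hγ, s', hs'⟩ := h1
    exact ⟨γ, hγ, 0, s', h0, hs'⟩
  -- The leaf is the image of a line, so the locally constant sign is constant on it.
  refine isPreconnected_univ.induction₂' (fun s s' => IsNegative F α w (γ s) ↔
    IsNegative F α w (γ s')) (fun t _ => ?_) (fun _ _ _ _ _ _ h1 h2 => h1.trans h2)
    (mem_univ s) (mem_univ s')
  have hp : ∀ t', w.1 = F.proj (γ t') := fun t' => hw.trans (F.proj_integralCurve hγ _ _)
  have hc : Continuous γ := continuous_iff_continuousAt.2 fun t => (hγ t).continuousAt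
  have := hF.eventually_isNegative_iff hg hα hker (x₀ := t) (U := γ) hc.continuousAt
    (m₀ := F.proj (γ t)) (mem_extChartAt_source _) (w := fun _ => w) (.of_forall hp)
    continuousAt_const ht
  rw [nhdsWithin_univ]
  exact this.mono fun x hx => ⟨hx.symm, hx⟩

/-- The null vector dual to the contact form. -/
lemma exists_dual_null (u : CartanProlongation ξ) :
    ∃ K : TangentSpace (𝓡 3) (F.proj u), g.form _ K K = 0 ∧ K ≠ 0 ∧
      ∀ T : TangentSpace (𝓡 3) (F.proj u), IsNegative F α ⟨_, T⟩ u ↔ g.form _ T K < 0 := by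
  have hb := LorentzMetric.isConeForm hg
  obtain ⟨f, q, hq, rfl⟩ := exists_frame_circ u
  have hm : param F f q ∈ (extChartAt (𝓡 3) (param F f q)).source := mem_extChartAt_source _
  obtain ⟨r, -, hr⟩ := hF.exists_contactForm_eq hg hα hker f hq hm
  obtain ⟨hr0, hr⟩ := hr.self_of_nhds
  have hnull := hF.null_dparam f hb hq
  -- The contact form at `u` is the product with this multiple of the null vector.
  refine ⟨r q • dparam F f q (0, 1), ?_, ?_, fun T => ?_⟩
  · have : ∀ (b : E3 →L[ℝ] E3 →L[ℝ] ℝ) (k : E3) (c : ℝ), b k k = 0 → b (c • k) (c • k) = 0 := by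
      intro b k c h
      simp [h]
    exact this _ _ _ hnull
  · exact smul_ne_zero hr0 (hF.dparam_vertical_ne_zero f hq)
  · rw [hF.isNegative_circ_iff (α := α) hq hm (ℓ := fun z => r q * coordForm g.form (param F f q)
      (paramCoord F f (param F f q) q) (fderiv ℝ (paramCoord F f (param F f q)) q (0, 1)) z) hr rfl, hF.fderiv_paramCoord f hq hm]
    have h1 := coordForm_ext (b := g.form) hm (dparam F f q (0, 1)) T
    have h2 : g.form (param F f q) T (r q • dparam F f q (0, 1)) =
        r q * g.form (param F f q) T (dparam F f q (0, 1)) := map_smul (g.form (param F f q) T) _ _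
    have h3 := (g.lorentz (param F f q)).1 T (dparam F f q (0, 1))
    dsimp only at h3
    have h4 : g.form (F.proj (f.circ q)) T (r q • dparam F f q (0, 1)) =
        r q * coordForm g.form (param F f q) (paramCoord F f (param F f q) q)
          (vecCoord (param F f q) ⟨param F f q, dparam F f q (0, 1)⟩)
          (vecCoord (param F f q) ⟨F.proj (f.circ q), T⟩) := by
      refine h2.trans ?_
      rw [h3]
      exact congrArg (fun x => r q * x) h1.symm
    rw [h4]

end IsNullFibration

end TimeOrientation

open CartanProlongation

/-! ### Gluing local timelike fields. -/

section TimeOrientable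

variable {N : Type*} [TopologicalSpace N] [ChartedSpace E3 N] [IsManifold (𝓡 3) ∞ N]
  {ξ : ContactStructure N} {F : OrientedCircleFoliation (CartanProlongation ξ) 𝓘(ℝ, E3 × ℝ)}
  [ChartedSpace E3 F.LeafSpace] [IsManifold (𝓡 3) ∞ F.LeafSpace]

lemma OrientedCircleFoliation.proj_surjective : Function.Surjective F.proj := Quotient.mk_surjective

namespace IsNullFibration

variable [T2Space N] (hF : IsNullFibration F) {g : LorentzMetric F.LeafSpace}
  (hg : g.HasNullCones (pushforwardFibre (engel ξ) F.proj))
  {α : (x : N) → TangentSpace (𝓡 3) x →L[ℝ] ℝ}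
  (hα : ContMDiff (𝓡 3).tangent 𝓘(ℝ, ℝ) ∞ (fun v : TangentBundle (𝓡 3) N => α v.1 v.2))
  (hker : ∀ (x : N) (v : TangentSpace (𝓡 3) x), v ∈ ξ.plane x ↔ α x v = 0)

include hF

/-- A local section of the Cartan prolongation over the leaf space. -/
lemma exists_local_section (u : CartanProlongation ξ) :
    ∃ U : F.LeafSpace → CartanProlongation ξ, ContinuousAt U (F.proj u) ∧ U (F.proj u) = u ∧
      ∀ᶠ m in 𝓝 (F.proj u), F.proj (U m) = m := by
  obtain ⟨s, h1, h2, h3⟩ := exists_section_of_isSubmersionAt (hF.submersion.isSubmersionAt u)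
  exact ⟨s, h2.continuousAt, h1, h3⟩

include hg hα hker

/-- By `exists_dual_null` the sign condition at each point `u` of the leaf reads `g(T, K u) < 0` for
a null vector `K u`; so `convex_timelike` applies. -/
lemma convex_negative (m : F.LeafSpace) : Convex ℝ {T : TangentSpace (𝓡 3) m |
    g.form m T T < 0 ∧ ∀ u, F.proj u = m → IsNegative F α ⟨m, T⟩ u} := by
  have h : ∀ u : {u // F.proj u = m}, ∃ K : TangentSpace (𝓡 3) m, g.form m K K = 0 ∧
      ∀ T : TangentSpace (𝓡 3) m, IsNegative F α ⟨m, T⟩ u.1 ↔ g.form m T K < 0 := by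
    rintro ⟨u, rfl⟩
    obtain ⟨K, h1, -, h2⟩ := hF.exists_dual_null hg hα hker u
    exact ⟨K, h1, h2⟩
  choose K hK hKT using h
  obtain ⟨u₀, hu₀⟩ := F.proj_surjective m
  have h1 := (g.lorentz m).convex_timelike (E := E3) (b := g.form m) (⟨u₀, hu₀⟩ : {u // F.proj u = m})
    K (hK _)
  have h2 : {T : TangentSpace (𝓡 3) m |
      g.form m T T < 0 ∧ ∀ u, F.proj u = m → IsNegative F α ⟨m, T⟩ u} =
      {T : E3 | g.form m T T < 0 ∧ ∀ i, g.form m T (K i) < 0} := by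
    ext T
    exact and_congr_right fun _ => ⟨fun h u => (hKT u T).1 (h u.1 u.2), fun h u hu =>
      (hKT ⟨u, hu⟩ T).2 (h ⟨u, hu⟩)⟩
  exact h2 ▸ h1

lemma exists_negative_timelike (u : CartanProlongation ξ) :
    ∃ T : TangentSpace (𝓡 3) (F.proj u), g.form _ T T < 0 ∧ IsNegative F α ⟨_, T⟩ u := by
  obtain ⟨K, hK, hK0, h⟩ := hF.exists_dual_null hg hα hker u
  obtain ⟨T, hT, -⟩ := (g.lorentz (F.proj u)).2
  have key : ∀ (b : E3 →L[ℝ] E3 →L[ℝ] ℝ) (K T : E3), IsLorentzForm (fun v w => b v w) →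
      b K K = 0 → K ≠ 0 → b T T < 0 → ∃ T', b T' T' < 0 ∧ b T' K < 0 := by
    intro b K T hb hK hK0 hT
    have h1 : b T K ≠ 0 := fun h0 => (hb.pos_of_orthogonal_timelike hT h0 hK0).ne' hK
    rcases h1.lt_or_gt with h2 | h2
    · exact ⟨T, hT, h2⟩
    · exact ⟨-T, by simpa using hT, by simpa using h2⟩
  obtain ⟨T', h1, h2⟩ := key (g.form (F.proj u)) K T (g.lorentz _) hK hK0 hT
  exact ⟨T', h1, (h T').2 h2⟩

/-- A field with constant components in a chart stays timelike near `m₀`. Its sign at the points of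
a local section stays negative by `eventually_isNegative_iff`, and `isNegative_iff_of_proj_eq`
spreads this over each leaf. -/
lemma exists_local_timelike (m₀ : F.LeafSpace) :
    ∃ s : (m : F.LeafSpace) → TangentSpace (𝓡 3) m, ∀ᶠ m in 𝓝 m₀,
      ContMDiffAt (𝓡 3) (𝓡 3).tangent ∞ (fun m => (⟨m, s m⟩ : TangentBundle (𝓡 3) F.LeafSpace)) m ∧
      g.form m (s m) (s m) < 0 ∧ ∀ u, F.proj u = m → IsNegative F α ⟨m, s m⟩ u := by
  obtain ⟨u₀, rfl⟩ := F.proj_surjective m₀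
  set m₀ := F.proj u₀ with hm₀def
  have hm₀ := mem_extChartAt_source (I := 𝓡 3) m₀
  obtain ⟨T, hT, hTn⟩ := hF.exists_negative_timelike hg hα hker u₀
  obtain ⟨U, hUc, hU₀, hU⟩ := hF.exists_local_section u₀
  set w₀ := vecCoord m₀ ⟨m₀, T⟩ with hw₀
  set s : (m : F.LeafSpace) → TangentSpace (𝓡 3) m := fun m =>
    (mfderiv 𝓘(ℝ, E3) (𝓡 3) (extChartAt (𝓡 3) m₀).symm (extChartAt (𝓡 3) m₀ m) w₀ : E3) with hs
  have hsw : ∀ m ∈ (extChartAt (𝓡 3) m₀).source, (⟨m, s m⟩ : TangentBundle (𝓡 3) F.LeafSpace) =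
      vecOfCoord m₀ (extChartAt (𝓡 3) m₀ m, w₀) := fun m hm =>
    congrArg (fun x => (⟨x, (s m : E3)⟩ : TangentBundle (𝓡 3) F.LeafSpace))
      ((extChartAt (𝓡 3) m₀).left_inv hm).symm
  have hsv : ∀ m ∈ (extChartAt (𝓡 3) m₀).source, vecCoord m₀ ⟨m, s m⟩ = w₀ := fun m hm => by
    rw [hsw m hm]
    exact vecCoord_vecOfCoord ((extChartAt (𝓡 3) m₀).map_source hm)
  have hs₀ : s m₀ = T := mfderiv_ext_injective hm₀ (hsv m₀ hm₀)
  have hsrc := (isOpen_extChartAt_source (I := 𝓡 3) m₀).mem_nhds hm₀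
  have hform : ∀ m ∈ (extChartAt (𝓡 3) m₀).source, g.form m (s m) (s m) =
      coordForm g.form m₀ (extChartAt (𝓡 3) m₀ m) w₀ w₀ := fun m hm => by
    rw [← coordForm_ext hm, hsv m hm]
  have htl : ∀ᶠ m in 𝓝 m₀, g.form m (s m) (s m) < 0 := by
    have hc : ContinuousAt (fun m => coordForm g.form m₀ (extChartAt (𝓡 3) m₀ m) w₀ w₀) m₀ := by
      have h1 : ContinuousAt (coordForm g.form m₀) (extChartAt (𝓡 3) m₀ m₀) :=
        (g.contDiffAt_coordForm ((extChartAt (𝓡 3) m₀).map_source hm₀)).continuousAt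
      have h2 := ContinuousAt.comp (g := coordForm g.form m₀) h1 (continuousAt_extChartAt (I := 𝓡 3) m₀)
      exact (h2.clm_apply continuousAt_const).clm_apply continuousAt_const
    have h0 : coordForm g.form m₀ (extChartAt (𝓡 3) m₀ m₀) w₀ w₀ < 0 := by
      rw [← hform m₀ hm₀, hs₀]
      exact hT
    filter_upwards [hsrc, hc.eventually (gt_mem_nhds h0)] with m hm h
    rwa [hform m hm]
  have hneg := hF.eventually_isNegative_iff hg hα hker hUc (m₀ := m₀) (by rw [hU₀]; exact hm₀)
    (w := fun m => ⟨m, s m⟩) (hU.mono fun m hm => hm.symm)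
    ((continuousAt_const (y := w₀)).congr (eventually_of_mem hsrc fun m hm => (hsv m hm).symm))
    htl.self_of_nhds
  refine ⟨s, ?_⟩
  filter_upwards [hsrc, htl, hneg, hU] with m hm h1 h2 h3
  refine ⟨?_, h1, fun u hu => ?_⟩
  · have h4 : ContMDiffAt (𝓡 3) (𝓡 3).tangent ∞
        (fun m => vecOfCoord m₀ (extChartAt (𝓡 3) m₀ m, w₀)) m :=
      ContMDiffAt.comp m (g := vecOfCoord m₀) (f := fun m => (extChartAt (𝓡 3) m₀ m, w₀))
        (contMDiffAt_vecOfCoord ((extChartAt (𝓡 3) m₀).map_source hm))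
        ((contMDiffAt_ext hm).prodMk_space contMDiffAt_const)
    refine h4.congr_of_eventuallyEq ?_
    filter_upwards [(isOpen_extChartAt_source m₀).mem_nhds hm] with y hy using hsw y hy
  · refine (hF.isNegative_iff_of_proj_eq hg hα hker (hu.trans h3.symm) hu.symm h1).2 (h2.2 ?_)
    rw [hU₀]
    change IsNegative F α ⟨m₀, s m₀⟩ u₀
    rw [hs₀]
    exact hTn

end IsNullFibration

/-- A metric with these null cones is time-orientable if the contact structure is coorientable. -/
theorem IsNullFibration.isTimeOrientable [T2Space N] [T2Space F.LeafSpace]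
    [SecondCountableTopology F.LeafSpace] (hF : IsNullFibration F) {g : LorentzMetric F.LeafSpace}
    (hg : g.HasNullCones (pushforwardFibre (engel ξ) F.proj)) (hξ : ξ.IsCoorientable) :
    g.IsTimeOrientable := by
  obtain ⟨α, hα, hker⟩ := hξ
  have : LocallyCompactSpace F.LeafSpace := ChartedSpace.locallyCompactSpace E3 F.LeafSpace
  have : SigmaCompactSpace F.LeafSpace := inferInstance
  -- At each point the admissible timelike vectors form a convex set, so a partition of unity does
  -- not leave the timelike cone.
  obtain ⟨s, hs⟩ := exists_contMDiffSection_forall_mem_convex_of_local (n := (⊤ : ℕ∞)) (𝓡 3)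
    (F_fiber := E3) (fun m : F.LeafSpace => TangentSpace (𝓡 3) m) _
    (hF.convex_negative hg hα hker) (by
      intro m₀
      obtain ⟨s, hs⟩ := hF.exists_local_timelike hg hα hker m₀
      exact ⟨_, hs, s, fun m hm => hm.1.contMDiffWithinAt, fun m hm => hm.2⟩)
  exact ⟨fun m => s m, s.contMDiff, fun m => (hs m).1⟩

end TimeOrientable

/-! ### The null vectors of the metric in polar coordinates -/

open CartanProlongation

lemma eventually_eq_of_hasDerivAt_zero {E : Type*} [NormedAddCommGroup E] [NormedSpace ℝ E]
    {h : ℝ → E} {t₀ : ℝ} (hd : ∀ᶠ t in 𝓝 t₀, HasDerivAt h 0 t) : ∀ᶠ t in 𝓝 t₀, h t = h t₀ := by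
  obtain ⟨ε, hε, hb⟩ := Metric.eventually_nhds_iff_ball.1 hd
  filter_upwards [Metric.ball_mem_nhds t₀ hε] with t ht
  exact Metric.isOpen_ball.is_const_of_deriv_eq_zero (convex_ball t₀ ε).isPreconnected
    (fun s hs => (hb s hs).differentiableAt.differentiableWithinAt) (fun s hs => (hb s hs).deriv) ht
    (Metric.mem_ball_self hε)

section Velocity

variable {M : Type*} [TopologicalSpace M] [ChartedSpace E3 M] [IsManifold (𝓡 3) ∞ M]

lemma vecCoord_velocity {γ : ℝ → M} {t : ℝ} {m₀ : M} (hγ : MDifferentiableAt 𝓘(ℝ, ℝ) (𝓡 3) γ t)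
    (hm : γ t ∈ (extChartAt (𝓡 3) m₀).source) :
    vecCoord m₀ (velocity γ t) = deriv (fun s => extChartAt (𝓡 3) m₀ (γ s)) t := by
  have h1 := (mdifferentiableAt_ext hm).hasMFDerivAt.comp t hγ.hasMFDerivAt
  have h2 : (fderiv ℝ (fun s => extChartAt (𝓡 3) m₀ (γ s)) t : ℝ →L[ℝ] E3) = _ :=
    (mfderiv_eq_fderiv (𝕜 := ℝ) (f := fun s => extChartAt (𝓡 3) m₀ (γ s)) (x := t)).symm.trans
      h1.mfderiv
  rw [← fderiv_apply_one_eq_deriv]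
  exact (congrArg (fun T : ℝ →L[ℝ] E3 => T 1) h2).symm

lemma contMDiffAt_velocity {γ : ℝ → M} {t : ℝ} (hγ : ∀ᶠ s in 𝓝 t, ContMDiffAt 𝓘(ℝ, ℝ) (𝓡 3) ∞ γ s) :
    ContMDiffAt 𝓘(ℝ, ℝ) (𝓡 3).tangent ∞ (velocity γ) t := by
  have hm := mem_extChartAt_source (I := 𝓡 3) (γ t)
  refine (contMDiffAt_tangentBundle_iff (m₀ := γ t) hm).2 ⟨hγ.self_of_nhds, ?_⟩
  have hc : ContDiffAt ℝ ∞ (fun s => extChartAt (𝓡 3) (γ t) (γ s)) t :=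
    ((contMDiffAt_ext hm).comp t hγ.self_of_nhds).contDiffAt
  have hd : ContDiffAt ℝ ∞ (deriv (fun s => extChartAt (𝓡 3) (γ t) (γ s))) t :=
    (hc.fderiv_right (m := ∞) le_rfl).clm_apply contDiffAt_const
  refine hd.contMDiffAt.congr_of_eventuallyEq ?_
  filter_upwards [hγ, hγ.self_of_nhds.continuousAt.eventually
    ((isOpen_extChartAt_source (γ t)).mem_nhds hm)] with s h1 h2
  exact vecCoord_velocity (h1.mdifferentiableAt (by simp)) h2

end Velocity

/-! ### The product of the null vector with horizontal directions. -/

section Pairing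

variable {N : Type*} [TopologicalSpace N] [ChartedSpace E3 N] [IsManifold (𝓡 3) ∞ N]
  {ξ : ContactStructure N} {F : OrientedCircleFoliation (CartanProlongation ξ) 𝓘(ℝ, E3 × ℝ)}
  [ChartedSpace E3 F.LeafSpace] [IsManifold (𝓡 3) ∞ F.LeafSpace]

variable (F) in
/-- The multiples of the derivative of `param` in the angle. -/
def scaledNull (f : Frame ξ) (q : E3 × ℝ) (s : ℝ) : TangentBundle (𝓡 3) F.LeafSpace :=
  ⟨param F f q, s • dparam F f q (0, 1)⟩

/-- The product of the null vector with the image of a horizontal vector. -/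
def pairing (g : LorentzMetric F.LeafSpace) (f : Frame ξ) (q : E3 × ℝ) (v : E3) : ℝ :=
  g.form (param F f q) (dparam F f q (0, 1)) (dparam F f q (v, 0))

namespace IsNullFibration

variable [T2Space N] (hF : IsNullFibration F) {g : LorentzMetric F.LeafSpace} {f : Frame ξ} {m₀ : F.LeafSpace}
  {q : E3 × ℝ} (hq : q.1 ∈ f.dom)

include hF hq

lemma vecCoord_scaledNull (hm : param F f q ∈ (extChartAt (𝓡 3) m₀).source) (s : ℝ) :
    vecCoord m₀ (scaledNull F f q s) = s • fderiv ℝ (paramCoord F f m₀) q (0, 1) := by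
  rw [hF.fderiv_paramCoord f hq hm]
  exact vecCoord_smul _ _ _ _

lemma pairing_eq (hm : param F f q ∈ (extChartAt (𝓡 3) m₀).source) (v : E3) :
    pairing g f q v = coordForm g.form m₀ (paramCoord F f m₀ q)
      (fderiv ℝ (paramCoord F f m₀) q (0, 1)) (fderiv ℝ (paramCoord F f m₀) q (v, 0)) := by
  rw [hF.fderiv_paramCoord f hq hm, hF.fderiv_paramCoord f hq hm]
  exact (coordForm_ext hm _ _).symm

lemma contDiffAt_pairing (v : E3) : ContDiffAt ℝ ∞ (fun x => pairing g f x v) q := by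
  have hm : param F f q ∈ (extChartAt (𝓡 3) (param F f q)).source := mem_extChartAt_source _
  have hQ := hF.contDiffAt_paramCoord f hq hm
  refine (((hF.contDiffAt_coordForm_paramCoord (g := g) f hq hm).clm_apply
    (contDiffAt_fderiv_apply hQ (0, 1))).clm_apply
      (contDiffAt_fderiv_apply hQ (v, 0))).congr_of_eventuallyEq ?_
  filter_upwards [hF.eventually_mem_source f hq hm] with x hx using hF.pairing_eq hx.1 hx.2 v

omit hF hq in
lemma pairing_add_smul (f : Frame ξ) (q : E3 × ℝ) (c : ℝ) (v w : E3) :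
    pairing g f q (v + c • w) = pairing g f q v + c * pairing g f q w := by
  have e : ((v + c • w, 0) : E3 × ℝ) = (v, 0) + c • (w, 0) := by ext1 <;> simp
  unfold pairing
  rw [e, map_add, map_smul, map_add, map_smul, smul_eq_mul]

lemma eventually_param_add : ∀ᶠ x in 𝓝 q, param F f (x + (0, 2 * Real.pi)) = param F f x := by
  filter_upwards [f.eventually_mem_dom hq] with x hx
  refine congrArg F.proj ((f.circ_eq_circ_iff (by simpa using hx) hx).2 ⟨by simp, ?_⟩)
  simp

lemma scaledNull_add (s : ℝ) : scaledNull F f (q + (0, 2 * Real.pi)) s = scaledNull F f q s := by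
  have hm : param F f q ∈ (extChartAt (𝓡 3) (param F f q)).source := mem_extChartAt_source _
  have h := hF.eventually_param_add hq
  have hq' : (q + (0, 2 * Real.pi)).1 ∈ f.dom := by simpa using hq
  have hm' : param F f (q + (0, 2 * Real.pi)) ∈ (extChartAt (𝓡 3) (param F f q)).source := by
    rwa [h.self_of_nhds]
  refine tangent_ext (m₀ := param F f q) hm' h.self_of_nhds ?_
  rw [hF.vecCoord_scaledNull hq' hm', hF.vecCoord_scaledNull hq hm]
  rw [← fderiv_comp_add_right]
  have : (fun x => paramCoord F f (param F f q) (x + (0, 2 * Real.pi))) =ᶠ[𝓝 q]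
      paramCoord F f (param F f q) := h.mono fun x hx => congrArg (extChartAt (𝓡 3) (param F f q)) hx
  rw [this.fderiv_eq]

/-- Periodicity in the angle will make the affine parameter range over the whole line. -/
lemma pairing_add (v : E3) : pairing g f (q + (0, 2 * Real.pi)) v = pairing g f q v := by
  have hm : param F f q ∈ (extChartAt (𝓡 3) (param F f q)).source := mem_extChartAt_source _
  have h := hF.eventually_param_add hq
  have hq' : (q + (0, 2 * Real.pi)).1 ∈ f.dom := by simpa using hq
  have hm' : param F f (q + (0, 2 * Real.pi)) ∈ (extChartAt (𝓡 3) (param F f q)).source := by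
    rwa [h.self_of_nhds]
  rw [hF.pairing_eq hq' hm', hF.pairing_eq hq hm, ← fderiv_comp_add_right]
  have : (fun x => paramCoord F f (param F f q) (x + (0, 2 * Real.pi))) =ᶠ[𝓝 q]
      paramCoord F f (param F f q) := h.mono fun x hx => congrArg (extChartAt (𝓡 3) (param F f q)) hx
  rw [this.fderiv_eq]
  have h0 : paramCoord F f (param F f q) (q + (0, 2 * Real.pi)) = paramCoord F f (param F f q) q :=
    this.self_of_nhds
  rw [h0]

variable (hg : g.HasNullCones (pushforwardFibre (engel ξ) F.proj))

include hg

lemma pairing_eq_zero_iff {v : E3} :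
    pairing g f q v = 0 ↔ ∃ c s : ℝ, v = c • f.V q.1 + s • f.Y q.1 := by
  have hm : param F f q ∈ (extChartAt (𝓡 3) (param F f q)).source := mem_extChartAt_source _
  rw [hF.pairing_eq hq hm]
  exact hF.coordForm_horizontal_eq_zero_iff f (LorentzMetric.isConeForm hg) hq hm

lemma exists_pairing_ne_zero : ∃ v : E3, ∀ θ, pairing g f (q.1, θ) v ≠ 0 := by
  have hm : param F f q ∈ (extChartAt (𝓡 3) (param F f q)).source := mem_extChartAt_source _
  obtain ⟨v, hv⟩ := hF.exists_transverse hg f hq hm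
  rw [← hF.pairing_eq hq hm, Ne, hF.pairing_eq_zero_iff hq hg] at hv
  refine ⟨v, fun θ => ?_⟩
  rwa [Ne, hF.pairing_eq_zero_iff (q := (q.1, θ)) hq hg]

/-- For every angle the functional has the same kernel, the contact plane at the base point, so
these functionals are all proportional. This is what makes the fibres project to geodesics. -/
lemma exists_pairing_eq_mul {v₀ : E3} (hv₀ : ∀ θ, pairing g f (q.1, θ) v₀ ≠ 0) (v : E3) :
    ∃ c : ℝ, ∀ θ, pairing g f (q.1, θ) v = c * pairing g f (q.1, θ) v₀ := by
  set c := pairing g f q v / pairing g f q v₀ with hc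
  have h1 : pairing g f q (v + -c • v₀) = 0 := by
    rw [pairing_add_smul, hc]
    have := hv₀ q.2
    field_simp
    ring
  rw [hF.pairing_eq_zero_iff hq hg] at h1
  refine ⟨c, fun θ => ?_⟩
  have h2 := (hF.pairing_eq_zero_iff (q := (q.1, θ)) hq hg).2 h1
  rw [pairing_add_smul] at h2
  linarith

lemma pairing_dir' (θ : ℝ) : pairing g f (q.1, θ) (f.dir' q) = 0 :=
  (hF.pairing_eq_zero_iff (q := (q.1, θ)) hq hg).2 ⟨_, _, rfl⟩

/-- The derivative in the angle of the product of the null vector with a variation vector. -/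
lemma fderiv_coordForm_vertical (hm : param F f q ∈ (extChartAt (𝓡 3) m₀).source) (v : E3 × ℝ) :
    fderiv ℝ (fun x => coordForm g.form m₀ (paramCoord F f m₀ x)
      (fderiv ℝ (paramCoord F f m₀) x (0, 1)) (fderiv ℝ (paramCoord F f m₀) x v)) q (0, 1) =
      deriv (fun θ => pairing g f (q.1, θ) v.1) q.2 := by
  have hb := LorentzMetric.isConeForm hg
  have h1 : (fun x => coordForm g.form m₀ (paramCoord F f m₀ x)
      (fderiv ℝ (paramCoord F f m₀) x (0, 1)) (fderiv ℝ (paramCoord F f m₀) x v)) =ᶠ[𝓝 q]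
      fun x => pairing g f x v.1 := by
    filter_upwards [hF.eventually_mem_source f hq hm] with x hx
    have e : v = (v.1, 0) + v.2 • (0, 1) := by ext1 <;> simp
    rw [hF.pairing_eq hx.1 hx.2]
    conv_lhs => rw [e]
    rw [map_add, map_smul, map_add, map_smul, hF.coordForm_null f hb hx.1 hx.2]
    simp
  rw [h1.fderiv_eq]
  have h2 := ((hF.contDiffAt_pairing (g := g) hq v.1).differentiableAt (by simp)).hasFDerivAt
  have h3 : HasDerivAt (fun θ : ℝ => (q.1, θ)) ((0, 1) : E3 × ℝ) q.2 :=
    (hasDerivAt_const _ _).prodMk (hasDerivAt_id _)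
  exact (h2.comp_hasDerivAt (f := fun θ : ℝ => (q.1, θ)) q.2 h3).deriv.symm

/-- The Euler-Lagrange form along a curve with velocity proportional to the null vector. -/
lemma geodesicForm_eq (hm : param F f q ∈ (extChartAt (𝓡 3) m₀).source) : ∃ h' : ℝ,
    ∀ (c : ℝ → E3) (x : ℝ → E3 × ℝ) (a : ℝ → ℝ) (t a' β : ℝ), x t = q →
      c t = paramCoord F f m₀ q → HasDerivAt x (β • leafDir F f q + a t • (0, 1)) t →
      HasDerivAt a a' t →
      (∀ᶠ s in 𝓝 t, deriv c s = a s • fderiv ℝ (paramCoord F f m₀) (x s) (0, 1)) →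
      ∀ v : E3 × ℝ,
      coordForm g.form m₀ (c t) (deriv (deriv c) t) (fderiv ℝ (paramCoord F f m₀) q v) +
      fderiv ℝ (fun y => coordForm g.form m₀ y (deriv c t) (fderiv ℝ (paramCoord F f m₀) q v))
        (c t) (deriv c t) -
      (1 / 2) * fderiv ℝ (fun y => coordForm g.form m₀ y (deriv c t) (deriv c t)) (c t)
        (fderiv ℝ (paramCoord F f m₀) q v) =
      a t ^ 2 * deriv (fun θ => pairing g f (q.1, θ) v.1) q.2 +
      (a' + a t * β * h') * pairing g f q v.1 -
      a t * β * coordForm g.form m₀ (paramCoord F f m₀ q)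
        (fderiv ℝ (paramCoord F f m₀) q (f.dir' q, 0)) (fderiv ℝ (paramCoord F f m₀) q v) := by
  have hb := LorentzMetric.isConeForm hg
  obtain ⟨h', hh'⟩ := hF.fderiv_nullVec_leafDir f hq hm
  refine ⟨h', fun c x a t a' β hxt hct hx ha hc v => ?_⟩
  have hB : DifferentiableAt ℝ (coordForm g.form m₀) (paramCoord F f m₀ q) :=
    (g.contDiffAt_coordForm ((extChartAt (𝓡 3) m₀).map_source hm)).differentiableAt (by simp)
  have hs : ∀ x v w, coordForm g.form m₀ x v w = coordForm g.form m₀ x w v :=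
    fun x v w => (g.lorentz _).1 _ _
  have hnull : ∀ᶠ x in 𝓝 q, coordForm g.form m₀ (paramCoord F f m₀ x)
      (fderiv ℝ (paramCoord F f m₀) x (0, 1)) (fderiv ℝ (paramCoord F f m₀) x (0, 1)) = 0 :=
    (hF.eventually_mem_source f hq hm).mono fun x hx => hF.coordForm_null f hb hx.1 hx.2
  -- The vector `leafDir` plays the part of `n`, and the image of `dir'` that of `d`.
  rw [geodesicForm_of_lift hB (hF.contDiffAt_paramCoord f hq hm) hs hnull hh' hxt hct hx ha hc v,
    hF.fderiv_coordForm_vertical hq hg hm v]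
  have e : v = (v.1, 0) + v.2 • (0, 1) := by ext1 <;> simp
  have h2 : coordForm g.form m₀ (paramCoord F f m₀ q) (fderiv ℝ (paramCoord F f m₀) q (0, 1))
      (fderiv ℝ (paramCoord F f m₀) q v) = pairing g f q v.1 := by
    rw [hF.pairing_eq hq hm]
    conv_lhs => rw [e]
    rw [map_add, map_smul, map_add, map_smul, hF.coordForm_null f hb hq hm]
    simp
  rw [h2]

/-- Near a null vector, the null vectors have smooth polar coordinates. -/
lemma exists_lift {s : ℝ} (hs : s ≠ 0) :
    ∃ (X : TangentBundle (𝓡 3) F.LeafSpace → E3 × ℝ) (R : TangentBundle (𝓡 3) F.LeafSpace → ℝ),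
      X (scaledNull F f q s) = q ∧ R (scaledNull F f q s) = s ∧
      ∀ᶠ w in 𝓝 (scaledNull F f q s),
        ContMDiffAt (𝓡 3).tangent 𝓘(ℝ, E3 × ℝ) ∞ X w ∧ ContMDiffAt (𝓡 3).tangent 𝓘(ℝ, ℝ) ∞ R w ∧
        (X w).1 ∈ f.dom ∧
        (g.form w.1 w.2 w.2 = 0 → R w ≠ 0 ∧ w = scaledNull F f (X w) (R w)) := by
  have hb := LorentzMetric.isConeForm hg
  set m₀ := param F f q with hm₀
  have hm : param F f q ∈ (extChartAt (𝓡 3) m₀).source := mem_extChartAt_source _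
  have hsym : ∀ x v w, coordForm g.form m₀ x v w = coordForm g.form m₀ x w v :=
    fun x v w => (g.lorentz _).1 _ _
  have hnull : ∀ᶠ x in 𝓝 q, coordForm g.form m₀ (paramCoord F f m₀ x)
      (fderiv ℝ (paramCoord F f m₀) x (0, 1)) (fderiv ℝ (paramCoord F f m₀) x (0, 1)) = 0 :=
    (hF.eventually_mem_source f hq hm).mono fun x hx => hF.coordForm_null f hb hx.1 hx.2
  obtain ⟨v, hv⟩ := hF.exists_transverse hg f hq hm
  obtain ⟨h', hh'⟩ := hF.fderiv_nullVec_leafDir f hq hm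
  -- Modulo the null vector, its derivative along the leaf is minus the image of `dir'`. It is
  -- therefore orthogonal to the null vector and independent of it, as required.
  obtain ⟨G, hG, hG₀, hGn⟩ := exists_smooth_null_lift (B := coordForm g.form m₀)
    (Q := paramCoord F f m₀) (q := q) (τ := (0, 1)) (by simp) (by simp)
    (g.contDiffAt_coordForm ((extChartAt (𝓡 3) m₀).map_source hm)).continuousAt
    (hF.eventually_contDiffAt_paramCoord f hq hm) (hF.fderiv_paramCoord_surjective f hq hm)
    (hF.fderiv_paramCoord_leafDir f hq hm) (hF.leafDir_ne_zero f hq) hsym hnull hv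
    (by
      rw [hh', map_sub, map_smul, hF.coordForm_null f hb hq hm, hF.coordForm_dir' f hb hq hm]
      simp)
    (fun c hc => hF.fderiv_paramCoord_dir'_ne_smul f hq hm (h' - c) (by
      rw [hh'] at hc
      rw [sub_smul, ← hc]
      abel)) hs
  set C : TangentBundle (𝓡 3) F.LeafSpace → E3 × E3 :=
    fun w => (extChartAt (𝓡 3) m₀ w.1, vecCoord m₀ w) with hC
  have hCs : ∀ w : TangentBundle (𝓡 3) F.LeafSpace, w.1 ∈ (extChartAt (𝓡 3) m₀).source →
      ContMDiffAt (𝓡 3).tangent 𝓘(ℝ, E3 × E3) ∞ C w := fun w hw =>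
    ((contMDiffAt_ext hw).comp w (contMDiffAt_tangent_proj w)).prodMk_space (contMDiffAt_vecCoord hw)
  have hC₀ : C (scaledNull F f q s) =
      (paramCoord F f m₀ q, s • fderiv ℝ (paramCoord F f m₀) q (0, 1)) := by
    rw [← hF.vecCoord_scaledNull hq hm]
    rfl
  have hw₀ : (scaledNull F f q s).1 ∈ (extChartAt (𝓡 3) m₀).source := hm
  have hCt : Tendsto C (𝓝 (scaledNull F f q s))
      (𝓝 (paramCoord F f m₀ q, s • fderiv ℝ (paramCoord F f m₀) q (0, 1))) := by
    rw [← hC₀]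
    exact (hCs _ hw₀).continuousAt
  have hGt : Tendsto (fun z => (G z).1) (𝓝 (paramCoord F f m₀ q, s •
      fderiv ℝ (paramCoord F f m₀) q (0, 1))) (𝓝 q) := by
    have := (continuousAt_fst.comp hG.self_of_nhds.continuousAt).tendsto
    simpa only [Function.comp_def, hG₀] using this
  have hsrc : ∀ᶠ w in 𝓝 (scaledNull F f q s), w.1 ∈ (extChartAt (𝓡 3) m₀).source :=
    (contMDiffAt_tangent_proj _).continuousAt.eventually ((isOpen_extChartAt_source m₀).mem_nhds hw₀)
  refine ⟨fun w => (G (C w)).1, fun w => (G (C w)).2, by simp only [hC₀, hG₀],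
    by simp only [hC₀, hG₀], ?_⟩
  filter_upwards [hsrc, hCt.eventually hG, hCt.eventually hGn,
    (hGt.comp hCt).eventually (hF.eventually_mem_source f hq hm)] with w hw h1 h2 h3
  have h4 := h1.contMDiffAt.comp w (hCs w hw)
  refine ⟨contDiffAt_fst.contMDiffAt.comp w h4, contDiffAt_snd.contMDiffAt.comp w h4, h3.1, ?_⟩
  intro hnw
  obtain ⟨h5, h6, h7⟩ := h2 ((coordForm_ext hw w.2 w.2).trans hnw)
  refine ⟨h7, tangent_ext (m₀ := m₀) hw ?_ ?_⟩
  · exact (extChartAt (𝓡 3) m₀).injOn hw h3.2 h5.symm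
  · exact h6.trans (hF.vecCoord_scaledNull h3.1 h3.2 _).symm

end IsNullFibration

end Pairing

/-! ### Null geodesics in polar coordinates -/

open CartanProlongation

section NullGeodesics

variable {N : Type*} [TopologicalSpace N] [ChartedSpace E3 N] [IsManifold (𝓡 3) ∞ N]
  {ξ : ContactStructure N} {F : OrientedCircleFoliation (CartanProlongation ξ) 𝓘(ℝ, E3 × ℝ)}
  [ChartedSpace E3 F.LeafSpace] [IsManifold (𝓡 3) ∞ F.LeafSpace]

namespace IsNullFibration

variable [T2Space N] (hF : IsNullFibration F) {g : LorentzMetric F.LeafSpace} {f : Frame ξ}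
  {q : E3 × ℝ} (hq : q.1 ∈ f.dom) (hg : g.HasNullCones (pushforwardFibre (engel ξ) F.proj))

include hF hq hg

lemma isNull_scaledNull {s : ℝ} (hs : s ≠ 0) : g.IsNull (scaledNull F f q s) := by
  refine ⟨smul_ne_zero hs (hF.dparam_vertical_ne_zero f hq), ?_⟩
  have h := hF.mem_pushforwardFibre_param f hq s
  rw [hg] at h
  exact h

/-- In polar coordinates, a null geodesic moves in the fibres of the Cartan prolongation. -/
lemma eventually_velocity_eq {γ : ℝ → F.LeafSpace} {J : Set ℝ} (hJ : IsOpen J)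
    (hgeo : g.IsGeodesicOn γ J) (hnull : ∀ t ∈ J, g.IsNull (velocity γ t)) {t₀ : ℝ} (ht₀ : t₀ ∈ J)
    {s : ℝ} (hs : s ≠ 0) (hv : velocity γ t₀ = scaledNull F f q s) (v₀ : E3) :
    ∃ θ r : ℝ → ℝ, θ t₀ = q.2 ∧ ∀ᶠ t in 𝓝 t₀, HasDerivAt θ (r t) t ∧
      velocity γ t = scaledNull F f (q.1, θ t) (r t) ∧
      r t * pairing g f (q.1, θ t) v₀ = s * pairing g f q v₀ := by
  obtain ⟨X, R, hX₀, hR₀, hXR⟩ := hF.exists_lift hq hg hs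
  have hγ : ∀ t ∈ J, ContMDiffAt 𝓘(ℝ, ℝ) (𝓡 3) ∞ γ t := fun t ht =>
    (hgeo.1 t ht).contMDiffAt (hJ.mem_nhds ht)
  have hvs : ∀ t ∈ J, ContMDiffAt 𝓘(ℝ, ℝ) (𝓡 3).tangent ∞ (velocity γ) t := fun t ht =>
    contMDiffAt_velocity (eventually_of_mem (hJ.mem_nhds ht) hγ)
  set x : ℝ → E3 × ℝ := fun t => X (velocity γ t) with hx
  set r : ℝ → ℝ := fun t => R (velocity γ t) with hr
  have hE : ∀ᶠ t in 𝓝 t₀, t ∈ J ∧ ContDiffAt ℝ ∞ x t ∧ ContDiffAt ℝ ∞ r t ∧ (x t).1 ∈ f.dom ∧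
      r t ≠ 0 ∧ velocity γ t = scaledNull F f (x t) (r t) := by
    have h1 := (hvs t₀ ht₀).continuousAt.eventually (hv ▸ hXR)
    filter_upwards [hJ.mem_nhds ht₀, h1] with t ht h2
    obtain ⟨h3, h4, h5, h6⟩ := h2
    obtain ⟨h7, h8⟩ := h6 (hnull t ht).2
    exact ⟨ht, (h3.comp t (hvs t ht)).contDiffAt, (h4.comp t (hvs t ht)).contDiffAt, h5, h7, h8⟩
  have key : ∀ t, (∀ᶠ s in 𝓝 t, s ∈ J ∧ ContDiffAt ℝ ∞ x s ∧ ContDiffAt ℝ ∞ r s ∧ (x s).1 ∈ f.dom ∧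
      r s ≠ 0 ∧ velocity γ s = scaledNull F f (x s) (r s)) → HasDerivAt x (0, r t) t ∧
      r t ^ 2 * deriv (fun θ => pairing g f ((x t).1, θ) v₀) (x t).2 +
        deriv r t * pairing g f (x t) v₀ = 0 := by
    intro t hEt
    obtain ⟨htJ, hxt, hrt, hdom, hr0, hvt⟩ := hEt.self_of_nhds
    have hp : ∀ s, velocity γ s = scaledNull F f (x s) (r s) → γ s = param F f (x s) := fun s hs =>
      congrArg (fun w => w.1) hs
    have hm : param F f (x t) ∈ (extChartAt (𝓡 3) (γ t)).source := by
      rw [← hp t hvt]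
      exact mem_extChartAt_source _
    set Q := paramCoord F f (γ t) with hQ
    set c : ℝ → E3 := fun s => extChartAt (𝓡 3) (γ t) (γ s) with hc
    have hcQ : c =ᶠ[𝓝 t] fun s => Q (x s) := hEt.mono fun s hs =>
      congrArg (extChartAt (𝓡 3) (γ t)) (hp s hs.2.2.2.2.2)
    have hcd : ∀ᶠ s in 𝓝 t, deriv c s = r s • fderiv ℝ Q (x s) (0, 1) := by
      filter_upwards [hEt, hxt.continuousAt.eventually (hF.eventually_mem_source f hdom hm)]
        with s h1 h2
      have h3 : γ s ∈ (extChartAt (𝓡 3) (γ t)).source := by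
        rw [hp s h1.2.2.2.2.2]
        exact h2.2
      rw [← hF.vecCoord_scaledNull h2.1 h2.2, ← h1.2.2.2.2.2]
      exact (vecCoord_velocity ((hγ s h1.1).mdifferentiableAt (by simp)) h3).symm
    have hQd : HasFDerivAt Q (fderiv ℝ Q (x t)) (x t) :=
      ((hF.contDiffAt_paramCoord f hdom hm).differentiableAt (by simp)).hasFDerivAt
    have hxd : HasDerivAt x (deriv x t) t := (hxt.differentiableAt (by simp)).hasDerivAt
    -- The lift `x` projects to the geodesic, whose velocity is `r` times the null vector; so `x'`
    -- differs from `r ∂_θ` by a multiple of `leafDir`.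
    have h1 : fderiv ℝ Q (x t) (deriv x t - r t • (0, 1)) = 0 := by
      rw [map_sub, map_smul, ← hcd.self_of_nhds, hcQ.deriv_eq, sub_eq_zero]
      exact ((hQd.comp_hasDerivAt t hxd).deriv).symm
    obtain ⟨β, hβ⟩ := (hF.fderiv_paramCoord_eq_zero_iff f hdom hm).1 h1
    have hxd' : HasDerivAt x (β • leafDir F f (x t) + r t • (0, 1)) t := by
      rwa [← hβ, sub_add_cancel]
    have hrd : HasDerivAt r (deriv r t) t := (hrt.differentiableAt (by simp)).hasDerivAt
    obtain ⟨h', hform⟩ := hF.geodesicForm_eq hdom hg hm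
    have hEL : ∀ v : E3 × ℝ, r t ^ 2 * deriv (fun θ => pairing g f ((x t).1, θ) v.1) (x t).2 +
        (deriv r t + r t * β * h') * pairing g f (x t) v.1 -
        r t * β * coordForm g.form (γ t) (Q (x t)) (fderiv ℝ Q (x t) (f.dir' (x t), 0))
          (fderiv ℝ Q (x t) v) = 0 := fun v =>
      (hform c x r t (deriv r t) β rfl hcQ.self_of_nhds hxd' hrd hcd v).symm.trans
        (hgeo.2 t htJ (fderiv ℝ Q (x t) v))
    -- The geodesic equation is tested on the image of `dir'`. Its pairings vanish for all angles,
    -- so only `-r β` times a positive square remains.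
    have hβ0 : β = 0 := by
      have h2 := hEL (f.dir' (x t), 0)
      have h3 : (fun θ => pairing g f ((x t).1, θ) (f.dir' (x t))) = fun _ => 0 :=
        funext fun θ => hF.pairing_dir' hdom hg θ
      have h4 : pairing g f (x t) (f.dir' (x t)) = 0 := hF.pairing_dir' hdom hg (x t).2
      have h5 := hF.coordForm_dir'_pos f (LorentzMetric.isConeForm hg) hdom hm
      rw [h4, h3, deriv_const, mul_zero, mul_zero, zero_add, zero_sub, neg_eq_zero] at h2
      exact (mul_eq_zero.1 ((mul_eq_zero.1 h2).resolve_right h5.ne')).resolve_left hr0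
    subst hβ0
    constructor
    · simpa using hxd'
    · simpa using hEL (v₀, 0)
  have hx₀ : x t₀ = q := by rw [hx, ← hX₀, ← hv]
  have hr₀ : r t₀ = s := by rw [hr, ← hR₀, ← hv]
  have hy : ∀ᶠ t in 𝓝 t₀, (x t).1 = q.1 := by
    have h1 : ∀ᶠ t in 𝓝 t₀, HasDerivAt (fun t => (x t).1) 0 t :=
      hE.eventually_nhds.mono fun t ht => (key t ht).1.fst
    simpa only [hx₀] using eventually_eq_of_hasDerivAt_zero h1
  have hθ : ∀ᶠ t in 𝓝 t₀, HasDerivAt (fun t => (x t).2) (r t) t :=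
    hE.eventually_nhds.mono fun t ht => (key t ht).1.snd
  -- With `β = 0` the equation in the direction `v₀` says that the derivative of this product,
  -- divided by `1`, is `r ^ 2 φ' + r' φ = 0` for `φ` the pairing with `v₀`.
  have hcons : ∀ᶠ t in 𝓝 t₀, r t * pairing g f (q.1, (x t).2) v₀ = s * pairing g f q v₀ := by
    have h1 : ∀ᶠ t in 𝓝 t₀, HasDerivAt (fun t => r t * pairing g f (q.1, (x t).2) v₀) 0 t := by
      filter_upwards [hE.eventually_nhds, hθ, hy] with t h2 h3 h4
      have h5 := (key t h2).2
      have h6 : HasDerivAt r (deriv r t) t :=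
        (h2.self_of_nhds.2.2.1.differentiableAt (by simp)).hasDerivAt
      have h7 : HasDerivAt (fun θ => pairing g f (q.1, θ) v₀)
          (deriv (fun θ => pairing g f (q.1, θ) v₀) (x t).2) (x t).2 := by
        have h8 : ContDiffAt ℝ ∞ (fun x => pairing g f x v₀) (q.1, (x t).2) :=
          hF.contDiffAt_pairing (q := (q.1, (x t).2)) hq v₀
        have h9 : ContDiffAt ℝ ∞ (fun θ => pairing g f (q.1, θ) v₀) (x t).2 :=
          ContDiffAt.comp (f := fun θ : ℝ => (q.1, θ)) (g := fun x => pairing g f x v₀) (x t).2 h8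
            (contDiffAt_const.prodMk contDiffAt_id)
        exact (h9.differentiableAt (by simp)).hasDerivAt
      have h8 := h6.mul (h7.comp (h := fun t => (x t).2) t h3)
      have h9 : x t = (q.1, (x t).2) := Prod.ext h4 rfl
      rw [h4, h9] at h5
      dsimp only at h5
      refine HasDerivAt.congr_deriv h8 ?_
      simp only [Function.comp_apply]
      linear_combination h5
    have h2 := eventually_eq_of_hasDerivAt_zero h1
    simpa only [hx₀, hr₀] using h2
  refine ⟨fun t => (x t).2, r, congrArg Prod.snd hx₀, ?_⟩
  filter_upwards [hE, hy, hθ, hcons] with t h1 h2 h3 h4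
  refine ⟨h3, ?_, h4⟩
  rw [h1.2.2.2.2.2]
  congr 1
  exact Prod.ext h2 rfl

/-- The model of a null geodesic. -/
lemma isGeodesicOn_model {φ S : ℝ → ℝ} {v₀ : E3} (hφ : ∀ θ, φ θ = pairing g f (q.1, θ) v₀)
    (hφ0 : ∀ θ, φ θ ≠ 0) (hS : ContDiff ℝ ∞ S) (hSd : ∀ τ, HasDerivAt S (φ (S τ))⁻¹ τ) (A B : ℝ) :
    g.IsGeodesicOn (fun t => param F f (q.1, S (A * t + B))) univ ∧
      ∀ t, velocity (fun t => param F f (q.1, S (A * t + B))) t =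
        scaledNull F f (q.1, S (A * t + B)) (A / φ (S (A * t + B))) := by
  set γ : ℝ → F.LeafSpace := fun t => param F f (q.1, S (A * t + B)) with hγdef
  set x : ℝ → E3 × ℝ := fun t => (q.1, S (A * t + B)) with hx
  set a : ℝ → ℝ := fun t => A / φ (S (A * t + B)) with ha
  have hxs : ContDiff ℝ ∞ x := contDiff_const.prodMk (hS.comp (by fun_prop))
  have hγs : ∀ t, ContMDiffAt 𝓘(ℝ, ℝ) (𝓡 3) ∞ γ t := fun t =>
    ContMDiffAt.comp t (g := param F f) (f := x) (hF.contMDiffAt_param f (q := x t) hq)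
      hxs.contMDiff.contMDiffAt
  have hlin : ∀ t, HasDerivAt (fun t => A * t + B) A t := fun t => by
    simpa using ((hasDerivAt_id t).const_mul A).add_const B
  have hSt : ∀ t, HasDerivAt (fun t => S (A * t + B)) (a t) t := fun t => by
    have := (hSd (A * t + B)).comp t (hlin t)
    rwa [inv_mul_eq_div] at this
  have hxd : ∀ t, HasDerivAt x (a t • (0, 1)) t := fun t => by
    have := (hasDerivAt_const t q.1).prodMk (hSt t)
    convert this using 1
    simp
  have hsrc : ∀ t, ∀ᶠ s in 𝓝 t, param F f (x s) ∈ (extChartAt (𝓡 3) (γ t)).source := fun t =>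
    (hxs.continuous.continuousAt.eventually (hF.eventually_mem_source f (q := x t) hq
      (mem_extChartAt_source (γ t)))).mono fun s hs => hs.2
  have hcd : ∀ t m₀, param F f (x t) ∈ (extChartAt (𝓡 3) m₀).source →
      deriv (fun s => extChartAt (𝓡 3) m₀ (γ s)) t = a t • fderiv ℝ (paramCoord F f m₀) (x t) (0, 1) := by
    intro t m₀ hm
    have hQd : HasFDerivAt (paramCoord F f m₀) (fderiv ℝ (paramCoord F f m₀) (x t)) (x t) :=
      ((hF.contDiffAt_paramCoord f (q := x t) hq hm).differentiableAt (by simp)).hasFDerivAt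
    have := (hQd.comp_hasDerivAt t (hxd t)).deriv
    rw [map_smul] at this
    exact this
  refine ⟨⟨fun t _ => (hγs t).contMDiffWithinAt, fun t _ w => ?_⟩, fun t => ?_⟩
  · have hm : param F f (x t) ∈ (extChartAt (𝓡 3) (γ t)).source := mem_extChartAt_source (γ t)
    obtain ⟨v, rfl⟩ := hF.fderiv_paramCoord_surjective f (q := x t) hq hm w
    obtain ⟨h', hform⟩ := hF.geodesicForm_eq (q := x t) hq hg hm
    have hφs : ContDiff ℝ ∞ φ := by
      rw [contDiff_iff_contDiffAt]
      intro θ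
      have h9 : ContDiffAt ℝ ∞ (fun θ => pairing g f (q.1, θ) v₀) θ :=
        ContDiffAt.comp (f := fun θ : ℝ => (q.1, θ)) (g := fun x => pairing g f x v₀) θ
          (hF.contDiffAt_pairing (q := (q.1, θ)) hq v₀) (contDiffAt_const.prodMk contDiffAt_id)
      exact h9.congr_of_eventuallyEq (.of_forall hφ)
    have hφd : HasDerivAt φ (deriv φ (x t).2) (x t).2 :=
      (hφs.contDiffAt.differentiableAt (by simp)).hasDerivAt
    -- The product of `a` with `φ` along the curve is the constant `A`; this is the derivative that
    -- results.
    have had : HasDerivAt a (-(a t) ^ 2 * deriv φ (x t).2 / φ (x t).2) t := by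
      have h1 := (hφd.comp (h := fun t => S (A * t + B)) t (hSt t))
      have h2 := (hasDerivAt_const t A).div h1 (hφ0 _)
      refine HasDerivAt.congr_deriv h2 ?_
      have h3 : a t * φ (x t).2 = A := div_mul_cancel₀ _ (hφ0 _)
      change (0 * φ (x t).2 - A * (deriv φ (x t).2 * a t)) / φ (x t).2 ^ 2 = _
      rw [← h3]
      have := hφ0 (x t).2
      field_simp
      ring
    have h1 := hform (fun s => extChartAt (𝓡 3) (γ t) (γ s)) x a t _ 0 rfl rfl
      (by simpa using hxd t) had ((hsrc t).mono fun s hs => hcd s _ hs) v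
    refine h1.trans ?_
    -- By proportionality the geodesic form becomes `c (a ^ 2 φ' + a' φ)`, which is zero because `a
    -- φ` is constant.
    obtain ⟨c, hc⟩ := hF.exists_pairing_eq_mul hq hg (v₀ := v₀) (fun θ => hφ θ ▸ hφ0 θ) v.1
    have h2 : (fun θ => pairing g f ((x t).1, θ) v.1) = fun θ => c * φ θ := by
      funext θ
      rw [hφ]
      exact hc θ
    have h3 : pairing g f (x t) v.1 = c * φ (x t).2 := congrFun h2 _
    rw [h2, h3, deriv_const_mul _ hφd.differentiableAt]
    have := hφ0 (x t).2
    field_simp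
    ring
  · have hm : param F f (x t) ∈ (extChartAt (𝓡 3) (γ t)).source := mem_extChartAt_source (γ t)
    refine tangent_ext (m₀ := γ t) hm rfl ?_
    rw [vecCoord_velocity ((hγs t).mdifferentiableAt (by simp)) hm, hcd t _ hm]
    exact (hF.vecCoord_scaledNull (q := x t) hq hm _).symm

end IsNullFibration

end NullGeodesics

/-- A primitive of a nowhere vanishing periodic smooth function is a diffeomorphism of the line. -/
lemma exists_periodic_primitive {φ : ℝ → ℝ} (hφ : ContDiff ℝ ∞ φ) (h0 : ∀ x, φ x ≠ 0) {p : ℝ}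
    (hp : p ≠ 0) (hper : Function.Periodic φ p) :
    ∃ (T S : ℝ → ℝ) (C : ℝ), ContDiff ℝ ∞ S ∧ (∀ x, HasDerivAt T (φ x) x) ∧
      (∀ τ, HasDerivAt S (φ (S τ))⁻¹ τ) ∧ (∀ x, S (T x) = x) ∧ (∀ τ, T (S τ) = τ) ∧
      ∀ (n : ℤ) x, T (x + n * p) = T x + n * C := by
  obtain ⟨T, S, hT, hTd, ho, hoc, hST, hS⟩ := exists_primitive_with_inverse hφ h0
  have h1 : ∀ x, T (x + p) = T x + (T p - T 0) := by
    intro x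
    have hd : ∀ x, HasDerivAt (fun x => T (x + p) - T x) 0 x := fun x => by
      have := ((hTd (x + p)).comp_add_const x p).sub (hTd x)
      rwa [hper, sub_self] at this
    have := is_const_of_deriv_eq_zero (fun x => (hd x).differentiableAt) (fun x => (hd x).deriv) x 0
    simp only [zero_add] at this
    linarith
  set C := T p - T 0 with hC
  have hper' : ∀ (n : ℤ) x, T (x + n * p) = T x + n * C := by
    intro n
    induction n using Int.induction_on with
    | zero => simp
    | succ n ih =>
      intro x
      have h2 := h1 (x + n * p)
      have h3 := ih x
      push_cast at h3 ⊢
      rw [add_mul, one_mul, ← add_assoc, h2, h3]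
      ring
    | pred n ih =>
      intro x
      have h2 := h1 (x + (-(n : ℤ) - 1 : ℤ) * p)
      have h3 := ih x
      push_cast at h2 h3 ⊢
      rw [show x + (-(n : ℝ) - 1) * p + p = x + -(n : ℝ) * p by ring, h3] at h2
      linarith
  -- A zero increment over a period would contradict the injectivity of `T`.
  have hC0 : C ≠ 0 := by
    intro h
    have h2 := h1 0
    rw [h, zero_add, add_zero] at h2
    have := congrArg S h2
    rw [hST, hST] at this
    exact hp this
  -- The range is an interval that contains `T 0 + n C` for all integers `n`, so it is unbounded on
  -- both sides.
  have huniv : range T = univ := by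
    refine eq_univ_of_forall fun τ => ?_
    have key : ∀ z : ℝ, ∃ n : ℤ, z ≤ n * C := by
      intro z
      rcases hC0.lt_or_gt with h | h
      · obtain ⟨n, hn⟩ := exists_int_lt (z / C)
        exact ⟨n, by rw [lt_div_iff_of_neg h] at hn; exact hn.le⟩
      · obtain ⟨n, hn⟩ := exists_int_gt (z / C)
        exact ⟨n, by rw [div_lt_iff₀ h] at hn; exact hn.le⟩
    obtain ⟨n, hn⟩ := key (τ - T 0)
    obtain ⟨k, hk⟩ := key (T 0 - τ)
    refine hoc.out (mem_range_self (0 + ((-k : ℤ) : ℝ) * p)) (mem_range_self (0 + n * p)) ⟨?_, ?_⟩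
    · rw [hper']
      push_cast
      linarith
    · rw [hper']
      linarith
  have hTS : ∀ τ, T (S τ) = τ := by
    intro τ
    obtain ⟨x, rfl⟩ : τ ∈ range T := huniv ▸ mem_univ τ
    rw [hST]
  have hSs : ContDiff ℝ ∞ S := by
    rw [huniv] at hS
    exact contDiffOn_univ.1 hS
  refine ⟨T, S, C, hSs, hTd, fun τ => ?_, hST, hTS, hper'⟩
  exact HasDerivAt.of_local_left_inverse hSs.continuous.continuousAt (hTd _) (h0 _)
    (.of_forall hTS)

/-! ### Classification of the null geodesics -/

open CartanProlongation

section Classification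

variable {N : Type*} [TopologicalSpace N] [ChartedSpace E3 N] [IsManifold (𝓡 3) ∞ N]
  {ξ : ContactStructure N} {F : OrientedCircleFoliation (CartanProlongation ξ) 𝓘(ℝ, E3 × ℝ)}
  [ChartedSpace E3 F.LeafSpace] [IsManifold (𝓡 3) ∞ F.LeafSpace]

variable (F) in
/-- The set of leaves which meet the fibre of the Cartan prolongation over `x`. -/
def nullCurve (x : N) : Set F.LeafSpace := F.proj '' (base ⁻¹' {x})

variable (F) in
/-- The vector `w` is the projection of a vector of the Engel structure over `x`. -/
def IsRayTangent (w : TangentBundle (𝓡 3) F.LeafSpace) (x : N) : Prop :=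
  ∃ u : CartanProlongation ξ, u.base = x ∧ w ∈ pushforward (engel ξ) F.proj u

lemma nullCurve_eq_range {f : Frame ξ} {y : E3} (hy : y ∈ f.dom) :
    nullCurve F ((extChartAt (𝓡 3) f.center).symm y) = range fun θ => param F f (y, θ) := by
  have ht := f.dom_subset hy
  have hc : f.Covers ((extChartAt (𝓡 3) f.center).symm y) :=
    ⟨(extChartAt (𝓡 3) f.center).map_target ht, by rwa [(extChartAt (𝓡 3) f.center).right_inv ht]⟩
  rw [nullCurve, base_preimage_singleton hc, (extChartAt (𝓡 3) f.center).right_inv ht, ← range_comp]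
  rfl

namespace IsNullFibration

variable [T2Space N] (hF : IsNullFibration F) {g : LorentzMetric F.LeafSpace} {f f' : Frame ξ}
  {q q' : E3 × ℝ} {s s' : ℝ}

include hF

lemma circ_eq_of_scaledNull_eq (hq : q.1 ∈ f.dom) (hq' : q'.1 ∈ f'.dom) (hs : s ≠ 0)
    (h : scaledNull F f q s = scaledNull F f' q' s') : f.circ q = f'.circ q' := by
  refine hF.circ_eq_of_nullVec_eq (s := s⁻¹ * s') hq hq' ?_
  have key : ∀ (m m' : F.LeafSpace) (v : TangentSpace (𝓡 3) m) (v' : TangentSpace (𝓡 3) m'),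
      (⟨m, v⟩ : TangentBundle (𝓡 3) F.LeafSpace) = ⟨m', v'⟩ → ∀ r : ℝ,
      (⟨m, r • v⟩ : TangentBundle (𝓡 3) F.LeafSpace) = ⟨m', r • v'⟩ := by
    intro m m' v v' h r
    cases h
    rfl
  have h1 := key _ _ _ _ h s⁻¹
  rwa [smul_smul, smul_smul, inv_mul_cancel₀ hs, one_smul] at h1

lemma scaledNull_scale_injective (hq : q.1 ∈ f.dom) (h : scaledNull F f q s = scaledNull F f q s') :
    s = s' := by
  have hm : param F f q ∈ (extChartAt (𝓡 3) (param F f q)).source := mem_extChartAt_source _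
  have h1 := congrArg (vecCoord (param F f q)) h
  rw [hF.vecCoord_scaledNull hq hm, hF.vecCoord_scaledNull hq hm] at h1
  exact smul_left_injective ℝ (hF.fderiv_paramCoord_vertical_ne_zero f hq hm) h1

lemma isRayTangent_scaledNull (hq : q.1 ∈ f.dom) : IsRayTangent F (scaledNull F f q s) (f.circ q).base :=
  ⟨f.circ q, rfl, (hF.mem_pushforward_circ f hq).2 ⟨s, rfl⟩⟩

lemma isRayTangent_scaledNull_iff (hq : q.1 ∈ f.dom) (hs : s ≠ 0) {x : N} :
    IsRayTangent F (scaledNull F f q s) x ↔ x = (f.circ q).base := by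
  refine ⟨?_, fun h => h ▸ hF.isRayTangent_scaledNull hq⟩
  rintro ⟨u, rfl, hu⟩
  obtain ⟨f', q', hq', rfl⟩ := exists_frame_circ u
  obtain ⟨s', h⟩ := (hF.mem_pushforward_circ f' hq').1 hu
  rw [hF.circ_eq_of_scaledNull_eq hq hq' hs h]

lemma exists_eq_scaledNull (hg : g.HasNullCones (pushforwardFibre (engel ξ) F.proj))
    {w : TangentBundle (𝓡 3) F.LeafSpace} (hw : g.IsNull w) :
    ∃ (f : Frame ξ) (q : E3 × ℝ) (s : ℝ), q.1 ∈ f.dom ∧ s ≠ 0 ∧ w = scaledNull F f q s := by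
  have h1 : w.2 ∈ pushforwardFibre (engel ξ) F.proj w.1 := by
    rw [hg]
    exact hw.2
  obtain ⟨f, q, s, hq, h⟩ := hF.exists_of_mem_pushforwardFibre h1
  refine ⟨f, q, s, hq, ?_, h⟩
  rintro rfl
  rw [zero_smul] at h
  have key : ∀ (w : TangentBundle (𝓡 3) F.LeafSpace) (m : F.LeafSpace), w = ⟨m, 0⟩ → w.2 = 0 := by
    rintro _ m rfl
    rfl
  exact hw.1 (key _ _ h)

lemma exists_eq_scaledNull_of_covers {w : TangentBundle (𝓡 3) F.LeafSpace} (hw : w.2 ≠ 0) {x : N}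
    (hwx : IsRayTangent F w x) (hf : f.Covers x) :
    ∃ θ s, s ≠ 0 ∧ w = scaledNull F f (extChartAt (𝓡 3) f.center x, θ) s := by
  obtain ⟨u, rfl, hu⟩ := hwx
  obtain ⟨θ, hθ⟩ := f.exists_circ_eq hf.1 hf.2
  rw [← hθ] at hu
  obtain ⟨s, h⟩ := (hF.mem_pushforward_circ f (q := (_, θ)) hf.2).1 hu
  refine ⟨θ, s, ?_, h⟩
  rintro rfl
  rw [zero_smul] at h
  have key : ∀ (w : TangentBundle (𝓡 3) F.LeafSpace) (m : F.LeafSpace), w = ⟨m, 0⟩ → w.2 = 0 := by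
    rintro _ m rfl
    rfl
  exact hw (key _ _ h)

variable (hg : g.HasNullCones (pushforwardFibre (engel ξ) F.proj))

include hg

/-- The parametrisations of the null geodesic given by a fibre of the Cartan prolongation. -/
lemma exists_model {y : E3} (hy : y ∈ f.dom) : ∃ mv : ℝ → ℝ → TangentBundle (𝓡 3) F.LeafSpace,
    (∀ A B, A ≠ 0 → g.IsMaximalNullGeodesic (fun t => (mv A (A * t + B)).1) univ ∧
      (∀ t, velocity (fun t => (mv A (A * t + B)).1) t = mv A (A * t + B)) ∧
      range (fun t => (mv A (A * t + B)).1) = nullCurve F ((extChartAt (𝓡 3) f.center).symm y)) ∧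
    (∀ θ s, s ≠ 0 → ∃ A τ, A ≠ 0 ∧ mv A τ = scaledNull F f (y, θ) s) ∧
    (∀ A B A' B' t, A ≠ 0 → mv A (A * t + B) = mv A' (A' * t + B') →
      ∀ t', mv A (A * t' + B) = mv A' (A' * t' + B')) ∧
    ∀ (γ : ℝ → F.LeafSpace) (J : Set ℝ), IsOpen J → g.IsGeodesicOn γ J →
      (∀ t ∈ J, g.IsNull (velocity γ t)) → ∀ t₀ ∈ J, ∀ θ s, s ≠ 0 →
      velocity γ t₀ = scaledNull F f (y, θ) s → ∃ A B, A ≠ 0 ∧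
      ∀ᶠ t in 𝓝 t₀, velocity γ t = mv A (A * t + B) := by
  obtain ⟨v₀, hv₀⟩ := hF.exists_pairing_ne_zero (q := (y, 0)) hy hg
  set φ : ℝ → ℝ := fun θ => pairing g f (y, θ) v₀ with hφdef
  have hφs : ContDiff ℝ ∞ φ := by
    rw [contDiff_iff_contDiffAt]
    intro θ
    exact ContDiffAt.comp (f := fun θ : ℝ => (y, θ)) (g := fun x => pairing g f x v₀) θ
      (hF.contDiffAt_pairing (q := (y, θ)) hy v₀) (contDiffAt_const.prodMk contDiffAt_id)
  have hadd : ∀ θ : ℝ, ((y, θ) : E3 × ℝ) + (0, 2 * Real.pi) = (y, θ + 2 * Real.pi) := fun θ => by simp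
  have hφp : Function.Periodic φ (2 * Real.pi) := fun θ => by
    have := hF.pairing_add (g := g) (q := (y, θ)) hy v₀
    rwa [hadd] at this
  have hnp : ∀ s, Function.Periodic (fun θ => scaledNull F f (y, θ) s) (2 * Real.pi) := fun s θ => by
    have := hF.scaledNull_add (q := (y, θ)) hy s
    rwa [hadd] at this
  have h2π : 2 * Real.pi ≠ 0 := by positivity
  obtain ⟨T, S, C, hS, hT, hSd, hST, hTS, hTp⟩ := exists_periodic_primitive hφs hv₀ h2π hφp
  -- Here `τ` is the affine parameter with derivative `φ` in the angle and `A` is its rate of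
  -- change, so the angular speed is `A / φ`.
  set mv : ℝ → ℝ → TangentBundle (𝓡 3) F.LeafSpace :=
    fun A τ => scaledNull F f (y, S τ) (A / φ (S τ)) with hmv
  have hmodel := fun A B => hF.isGeodesicOn_model (q := (y, 0)) hy hg (φ := φ) (S := S)
    (fun θ => rfl) hv₀ hS hSd A B
  refine ⟨mv, fun A B hA => ⟨?_, (hmodel A B).2, ?_⟩, ?_, ?_, ?_⟩
  · refine ⟨isOpen_univ, ordConnected_univ, univ_nonempty, (hmodel A B).1, fun t _ => ?_,
      fun _ _ _ _ h _ _ => univ_subset_iff.1 h⟩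
    have h1 : velocity (fun t => (mv A (A * t + B)).1) t = _ := (hmodel A B).2 t
    rw [h1]
    exact hF.isNull_scaledNull (q := (y, S (A * t + B))) hy hg (div_ne_zero hA (hv₀ _))
  · rw [nullCurve_eq_range hy]
    refine Subset.antisymm ?_ ?_
    · rintro _ ⟨t, rfl⟩
      exact ⟨S (A * t + B), rfl⟩
    · rintro _ ⟨θ, rfl⟩
      refine ⟨(T θ - B) / A, ?_⟩
      change param F f (y, S (A * ((T θ - B) / A) + B)) = _
      rw [mul_div_cancel₀ _ hA, sub_add_cancel, hST]
  · intro θ s hs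
    refine ⟨s * φ θ, T θ, mul_ne_zero hs (hv₀ θ), ?_⟩
    simp only [hmv, hST]
    rw [mul_div_cancel_right₀ _ (hv₀ θ)]
  -- Equal velocities come from one point of the prolongation, so the angles differ by `2 π n` and
  -- the affine parameters by `n C`. Then the scales agree, `A = A'`, and the shift by `n C`
  -- persists at all times.
  · intro A B A' B' t hA h t'
    have h1 := hF.circ_eq_of_scaledNull_eq (q := (y, S (A * t + B))) (q' := (y, S (A' * t + B')))
      hy hy (div_ne_zero hA (hv₀ _)) h
    rw [f.circ_eq_circ_iff (p := (y, S (A * t + B))) (q := (y, S (A' * t + B'))) hy hy] at h1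
    obtain ⟨n, hn⟩ := Real.Angle.angle_eq_iff_two_pi_dvd_sub.1 h1.2.symm
    have hn' : S (A' * t + B') = S (A * t + B) + n * (2 * Real.pi) := by
      dsimp only at hn
      linarith
    have h2 : ∀ A σ, mv A (σ + n * C) = mv A σ := by
      intro A σ
      have h3 : S (σ + n * C) = S σ + n * (2 * Real.pi) := by
        conv_lhs => rw [← hTS σ, ← hTp, hST]
      simp only [hmv, h3]
      rw [(hφp.int_mul n) (S σ)]
      exact (hnp _).int_mul n (S σ)
    have h4 : A' * t + B' = A * t + B + n * C := by
      rw [← hTS (A' * t + B'), hn', hTp, hTS]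
    rw [h4, h2] at h
    have h5 := hF.scaledNull_scale_injective (q := (y, S (A * t + B))) hy h
    have h6 : A = A' := (div_left_inj' (hv₀ _)).1 h5
    subst h6
    have h7 : A * t' + B' = A * t' + B + n * C := by linarith
    rw [h7, h2]
  · intro γ J hJ hgeo hnull t₀ ht₀ θ₀ s hs hv
    obtain ⟨θ, r, hθ₀, h⟩ := hF.eventually_velocity_eq (q := (y, θ₀)) hy hg hJ hgeo hnull ht₀ hs hv v₀
    set A := s * φ θ₀ with hA
    -- By the conservation law `r φ = A`, the affine parameter `T (θ t)` is an affine function of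
    -- `t`.
    have h1 : ∀ᶠ t in 𝓝 t₀, HasDerivAt (fun t => T (θ t) - A * t) 0 t := by
      filter_upwards [h] with t ht
      have h2 := ((hT (θ t)).comp t ht.1).sub ((hasDerivAt_id t).const_mul A)
      refine HasDerivAt.congr_deriv h2 ?_
      have h3 : r t * φ (θ t) = A := ht.2.2
      rw [← h3]
      ring
    refine ⟨A, T (θ t₀) - A * t₀, mul_ne_zero hs (hv₀ θ₀), ?_⟩
    filter_upwards [h, eventually_eq_of_hasDerivAt_zero h1] with t ht h2
    have h3 : r t * φ (θ t) = A := ht.2.2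
    have h4 : θ t = S (A * t + (T (θ t₀) - A * t₀)) := by
      rw [← h2, add_sub_cancel, hST]
    rw [ht.2.1]
    simp only [hmv]
    rw [← h4, ← h3, mul_div_cancel_right₀ _ (hv₀ _)]

/-- Every null geodesic is carried by a fibre of the Cartan prolongation. -/
lemma isRayTangent_velocity_iff {γ : ℝ → F.LeafSpace} {J : Set ℝ} (hJ : IsOpen J)
    (hJc : J.OrdConnected) (hgeo : g.IsGeodesicOn γ J) (hnull : ∀ t ∈ J, g.IsNull (velocity γ t))
    {t t' : ℝ} (ht : t ∈ J) (ht' : t' ∈ J) (x : N) :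
    IsRayTangent F (velocity γ t) x ↔ IsRayTangent F (velocity γ t') x := by
  refine hJc.isPreconnected.induction₂' (fun s s' => IsRayTangent F (velocity γ s) x ↔
    IsRayTangent F (velocity γ s') x) (fun t₀ ht₀ => ?_) (fun _ _ _ _ _ _ h1 h2 => h1.trans h2) ht ht'
  obtain ⟨f, q, s, hq, hs, hv⟩ := hF.exists_eq_scaledNull hg (hnull t₀ ht₀)
  obtain ⟨θ, r, -, h⟩ := hF.eventually_velocity_eq hq hg hJ hgeo hnull ht₀ hs hv 0
  rw [hJ.nhdsWithin_eq ht₀]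
  have h0 : ∀ t, velocity γ t = scaledNull F f (q.1, θ t) (r t) → t ∈ J →
      (IsRayTangent F (velocity γ t) x ↔ x = (extChartAt (𝓡 3) f.center).symm q.1) := by
    intro t h1 ht
    have hr : r t ≠ 0 := by
      intro h2
      apply (hnull t ht).1
      rw [h1, h2]
      exact zero_smul ℝ _
    rw [h1, hF.isRayTangent_scaledNull_iff (q := (q.1, θ t)) hq hr, f.base_circ (p := (q.1, θ t)) hq]
  filter_upwards [h, hJ.mem_nhds ht₀] with t h1 h2
  have h3 := (h0 t₀ h.self_of_nhds.2.1 ht₀).trans (h0 t h1.2.1 h2).symm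
  exact ⟨h3, h3.symm⟩

/-- The image of a maximal null geodesic is given by a fibre of the Cartan prolongation. -/
lemma image_maximalNullGeodesic {γ : ℝ → F.LeafSpace} {J : Set ℝ}
    (hγ : g.IsMaximalNullGeodesic γ J) :
    ∃ x : N, γ '' J = nullCurve F x ∧ ∀ t ∈ J, IsRayTangent F (velocity γ t) x := by
  obtain ⟨t₀, ht₀⟩ := hγ.nonempty
  obtain ⟨f, q, s, hq, hs, hv⟩ := hF.exists_eq_scaledNull hg (hγ.isNull t₀ ht₀)
  obtain ⟨mv, hmv, -, hagree, hloc⟩ := hF.exists_model hg hq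
  obtain ⟨A, B, hA, hAB⟩ := hloc γ J hγ.isOpen hγ.isGeodesicOn hγ.isNull t₀ ht₀ q.2 s hs hv
  have hray : ∀ t ∈ J, IsRayTangent F (velocity γ t) ((extChartAt (𝓡 3) f.center).symm q.1) := by
    intro t ht
    refine (hF.isRayTangent_velocity_iff hg hγ.isOpen hγ.ordConnected hγ.isGeodesicOn hγ.isNull
      ht₀ ht _).1 ?_
    rw [hv, ← f.base_circ hq]
    exact hF.isRayTangent_scaledNull hq
  have htar := f.dom_subset hq
  have hcov : f.Covers ((extChartAt (𝓡 3) f.center).symm q.1) :=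
    ⟨(extChartAt (𝓡 3) f.center).map_target htar,
      by rwa [(extChartAt (𝓡 3) f.center).right_inv htar]⟩
  -- Near each time the geodesic follows some model, and two models that agree once agree always. So
  -- agreement with the given model is locally constant on the interval `J`.
  have hall : ∀ t ∈ J, velocity γ t = mv A (A * t + B) := by
    intro t ht
    refine (hγ.ordConnected.isPreconnected.induction₂' (fun s s' => velocity γ s = mv A (A * s + B) ↔
      velocity γ s' = mv A (A * s' + B)) (fun t₁ ht₁ => ?_)
      (fun _ _ _ _ _ _ h1 h2 => h1.trans h2) ht₀ ht).1 hAB.self_of_nhds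
    obtain ⟨θ, s₁, hs₁, hv₁⟩ := hF.exists_eq_scaledNull_of_covers (hγ.isNull t₁ ht₁).1 (hray t₁ ht₁) hcov
    rw [(extChartAt (𝓡 3) f.center).right_inv htar] at hv₁
    obtain ⟨A', B', hA', hAB'⟩ := hloc γ J hγ.isOpen hγ.isGeodesicOn hγ.isNull t₁ ht₁ θ s₁ hs₁ hv₁
    rw [hγ.isOpen.nhdsWithin_eq ht₁]
    filter_upwards [hAB'] with t₂ ht₂
    have h3 : velocity γ t₁ = mv A (A * t₁ + B) ↔ velocity γ t₂ = mv A (A * t₂ + B) := by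
      rw [hAB'.self_of_nhds, ht₂]
      exact ⟨fun h => hagree _ _ _ _ _ hA' h _, fun h => hagree _ _ _ _ _ hA' h _⟩
    exact ⟨h3, h3.symm⟩
  obtain ⟨h1, h2, h3⟩ := hmv A B hA
  have heq : EqOn (fun t => (mv A (A * t + B)).1) γ J := fun t ht =>
    (congrArg (fun w => w.1) (hall t ht)).symm
  -- The model is a geodesic on the whole line that extends `γ`, so maximality leaves no other
  -- interval.
  have hJ : univ = J := hγ.maximal _ _ isOpen_univ ordConnected_univ (subset_univ J)
    h1.isGeodesicOn heq
  refine ⟨_, ?_, hray⟩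
  rw [← h3, ← heq.image_eq, ← hJ, image_univ]

/-- The fibres of the Cartan prolongation are null geodesics, in all null directions. -/
lemma exists_maximalNullGeodesic {x : N} {w : TangentBundle (𝓡 3) F.LeafSpace} (hw : w.2 ≠ 0)
    (hwx : IsRayTangent F w x) : ∃ γ : ℝ → F.LeafSpace, g.IsMaximalNullGeodesic γ univ ∧
      γ '' univ = nullCurve F x ∧ ∃ t, velocity γ t = w := by
  obtain ⟨f, hf⟩ := exists_frame_covers ξ x
  obtain ⟨θ, s, hs, rfl⟩ := hF.exists_eq_scaledNull_of_covers hw hwx hf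
  obtain ⟨mv, hmv, hex, -, -⟩ := hF.exists_model hg hf.2
  obtain ⟨A, τ, hA, hAτ⟩ := hex θ s hs
  obtain ⟨h1, h2, h3⟩ := hmv A 0 hA
  refine ⟨_, h1, ?_, τ / A, ?_⟩
  · rw [image_univ, h3, (extChartAt (𝓡 3) f.center).left_inv hf.1]
  · rw [h2, add_zero, mul_div_cancel₀ _ hA, hAτ]

end IsNullFibration

end Classification

/-! ### The null geodesics are parametrised by the contact manifold -/

open CartanProlongation

section Parametrisation

variable {N : Type*} [TopologicalSpace N] [ChartedSpace E3 N] [IsManifold (𝓡 3) ∞ N]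
  {ξ : ContactStructure N} {F : OrientedCircleFoliation (CartanProlongation ξ) 𝓘(ℝ, E3 × ℝ)}
  [ChartedSpace E3 F.LeafSpace] [IsManifold (𝓡 3) ∞ F.LeafSpace]

namespace IsNullFibration

variable [T2Space N] (hF : IsNullFibration F) {g : LorentzMetric F.LeafSpace} {f f' : Frame ξ}

include hF

lemma hasDerivAt_paramCoord_vertical {m₀ : F.LeafSpace} {y : E3} {θ : ℝ} (hy : y ∈ f.dom)
    (hm : param F f (y, θ) ∈ (extChartAt (𝓡 3) m₀).source) :
    HasDerivAt (fun θ => paramCoord F f m₀ (y, θ)) (fderiv ℝ (paramCoord F f m₀) (y, θ) (0, 1)) θ :=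
  ((hF.contDiffAt_paramCoord f (q := (y, θ)) hy hm).differentiableAt (by simp)).hasFDerivAt.comp_hasDerivAt θ
    ((hasDerivAt_const θ y).prodMk (hasDerivAt_id θ))

/-- If the two images coincide, the points of angle `1 / (n + 1)` on the first curve are points of
angle `φ n` on the second. By compactness the `φ n` accumulate, so the curves are tangent at the
limit point (`exists_smul_of_accumulating_intersections`). Proportional null vectors come from the
same point of the prolongation, hence from the same base point. -/
lemma nullCurve_injective [T2Space F.LeafSpace] : Function.Injective (nullCurve F) := by
  intro x x' h
  obtain ⟨f, hf⟩ := exists_frame_covers ξ x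
  obtain ⟨f', hf'⟩ := exists_frame_covers ξ x'
  set y := extChartAt (𝓡 3) f.center x with hy
  set y' := extChartAt (𝓡 3) f'.center x' with hy'
  have hx : (extChartAt (𝓡 3) f.center).symm y = x := (extChartAt (𝓡 3) f.center).left_inv hf.1
  have hx' : (extChartAt (𝓡 3) f'.center).symm y' = x' := (extChartAt (𝓡 3) f'.center).left_inv hf'.1
  rw [← hx, ← hx', nullCurve_eq_range hf.2, nullCurve_eq_range hf'.2] at h
  have hsub : ∀ θ, ∃ φ ∈ Icc 0 (2 * Real.pi), param F f' (y', φ) = param F f (y, θ) := by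
    intro θ
    obtain ⟨φ, hφ⟩ : param F f (y, θ) ∈ range fun θ => param F f' (y', θ) := h ▸ ⟨θ, rfl⟩
    refine ⟨toIcoMod Real.two_pi_pos 0 φ, ?_, ?_⟩
    · have := toIcoMod_mem_Ico Real.two_pi_pos 0 φ
      rw [zero_add] at this
      exact Ico_subset_Icc_self this
    · rw [← hφ]
      refine congrArg F.proj ((f'.circ_eq_circ_iff (p := (y', _)) (q := (y', _)) hf'.2 hf'.2).2 ⟨rfl, ?_⟩)
      exact Real.Angle.coe_toIcoMod φ 0
  choose φ hφ hφe using fun n : ℕ => hsub (1 / ((n : ℝ) + 1))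
  obtain ⟨φ₀, -, k, hk, hlim⟩ := isCompact_Icc.tendsto_subseq hφ
  have hs : Tendsto (fun n => 1 / ((k n : ℝ) + 1)) atTop (𝓝 0) :=
    tendsto_one_div_add_atTop_nhds_zero_nat.comp hk.tendsto_atTop
  have hc : ContinuousAt (fun θ : ℝ => param F f (y, θ)) 0 :=
    ContinuousAt.comp (g := param F f) (f := fun θ : ℝ => (y, θ))
      (hF.contMDiffAt_param f (q := (y, 0)) hf.2).continuousAt (by fun_prop)
  have hc' : ContinuousAt (fun θ : ℝ => param F f' (y', θ)) φ₀ :=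
    ContinuousAt.comp (g := param F f') (f := fun θ : ℝ => (y', θ))
      (hF.contMDiffAt_param f' (q := (y', φ₀)) hf'.2).continuousAt (by fun_prop)
  have heq : param F f (y, 0) = param F f' (y', φ₀) := by
    refine tendsto_nhds_unique (hc.tendsto.comp hs) ((hc'.tendsto.comp hlim).congr fun n => ?_)
    exact hφe (k n)
  set m₀ := param F f (y, 0) with hm₀
  have hm : param F f (y, 0) ∈ (extChartAt (𝓡 3) m₀).source := mem_extChartAt_source _
  have hm' : param F f' (y', φ₀) ∈ (extChartAt (𝓡 3) m₀).source := heq ▸ mem_extChartAt_source _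
  have hd := hF.hasDerivAt_paramCoord_vertical hf.2 hm
  have hd' := hF.hasDerivAt_paramCoord_vertical hf'.2 hm'
  obtain ⟨c, hc⟩ := exists_smul_of_accumulating_intersections hd.differentiableAt
    hd'.differentiableAt (by
      rw [hd'.deriv]
      exact hF.fderiv_paramCoord_vertical_ne_zero f' (q := (y', φ₀)) hf'.2 hm') hs
    (fun n => by positivity) hlim (congrArg (extChartAt (𝓡 3) m₀) heq)
    (Eventually.of_forall fun n => (congrArg (extChartAt (𝓡 3) m₀) (hφe (k n))).symm)
  rw [hd.deriv, hd'.deriv] at hc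
  have h1 : scaledNull F f (y, 0) 1 = scaledNull F f' (y', φ₀) c := by
    refine tangent_ext (m₀ := m₀) hm heq ?_
    rw [hF.vecCoord_scaledNull (q := (y, 0)) hf.2 hm,
      hF.vecCoord_scaledNull (q := (y', φ₀)) hf'.2 hm', hc, one_smul]
  have h2 := congrArg base (hF.circ_eq_of_scaledNull_eq (q := (y, 0)) (q' := (y', φ₀)) hf.2 hf'.2
    one_ne_zero h1)
  rwa [f.base_circ (p := (y, 0)) hf.2, f'.base_circ (p := (y', φ₀)) hf'.2, hx, hx'] at h2

variable (hg : g.HasNullCones (pushforwardFibre (engel ξ) F.proj))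

lemma scaledNull_ne_zero {q : E3 × ℝ} (hq : q.1 ∈ f.dom) {s : ℝ} (hs : s ≠ 0) :
    (scaledNull F f q s).2 ≠ 0 := fun h =>
  (smul_eq_zero.1 (h : s • (dparam F f q (0, 1) : E3) = 0)).elim hs
    (hF.dparam_vertical_ne_zero f hq)

include hg

lemma exists_nullCurve_eq (x : N) : ∃ (γ : ℝ → F.LeafSpace) (J : Set ℝ),
    g.IsMaximalNullGeodesic γ J ∧ nullCurve F x = γ '' J := by
  obtain ⟨u, rfl⟩ := exists_base_eq ξ x
  obtain ⟨f, q, hq, rfl⟩ := exists_frame_circ u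
  obtain ⟨γ, h1, h2, -⟩ := hF.exists_maximalNullGeodesic hg (hF.scaledNull_ne_zero hq one_ne_zero)
    (hF.isRayTangent_scaledNull hq (s := 1))
  exact ⟨γ, univ, h1, h2.symm⟩

/-- The bijection from the contact manifold to the space of null geodesics. -/
def nullGeodesicEquiv [T2Space F.LeafSpace] : N ≃ g.NullGeodesicSpace :=
  Equiv.ofBijective (fun x => ⟨nullCurve F x, hF.exists_nullCurve_eq hg x⟩) <| by
    refine ⟨fun x x' h => hF.nullCurve_injective (congrArg Subtype.val h), ?_⟩
    rintro ⟨L, γ, J, hγ, rfl⟩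
    obtain ⟨x, hx, -⟩ := hF.image_maximalNullGeodesic hg hγ
    exact ⟨x, Subtype.ext hx.symm⟩

/-- The smooth and contact structures below use the space of null geodesics only through this
criterion for tangency. -/
lemma isTangentTo_nullGeodesicEquiv_iff [T2Space F.LeafSpace]
    {w : TangentBundle (𝓡 3) F.LeafSpace} {x : N} :
    LorentzMetric.IsTangentTo w (hF.nullGeodesicEquiv hg x) ↔ w.2 ≠ 0 ∧ IsRayTangent F w x := by
  constructor
  · rintro ⟨γ, J, hγ, hL, t, ht, rfl⟩
    obtain ⟨x', hx', h⟩ := hF.image_maximalNullGeodesic hg hγ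
    have : x = x' := hF.nullCurve_injective (hL.trans hx')
    subst this
    exact ⟨(hγ.isNull t ht).1, h t ht⟩
  · rintro ⟨hw, hwx⟩
    obtain ⟨γ, h1, h2, t, ht⟩ := hF.exists_maximalNullGeodesic hg hw hwx
    exact ⟨γ, univ, h1, h2.symm, t, mem_univ t, ht⟩

end IsNullFibration

end Parametrisation

/-! ### Transport of contact manifolds along bijections -/

section Transport

variable {N L : Type*} [TopologicalSpace N] [ChartedSpace E3 N]

/-- The charts transported along a homeomorphism. -/
abbrev transportedCharts [TopologicalSpace L] (e : N ≃ₜ L) : ChartedSpace E3 L where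
  atlas := (fun c => e.symm.toOpenPartialHomeomorph ≫ₕ c) '' atlas E3 N
  chartAt l := e.symm.toOpenPartialHomeomorph ≫ₕ chartAt E3 (e.symm l)
  mem_chart_source l := by simp
  chart_mem_atlas l := mem_image_of_mem _ (chart_mem_atlas E3 _)

lemma isManifold_transportedCharts [IsManifold (𝓡 3) ∞ N] [TopologicalSpace L] (e : N ≃ₜ L) :
    @IsManifold ℝ _ E3 _ _ E3 _ (𝓡 3) ∞ L _ (transportedCharts e) := by
  let := transportedCharts e
  have : HasGroupoid L (contDiffGroupoid ∞ (𝓡 3)) := by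
    constructor
    rintro _ _ ⟨c, hc, rfl⟩ ⟨c', hc', rfl⟩
    refine (contDiffGroupoid ∞ (𝓡 3)).mem_of_eqOnSource
      (HasGroupoid.compatible (G := contDiffGroupoid ∞ (𝓡 3)) hc hc') ?_
    constructor
    · ext z
      simp
    · intro z _
      simp
  exact IsManifold.mk' _ _ _

variable [IsManifold (𝓡 3) ∞ N]

lemma contMDiff_transport [TopologicalSpace L] (e : N ≃ₜ L) :
    letI := transportedCharts e
    ContMDiff (𝓡 3) (𝓡 3) ∞ e := by
  let := transportedCharts e
  intro x
  rw [contMDiffAt_iff]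
  refine ⟨e.continuous.continuousAt, ?_⟩
  have h1 : extChartAt (𝓡 3) (e x) ∘ e ∘ (extChartAt (𝓡 3) x).symm =
      extChartAt (𝓡 3) x ∘ (extChartAt (𝓡 3) x).symm := by
    ext1 z
    change extChartAt (𝓡 3) (e.symm (e x)) (e.symm (e ((extChartAt (𝓡 3) x).symm z))) = _
    simp only [e.symm_apply_apply, Function.comp_apply]
  rw [h1]
  refine contDiffWithinAt_id.congr_of_eventuallyEq ?_ ?_
  · refine eventually_nhdsWithin_of_eventually_nhds ?_
    filter_upwards [(isOpen_extChartAt_target x).mem_nhds (mem_extChartAt_target x)] with z hz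
    exact (extChartAt (𝓡 3) x).right_inv hz
  · exact (extChartAt (𝓡 3) x).right_inv (mem_extChartAt_target x)

lemma contMDiff_transport_symm [TopologicalSpace L] (e : N ≃ₜ L) :
    letI := transportedCharts e
    ContMDiff (𝓡 3) (𝓡 3) ∞ e.symm := by
  let := transportedCharts e
  intro l
  rw [contMDiffAt_iff]
  refine ⟨e.symm.continuous.continuousAt, ?_⟩
  have h1 : extChartAt (𝓡 3) (e.symm l) ∘ e.symm ∘ (extChartAt (𝓡 3) l).symm =
      extChartAt (𝓡 3) l ∘ (extChartAt (𝓡 3) l).symm := rfl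
  rw [h1]
  refine contDiffWithinAt_id.congr_of_eventuallyEq ?_ ?_
  · refine eventually_nhdsWithin_of_eventually_nhds ?_
    filter_upwards [(isOpen_extChartAt_target l).mem_nhds (mem_extChartAt_target l)] with z hz
    exact (extChartAt (𝓡 3) l).right_inv hz
  · exact (extChartAt (𝓡 3) l).right_inv (mem_extChartAt_target l)

/-- The image of a contact structure under a diffeomorphism whose charts are transported. -/
lemma exists_transport (ξ : ContactStructure N) (Ψ : N ≃ L) :
    ∃ (_ : TopologicalSpace L) (_ : ChartedSpace E3 L) (_ : IsManifold (𝓡 3) ∞ L)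
      (Φ : N ≃ₘ^∞⟮𝓡 3, 𝓡 3⟯ L) (H : ContactStructure L), (∀ x, Φ x = Ψ x) ∧
      ∀ (x : N) (v : TangentSpace (𝓡 3) x),
        v ∈ ξ.plane x ↔ mfderiv (𝓡 3) (𝓡 3) Φ x v ∈ H.plane (Φ x) := by
  let : TopologicalSpace L := TopologicalSpace.induced Ψ.symm inferInstance
  let e : N ≃ₜ L := (Ψ.symm.toHomeomorphOfIsInducing ⟨rfl⟩).symm
  let := transportedCharts e
  have hman := isManifold_transportedCharts e
  let Φ : N ≃ₘ^∞⟮𝓡 3, 𝓡 3⟯ L :=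
    ⟨e.toEquiv, contMDiff_transport e, contMDiff_transport_symm e⟩
  have hΦs : ∀ l, MDifferentiableAt (𝓡 3) (𝓡 3) e.symm l := fun l =>
    (contMDiff_transport_symm e l).mdifferentiableAt (by simp)
  have hΦd : ∀ x, MDifferentiableAt (𝓡 3) (𝓡 3) e x := fun x =>
    (contMDiff_transport e x).mdifferentiableAt (by simp)
  let H : ContactStructure L :=
    { plane := fun l => (ξ.plane (e.symm l)).comap
        (mfderiv (𝓡 3) (𝓡 3) e.symm l).toLinearMap
      exists_form := by
        intro l₀
        obtain ⟨U, a, hU, hxU, hUt, ha, hpl, hw⟩ := ξ.exists_form (e.symm l₀)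
        have htar : (extChartAt (𝓡 3) l₀).target = (extChartAt (𝓡 3) (e.symm l₀)).target := by
          have h : chartAt E3 l₀ = e.symm.toOpenPartialHomeomorph ≫ₕ chartAt E3 (e.symm l₀) := rfl
          simp [extChartAt, h]
        -- The transported chart gives corresponding points the same coordinates, so the local
        -- contact form is unchanged.
        refine ⟨U, a, hU, hxU, htar ▸ hUt, ha, ?_, hw⟩
        intro l hl hlU v
        have hl' : e.symm l ∈ (extChartAt (𝓡 3) (e.symm l₀)).source := by
          have h : chartAt E3 l₀ = e.symm.toOpenPartialHomeomorph ≫ₕ chartAt E3 (e.symm l₀) := rfl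
          simpa [extChartAt, h] using hl
        refine (hpl (e.symm l) hl' hlU (mfderiv (𝓡 3) (𝓡 3) e.symm l v)).trans ?_
        have h1 : HasMFDerivAt (𝓡 3) 𝓘(ℝ, E3) (extChartAt (𝓡 3) l₀) l _ :=
          (mdifferentiableAt_extChartAt (I := 𝓡 3) (x := e.symm l₀)
            (by simpa using hl')).hasMFDerivAt.comp l (hΦs l).hasMFDerivAt
        have h2 : mfderiv (𝓡 3) 𝓘(ℝ, E3) (extChartAt (𝓡 3) l₀) l v =
            mfderiv (𝓡 3) 𝓘(ℝ, E3) (extChartAt (𝓡 3) (e.symm l₀)) (e.symm l)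
              (mfderiv (𝓡 3) (𝓡 3) e.symm l v) :=
          congrArg (fun T : E3 →L[ℝ] E3 => T v) h1.mfderiv
        rw [h2]
        rfl }
  refine ⟨inferInstance, inferInstance, hman, Φ, H, fun _ => rfl, ?_⟩
  intro x v
  have key : ∀ z, z = x → ∀ v' : TangentSpace (𝓡 3) z, (v' : E3) = v →
      (v ∈ ξ.plane x ↔ v' ∈ ξ.plane z) := by
    rintro z rfl v' h
    rw [← h]
  refine key (e.symm (e x)) (e.symm_apply_apply x) _ ?_
  have h1 : HasMFDerivAt (𝓡 3) (𝓡 3) (e.symm ∘ e) x _ :=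
    (hΦs (e x)).hasMFDerivAt.comp x (hΦd x).hasMFDerivAt
  have h2 : (e.symm ∘ e : N → N) = id := funext e.symm_apply_apply
  rw [h2] at h1
  exact congrArg (fun T : E3 →L[ℝ] E3 => T v) (hasMFDerivAt_unique h1 (hasMFDerivAt_id x))

end Transport

/-! ### The canonical contact structure on the space of null geodesics -/

open CartanProlongation

section DiffeoCoordinates

variable {N L : Type*} [TopologicalSpace N] [ChartedSpace E3 N] [IsManifold (𝓡 3) ∞ N]
  {ξ : ContactStructure N} [TopologicalSpace L] [ChartedSpace E3 L]

/-- The coordinates of the chart of a frame, transported along a diffeomorphism. -/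
def transportCoord (f : Frame ξ) (Φ : N ≃ₘ^∞⟮𝓡 3, 𝓡 3⟯ L) (l : L) : E3 :=
  extChartAt (𝓡 3) f.center (Φ.symm l)

/-- The differential of `transportCoord`. -/
def dtransportCoord (f : Frame ξ) (Φ : N ≃ₘ^∞⟮𝓡 3, 𝓡 3⟯ L) (l : L) : TangentSpace (𝓡 3) l →ₗ[ℝ] E3 :=
  (mfderiv (𝓡 3) 𝓘(ℝ, E3) (transportCoord f Φ) l).toLinearMap

variable {f : Frame ξ} {Φ : N ≃ₘ^∞⟮𝓡 3, 𝓡 3⟯ L} {x : N} (hf : f.Covers x)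

include hf

lemma mdifferentiableAt_transportCoord :
    MDifferentiableAt (𝓡 3) 𝓘(ℝ, E3) (transportCoord f Φ) (Φ x) := by
  have h1 : Φ.symm (Φ x) ∈ (extChartAt (𝓡 3) f.center).source := by
    rw [Φ.symm_apply_apply]
    exact hf.1
  exact ((contMDiffAt_ext h1).comp (Φ x) (Φ.symm.contMDiff (Φ x))).mdifferentiableAt (by simp)

lemma dtransportCoord_mfderiv (v : TangentSpace (𝓡 3) x) :
    dtransportCoord f Φ (Φ x) (mfderiv (𝓡 3) (𝓡 3) Φ x v) =
      mfderiv (𝓡 3) 𝓘(ℝ, E3) (extChartAt (𝓡 3) f.center) x v := by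
  have h1 : HasMFDerivAt (𝓡 3) 𝓘(ℝ, E3) (transportCoord f Φ ∘ Φ) x _ :=
    (mdifferentiableAt_transportCoord hf).hasMFDerivAt.comp x
      (Φ.mdifferentiable (by simp) x).hasMFDerivAt
  have h2 : transportCoord f Φ ∘ Φ = extChartAt (𝓡 3) f.center := by
    ext1 z
    simp [transportCoord]
  rw [h2] at h1
  exact (congrArg (fun T : E3 →L[ℝ] E3 => T v) h1.mfderiv).symm

lemma mfderiv_ext_surjective :
    Function.Surjective (mfderiv (𝓡 3) 𝓘(ℝ, E3) (extChartAt (𝓡 3) f.center) x) := by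
  have key : ∀ T : E3 →ₗ[ℝ] E3, Function.Injective T → Function.Surjective T := fun _ =>
    LinearMap.injective_iff_surjective.1
  exact key (mfderiv (𝓡 3) 𝓘(ℝ, E3) (extChartAt (𝓡 3) f.center) x).toLinearMap
    (mfderiv_ext_injective hf.1)

lemma dtransportCoord_surjective : Function.Surjective (dtransportCoord f Φ (Φ x)) := fun w => by
  obtain ⟨v, rfl⟩ := mfderiv_ext_surjective hf w
  exact ⟨_, dtransportCoord_mfderiv hf v⟩

lemma dtransportCoord_injective : Function.Injective (dtransportCoord f Φ (Φ x)) := by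
  have key : ∀ T : E3 →ₗ[ℝ] E3, Function.Surjective T → Function.Injective T := fun _ =>
    LinearMap.injective_iff_surjective.2
  exact key (dtransportCoord f Φ (Φ x)) (dtransportCoord_surjective hf)

lemma mem_plane_iff_dtransportCoord {H : ContactStructure L}
    (hH : ∀ v : TangentSpace (𝓡 3) x, v ∈ ξ.plane x ↔ mfderiv (𝓡 3) (𝓡 3) Φ x v ∈ H.plane (Φ x))
    (w : TangentSpace (𝓡 3) (Φ x)) : w ∈ H.plane (Φ x) ↔ ∃ c s : ℝ, dtransportCoord f Φ (Φ x) w =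
      c • f.V (extChartAt (𝓡 3) f.center x) + s • f.Y (extChartAt (𝓡 3) f.center x) := by
  obtain ⟨v, hv⟩ := mfderiv_ext_surjective hf (dtransportCoord f Φ (Φ x) w)
  have h1 : mfderiv (𝓡 3) (𝓡 3) Φ x v = w :=
    dtransportCoord_injective hf ((dtransportCoord_mfderiv hf v).trans hv)
  have h2 := f.mem_plane_iff x hf.1 hf.2 v
  rw [hH, h1, hv] at h2
  exact h2

/-- The coordinates of the velocity of a curve. -/
lemma hasDerivAt_transportCoord {ℓ : ℝ → L} {ε : ℝ} (hℓ : MDifferentiableAt 𝓘(ℝ, ℝ) (𝓡 3) ℓ ε)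
    {w : TangentSpace (𝓡 3) (Φ x)}
    (hw : tangentMap 𝓘(ℝ, ℝ) (𝓡 3) ℓ ⟨ε, (1 : ℝ)⟩ = ⟨Φ x, w⟩) :
    HasDerivAt (fun ε => transportCoord f Φ (ℓ ε)) (dtransportCoord f Φ (Φ x) w) ε := by
  have h0 : ℓ ε = Φ x := congrArg (fun w => w.1) hw
  have h1 : MDifferentiableAt (𝓡 3) 𝓘(ℝ, E3) (transportCoord f Φ) (ℓ ε) := by
    rw [h0]
    exact mdifferentiableAt_transportCoord hf
  obtain ⟨T, hT, hT1⟩ : ∃ T : ℝ →L[ℝ] E3, HasFDerivAt (transportCoord f Φ ∘ ℓ) T ε ∧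
      T 1 = mfderiv (𝓡 3) 𝓘(ℝ, E3) (transportCoord f Φ) (ℓ ε)
        (mfderiv 𝓘(ℝ, ℝ) (𝓡 3) ℓ ε (1 : ℝ)) :=
    ⟨_, (h1.hasMFDerivAt.comp ε hℓ.hasMFDerivAt).hasFDerivAt, rfl⟩
  refine hT.hasDerivAt.congr_deriv (hT1.trans ?_)
  have key : ∀ z : TangentBundle (𝓡 3) L, z = ⟨Φ x, w⟩ →
      (mfderiv (𝓡 3) 𝓘(ℝ, E3) (transportCoord f Φ) z.1 z.2 : E3) = dtransportCoord f Φ (Φ x) w := by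
    rintro _ rfl
    rfl
  exact key _ hw

end DiffeoCoordinates

/-! ### Tangent spaces of the skies and the canonical structures. -/

section Sky

variable {N : Type*} [TopologicalSpace N] [ChartedSpace E3 N] [IsManifold (𝓡 3) ∞ N]
  {ξ : ContactStructure N} {F : OrientedCircleFoliation (CartanProlongation ξ) 𝓘(ℝ, E3 × ℝ)}
  [ChartedSpace E3 F.LeafSpace] [IsManifold (𝓡 3) ∞ F.LeafSpace]

namespace IsNullFibration

variable [T2Space N] (hF : IsNullFibration F) {g : LorentzMetric F.LeafSpace} {f : Frame ξ}

include hF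

lemma contMDiffAt_scaledNull {q : E3 × ℝ} (hq : q.1 ∈ f.dom) (s : ℝ) :
    ContMDiffAt 𝓘(ℝ, E3 × ℝ) (𝓡 3).tangent ∞ (fun q => scaledNull F f q s) q := by
  have hm : param F f q ∈ (extChartAt (𝓡 3) (param F f q)).source := mem_extChartAt_source _
  refine (contMDiffAt_tangentBundle_iff (m₀ := param F f q) hm).2 ⟨hF.contMDiffAt_param f hq, ?_⟩
  have hQ := hF.contDiffAt_paramCoord f hq hm
  refine ((contDiffAt_fderiv_apply hQ (0, 1)).const_smul s).contMDiffAt.congr_of_eventuallyEq ?_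
  filter_upwards [hF.eventually_mem_source f hq hm] with x hx
  exact hF.vecCoord_scaledNull hx.1 hx.2 s

variable (hg : g.HasNullCones (pushforwardFibre (engel ξ) F.proj))
  [TopologicalSpace g.NullGeodesicSpace] [ChartedSpace E3 g.NullGeodesicSpace]
  {Φ : N ≃ₘ^∞⟮𝓡 3, 𝓡 3⟯ g.NullGeodesicSpace}
  (hΦ : ∀ x w, LorentzMetric.IsTangentTo w (Φ x) ↔ w.2 ≠ 0 ∧ IsRayTangent F w x)

include hΦ

lemma isTangentTo_scaledNull {q : E3 × ℝ} (hq : q.1 ∈ f.dom) {s : ℝ} (hs : s ≠ 0) :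
    LorentzMetric.IsTangentTo (scaledNull F f q s) (Φ ((extChartAt (𝓡 3) f.center).symm q.1)) := by
  refine (hΦ _ _).2 ⟨hF.scaledNull_ne_zero hq hs, ?_⟩
  rw [← f.base_circ hq]
  exact hF.isRayTangent_scaledNull hq

include hg

/-- The base component of the smooth polar coordinates of `exists_lift` extends the map from null
vectors to null geodesics. Local sections are obtained by keeping the polar angle and the scale
fixed while the base point varies. -/
lemma isCanonicalSmoothStructure : g.IsCanonicalSmoothStructure := by
  constructor
  · intro v hv
    obtain ⟨f, q, s, hq, hs, rfl⟩ := hF.exists_eq_scaledNull hg hv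
    obtain ⟨X, R, -, -, h⟩ := hF.exists_lift hq hg hs
    obtain ⟨O, hO, hOo, hvO⟩ := mem_nhds_iff.1 h
    refine ⟨O, fun w => Φ ((extChartAt (𝓡 3) f.center).symm (X w).1), hOo, hvO, ?_, ?_⟩
    · intro w hw
      obtain ⟨h1, -, h2, -⟩ := hO hw
      have h3 : ContMDiffAt (𝓡 3).tangent 𝓘(ℝ, E3) ∞ (fun w => (X w).1) w :=
        ContMDiffAt.comp w (g := fun z : E3 × ℝ => z.1) contDiffAt_fst.contMDiffAt h1
      have h4 := ContMDiffAt.comp w (g := (extChartAt (𝓡 3) f.center).symm) (f := fun w => (X w).1)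
        (contMDiffAt_ext_symm (f.dom_subset h2)) h3
      exact (ContMDiffAt.comp w (g := Φ) (Φ.contMDiff _) h4).contMDiffWithinAt
    · intro w hw hwn
      obtain ⟨-, -, h2, h3⟩ := hO hw
      obtain ⟨h4, h5⟩ := h3 hwn.2
      have h6 := hF.isTangentTo_scaledNull hΦ h2 h4
      rwa [← h5] at h6
  · intro L v hv
    obtain ⟨x, rfl⟩ : ∃ x, Φ x = L := ⟨_, Φ.apply_symm_apply L⟩
    obtain ⟨f, hf⟩ := exists_frame_covers ξ x
    obtain ⟨hv0, hvx⟩ := (hΦ _ _).1 hv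
    obtain ⟨θ, s, hs, rfl⟩ := hF.exists_eq_scaledNull_of_covers hv0 hvx hf
    refine ⟨Φ.symm ⁻¹' {z | f.Covers z}, fun l => scaledNull F f (transportCoord f Φ l, θ) s,
      ?_, ?_, ?_, ?_, ?_⟩
    · refine IsOpen.preimage Φ.symm.continuous ?_
      exact (continuousOn_extChartAt f.center).isOpen_inter_preimage
        (isOpen_extChartAt_source f.center) f.isOpen_dom
    · change f.Covers (Φ.symm (Φ x))
      rwa [Φ.symm_apply_apply]
    · intro l hl
      have h1 : ContMDiffAt (𝓡 3) 𝓘(ℝ, E3) ∞ (transportCoord f Φ) l :=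
        (contMDiffAt_ext hl.1).comp l (Φ.symm.contMDiff l)
      have h2 : ContMDiffAt (𝓡 3) 𝓘(ℝ, E3 × ℝ) ∞ (fun l => (transportCoord f Φ l, θ)) l :=
        h1.prodMk_space contMDiffAt_const
      exact (ContMDiffAt.comp l (g := fun q => scaledNull F f q s)
        (f := fun l => (transportCoord f Φ l, θ))
        (hF.contMDiffAt_scaledNull (q := (transportCoord f Φ l, θ)) hl.2 s) h2).contMDiffWithinAt
    · simp only [transportCoord, Φ.symm_apply_apply]
    · intro l hl
      have h1 := hF.isTangentTo_scaledNull hΦ (q := (transportCoord f Φ l, θ)) hl.2 hs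
      have h2 : (extChartAt (𝓡 3) f.center).symm (transportCoord f Φ l) = Φ.symm l :=
        (extChartAt (𝓡 3) f.center).left_inv hl.1
      dsimp only at h1
      rwa [h2, Φ.apply_symm_apply] at h1

variable {x : N} (hf : f.Covers x)

include hf

/-- The null vectors `c ε` have a fixed foot point, so their lifts to polar coordinates have
constant projection. The velocity of the lift is then a multiple of `leafDir`, whose horizontal part
is `dir`. -/
lemma exists_dtransportCoord_eq_smul_dir {θ s : ℝ} (hs : s ≠ 0) {w : TangentSpace (𝓡 3) (Φ x)}
    {c : ℝ → TangentBundle (𝓡 3) F.LeafSpace} {ℓ : ℝ → g.NullGeodesicSpace}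
    (hc : ContMDiff 𝓘(ℝ, ℝ) (𝓡 3).tangent ∞ c) (hℓ : ContMDiff 𝓘(ℝ, ℝ) (𝓡 3) ∞ ℓ)
    (hcp : ∀ ε, (c ε).proj = (scaledNull F f (extChartAt (𝓡 3) f.center x, θ) s).proj)
    (hcℓ : ∀ ε, LorentzMetric.IsTangentTo (c ε) (ℓ ε))
    (hc0 : c 0 = scaledNull F f (extChartAt (𝓡 3) f.center x, θ) s)
    (hw : tangentMap 𝓘(ℝ, ℝ) (𝓡 3) ℓ ⟨0, (1 : ℝ)⟩ = ⟨Φ x, w⟩) :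
    ∃ a : ℝ, dtransportCoord f Φ (Φ x) w = a • f.dir (extChartAt (𝓡 3) f.center x, θ) := by
  set q : E3 × ℝ := (extChartAt (𝓡 3) f.center x, θ) with hq
  have hqd : q.1 ∈ f.dom := hf.2
  obtain ⟨X, R, hX, -, h⟩ := hF.exists_lift hqd hg hs
  set m₀ := param F f q with hm₀
  have hm : param F f q ∈ (extChartAt (𝓡 3) m₀).source := mem_extChartAt_source _
  rw [← hc0] at h hX
  have hev := hc.continuous.continuousAt.eventually h
  have hZ : ∀ᶠ ε in 𝓝 0, (X (c ε)).1 ∈ f.dom ∧ R (c ε) ≠ 0 ∧ c ε = scaledNull F f (X (c ε)) (R (c ε)) := by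
    filter_upwards [hev] with ε hε
    obtain ⟨γ, J, hγ, -, t, ht, htc⟩ := hcℓ ε
    have hn := hγ.isNull t ht
    rw [htc] at hn
    exact ⟨hε.2.2.1, hε.2.2.2 hn.2⟩
  have hZd : DifferentiableAt ℝ (fun ε => X (c ε)) 0 :=
    ((ContMDiffAt.comp (0 : ℝ) (g := X) h.self_of_nhds.1 (hc 0)).contDiffAt).differentiableAt (by simp)
  have hQ := (hF.contDiffAt_paramCoord f hqd hm).differentiableAt (by simp)
  have h1 : HasDerivAt (fun ε => paramCoord F f m₀ (X (c ε)))
      (fderiv ℝ (paramCoord F f m₀) q (deriv (fun ε => X (c ε)) 0)) 0 := by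
    refine HasFDerivAt.comp_hasDerivAt (l := paramCoord F f m₀) 0 ?_ hZd.hasDerivAt
    rw [hX]
    exact hQ.hasFDerivAt
  have h2 : HasDerivAt (fun ε => paramCoord F f m₀ (X (c ε))) 0 0 := by
    refine (hasDerivAt_const (0 : ℝ) (extChartAt (𝓡 3) m₀ m₀)).congr_of_eventuallyEq ?_
    filter_upwards [hZ] with ε hε
    refine congrArg (extChartAt (𝓡 3) m₀) ?_
    exact (congrArg (fun w => w.1) hε.2.2).symm.trans (hcp ε)
  obtain ⟨a, ha⟩ := (hF.fderiv_paramCoord_eq_zero_iff f hqd hm).1 (h1.unique h2)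
  refine ⟨a, ?_⟩
  have h3 := hasDerivAt_transportCoord hf (hℓ.mdifferentiableAt (by simp)) hw
  have h4 : HasDerivAt (fun ε => (X (c ε)).1) (deriv (fun ε => X (c ε)) 0).1 0 :=
    (ContinuousLinearMap.fst ℝ E3 ℝ).hasFDerivAt.comp_hasDerivAt (0 : ℝ) hZd.hasDerivAt
  have h5 : (fun ε => transportCoord f Φ (ℓ ε)) =ᶠ[𝓝 0] fun ε => (X (c ε)).1 := by
    filter_upwards [hZ] with ε hε
    obtain ⟨z, hz⟩ : ∃ z, Φ z = ℓ ε := ⟨_, Φ.apply_symm_apply _⟩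
    have h6 := hcℓ ε
    rw [← hz, hΦ, hε.2.2, hF.isRayTangent_scaledNull_iff hε.1 hε.2.1] at h6
    rw [← hz, h6.2, transportCoord, Φ.symm_apply_apply, f.ext_base_circ hε.1]
  rw [h3.unique (h4.congr_of_eventuallyEq h5), ha]
  rfl

-- Conversely, moving along the leaf realises the direction `dir`.
omit hg in
lemma exists_curve_dtransportCoord_eq {θ s : ℝ} (hs : s ≠ 0) : ∃ (δ : ℝ)
    (w : TangentSpace (𝓡 3) (Φ x)) (c : ℝ → TangentBundle (𝓡 3) F.LeafSpace)
    (ℓ : ℝ → g.NullGeodesicSpace), δ ≠ 0 ∧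
    dtransportCoord f Φ (Φ x) w = δ • f.dir (extChartAt (𝓡 3) f.center x, θ) ∧
    ContMDiff 𝓘(ℝ, ℝ) (𝓡 3).tangent ∞ c ∧ ContMDiff 𝓘(ℝ, ℝ) (𝓡 3) ∞ ℓ ∧
    (∀ ε, (c ε).proj = (scaledNull F f (extChartAt (𝓡 3) f.center x, θ) s).proj) ∧
    (∀ ε, LorentzMetric.IsTangentTo (c ε) (ℓ ε)) ∧
    c 0 = scaledNull F f (extChartAt (𝓡 3) f.center x, θ) s ∧ ℓ 0 = Φ x ∧
    tangentMap 𝓘(ℝ, ℝ) (𝓡 3) ℓ ⟨0, (1 : ℝ)⟩ = ⟨Φ x, w⟩ := by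
  set q : E3 × ℝ := (extChartAt (𝓡 3) f.center x, θ) with hq
  have hqd : q.1 ∈ f.dom := hf.2
  set m₀ := param F f q with hm₀
  have hm : param F f q ∈ (extChartAt (𝓡 3) m₀).source := mem_extChartAt_source _
  obtain ⟨G, hG, hG0, hG'⟩ := hF.exists_straightening f hqd hm
  set p := paramCoord F f m₀ q with hp
  have hcont : ContinuousAt (fun t : ℝ => (p, t)) 0 := by fun_prop
  obtain ⟨δ, hδ, hball⟩ := Metric.eventually_nhds_iff.1 (hcont.eventually hG)
  -- The curves in `skyTangent` are defined for all real parameters; `δ / 2 * sin ε` stays within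
  -- the range where the arc of the leaf is defined and has nonzero derivative at `0`.
  have hgood : ∀ ε : ℝ, ContDiffAt ℝ ∞ G (p, δ / 2 * Real.sin ε) ∧
      paramCoord F f m₀ (G (p, δ / 2 * Real.sin ε)) = p ∧ (G (p, δ / 2 * Real.sin ε)).1 ∈ f.dom ∧
      param F f (G (p, δ / 2 * Real.sin ε)) ∈ (extChartAt (𝓡 3) m₀).source := by
    intro ε
    refine hball ?_
    rw [dist_zero_right, Real.norm_eq_abs, abs_mul, abs_of_pos (half_pos hδ)]
    nlinarith [Real.abs_sin_le_one ε]
  set Z : ℝ → E3 × ℝ := fun ε => G (p, δ / 2 * Real.sin ε) with hZ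
  have hZs : ContDiff ℝ ∞ Z := contDiff_iff_contDiffAt.2 fun ε =>
    ContDiffAt.comp (g := G) ε (hgood ε).1
      (contDiffAt_const.prodMk (contDiffAt_const.mul Real.contDiff_sin.contDiffAt))
  have hZ0 : Z 0 = q := by simp only [hZ, Real.sin_zero, mul_zero, hG0]
  have hZ' : HasDerivAt Z ((δ / 2) • leafDir F f q) 0 := by
    have h1 : HasDerivAt (fun ε : ℝ => (p, δ / 2 * Real.sin ε)) (0, δ / 2 * Real.cos 0) 0 :=
      (hasDerivAt_const (0 : ℝ) p).prodMk ((Real.hasDerivAt_sin 0).const_mul (δ / 2))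
    have h2 : HasFDerivAt G (fderiv ℝ G (p, 0)) (p, δ / 2 * Real.sin 0) := by
      have := ((hgood 0).1.differentiableAt (by simp)).hasFDerivAt
      simpa only [Real.sin_zero, mul_zero] using this
    refine (h2.comp_hasDerivAt (0 : ℝ) h1).congr_deriv ?_
    rw [← hG', ← map_smul]
    simp
  have hℓ : ContMDiff 𝓘(ℝ, ℝ) (𝓡 3) ∞ (fun ε => Φ ((extChartAt (𝓡 3) f.center).symm (Z ε).1)) := by
    intro ε
    have h1 : ContMDiffAt 𝓘(ℝ, ℝ) 𝓘(ℝ, E3) ∞ (fun ε => (Z ε).1) ε :=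
      (contDiffAt_fst.comp ε hZs.contDiffAt).contMDiffAt
    have h2 := ContMDiffAt.comp ε (g := (extChartAt (𝓡 3) f.center).symm) (f := fun ε => (Z ε).1)
      (contMDiffAt_ext_symm (f.dom_subset (hgood ε).2.2.1)) h1
    exact ContMDiffAt.comp ε (g := Φ) (Φ.contMDiff _) h2
  have hℓ0 : Φ ((extChartAt (𝓡 3) f.center).symm (Z 0).1) = Φ x := by
    rw [hZ0]
    exact congrArg Φ ((extChartAt (𝓡 3) f.center).left_inv hf.1)
  have key : ∀ z : TangentBundle (𝓡 3) g.NullGeodesicSpace, z.1 = Φ x →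
      ∃ w : TangentSpace (𝓡 3) (Φ x), z = ⟨Φ x, w⟩ := by
    rintro ⟨_, w⟩ rfl
    exact ⟨w, rfl⟩
  obtain ⟨w, hw⟩ := key (tangentMap 𝓘(ℝ, ℝ) (𝓡 3)
    (fun ε => Φ ((extChartAt (𝓡 3) f.center).symm (Z ε).1)) ⟨0, (1 : ℝ)⟩) hℓ0
  refine ⟨δ / 2, w, fun ε => scaledNull F f (Z ε) s, _, (half_pos hδ).ne', ?_, ?_, hℓ, ?_, ?_, ?_,
    hℓ0, hw⟩
  · have h1 := hasDerivAt_transportCoord hf (hℓ.mdifferentiableAt (by simp)) hw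
    have h2 : HasDerivAt (fun ε => (Z ε).1) ((δ / 2) • f.dir q) 0 :=
      (ContinuousLinearMap.fst ℝ E3 ℝ).hasFDerivAt.comp_hasDerivAt (0 : ℝ) hZ'
    refine h1.unique (h2.congr_of_eventuallyEq (Eventually.of_forall fun ε => ?_))
    simp only [transportCoord, Φ.symm_apply_apply]
    exact (extChartAt (𝓡 3) f.center).right_inv (f.dom_subset (hgood ε).2.2.1)
  · intro ε
    exact ContMDiffAt.comp ε (g := fun q => scaledNull F f q s)
      (hF.contMDiffAt_scaledNull (hgood ε).2.2.1 s) hZs.contDiffAt.contMDiffAt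
  · intro ε
    exact (extChartAt (𝓡 3) m₀).injOn (hgood ε).2.2.2 hm (hgood ε).2.1
  · intro ε
    exact hF.isTangentTo_scaledNull hΦ (hgood ε).2.2.1 hs
  · simp only [hZ0]

/-- The tangent spaces of the skies are the rays of the points of the Cartan prolongation. -/
lemma skyTangent_eq {θ s : ℝ} (hs : s ≠ 0) :
    LorentzMetric.skyTangent (Φ x) (scaledNull F f (extChartAt (𝓡 3) f.center x, θ) s) =
      (Submodule.span ℝ {f.dir (extChartAt (𝓡 3) f.center x, θ)}).comap
        (dtransportCoord f Φ (Φ x)) := by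
  apply le_antisymm
  · refine Submodule.span_le.2 ?_
    rintro w ⟨c, ℓ, hc, hℓ, hcp, hcℓ, hc0, -, hw⟩
    obtain ⟨a, ha⟩ := hF.exists_dtransportCoord_eq_smul_dir hg hΦ hf hs hc hℓ hcp hcℓ hc0 hw
    exact Submodule.mem_span_singleton.2 ⟨a, ha.symm⟩
  · intro w hw
    obtain ⟨a, ha⟩ := Submodule.mem_span_singleton.1 (Submodule.mem_comap.1 hw)
    obtain ⟨δ, w', c, ℓ, hδ, hw', h⟩ := hF.exists_curve_dtransportCoord_eq hΦ hf (θ := θ) hs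
    have h1 : w = (a / δ) • w' := by
      apply dtransportCoord_injective hf
      rw [map_smul, hw', ← ha, smul_smul, div_mul_cancel₀ _ hδ]
    rw [h1]
    exact Submodule.smul_mem _ _ (Submodule.subset_span ⟨c, ℓ, h⟩)

-- By `skyTangent_eq` the skies through two null vectors of one geodesic have as tangents the lines
-- of two polar angles in the same contact plane. They meet only in zero exactly when the lines
-- differ, and then they span the plane.
omit hf in
lemma isCanonicalContactStructure {H : ContactStructure g.NullGeodesicSpace}
    (hH : ∀ (x : N) (v : TangentSpace (𝓡 3) x),
      v ∈ ξ.plane x ↔ mfderiv (𝓡 3) (𝓡 3) Φ x v ∈ H.plane (Φ x)) :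
    LorentzMetric.IsCanonicalContactStructure H := by
  intro L
  obtain ⟨x, rfl⟩ : ∃ x, Φ x = L := ⟨_, Φ.apply_symm_apply L⟩
  obtain ⟨f, hf⟩ := exists_frame_covers ξ x
  set y := extChartAt (𝓡 3) f.center x with hy
  have hinj := dtransportCoord_injective (Φ := Φ) hf
  have hsurj := dtransportCoord_surjective (Φ := Φ) hf
  have hxy : (extChartAt (𝓡 3) f.center).symm y = x := (extChartAt (𝓡 3) f.center).left_inv hf.1
  constructor
  · have htan : ∀ θ, LorentzMetric.IsTangentTo (scaledNull F f (y, θ) 1) (Φ x) := fun θ => by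
      have := hF.isTangentTo_scaledNull hΦ (q := (y, θ)) hf.2 one_ne_zero
      dsimp only at this
      rwa [hxy] at this
    refine ⟨_, _, htan 0, htan (Real.pi / 2), ?_⟩
    rw [hF.skyTangent_eq hg hΦ hf one_ne_zero, hF.skyTangent_eq hg hΦ hf one_ne_zero,
      Submodule.disjoint_def]
    intro w h1 h2
    obtain ⟨a, ha⟩ := Submodule.mem_span_singleton.1 (Submodule.mem_comap.1 h1)
    obtain ⟨b, hb⟩ := Submodule.mem_span_singleton.1 (Submodule.mem_comap.1 h2)
    have h3 := congrArg f.lam (ha.trans hb.symm)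
    rw [map_smul, map_smul, f.lam_dir hf.2, f.lam_dir hf.2] at h3
    simp only [Real.cos_zero, Real.cos_pi_div_two, smul_eq_mul, mul_one, mul_zero] at h3
    apply hinj
    rw [← ha, h3, zero_smul, map_zero]
  · intro v w hv hw hdisj
    obtain ⟨θ, s, hs, rfl⟩ := hF.exists_eq_scaledNull_of_covers ((hΦ _ _).1 hv).1 ((hΦ _ _).1 hv).2 hf
    obtain ⟨φ, r, hr, rfl⟩ := hF.exists_eq_scaledNull_of_covers ((hΦ _ _).1 hw).1 ((hΦ _ _).1 hw).2 hf
    rw [hF.skyTangent_eq hg hΦ hf hs, hF.skyTangent_eq hg hΦ hf hr] at hdisj ⊢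
    have hcombo : ∀ a b θ φ : ℝ, a • f.dir (y, θ) + b • f.dir (y, φ) =
        (a * Real.cos θ + b * Real.cos φ) • f.V y + (a * Real.sin θ + b * Real.sin φ) • f.Y y := by
      intro a b θ φ
      simp only [Frame.dir]
      module
    -- This is `sin (φ - θ)`; if it vanished, the two directions would be proportional and the two
    -- lines equal.
    set D := Real.cos θ * Real.sin φ - Real.sin θ * Real.cos φ with hD
    have hD0 : D ≠ 0 := by
      intro h0
      obtain ⟨w, hw⟩ := hsurj (f.dir (y, θ))
      have h1 : f.dir (y, θ) = (Real.cos θ * Real.cos φ + Real.sin θ * Real.sin φ) • f.dir (y, φ) := by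
        have h2 := hcombo 1 (-(Real.cos θ * Real.cos φ + Real.sin θ * Real.sin φ)) θ φ
        have e1 : 1 * Real.cos θ + -(Real.cos θ * Real.cos φ + Real.sin θ * Real.sin φ) * Real.cos φ =
            0 := by
          linear_combination Real.sin φ * h0 - Real.cos θ * Real.sin_sq_add_cos_sq φ
        have e2 : 1 * Real.sin θ + -(Real.cos θ * Real.cos φ + Real.sin θ * Real.sin φ) * Real.sin φ =
            0 := by
          linear_combination -Real.cos φ * h0 - Real.sin θ * Real.sin_sq_add_cos_sq φ
        rw [e1, e2, zero_smul, zero_smul, add_zero, one_smul, neg_smul] at h2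
        exact eq_of_sub_eq_zero ((sub_eq_add_neg _ _).trans h2)
      have h2 : w = 0 := Submodule.disjoint_def.1 hdisj w
        (Submodule.mem_comap.2 (Submodule.mem_span_singleton.2 ⟨1, (one_smul _ _).trans hw.symm⟩))
        (Submodule.mem_comap.2 (Submodule.mem_span_singleton.2 ⟨_, h1.symm.trans hw.symm⟩))
      rw [h2, map_zero] at hw
      exact f.dir_ne_zero (p := (y, θ)) hf.2 hw.symm
    ext w
    rw [mem_plane_iff_dtransportCoord hf (hH x), Submodule.mem_sup]
    constructor
    · rintro ⟨a, b, hab⟩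
      -- The coefficients along the two directions are given by Cramer's rule with determinant `D`.
      obtain ⟨w₁, hw₁⟩ := hsurj (((a * Real.sin φ - b * Real.cos φ) / D) • f.dir (y, θ))
      refine ⟨w₁, ?_, w - w₁, ?_, add_sub_cancel _ _⟩
      · exact Submodule.mem_comap.2 (Submodule.mem_span_singleton.2 ⟨_, hw₁.symm⟩)
      · refine Submodule.mem_comap.2 (Submodule.mem_span_singleton.2
          ⟨(b * Real.cos θ - a * Real.sin θ) / D, ?_⟩)
        rw [map_sub, hab, hw₁, eq_sub_iff_add_eq, add_comm, hcombo]
        congr 2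
        · field_simp
          rw [hD]
          ring
        · field_simp
          rw [hD]
          ring
    · rintro ⟨w₁, h1, w₂, h2, rfl⟩
      obtain ⟨a, ha⟩ := Submodule.mem_span_singleton.1 (Submodule.mem_comap.1 h1)
      obtain ⟨b, hb⟩ := Submodule.mem_span_singleton.1 (Submodule.mem_comap.1 h2)
      exact ⟨_, _, by rw [map_add, ← ha, ← hb, hcombo]⟩

end IsNullFibration

end Sky

end NullGeod

end

/-! ### The theorem. -/

open NullGeod in
theorem corollary4p9 {N : Type*} [TopologicalSpace N] [ChartedSpace E3 N]
    [IsManifold (𝓡 3) ∞ N] [T2Space N] [SecondCountableTopology N] [ConnectedSpace N]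
    (ξ : ContactStructure N)
    -- an oriented foliation by circles of the Cartan prolongation, whose leaf space is `M` below
    (F : OrientedCircleFoliation (CartanProlongation ξ) 𝓘(ℝ, E3 × ℝ))
    -- i)
    (h₁ : ∀ u, Disjoint (F.tangent u) (engelKernel (CartanProlongation.engel ξ) u) ∧
      F.tangent u ⊔ engelKernel (CartanProlongation.engel ξ) u = CartanProlongation.engel ξ u)
    -- ii)
    [ChartedSpace E3 F.LeafSpace] [IsManifold (𝓡 3) ∞ F.LeafSpace] [T2Space F.LeafSpace]
    [SecondCountableTopology F.LeafSpace]
    (h₂ : Manifold.IsSubmersion 𝓘(ℝ, E3 × ℝ) (𝓡 3) ∞ F.proj)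
    -- iii)
    (h₃ : ∀ m, IsCone (pushforwardFibre (CartanProlongation.engel ξ) F.proj m))
    (h₄ : ∀ u, InjOn (pushforward (CartanProlongation.engel ξ) F.proj) (F.leaf u)) :
    ConnectedSpace F.LeafSpace ∧
    (∃ g : LorentzMetric F.LeafSpace,
      g.HasNullCones (pushforwardFibre (CartanProlongation.engel ξ) F.proj)) ∧
    ∀ g : LorentzMetric F.LeafSpace,
      g.HasNullCones (pushforwardFibre (CartanProlongation.engel ξ) F.proj) →
        (ξ.IsCoorientable → g.IsTimeOrientable) ∧ IsContactomorphicToNullGeodesics ξ g := by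
  have hF : IsNullFibration F := ⟨h₁, h₂, h₃, h₄⟩
  refine ⟨?_, hF.exists_metric, fun g hg => ⟨hF.isTimeOrientable hg, ?_⟩⟩
  · exact F.proj_surjective.connectedSpace hF.contMDiff_proj.continuous
  · obtain ⟨hT, hC, hM, Φ, H, hΦ, hH⟩ := exists_transport ξ (hF.nullGeodesicEquiv hg)
    have h : ∀ x w, LorentzMetric.IsTangentTo w (Φ x) ↔ w.2 ≠ 0 ∧ IsRayTangent F w x := by
      intro x w
      rw [hΦ]
      exact hF.isTangentTo_nullGeodesicEquiv_iff hg
    exact ⟨hT, hC, hM, H, hF.isCanonicalSmoothStructure hg h, hF.isCanonicalContactStructure hg h hH,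
      Φ, hH⟩
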